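/- Let $k$ be a field with $\operatorname{char} k\neq 2$, and let $G=\{1,\sigma\}$ be the group of order two. **Setting.** Let $\Sigma$ be a compact connected oriented surface with non-empty boundary, $\mathcal M$ a finite set of marked points on $\partial\Sigma$ meeting every boundary component, and $\mathcal P$ a finite non-empty set of points (punctures) in the interior of $\Sigma$; assume that $(\Sigma,\mathcal M,\mathcal P)$ is not a once-punctured monogon. Let $\tau$ be an ideal triangulation of $(\Sigma,\mathcal M,\mathcal P)$, i.e. a finite collection of arcs with end points in $\mathcal M\cup\mathcal P$ cutting $\Sigma$ into ideal triangles (self-folded triangles are allowed), such that each puncture is enclosed in a self-folded triangle and no triangle shares a side with two self-folded triangles. For $P\in\mathcal P$ let $i_P$ be the folded side, and $\ell_P$ the loop, of the self-folded triangle enclosing $P$. **The surface $\widetilde\Sigma$.** Let $\Sigma^+$ be the surface obtained by cutting $\Sigma$ along all the arcs $i_P$. The two copies of $i_P$ form a segment $[P_1^+,P_2^+]$ of $\partial \Sigma^+$; fix a homeomorphism $\varphi_P:[P_1^+,P_2^+]\to[0,1]$. Let $\mathcal M^+\subset\Sigma^+$ be the set of points of $\mathcal M$ which are not end points of any $i_P$,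 and $\tau^+$ the set of arcs of $\tau$ that are not sides of a self-folded triangle, seen in $\Sigma^+$. Let $\Sigma^-$ (with $\mathcal M^-$, $\tau^-$, $P_1^-,P_2^-$) be a copy of $\Sigma^+$, with the same orientation, and let $\widetilde\Sigma$ be the quotient of $\Sigma^+\sqcup\Sigma^-$ by the identifications, for all $P\in\mathcal P$, of $x\in[P_1^+,P_2^+]$ with the copy in $\Sigma^-$ of $\varphi_P^{-1}(1-\varphi_P(x))$. Let $\widetilde{\mathcal M}$ be the image in $\widetilde\Sigma$ of $\mathcal M^+\cup\mathcal M^-\cup\{P_1^\pm,P_2^\pm : P\in\mathcal P\}$. **Quivers with potential.** For an ideal triangulation $\tau$ of the type above, or of a surface without punctures, the adjacency quiver $Q(\tau)$ has the arcs of $\tau$ as vertices, and an arrow $a\to b$ for each triangle $\Delta$ that is not self-folded and in which the side $\pi(b)$ follows the side $\pi(a)$ in clockwise order, where $\pi(i_P)=\ell_P$ and $\pi(a)=a$ for the other arcs. The potential $S(\tau)$ is the sum of all $3$-cycles of $Q(\tau)$ (up to rotation) formed by arrows coming from the three corners of one triangle. The group $G$ acts on $(Q(\tau),S(\tau))$ by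 the involution $\sigma$ of $Q(\tau)$ which exchanges $i_P$ and $\ell_P$ for each $P$, fixes the other vertices, and sends each arrow to an arrow coming from the same corner of the same triangle. Let $\Lambda$ be the complete path algebra of $Q=Q(\tau)$ and $\Lambda G$ the skew group algebra. For a vertex $i$ put $e_i^\pm=\frac12 e_i\otimes(1\pm\sigma)$ if $\sigma i=i$, and $e_i^+=\frac12(e_i+e_{\sigma i})\otimes(1+\sigma)$ otherwise. The quiver $Q_G=Q(\tau)_G$ has as vertices $i^+,i^-$ for each fixed vertex $i$ and $j^+$ for each $j$ in a set of representatives of the orbits of non-fixed vertices; for each $\alpha:i\to j$ in a set of representatives of the orbits of arrows it has arrows $\alpha^{+},\alpha^-$ if $i$ or $j$ is fixed (from $i^\pm$, resp. $i^+$ if $i$ is not fixed, to $j^\pm$, resp. $j^+$ if $j$ is not fixed), and one arrow $\alpha^+:i^+\to j^+$ otherwise. Let $\bar e$ be the sum of the idempotents attached to the vertices of $Q_G$. Sending vertices of $Q_G$ to these idempotents and an arrow $\alpha^{\pm}:x\to y$ to $e_y(\alpha\otimes1)e_x$ identifies the complete path algebra of $Q_G$ with $\bar e(\Lambda G)\bar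 e$. Under this identification, $S_G=S(\tau)_G$ is the element $\iota'(S(\tau))$, where $\iota'$ is linear and sends a cyclic path $w$ to $\bar e(w\otimes 1)\bar e$ if $w$ starts at a fixed vertex and to $2\bar e(w\otimes1)\bar e$ otherwise. **Theorem.** (1) $\widetilde\Sigma$ is a compact connected oriented topological surface with non-empty boundary, whose orientation restricts to the given ones on $\Sigma^+$ and $\Sigma^-$; the set $\widetilde{\mathcal M}$ is a finite subset of $\partial\widetilde\Sigma$ which meets every boundary component. (2) $\widetilde\tau=\tau^+\cup\tau^-\cup\{[P_1^+,P_2^+] : P\in\mathcal P\}$ is an ideal triangulation of the unpunctured marked surface $(\widetilde\Sigma,\widetilde{\mathcal M})$. (3) For all choices of the representatives, the quivers with potential $(Q(\widetilde\tau),S(\widetilde\tau))$ and $(Q(\tau)_G,S(\tau)_G)$ are right equivalent, along the natural bijection of the vertices (the copy of $j$ in $\Sigma^\pm$ corresponds to $j^\pm$, and $[P_1^+,P_2^+]$ to the orbit $\{i_P,\ell_P\}$): there is an isomorphism of $k$-algebras between the complete path algebras that maps the vertex idempotents according to this bijection and maps $S(\widetilde\tau)$ to a potential cyclically equivalent to $S(\tau)_G$.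 -/

import Mathlib

universe u v w

open Set Topology

/-! ### Quivers, complete path algebras, potentials, right equivalence -/

/-- A quiver with vertices `V` and arrows `A`. -/
structure Quiv where
  V : Type u
  A : Type u
  s : A → V
  t : A → V

namespace Quiv

variable (Q : Quiv.{u})

/-- The end point of a path that starts at `v`; paths are written from right to left, so
`[α₁, …, αᵣ]` is the path `α₁ ⋯ αᵣ` which runs through `αᵣ` first. -/
def endpt (v : Q.V) : List Q.A → Q.V
  | [] => v
  | a :: _ => Q.t a

/-- The word `l` is a path that starts at `v`. -/
def IsWalk (v : Q.V) : List Q.A → Prop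
  | [] => True
  | a :: l => Q.s a = Q.endpt v l ∧ IsWalk v l

/-- Paths of `Q`, including a path of length zero at each vertex. -/
@[ext] structure Walk where
  src : Q.V
  arrows : List Q.A
  isWalk : Q.IsWalk src arrows

variable {Q}

theorem IsWalk.drop {v : Q.V} {l : List Q.A} (h : Q.IsWalk v l) (n : ℕ) :
    Q.IsWalk v (l.drop n) := by
  induction l generalizing n with
  | nil => simpa using h
  | cons a l ih =>
    cases n with
    | zero => simpa using h
    | succ n => simpa using ih h.2 n

theorem endpt_take {v : Q.V} (l : List Q.A) (n : ℕ) :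
    Q.endpt (Q.endpt v (l.drop n)) (l.take n) = Q.endpt v l := by
  cases l with
  | nil => simp [endpt]
  | cons a l => cases n <;> simp [endpt]

theorem IsWalk.take {v : Q.V} {l : List Q.A} (h : Q.IsWalk v l) (n : ℕ) :
    Q.IsWalk (Q.endpt v (l.drop n)) (l.take n) := by
  induction l generalizing n with
  | nil => simp [IsWalk]
  | cons a l ih =>
    cases n with
    | zero => simp [IsWalk]
    | succ n =>
      refine ⟨?_, ?_⟩
      · rw [List.drop_succ_cons, endpt_take]; exact h.1
      · rw [List.drop_succ_cons]; exact ih h.2 n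

namespace Walk

/-- The end point of a path. -/
def tgt (w : Q.Walk) : Q.V := Q.endpt w.src w.arrows

/-- The length of a path. -/
def length (w : Q.Walk) : ℕ := w.arrows.length

/-- The left factor, of length `n`, in a factorization of `w`. -/
def left (w : Q.Walk) (n : ℕ) : Q.Walk :=
  ⟨Q.endpt w.src (w.arrows.drop n), w.arrows.take n, w.isWalk.take n⟩

/-- The right factor in the factorization of `w` with a left factor of length `n`. -/
def right (w : Q.Walk) (n : ℕ) : Q.Walk := ⟨w.src, w.arrows.drop n, w.isWalk.drop n⟩

/-- The path of length zero at `v`. -/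
def nil (v : Q.V) : Q.Walk := ⟨v, [], trivial⟩

/-- The path of length one given by an arrow. -/
def single (a : Q.A) : Q.Walk := ⟨Q.s a, [a], rfl, trivial⟩

end Walk

end Quiv

/-- The complete path algebra of `Q`: all formal, possibly infinite, linear combinations of
paths (for a finite quiver). -/
def CPA (k : Type v) (Q : Quiv.{u}) : Type (max u v) := Q.Walk → k

namespace CPA

@[ext] theorem ext {k : Type v} {Q : Quiv.{u}} {f g : CPA k Q} (h : ∀ w, f w = g w) : f = g :=
  funext h

variable {k : Type v} [Field k] {Q : Quiv.{u}}

instance : AddCommGroup (CPA k Q) := inferInstanceAs (AddCommGroup (Q.Walk → k))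

noncomputable instance : Module k (CPA k Q) := inferInstanceAs (Module k (Q.Walk → k))

/-- Concatenation of paths, extended to formal linear combinations. -/
noncomputable instance : Mul (CPA k Q) :=
  ⟨fun f g w => ∑ n ∈ Finset.range (w.length + 1), f (w.left n) * g (w.right n)⟩

open Classical in
noncomputable instance : One (CPA k Q) := ⟨fun w => if w.arrows = [] then 1 else 0⟩

theorem mul_apply (f g : CPA k Q) (w : Q.Walk) :
    (f * g) w = ∑ n ∈ Finset.range (w.length + 1), f (w.left n) * g (w.right n) := rfl

open Classical in
theorem one_apply (w : Q.Walk) : (1 : CPA k Q) w = if w.arrows = [] then 1 else 0 := rfl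

theorem add_apply (f g : CPA k Q) (w : Q.Walk) : (f + g) w = f w + g w := rfl

theorem zero_apply (w : Q.Walk) : (0 : CPA k Q) w = 0 := rfl

theorem smul_apply (c : k) (f : CPA k Q) (w : Q.Walk) : (c • f) w = c * f w := rfl

protected theorem mul_assoc (f g h : CPA k Q) : f * g * h = f * (g * h) := by
  ext w
  simp only [mul_apply, Finset.sum_mul, Finset.mul_sum]
  have hl : ∀ n, n ∈ Finset.range (w.length + 1) → (w.left n).length = n := by
    intro n hn
    simp only [Finset.mem_range] at hn
    simp only [Quiv.Walk.left, Quiv.Walk.length, List.length_take] at hn ⊢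
    omega
  have hr : ∀ n, (w.right n).length = w.length - n := by
    intro n
    simp [Quiv.Walk.right, Quiv.Walk.length]
  rw [Finset.sum_comm' (s := Finset.range (w.length + 1))
    (t := fun n => Finset.range ((w.left n).length + 1))
    (t' := Finset.range (w.length + 1)) (s' := fun m => Finset.Ico m (w.length + 1))]
  · refine Finset.sum_congr rfl fun m hm => ?_
    rw [Finset.sum_Ico_eq_sum_range, hr]
    simp only [Finset.mem_range] at hm
    have : w.length + 1 - m = w.length - m + 1 := by omega
    rw [this]
    refine Finset.sum_congr rfl fun j hj => ?_
    have e1 : (w.left (m + j)).left m = w.left m := by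
      ext1
      · simp only [Quiv.Walk.left]
        rw [List.drop_take, Nat.add_sub_cancel_left, ← List.drop_drop,
          Quiv.endpt_take]
      · simp [Quiv.Walk.left, List.take_take]
    have e2 : (w.left (m + j)).right m = (w.right m).left j := by
      ext1
      · simp [Quiv.Walk.left, Quiv.Walk.right, List.drop_drop]
      · simp [Quiv.Walk.left, Quiv.Walk.right, List.drop_take]
    have e3 : w.right (m + j) = (w.right m).right j := by
      ext1
      · rfl
      · simp [Quiv.Walk.right, List.drop_drop]
    rw [e1, e2, e3, mul_assoc]
  · intro n m
    constructor
    · rintro ⟨hn, hm⟩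
      rw [hl n hn] at hm
      simp only [Finset.mem_range, Finset.mem_Ico] at *
      omega
    · rintro ⟨hn, hm⟩
      have hn' : n ∈ Finset.range (w.length + 1) := by
        simp only [Finset.mem_range, Finset.mem_Ico] at *
        omega
      refine ⟨hn', ?_⟩
      rw [hl n hn']
      simp only [Finset.mem_range, Finset.mem_Ico] at *
      omega

protected theorem one_mul (f : CPA k Q) : 1 * f = f := by
  ext w
  rw [mul_apply, Finset.sum_eq_single 0]
  · simp [one_apply, Quiv.Walk.left, Quiv.Walk.right]
  · intro n hn h0
    have : (w.left n).arrows ≠ [] := by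
      simp only [Finset.mem_range, Quiv.Walk.length] at hn
      intro h
      have := congrArg List.length h
      simp [Quiv.Walk.left] at this
      rcases this with h | h
      · exact h0 h
      · simp [h] at hn; omega
    simp [one_apply, this]
  · simp

protected theorem mul_one (f : CPA k Q) : f * 1 = f := by
  ext w
  rw [mul_apply, Finset.sum_eq_single w.length]
  · have : w.left w.length = w := by
      ext1 <;> simp [Quiv.Walk.left, Quiv.Walk.length, Quiv.endpt]
    rw [this]
    simp [one_apply, Quiv.Walk.right, Quiv.Walk.length]
  · intro n hn h0
    have : (w.right n).arrows ≠ [] := by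
      simp only [Finset.mem_range, Quiv.Walk.length] at hn h0
      intro h
      have := congrArg List.length h
      simp [Quiv.Walk.right] at this
      omega
    simp [one_apply, this]
  · simp

noncomputable instance : Ring (CPA k Q) :=
  { (inferInstance : AddCommGroup (CPA k Q)), (inferInstance : Mul (CPA k Q)),
    (inferInstance : One (CPA k Q)) with
    mul_assoc := CPA.mul_assoc
    one_mul := CPA.one_mul
    mul_one := CPA.mul_one
    left_distrib := fun f g h => by
      ext w; simp only [mul_apply, add_apply, mul_add, Finset.sum_add_distrib]
    right_distrib := fun f g h => by
      ext w; simp only [mul_apply, add_apply, add_mul, Finset.sum_add_distrib]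
    zero_mul := fun f => by ext w; simp [mul_apply, zero_apply]
    mul_zero := fun f => by ext w; simp [mul_apply, zero_apply] }

noncomputable instance : Algebra k (CPA k Q) :=
  Algebra.ofModule
    (fun c f g => by
      ext w; simp only [mul_apply, smul_apply, Finset.mul_sum, mul_assoc])
    (fun c f g => by
      ext w; simp only [mul_apply, smul_apply, Finset.mul_sum, mul_left_comm])

open Classical in
/-- A path as an element of the complete path algebra. -/
noncomputable def ofWalk (k : Type v) [Field k] (w : Q.Walk) : CPA k Q :=
  fun w' => if w' = w then 1 else 0

/-- The idempotent `e_v`. -/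
noncomputable def idem (k : Type v) [Field k] (v : Q.V) : CPA k Q := ofWalk k (Quiv.Walk.nil v)

/-- Cyclic equivalence of potentials: `S - S'` lies in the closure, for the topology given by
the powers of the arrow ideal, of the span of all `a₁ a₂ ⋯ a_d - a₂ ⋯ a_d a₁`, where
`a₁ ⋯ a_d` is a cyclic path. -/
def CyclicEquiv (S S' : CPA k Q) : Prop :=
  ∀ n : ℕ, ∃ u ∈ Submodule.span k
      {x : CPA k Q | ∃ w w' : Q.Walk, w.src = w.tgt ∧ w'.src = w'.tgt ∧
        (∃ (a : Q.A) (l : List Q.A), w.arrows = a :: l ∧ w'.arrows = l ++ [a]) ∧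
        x = ofWalk k w - ofWalk k w'},
    ∀ w : Q.Walk, w.length ≤ n → (S - S') w = u w

/-- The quivers with potential `(Q, S)` and `(Q', S')` are right equivalent, along the
bijection `θ` of the vertices: there is an isomorphism of algebras between the complete path
algebras that sends `e_v` to `e_{θ v}` and `S` to a potential cyclically equivalent to `S'`. -/
def RightEquiv {Q : Quiv.{u}} {Q' : Quiv.{w}} (θ : Q.V ≃ Q'.V)
    (S : CPA k Q) (S' : CPA k Q') : Prop :=
  ∃ Φ : CPA k Q ≃ₐ[k] CPA k Q',
    (∀ v, Φ (idem k v) = idem k (θ v)) ∧ CyclicEquiv (Φ S) S'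

end CPA

/-! ### Actions of the group of order two: the quiver with potential `(Q_G, S_G)` -/

namespace Quiv

/-- An action of the group `{1, σ}` on a quiver. -/
structure Involution (Q : Quiv.{u}) where
  v : Q.V → Q.V
  a : Q.A → Q.A
  v_v : ∀ i, v (v i) = i
  a_a : ∀ x, a (a x) = x
  s_a : ∀ x, Q.s (a x) = v (Q.s x)
  t_a : ∀ x, Q.t (a x) = v (Q.t x)

namespace Involution

variable {Q : Quiv.{u}} (σ : Q.Involution)

theorem endpt_map (i : Q.V) (l : List Q.A) : Q.endpt (σ.v i) (l.map σ.a) = σ.v (Q.endpt i l) := by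
  cases l with
  | nil => rfl
  | cons a l => simp [endpt, σ.t_a]

theorem isWalk_map {i : Q.V} {l : List Q.A} (h : Q.IsWalk i l) :
    Q.IsWalk (σ.v i) (l.map σ.a) := by
  induction l with
  | nil => trivial
  | cons a l ih => exact ⟨by rw [σ.s_a, endpt_map, h.1], ih h.2⟩

/-- The action of `σ` on paths. -/
def walk (w : Q.Walk) : Q.Walk := ⟨σ.v w.src, w.arrows.map σ.a, σ.isWalk_map w.isWalk⟩

/-- The action of `σ` on the complete path algebra (note that `σ⁻¹ = σ`). -/
def act {k : Type v} (f : CPA k Q) : CPA k Q := fun w => f (σ.walk w)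

/-- Sets of representatives of the orbits of vertices and of the orbits of arrows. -/
structure OrbitReps where
  vRep : Set Q.V
  aRep : Set Q.A
  v_mem : ∀ i, i ∈ vRep ∨ σ.v i ∈ vRep
  v_unique : ∀ i, i ∈ vRep → σ.v i ∈ vRep → σ.v i = i
  a_mem : ∀ x, x ∈ aRep ∨ σ.a x ∈ aRep
  a_unique : ∀ x, x ∈ aRep → σ.a x ∈ aRep → σ.a x = x

variable {σ} (o : σ.OrbitReps)

/-- Vertices of `Q_G`: `i⁺ = (i, true)` and `i⁻ = (i, false)` for a fixed vertex `i`, and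
`j⁺ = (j, true)` for a representative `j` of an orbit with two elements. -/
def SkewVertex : Type u :=
  {x : Q.V × Bool // x.1 ∈ o.vRep ∧ (σ.v x.1 ≠ x.1 → x.2 = true)}

open Classical in
/-- The representative of the orbit of `i`. -/
noncomputable def OrbitReps.rep (i : Q.V) : Q.V := if i ∈ o.vRep then i else σ.v i

theorem OrbitReps.rep_mem (i : Q.V) : o.rep i ∈ o.vRep := by
  unfold OrbitReps.rep
  split_ifs with h
  · exact h
  · exact (o.v_mem i).resolve_left h

open Classical in
/-- The vertex `i^ε` if `i` is fixed, and the vertex of the orbit of `i` otherwise. -/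
noncomputable def OrbitReps.vertex (i : Q.V) (ε : Bool) : SkewVertex o :=
  ⟨(o.rep i, if σ.v (o.rep i) = o.rep i then ε else true), o.rep_mem i,
    fun h => by simp [h]⟩

/-- The quiver `Q_G`. Its arrows are `α⁺` and `α⁻` for a representative `α` that starts or ends
at a fixed vertex, and `α⁺` for the other representatives. -/
noncomputable def skewQuiver : Quiv.{u} where
  V := SkewVertex o
  A := {x : Q.A × Bool // x.1 ∈ o.aRep ∧
    (σ.v (Q.s x.1) ≠ Q.s x.1 → σ.v (Q.t x.1) ≠ Q.t x.1 → x.2 = true)}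
  s x := o.vertex (Q.s x.1.1) x.1.2
  t x := o.vertex (Q.t x.1.1) x.1.2

/-- The skew group algebra of the complete path algebra: `⟨x, y⟩` stands for
`x ⊗ 1 + y ⊗ σ`. -/
abbrev Skew (k : Type v) (_σ : Q.Involution) := CPA k Q × CPA k Q

/-- The product `(x ⊗ g)(y ⊗ h) = x g(y) ⊗ gh` of the skew group algebra. -/
noncomputable def smul {k : Type v} [Field k] (a b : Skew k σ) : Skew k σ :=
  (a.1 * b.1 + a.2 * σ.act b.2, a.1 * b.2 + a.2 * σ.act b.1)

open Classical in
/-- The idempotents `½ e_i ⊗ (1 ± σ)` for `i` fixed, and `½ (e_i + e_{σ i}) ⊗ (1 + σ)` for `i`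
not fixed. -/
noncomputable def skewIdem (k : Type v) [Field k] (x : SkewVertex o) : Skew k σ :=
  let f : CPA k Q := if σ.v x.1.1 = x.1.1 then CPA.idem k x.1.1
    else CPA.idem k x.1.1 + CPA.idem k (σ.v x.1.1)
  ((2⁻¹ : k) • f, (if x.1.2 then (2⁻¹ : k) else -2⁻¹) • f)

/-- The idempotent `ē`, the sum of the idempotents of all the vertices of `Q_G`. -/
noncomputable def skewUnit (k : Type v) [Field k] : Skew k σ := ∑ᶠ x, skewIdem o k x

/-- The map `ι(λ) = ē (λ ⊗ 1) ē`. -/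
noncomputable def iota {k : Type v} [Field k] (f : CPA k Q) : Skew k σ :=
  smul (smul (skewUnit o k) (f, 0)) (skewUnit o k)

open Classical in
/-- The map `ι'`: a cyclic path `w` is sent to `ι(w)` if it starts at a fixed vertex, and to
`2 ι(w)` otherwise. -/
noncomputable def iota' {k : Type v} [Field k] (S : CPA k Q) : Skew k σ :=
  iota o (fun w => if σ.v w.src = w.src then S w else 2 * S w : CPA k Q)

/-- The element `α^± = e_{t(α)} (α ⊗ 1) e_{s(α)}` of the skew group algebra, for an arrow `α^±`
of `Q_G`. -/
noncomputable def skewArrow (k : Type v) [Field k] (x : (skewQuiver o).A) : Skew k σ :=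
  smul (smul (skewIdem o k ((skewQuiver o).t x)) (CPA.ofWalk k (Walk.single x.1.1), 0))
    (skewIdem o k ((skewQuiver o).s x))

/-- The element of the skew group algebra given by a path of `Q_G`. -/
noncomputable def skewWalk (k : Type v) [Field k] (p : (skewQuiver o).Walk) : Skew k σ :=
  p.arrows.foldr (fun x y => smul (skewArrow o k x) y) (skewIdem o k p.src)

/-- The canonical map from the complete path algebra of `Q_G` to the skew group algebra, which
identifies the former with `ē (ΛG) ē`. -/
noncomputable def skewEval {k : Type v} [Field k] (f : CPA k (skewQuiver o)) : Skew k σ :=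
  (fun w => ∑ᶠ p, f p * (skewWalk o k p).1 w, fun w => ∑ᶠ p, f p * (skewWalk o k p).2 w)

/-- `S'` is the potential `S_G = ι'(S)` on `Q_G`. -/
def IsSkewPotential {k : Type v} [Field k] (S : CPA k Q) (S' : CPA k (skewQuiver o)) : Prop :=
  skewEval o S' = iota' o S

end Involution

end Quiv

/-! ### Oriented surfaces with boundary -/

/-- The closed upper half plane, the local model for surfaces with boundary. -/
def HalfPlane : Set ℂ := {z | 0 ≤ z.im}

/-- The map `f` has local degree `+1` at `z`: the point `z` has a neighbourhood in `S`, and `f`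
maps small counterclockwise circles around `z` to loops that wind once counterclockwise around
`f z`. The function `ψ` is a continuous logarithm of the loop. -/
def PositiveAt {S : Set ℂ} (f : S → ℂ) (z : S) : Prop :=
  ∃ R > 0, Metric.ball (z : ℂ) R ⊆ S ∧ ∀ r : ℝ, 0 < r → r < R →
    ∃ ψ : ℝ → ℂ, Continuous ψ ∧ ψ (2 * Real.pi) = ψ 0 + 2 * Real.pi * Complex.I ∧
      ∀ (θ : ℝ) (w : S), (w : ℂ) = circleMap z r θ → f w - f z = Complex.exp (ψ θ)

/-- An oriented (topological) surface with boundary: an atlas with values in the closed half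
plane whose transition maps preserve the orientation. -/
structure OrientedSurface (X : Type u) [TopologicalSpace X] extends ChartedSpace HalfPlane X where
  positive : ∀ e ∈ atlas, ∀ e' ∈ atlas, ∀ z : HalfPlane, 0 < (z : ℂ).im →
    z ∈ (e.symm.trans e').source → PositiveAt (fun w => (e' (e.symm w) : ℂ)) z

namespace OrientedSurface

variable {X : Type u} [TopologicalSpace X] (O : OrientedSurface X)

/-- The boundary of the surface. -/
def boundary : Set X := {x | ∃ e ∈ O.atlas, x ∈ e.source ∧ (e x : ℂ).im = 0}

/-- `(X, M, P)` is a compact connected oriented surface with non-empty boundary, with a finite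
set `M` of marked points on the boundary that meets each boundary component, and a finite set `P`
of punctures in the interior. -/
structure IsMarkedSurface (M P : Set X) : Prop where
  t2 : T2Space X
  compact : CompactSpace X
  connected : ConnectedSpace X
  boundary_nonempty : O.boundary.Nonempty
  finite_marked : M.Finite
  marked_subset : M ⊆ O.boundary
  component : ∀ x ∈ O.boundary, (connectedComponentIn O.boundary x ∩ M).Nonempty
  finite_punctures : P.Finite
  disjoint_punctures : Disjoint P O.boundary

end OrientedSurface

/-! ### Ideal triangulations -/

/-- The corners of the standard triangle, in counterclockwise order. -/
def corner : Fin 3 → ℂ := ![0, 1, Complex.I]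

/-- The standard triangle. -/
def Tri : Set ℂ := convexHull ℝ (range corner)

/-- The corner `i` as a point of the triangle. -/
def cornerPt (i : Fin 3) : Tri := ⟨corner i, subset_convexHull ℝ _ (mem_range_self i)⟩

/-- The side opposite to the corner `i`, parametrized from the corner `i + 1` to the corner
`i + 2`. -/
noncomputable def edgePt (i : Fin 3) (x : unitInterval) : Tri :=
  ⟨(1 - x.1) • corner (i + 1) + x.1 • corner (i + 2),
    convex_convexHull ℝ _ (subset_convexHull ℝ _ (mem_range_self _))
      (subset_convexHull ℝ _ (mem_range_self _)) (by linarith [x.2.2]) x.2.1 (by ring)⟩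

/-- The disjoint union of triangles indexed by `T`, with the topology of a disjoint union. -/
abbrev TriSum (T : Type) : Type := (_ : T) × Tri

/-- The side `p` of one of the triangles of a disjoint union of triangles. -/
noncomputable def sidePt {T : Type} (p : T × Fin 3) (x : unitInterval) : TriSum T :=
  ⟨p.1, edgePt p.2 x⟩

/-- The sides in `E` are glued to their mates, reversing the direction; sides that are their own
mates are not glued to anything. -/
def SideGlue {T : Type} (mate : T × Fin 3 → T × Fin 3) (E : Set (T × Fin 3))
    (a b : TriSum T) : Prop :=
  ∃ p ∈ E, mate p ≠ p ∧ ∃ x : unitInterval,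
    a = sidePt p x ∧ b = sidePt (mate p) (unitInterval.symm x)

/-- An ideal triangulation of an oriented surface with set `V` of marked points and punctures:
the surface is cut by the arcs into ideal triangles, that is, it is obtained from finitely many
triangles by gluing some of their sides in pairs. Here `χ` is the gluing map; it preserves the
orientation on the interior of each triangle, and the vertices are exactly the points of `V`.
A triangle may be self-folded, that is, have two of its sides glued to each other. -/
structure IdealTriangulation {X : Type u} [TopologicalSpace X] (O : OrientedSurface X)
    (V : Set X) where
  T : Type
  finite : Finite T
  mate : T × Fin 3 → T × Fin 3
  mate_mate : ∀ p, mate (mate p) = p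
  χ : C(TriSum T, X)
  surjective : Function.Surjective χ
  eq_iff : ∀ a b, χ a = χ b ↔ Relation.EqvGen (SideGlue mate univ) a b
  vertices : range (fun p : T × Fin 3 => χ ⟨p.1, cornerPt p.2⟩) = V
  positive : ∀ (t : T) (z : Tri), (z : ℂ) ∈ interior Tri → ∀ e ∈ O.atlas,
    χ ⟨t, z⟩ ∈ e.source → PositiveAt (fun w => (e (χ ⟨t, w⟩) : ℂ)) z

namespace IdealTriangulation

variable {X : Type u} [TopologicalSpace X] {O : OrientedSurface X} {V : Set X}
  (τ : IdealTriangulation O V)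

/-- The side `p`, as a subset of the surface. -/
def sideSet (p : τ.T × Fin 3) : Set X := range fun x => τ.χ (sidePt p x)

/-- The arcs of the triangulation, that is, the sides which are not boundary segments. -/
def arcs : Set (Set X) := {A | ∃ p, τ.mate p ≠ p ∧ A = τ.sideSet p}

/-- For `p = (t, i)`: the triangle `t` is self-folded, with its sides `i + 1` and `i + 2` glued to
each other. The side `i` is then the loop, and the corner `i` the enclosed puncture. -/
def IsFolded (p : τ.T × Fin 3) : Prop := τ.mate (p.1, p.2 + 1) = (p.1, p.2 + 2)

/-- The self-folded triangles, each given by its loop. -/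
def Folded : Type := {p : τ.T × Fin 3 // τ.IsFolded p}

/-- The folded side of a self-folded triangle. -/
def radius (q : τ.Folded) : Set X := τ.sideSet (q.1.1, q.1.2 + 1)

/-- The loop of a self-folded triangle. -/
def loop (q : τ.Folded) : Set X := τ.sideSet q.1

/-- The side `p` is one of the two copies of the folded side of a self-folded triangle. -/
def IsFoldedSide (p : τ.T × Fin 3) : Prop :=
  ∃ q : τ.Folded, p = (q.1.1, q.1.2 + 1) ∨ p = (q.1.1, q.1.2 + 2)

/-- `π(a) = p`, where `π` sends the folded side of a self-folded triangle to its loop, and each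
other arc to itself (for a side `p` of a triangle that is not self-folded). -/
def Over (a : Set X) (p : τ.T × Fin 3) : Prop :=
  a = τ.sideSet p ∨ ∃ q : τ.Folded, a = τ.radius q ∧ τ.loop q = τ.sideSet p

/-- The adjacency quiver `Q(τ)`. Its vertices are the arcs. For each triangle `t` which is not
self-folded, and for each of its sides `(t, i)`, there is an arrow `a → b` if `π(a)` is the side
`(t, i)` and `π(b)` is the next side in clockwise order, `(t, i + 2)`.
(There are no cancelling pairs of arrows `a → b`, `b → a` when each puncture is enclosed in a
self-folded triangle, as is the case for all the triangulations considered here.) -/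
def quiver : Quiv.{u} where
  V := τ.arcs
  A := {x : (τ.T × Fin 3) × τ.arcs × τ.arcs //
    (∀ i, ¬ τ.IsFolded (x.1.1, i)) ∧ τ.Over x.2.1.1 x.1 ∧ τ.Over x.2.2.1 (x.1.1, x.1.2 + 2)}
  s x := x.1.2.1
  t x := x.1.2.2

open Classical in
/-- The potential `S(τ)`: the sum of the 3-cycles of the quiver that lie in one triangle
(one cycle for an internal triangle without loops, two cycles if one side is a loop).
Each cycle `γβα` is written with the arrow `α` which comes from the side `0`. -/
noncomputable def potential (k : Type v) [Field k] : CPA k τ.quiver := fun w =>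
  if ∃ (t : τ.T) (α β γ : τ.quiver.A), α.1.1 = (t, 0) ∧ β.1.1 = (t, 2) ∧ γ.1.1 = (t, 1) ∧
      w.src = w.tgt ∧ w.arrows = [γ, β, α] then 1 else 0

/-- The action of the group of order two on `Q(τ)` which exchanges the loop and the folded side of
each self-folded triangle, and fixes the other arcs. -/
structure IsFoldSwap (σ : τ.quiver.Involution) : Prop where
  swap : ∀ (q : τ.Folded) (a b : τ.arcs), a.1 = τ.radius q → b.1 = τ.loop q →
    σ.v a = b ∧ σ.v b = a
  fix : ∀ a : τ.arcs, (∀ q : τ.Folded, a.1 ≠ τ.radius q ∧ a.1 ≠ τ.loop q) → σ.v a = a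
  arrow : ∀ x : τ.quiver.A, (σ.a x).1.1 = x.1.1

/-! ### The surface cut along the folded sides, and its double -/

/-- The identifications in the surface cut along the folded sides: all sides are glued except the
folded ones. -/
def cutSetoid : Setoid (TriSum τ.T) :=
  Relation.EqvGen.setoid (SideGlue τ.mate {p | ¬ τ.IsFoldedSide p})

/-- The surface `Σ⁺` obtained by cutting along all the folded sides. -/
def Cut : Type := Quotient τ.cutSetoid

/-- The image in the cut surface of a point of a triangle. -/
def cutMk (a : TriSum τ.T) : τ.Cut := Quotient.mk τ.cutSetoid a

instance : TopologicalSpace τ.Cut := inferInstanceAs (TopologicalSpace (Quotient τ.cutSetoid))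

/-- The boundary segment `[P₁⁺, P₂⁺]` of the cut surface which comes from the two copies of the
folded side of a self-folded triangle. -/
def segment (q : τ.Folded) : Set τ.Cut :=
  range (fun x => τ.cutMk (sidePt (q.1.1, q.1.2 + 1) x)) ∪
    range (fun x => τ.cutMk (sidePt (q.1.1, q.1.2 + 2) x))

variable (φ : ∀ q : τ.Folded, τ.segment q ≃ₜ unitInterval)

/-- The gluing of `Σ⁺ = {true} × Cut` and `Σ⁻ = {false} × Cut` along the maps `Ψ_P`, which are given
by `t ↦ 1 - t` on the segment `[P₁⁺, P₂⁺]`, followed by the exchange of the two copies. -/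
def doubleSetoid : Setoid (Bool × τ.Cut) :=
  Relation.EqvGen.setoid fun a b => ∃ (q : τ.Folded) (x : τ.segment q),
    a = (true, x.1) ∧ b = (false, ((φ q).symm (unitInterval.symm (φ q x))).1)

/-- The surface `Σ̃`. -/
def Double : Type := Quotient (τ.doubleSetoid φ)

/-- The projection from the disjoint union of `Σ⁺` and `Σ⁻` to `Σ̃`. -/
def doubleMk (a : Bool × τ.Cut) : τ.Double φ := Quotient.mk (τ.doubleSetoid φ) a

instance : TopologicalSpace (τ.Double φ) :=
  inferInstanceAs (TopologicalSpace (Quotient (τ.doubleSetoid φ)))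

/-- The set `M⁺ ∪ {P₁⁺, P₂⁺}` of points of `Σ⁺`: the marked points which are not linked to a
puncture by a folded side, and the end points of the segments. -/
def cutMarked (M : Set X) : Set τ.Cut :=
  {y | ∃ a, y = τ.cutMk a ∧ τ.χ a ∈ M ∧ ∀ q : τ.Folded, τ.χ a ∉ τ.radius q} ∪
    {y | ∃ q : τ.Folded, y = ((φ q).symm 0).1 ∨ y = ((φ q).symm 1).1}

/-- The set `M̃` of marked points of `Σ̃`. -/
def doubleMarked (M : Set X) : Set (τ.Double φ) :=
  {y | ∃ (ε : Bool) (x : τ.Cut), x ∈ τ.cutMarked φ M ∧ y = τ.doubleMk φ (ε, x)}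

/-- The side `p` is an arc which is not a side of a self-folded triangle. -/
def IsPlain (p : τ.T × Fin 3) : Prop :=
  τ.mate p ≠ p ∧ (∀ i, ¬ τ.IsFolded (p.1, i)) ∧ ∀ i, ¬ τ.IsFolded ((τ.mate p).1, i)

/-- The copy in `Σ⁺` (for `ε = true`) or in `Σ⁻` (for `ε = false`) of the side `p`. -/
def doubleArc (ε : Bool) (p : τ.T × Fin 3) : Set (τ.Double φ) :=
  range fun x => τ.doubleMk φ (ε, τ.cutMk (sidePt p x))

/-- The image in `Σ̃` of a segment `[P₁⁺, P₂⁺]`. -/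
def doubleSegment (q : τ.Folded) : Set (τ.Double φ) :=
  (fun x => τ.doubleMk φ (true, x)) '' τ.segment q

/-- `τ̃ = τ⁺ ∪ τ⁻ ∪ {[P₁⁺, P₂⁺]}`. -/
def doubleArcs : Set (Set (τ.Double φ)) :=
  {A | ∃ ε p, τ.IsPlain p ∧ A = τ.doubleArc φ ε p} ∪ {A | ∃ q, A = τ.doubleSegment φ q}

/-- The orientation of `Σ̃` restricts to the given one on both `Σ⁺` and `Σ⁻`. -/
def IsCompatible (O' : OrientedSurface (τ.Double φ)) : Prop :=
  ∀ (ε : Bool) (t : τ.T) (z : Tri), (z : ℂ) ∈ interior Tri → ∀ e ∈ O'.atlas,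
    τ.doubleMk φ (ε, τ.cutMk ⟨t, z⟩) ∈ e.source →
      PositiveAt (fun w => (e (τ.doubleMk φ (ε, τ.cutMk ⟨t, w⟩)) : ℂ)) z

/-- The bijection `θ` from the arcs of a triangulation of `Σ̃` to the vertices of `Q(τ)_G` is the
natural one: `j^±` corresponds to the copy of `j` in `Σ^±`, and the orbit formed by the loop and the
folded side of a self-folded triangle corresponds to its segment. -/
def IsNatural {O' : OrientedSurface (τ.Double φ)} {V' : Set (τ.Double φ)}
    (τ' : IdealTriangulation O' V') {σ : τ.quiver.Involution} (o : σ.OrbitReps)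
    (θ : τ'.quiver.V ≃ (Quiv.Involution.skewQuiver o).V) : Prop :=
  ∀ (A : τ'.arcs) (a : τ.arcs) (ε : Bool), (θ A).1 = (a, ε) →
    (∀ p, τ.IsPlain p → a.1 = τ.sideSet p → A.1 = τ.doubleArc φ ε p) ∧
    (∀ q : τ.Folded, a.1 = τ.radius q ∨ a.1 = τ.loop q → A.1 = τ.doubleSegment φ q)

end IdealTriangulation

/-! Both the given surface and the double are treated as gluings: finitely many triangles with an
involution `mate` on their sides (`IsGluing`). Topology, orientation, quiver and potential are then
read off from the combinatorics of `mate`.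

From a gluing to a surface. The equivalence relation generated by gluing sides is explicit, because
an interior point of a side has only one partner (`eqvGen_sideGlue_cases`); it is closed, so the
quotient is compact Hausdorff. Interior points of triangles and of sides always have charts. A
vertex has a half-disc chart as soon as the corners around it form a linear sequence that ends at an
unglued side: the corners are then placed as equal sectors that fill the upper half plane.
Orientation is expressed by winding numbers. All charts have local degree one on the interiors of
the triangles; the local degree of an injective continuous map is locally constant, and each open
set contains an interior point of a triangle, so transition maps preserve the orientation
(`transition_positive`, `IsGluing.exists_orientedSurface`).

From the surface to the combinatorics. Interior points of glued sides do not lie on the boundary,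
because an embedded half disc whose diameter goes into a line is not a neighbourhood of the image of
its centre. Hence there are unglued sides close to each boundary point, and the corners at a marked
point form a linear sequence. The corner at an enclosed puncture is its own successor. This
distinguishes marked points from punctures and yields the combinatorial hypotheses `IsTame`.

The double. A self-folded triangle and the triangle on the other side of its loop form, once the
folded side is cut open, a single triangle one of whose sides is the segment `[P₁, P₂]`. An explicit
homeomorphism (`collarMap`) performs this merging; it is adapted to the given parametrization of the
segment, so that the gluing `t ↦ 1 - t` becomes the usual gluing of two sides. The double is
therefore a gluing of two copies of the triangles that are not self-folded: a side glued to a loop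
is now glued to the same side in the other copy, and all the other sides keep their mates
(`isGluing_double`). Linearity of corner sequences and connectedness are inherited, and the gluing
itself is the required triangulation.

The quivers with potential. A triangle has at most one side glued to a loop, so an arrow of `Q(τ)`
has at most one end that is not fixed, and the corner of an arrow determines its orbit
(`isCornerAction`). The arrows of `Q_G`, like those of the quiver of the double, thus correspond to
a corner and a sign. In the skew group algebra an arrow `α^±` is a multiple of `(α ± σα) ⊗ (1 ± σ)`,
with suitable signs. After rescaling, its coefficients are half the product of a sign at the source
and a sign at the target, and these signs telescope along a cycle of a triangle
(`arrowScale_mul_arrowCoeff`). Summing over the two lifts of a path, the contributions add up on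
closed paths and cancel on paths from `v` to `σ v`. So `S_G` is the sum of the cycles in the
triangles with nonzero coefficients that are products of scalars attached to the arrows, and a
rescaling of the arrows is the right equivalence. -/

/-! ### Winding numbers and local degrees -/

/-- The loop `γ` winds once counterclockwise around the origin. -/
def WindsOnce (γ : ℝ → ℂ) : Prop :=
  ∃ ψ : ℝ → ℂ, Continuous ψ ∧ ψ (2 * Real.pi) = ψ 0 + 2 * Real.pi * Complex.I ∧
    ∀ θ, γ θ = Complex.exp (ψ θ)

/-- The map `F` has local degree `+1` at `z`. -/
def IsPositiveAt (F : ℂ → ℂ) (z : ℂ) : Prop :=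
  ∃ R > 0, ∀ r : ℝ, 0 < r → r < R → WindsOnce fun θ => F (circleMap z r θ) - F z

/-- The exponential is a covering of the punctured plane, so a continuous map without zeros on a
simply connected, locally path connected space lifts through it. -/
theorem exists_log {A : Type*} [TopologicalSpace A] [SimplyConnectedSpace A]
    [LocallyPathConnectedSpace A] [Nonempty A] {H : A → ℂ} (hH : Continuous H) (h0 : ∀ a, H a ≠ 0) :
    ∃ L : A → ℂ, Continuous L ∧ ∀ a, H a = Complex.exp (L a) := by
  let a₀ : A := Classical.arbitrary A
  obtain ⟨L, ⟨-, hL⟩, -⟩ := Complex.isCoveringMapOn_exp.existsUnique_continuousMap_lifts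
    ⟨H, hH⟩ (a₀ := a₀) (e₀ := Complex.log (H a₀)) (Complex.exp_log (h0 a₀)) (fun a => h0 a)
  exact ⟨L, L.continuous, fun a => (congrFun hL a).symm⟩

/-- The difference is a continuous lift of the constant `1` through `exp`, and two lifts that agree
at one point are equal. -/
theorem log_diff_const {L L' : ℝ → ℂ} (hL : Continuous L) (hL' : Continuous L')
    (h : ∀ t, Complex.exp (L t) = Complex.exp (L' t)) (s t : ℝ) : L t - L' t = L s - L' s := by
  have h1 := Complex.isCoveringMap_exp.eq_of_comp_eq (g₁ := fun t => L t - L' t)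
    (g₂ := fun _ : ℝ => L s - L' s) (by fun_prop) (by fun_prop) (by
      ext t
      simp [Complex.exp_sub, h]) s rfl
  exact congrFun h1 t

/-- A logarithm `L` of the whole homotopy exists. Its increment over a period is constant in `τ`,
since `L (τ, 2π) - L (τ, 0)` is a continuous logarithm of `1`; for `τ = 0` it is the increment of
`ψ`. -/
theorem WindsOnce.homotopy {H : ℝ → ℝ → ℂ}
    (hc : ContinuousOn (fun p : ℝ × ℝ => H p.1 p.2) (Icc 0 1 ×ˢ univ))
    (h0 : ∀ τ ∈ Icc (0 : ℝ) 1, ∀ θ, H τ θ ≠ 0)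
    (hp : ∀ τ ∈ Icc (0 : ℝ) 1, H τ (2 * Real.pi) = H τ 0) (h : WindsOnce (H 0)) :
    WindsOnce (H 1) := by
  obtain ⟨ψ, hψ, hψ2, hψe⟩ := h
  -- The homotopy is only controlled for parameters in `[0, 1]`; clamping the parameter makes it a
  -- map on the simply connected space `ℝ × ℝ`.
  let p : ℝ → ℝ := fun τ => (projIcc 0 1 zero_le_one τ : ℝ)
  have hpc : Continuous p := continuous_subtype_val.comp continuous_projIcc
  have hpm : ∀ τ, p τ ∈ Icc (0 : ℝ) 1 := fun τ => (projIcc 0 1 zero_le_one τ).2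
  have hp0 : p 0 = 0 := by simp [p]
  have hp1 : p 1 = 1 := by simp [p]
  obtain ⟨L, hL, hLe⟩ := exists_log (H := fun x : ℝ × ℝ => H (p x.1) x.2)
    (hc.comp_continuous (f := fun x : ℝ × ℝ => (p x.1, x.2)) (by fun_prop)
      fun x => ⟨hpm x.1, mem_univ _⟩) (fun x => h0 _ (hpm x.1) _)
  refine ⟨fun θ => L (1, θ), by fun_prop, ?_, fun θ => ?_⟩
  · have e1 := log_diff_const (L := fun θ => L (0, θ)) (L' := ψ) (by fun_prop) hψ
      (fun t => by rw [← hLe, ← hψe]; simp [hp0]) 0 (2 * Real.pi)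
    have e2 := log_diff_const (L := fun τ => L (τ, 2 * Real.pi)) (L' := fun τ => L (τ, 0))
      (by fun_prop) (by fun_prop) (fun t => by rw [← hLe, ← hLe]; exact hp _ (hpm t)) 0 1
    have : L (0, 2 * Real.pi) - L (0, 0) = 2 * Real.pi * Complex.I := by
      rw [hψ2] at e1
      linear_combination e1
    change L (1, 2 * Real.pi) = L (1, 0) + _
    linear_combination e2 + this
  · rw [← hLe]
    simp [hp1]

theorem WindsOnce.homotopy_iff {H : ℝ → ℝ → ℂ}
    (hc : ContinuousOn (fun p : ℝ × ℝ => H p.1 p.2) (Icc 0 1 ×ˢ univ))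
    (h0 : ∀ τ ∈ Icc (0 : ℝ) 1, ∀ θ, H τ θ ≠ 0)
    (hp : ∀ τ ∈ Icc (0 : ℝ) 1, H τ (2 * Real.pi) = H τ 0) :
    WindsOnce (H 0) ↔ WindsOnce (H 1) := by
  refine ⟨WindsOnce.homotopy hc h0 hp, fun h => ?_⟩
  have hs : ∀ τ ∈ Icc (0 : ℝ) 1, 1 - τ ∈ Icc (0 : ℝ) 1 := fun τ hτ =>
    ⟨by linarith [hτ.2], by linarith [hτ.1]⟩
  have := WindsOnce.homotopy (H := fun τ θ => H (1 - τ) θ)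
    (hc.comp (f := fun x : ℝ × ℝ => (1 - x.1, x.2)) (by fun_prop)
      fun x hx => ⟨hs _ hx.1, mem_univ _⟩) (fun τ hτ => h0 _ (hs τ hτ))
    (fun τ hτ => hp _ (hs τ hτ)) (by simpa using h)
  simpa using this

theorem circleMap_two_pi' (z : ℂ) (r : ℝ) : circleMap z r (2 * Real.pi) = circleMap z r 0 := by
  simp [circleMap]

/-- For a continuous map, the winding numbers of the images of all small loops that wind once
around a point agree. -/
theorem windsOnce_comp_iff {F : ℂ → ℂ} {w₀ : ℂ} {R ρ : ℝ} (hF : ContinuousOn F (Metric.ball w₀ R))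
    (hF0 : ∀ w ∈ Metric.ball w₀ R, w ≠ w₀ → F w ≠ F w₀) (hρ : 0 < ρ) (hρR : ρ < R)
    {ψ : ℝ → ℂ} (hψ : Continuous ψ) (hψ2 : ψ (2 * Real.pi) = ψ 0 + 2 * Real.pi * Complex.I)
    (hψR : ∀ θ, ‖Complex.exp (ψ θ)‖ < R) :
    (WindsOnce fun θ => F (w₀ + Complex.exp (ψ θ)) - F w₀) ↔
      WindsOnce fun θ => F (circleMap w₀ ρ θ) - F w₀ := by
  -- Interpolating the logarithms rather than the loops keeps the loop away from the centre. The
  -- logarithm of its radius is interpolated linearly, so the loop also stays in the ball.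
  let K : ℝ → ℝ → ℂ := fun τ θ => (1 - τ) * ψ θ + τ * (Real.log ρ + θ * Complex.I)
  have hK : Continuous fun p : ℝ × ℝ => K p.1 p.2 := by simp only [K]; fun_prop
  have hKm : ∀ τ ∈ Icc (0 : ℝ) 1, ∀ θ, w₀ + Complex.exp (K τ θ) ∈ Metric.ball w₀ R := by
    intro τ hτ θ
    have h1 := hψR θ
    have hR : 0 < R := hρ.trans hρR
    rw [Complex.norm_exp, ← Real.lt_log_iff_exp_lt hR] at h1
    have h2 : Real.log ρ < Real.log R := Real.log_lt_log hρ hρR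
    rw [mem_ball_iff_norm, add_sub_cancel_left, Complex.norm_exp, ← Real.lt_log_iff_exp_lt hR]
    have : (K τ θ).re = (1 - τ) * (ψ θ).re + τ * Real.log ρ := by
      simp [K]
    rw [this]
    rcases hτ.1.eq_or_lt with h | h
    · rw [← h]; simpa using h1
    · nlinarith [hτ.2]
  have := WindsOnce.homotopy_iff (H := fun τ θ => F (w₀ + Complex.exp (K τ θ)) - F w₀)
    (by
      refine ContinuousOn.sub (hF.comp (by fun_prop) fun x hx => hKm _ hx.1 _) continuousOn_const)
    (fun τ hτ θ => sub_ne_zero.2 (hF0 _ (hKm τ hτ θ) (by simp)))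
    (fun τ hτ => by
      have : K τ (2 * Real.pi) = K τ 0 + 2 * Real.pi * Complex.I := by
        simp only [K, hψ2]; push_cast; ring
      simp only [this, Complex.exp_add, Complex.exp_two_pi_mul_I, mul_one])
  convert this using 2
  · ext θ; simp [K]
  · ext θ
    simp only [K, circleMap]
    rw [Complex.ofReal_one, sub_self, zero_mul, zero_add, one_mul, Complex.exp_add,
      ← Complex.ofReal_exp, Real.exp_log hρ]

/-- The increments of `F` along small circles are exponentials, hence nonzero. -/
theorem IsPositiveAt.ne {F : ℂ → ℂ} {z : ℂ} (h : IsPositiveAt F z) :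
    ∃ R > 0, ∀ w ∈ Metric.ball z R, w ≠ z → F w ≠ F z := by
  obtain ⟨R, hR, h⟩ := h
  refine ⟨R, hR, fun w hw hne heq => ?_⟩
  obtain ⟨ψ, -, -, h2⟩ := h ‖w - z‖ (norm_pos_iff.2 (sub_ne_zero.2 hne)) (mem_ball_iff_norm.1 hw)
  have := h2 (w - z).arg
  simp only [circleMap, Complex.norm_mul_exp_arg_mul_I, add_sub_cancel, heq, sub_self] at this
  exact Complex.exp_ne_zero _ this.symm

theorem norm_circleMap_sub' {z : ℂ} {r : ℝ} (hr : 0 < r) (θ : ℝ) : ‖circleMap z r θ - z‖ = r := by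
  simp [circleMap, abs_of_pos hr]

theorem IsPositiveAt.congr {F G : ℂ → ℂ} {z : ℂ} (h : IsPositiveAt F z) (hFG : F =ᶠ[𝓝 z] G) :
    IsPositiveAt G z := by
  obtain ⟨R, hR, h⟩ := h
  obtain ⟨R', hR', h'⟩ := Metric.eventually_nhds_iff.1 hFG
  refine ⟨min R R', lt_min hR hR', fun r hr hrR => ?_⟩
  convert h r hr (hrR.trans_le (min_le_left _ _)) using 2 with θ
  have e1 : F z = G z := h' (by simpa using hR')
  rw [e1, h' (y := circleMap z r θ)]
  rw [dist_eq_norm, norm_circleMap_sub' hr]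
  exact hrR.trans_le (min_le_right _ _)

/-- The image under `f` of a small circle winds once around `f z`, so `F` may be tested on it
instead of on a round circle, by `windsOnce_comp_iff`. The direction from right to left cancels `f`;
it is what is needed for transition maps. -/
theorem IsPositiveAt.comp_iff {F f : ℂ → ℂ} {z : ℂ} (hf : IsPositiveAt f z) (hfc : ContinuousAt f z)
    {R : ℝ} (hR : 0 < R) (hF : ContinuousOn F (Metric.ball (f z) R))
    (hF0 : ∀ w ∈ Metric.ball (f z) R, w ≠ f z → F w ≠ F (f z)) :
    IsPositiveAt F (f z) ↔ IsPositiveAt (fun w => F (f w)) z := by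
  obtain ⟨S, hS, hS'⟩ := Metric.continuousAt_iff.1 hfc R hR
  obtain ⟨S₂, hS₂, hf⟩ := hf
  have key : ∀ r, 0 < r → r < min S S₂ → ∀ ρ, 0 < ρ → ρ < R →
      ((WindsOnce fun θ => F (f (circleMap z r θ)) - F (f z)) ↔
        WindsOnce fun θ => F (circleMap (f z) ρ θ) - F (f z)) := by
    intro r hr hrS ρ hρ hρR
    obtain ⟨ψ, hψ, hψ2, hψe⟩ := hf r hr (hrS.trans_le (min_le_right _ _))
    rw [← windsOnce_comp_iff hF hF0 hρ hρR hψ hψ2]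
    · simp only [← hψe, add_sub_cancel]
    · intro θ
      rw [← hψe, ← dist_eq_norm]
      refine hS' ?_
      rw [dist_eq_norm, norm_circleMap_sub' hr]
      exact hrS.trans_le (min_le_left _ _)
  have hm : 0 < min S S₂ := lt_min hS hS₂
  constructor
  · rintro ⟨R', hR', h⟩
    refine ⟨min S S₂, hm, fun r hr hrS => ?_⟩
    have hmm : 0 < min R R' := lt_min hR hR'
    have := min_le_left R R'
    have := min_le_right R R'
    exact (key r hr hrS (min R R' / 2) (by linarith) (by linarith)).2
      (h _ (by linarith) (by linarith))
  · rintro ⟨R', hR', h⟩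
    refine ⟨R, hR, fun ρ hρ hρR => ?_⟩
    have hmm : 0 < min (min S S₂) R' := lt_min hm hR'
    have := min_le_left (min S S₂) R'
    have := min_le_right (min S S₂) R'
    exact (key (min (min S S₂) R' / 2) (by linarith) (by linarith) ρ hρ hρR).1
      (h _ (by linarith) (by linarith))

theorem IsPositiveAt.comp {F f : ℂ → ℂ} {z : ℂ} (hF : IsPositiveAt F (f z))
    (hf : IsPositiveAt f z) (hfc : ContinuousAt f z) (hFc : ∀ᶠ w in 𝓝 (f z), ContinuousAt F w) :
    IsPositiveAt (fun w => F (f w)) z := by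
  obtain ⟨R, hR, h⟩ := hF.ne
  obtain ⟨R', hR', h'⟩ := Metric.eventually_nhds_iff.1 hFc
  refine (hf.comp_iff hfc (lt_min hR hR') (fun w hw => ?_) fun w hw => ?_).1 hF
  · exact (h' (Metric.ball_subset_ball (min_le_right _ _) hw)).continuousWithinAt
  · exact h w (Metric.ball_subset_ball (min_le_left _ _) hw)

/-- The local degree of an injective continuous map is locally constant. -/
theorem IsPositiveAt.of_injOn {F : ℂ → ℂ} {z₀ : ℂ} {R : ℝ} (hF : ContinuousOn F (Metric.ball z₀ R))
    (hi : InjOn F (Metric.ball z₀ R)) {z z' : ℂ} (hz : z ∈ Metric.ball z₀ R)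
    (hz' : z' ∈ Metric.ball z₀ R) (h : IsPositiveAt F z) : IsPositiveAt F z' := by
  obtain ⟨S, hS, h⟩ := h
  rw [mem_ball_iff_norm] at hz hz'
  have hm : 0 < min S (R - ‖z - z₀‖) := lt_min hS (by linarith)
  have hm1 := min_le_left S (R - ‖z - z₀‖)
  have hm2 := min_le_right S (R - ‖z - z₀‖)
  set s := min S (R - ‖z - z₀‖) / 2 with hs
  refine ⟨R - ‖z' - z₀‖, by linarith, fun r hr hrR => ?_⟩
  -- Centre and radius move linearly from `(z, s)` to `(z', r)`. The circles stay in the ball by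
  -- convexity, and injectivity keeps the increments nonzero.
  let c : ℝ → ℂ := fun τ => (1 - τ) * z + τ * z'
  let ρ : ℝ → ℝ := fun τ => (1 - τ) * s + τ * r
  have hρ : ∀ τ ∈ Icc (0 : ℝ) 1, 0 < ρ τ := by
    intro τ hτ
    rcases hτ.1.eq_or_lt with h | h
    · simp [ρ, ← h]; linarith
    · have := mul_pos h hr
      have : 0 ≤ (1 - τ) * s := mul_nonneg (by linarith [hτ.2]) (by linarith)
      simp only [ρ]; linarith
  have hb : ∀ τ ∈ Icc (0 : ℝ) 1, ‖c τ - z₀‖ + ρ τ < R := by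
    intro τ hτ
    have e : c τ - z₀ = ((1 - τ : ℝ) : ℂ) * (z - z₀) + (τ : ℂ) * (z' - z₀) := by
      simp only [c]; push_cast; ring
    have h1 : ‖c τ - z₀‖ ≤ (1 - τ) * ‖z - z₀‖ + τ * ‖z' - z₀‖ := by
      rw [e]
      refine (norm_add_le _ _).trans ?_
      rw [norm_mul, norm_mul, Complex.norm_real, Complex.norm_real, Real.norm_of_nonneg hτ.1,
        Real.norm_of_nonneg (by linarith [hτ.2])]
    have h2 : ‖z - z₀‖ + s < R := by linarith
    have h3 : ‖z' - z₀‖ + r < R := by linarith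
    simp only [ρ]
    rcases hτ.1.eq_or_lt with h | h
    · rw [← h] at h1 ⊢; linarith
    · nlinarith [hτ.2]
  have hc1 : ∀ τ ∈ Icc (0 : ℝ) 1, c τ ∈ Metric.ball z₀ R := fun τ hτ => by
    rw [mem_ball_iff_norm]; linarith [hb τ hτ, hρ τ hτ]
  have hc2 : ∀ τ ∈ Icc (0 : ℝ) 1, ∀ θ, circleMap (c τ) (ρ τ) θ ∈ Metric.ball z₀ R := by
    intro τ hτ θ
    rw [mem_ball_iff_norm]
    have : circleMap (c τ) (ρ τ) θ - z₀ = (c τ - z₀) + (circleMap (c τ) (ρ τ) θ - c τ) := by ring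
    rw [this]
    refine (norm_add_le _ _).trans_lt ?_
    rw [norm_circleMap_sub' (hρ τ hτ)]
    exact hb τ hτ
  have := WindsOnce.homotopy (H := fun τ θ => F (circleMap (c τ) (ρ τ) θ) - F (c τ))
    (by
      refine ContinuousOn.sub (hF.comp ?_ fun x hx => hc2 _ hx.1 _)
        (hF.comp ?_ fun x hx => hc1 _ hx.1)
      · simp only [circleMap, c, ρ]; fun_prop
      · simp only [c]; fun_prop)
    (fun τ hτ θ => sub_ne_zero.2 fun h => by
      have h1 := hi (hc2 τ hτ θ) (hc1 τ hτ) h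
      have h2 := norm_circleMap_sub' (z := c τ) (hρ τ hτ) θ
      rw [h1, sub_self, norm_zero] at h2
      exact (hρ τ hτ).ne h2)
    (fun τ hτ => by simp only [circleMap_two_pi'])
    (by simpa [c, ρ] using h s (by linarith) (by linarith))
  simpa [c, ρ] using this

/-- Two maps whose increments never point in opposite directions have the same local degree. -/
theorem IsPositiveAt.of_slitPlane {F G : ℂ → ℂ} {z : ℂ} (hG : IsPositiveAt G z)
    (hFc : ∀ᶠ w in 𝓝 z, ContinuousAt F w) (hGc : ∀ᶠ w in 𝓝 z, ContinuousAt G w)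
    (h : ∀ᶠ w in 𝓝 z, w ≠ z → (F w - F z) / (G w - G z) ∈ Complex.slitPlane) :
    IsPositiveAt F z := by
  obtain ⟨R, hR, hG⟩ := hG
  obtain ⟨R', hR', h'⟩ := Metric.eventually_nhds_iff.1 (hFc.and (hGc.and h))
  refine ⟨min R R', lt_min hR hR', fun r hr hrR => ?_⟩
  obtain ⟨ψ, hψ, hψ2, hψe⟩ := hG r hr (hrR.trans_le (min_le_left _ _))
  have hd : ∀ θ, dist (circleMap z r θ) z < R' := fun θ => by
    rw [dist_eq_norm, norm_circleMap_sub' hr]; exact hrR.trans_le (min_le_right _ _)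
  have hne : ∀ θ, circleMap z r θ ≠ z := fun θ => by simp [hr.ne']
  -- The principal logarithm of the quotient is continuous on the slit plane and takes the same
  -- value at both ends of the period, so adding it does not change the increment of `ψ`.
  refine ⟨fun θ => ψ θ + Complex.log ((F (circleMap z r θ) - F z) / (G (circleMap z r θ) - G z)),
    ?_, ?_, fun θ => ?_⟩
  · refine hψ.add (continuous_iff_continuousAt.2 fun θ => ?_)
    refine ContinuousAt.clog ?_ ((h' (hd θ)).2.2 (hne θ))
    have hcm := (continuous_circleMap z r).continuousAt (x := θ)
    refine ContinuousAt.div ?_ ?_ ?_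
    · exact (ContinuousAt.comp (f := circleMap z r) (h' (hd θ)).1 hcm).sub continuousAt_const
    · exact (ContinuousAt.comp (f := circleMap z r) (h' (hd θ)).2.1 hcm).sub continuousAt_const
    · have := hψe θ
      simp only at this
      rw [this]; exact Complex.exp_ne_zero _
  · simp only [circleMap_two_pi', hψ2]; ring
  · have h1 := hψe θ
    simp only at h1
    have h2 := (h' (hd θ)).2.2 (hne θ)
    rw [Complex.exp_add, ← h1, Complex.exp_log (Complex.slitPlane_ne_zero h2),
      mul_div_cancel₀]
    rw [h1]; exact Complex.exp_ne_zero _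

theorem isPositiveAt_mul_add {a b z : ℂ} (ha : a ≠ 0) : IsPositiveAt (fun w => a * w + b) z := by
  refine ⟨1, one_pos, fun r hr _ => ⟨fun θ => Complex.log (a * r) + θ * Complex.I, by fun_prop,
    by push_cast; ring, fun θ => ?_⟩⟩
  rw [Complex.exp_add, Complex.exp_log (mul_ne_zero ha (by exact_mod_cast hr.ne'))]
  simp only [circleMap]; ring

/-- An affine map with positive determinant preserves the orientation. -/
theorem isPositiveAt_affine {F : ℂ → ℂ} {a b c d e f : ℝ}
    (hF : ∀ z, F z = (a * z.re + b * z.im + e : ℝ) + (c * z.re + d * z.im + f : ℝ) * Complex.I)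
    (hdet : 0 < a * d - b * c) (z : ℂ) : IsPositiveAt F z := by
  have hcont : Continuous F := by
    rw [funext hF]; fun_prop
  -- The linear part is `w ↦ α w + β w̄`, with determinant `|α|² - |β|²`; positivity says that `α w`
  -- dominates.
  let α : ℂ := ⟨(a + d) / 2, (c - b) / 2⟩
  let β : ℂ := ⟨(a - d) / 2, (c + b) / 2⟩
  have hn : Complex.normSq β < Complex.normSq α := by
    simp only [α, β, Complex.normSq_apply]; nlinarith
  have hα : α ≠ 0 := by
    intro h; rw [h, map_zero] at hn; exact absurd hn (not_lt.2 (Complex.normSq_nonneg _))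
  refine (isPositiveAt_mul_add (b := 0) hα).of_slitPlane
    (.of_forall fun w => hcont.continuousAt) (.of_forall fun w => by fun_prop)
    (.of_forall fun w hw => ?_)
  have e1 : F w - F z = α * (w - z) + β * (starRingEnd ℂ) (w - z) := by
    apply Complex.ext <;> simp [hF, α, β] <;> ring
  have hwz : w - z ≠ 0 := sub_ne_zero.2 hw
  have e2 : (F w - F z) / (α * w + 0 - (α * z + 0)) =
      1 + β * (starRingEnd ℂ) (w - z) / (α * (w - z)) := by
    rw [e1, show α * w + 0 - (α * z + 0) = α * (w - z) by ring, add_div,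
      div_self (mul_ne_zero hα hwz)]
  rw [e2, Complex.mem_slitPlane_iff]
  left
  have h3 : ‖β * (starRingEnd ℂ) (w - z) / (α * (w - z))‖ < 1 := by
    rw [norm_div, norm_mul, norm_mul, RCLike.norm_conj, mul_div_mul_right _ _ (norm_ne_zero_iff.2 hwz),
      div_lt_one (norm_pos_iff.2 hα)]
    rw [Complex.normSq_eq_norm_sq, Complex.normSq_eq_norm_sq] at hn
    exact lt_of_pow_lt_pow_left₀ 2 (norm_nonneg _) hn
  have h4 := (abs_le.1 (Complex.abs_re_le_norm (β * (starRingEnd ℂ) (w - z) / (α * (w - z))))).1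
  rw [Complex.add_re, Complex.one_re]
  linarith

/-- If `u / v` is real, then `u` is a real multiple of `v`; comparing real parts, or imaginary parts
when `v` is purely imaginary, shows that the factor is positive. -/
theorem div_mem_slitPlane_of_re {u v : ℂ} (h1 : v.re ≠ 0 → 0 < u.re * v.re)
    (h2 : v.re = 0 → 0 < u.im * v.im) : u / v ∈ Complex.slitPlane := by
  have hv : v ≠ 0 := by
    rintro rfl
    simp at h2
  rw [Complex.mem_slitPlane_iff]
  by_cases hz : (u / v).im = 0
  · left
    have e : u = ((u / v).re : ℂ) * v := by
      have : ((u / v).re : ℂ) = u / v := Complex.ext (by simp) (by simp [hz])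
      rw [this, div_mul_cancel₀ _ hv]
    have e1 := congrArg Complex.re e
    have e2 := congrArg Complex.im e
    rw [Complex.re_ofReal_mul] at e1
    rw [Complex.im_ofReal_mul] at e2
    by_cases h : v.re = 0
    · have := h2 h
      rw [e2, mul_assoc] at this
      exact pos_of_mul_pos_left this (mul_self_nonneg _)
    · have := h1 h
      rw [e1, mul_assoc] at this
      exact pos_of_mul_pos_left this (mul_self_nonneg _)
  · right; exact hz

theorem div_mem_slitPlane_of_im {u v : ℂ} (h1 : v.im ≠ 0 → 0 < u.im * v.im)
    (h2 : v.im = 0 → 0 < u.re * v.re) : u / v ∈ Complex.slitPlane := by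
  have : u / v = (-(Complex.I * u)) / (-(Complex.I * v)) := by
    rw [neg_div_neg_eq, mul_div_mul_left _ _ Complex.I_ne_zero]
  rw [this]
  refine div_mem_slitPlane_of_re ?_ ?_ <;> simpa

/-- A map which preserves the imaginary part and is increasing on horizontal lines. -/
theorem isPositiveAt_of_horizontal {F : ℂ → ℂ} {z : ℂ} (hFc : ∀ᶠ w in 𝓝 z, ContinuousAt F w)
    (him : ∀ᶠ w in 𝓝 z, (F w).im = w.im)
    (hre : ∀ᶠ w in 𝓝 z, w.im = z.im → w ≠ z → 0 < ((F w).re - (F z).re) * (w.re - z.re)) :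
    IsPositiveAt F z := by
  have hp : IsPositiveAt (fun w => 1 * w + 0) z := isPositiveAt_mul_add one_ne_zero
  refine hp.of_slitPlane hFc (.of_forall fun w => by fun_prop) ?_
  filter_upwards [him, hre] with w h1 h2 hw
  have h0 : (F z).im = z.im := him.self_of_nhds
  refine div_mem_slitPlane_of_im (fun h => ?_) fun h => ?_
  · simp only [one_mul, add_zero, Complex.sub_im, h1, h0] at h ⊢
    exact mul_self_pos.2 h
  · simp only [one_mul, add_zero, Complex.sub_im, Complex.sub_re, sub_eq_zero] at h ⊢
    exact h2 h hw

/-- A map which preserves the real part and is increasing on vertical lines. -/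
theorem isPositiveAt_of_vertical {F : ℂ → ℂ} {z : ℂ} (hFc : ∀ᶠ w in 𝓝 z, ContinuousAt F w)
    (hre : ∀ᶠ w in 𝓝 z, (F w).re = w.re)
    (him : ∀ᶠ w in 𝓝 z, w.re = z.re → w ≠ z → 0 < ((F w).im - (F z).im) * (w.im - z.im)) :
    IsPositiveAt F z := by
  have hp : IsPositiveAt (fun w => 1 * w + 0) z := isPositiveAt_mul_add one_ne_zero
  refine hp.of_slitPlane hFc (.of_forall fun w => by fun_prop) ?_
  filter_upwards [hre, him] with w h1 h2 hw
  have h0 : (F z).re = z.re := hre.self_of_nhds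
  refine div_mem_slitPlane_of_re (fun h => ?_) fun h => ?_
  · simp only [one_mul, add_zero, Complex.sub_re, h1, h0] at h ⊢
    exact mul_self_pos.2 h
  · simp only [one_mul, add_zero, Complex.sub_im, Complex.sub_re, sub_eq_zero] at h ⊢
    exact h2 h hw

/-- A function on a subset of the plane, extended by zero. -/
noncomputable def extendZero {S : Set ℂ} (f : S → ℂ) : ℂ → ℂ :=
  Function.extend Subtype.val f 0

theorem extendZero_apply {S : Set ℂ} (f : S → ℂ) (z : S) : extendZero f z = f z :=
  Subtype.val_injective.extend_apply f 0 z

/-- This passes from functions on a subset to total functions on the plane, which can be composed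
and compared without side conditions. -/
theorem positiveAt_iff {S : Set ℂ} {f : S → ℂ} {z : S} :
    PositiveAt f z ↔ (S ∈ 𝓝 (z : ℂ)) ∧ IsPositiveAt (extendZero f) z := by
  have hcm : ∀ (R r : ℝ) θ, 0 < r → r < R → circleMap (z : ℂ) r θ ∈ Metric.ball (z : ℂ) R := by
    intro R r θ hr hrR
    rw [mem_ball_iff_norm, norm_circleMap_sub' hr]; exact hrR
  constructor
  · rintro ⟨R, hR, hS, h⟩
    refine ⟨Filter.mem_of_superset (Metric.ball_mem_nhds _ hR) hS, R, hR, fun r hr hrR => ?_⟩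
    obtain ⟨ψ, h1, h2, h3⟩ := h r hr hrR
    refine ⟨ψ, h1, h2, fun θ => ?_⟩
    have := hS (hcm R r θ hr hrR)
    rw [← h3 θ ⟨_, this⟩ rfl, ← extendZero_apply f, ← extendZero_apply f]
  · rintro ⟨hS, R, hR, h⟩
    obtain ⟨R', hR', hS⟩ := Metric.mem_nhds_iff.1 hS
    refine ⟨min R R', lt_min hR hR', (Metric.ball_subset_ball (min_le_right _ _)).trans hS,
      fun r hr hrR => ?_⟩
    obtain ⟨ψ, h1, h2, h3⟩ := h r hr (hrR.trans_le (min_le_left _ _))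
    refine ⟨ψ, h1, h2, fun θ w hw => ?_⟩
    rw [← h3 θ]
    simp only [← hw, extendZero_apply]

theorem continuousAt_extendZero {S : Set ℂ} {f : S → ℂ} {z : S} (hS : S ∈ 𝓝 (z : ℂ))
    (hf : ContinuousAt f z) : ContinuousAt (extendZero f) z := by
  rw [ContinuousAt, extendZero_apply, ← map_nhds_subtype_coe_eq_nhds z.2 hS, Filter.tendsto_map'_iff]
  exact hf.tendsto.congr fun w => (extendZero_apply f w).symm

/-- A function with values in the upper half plane has no local degree at a point which is mapped
to the real line. -/
theorem PositiveAt.im_ne_zero {S : Set ℂ} {f : S → ℂ} {z : S} (hf : PositiveAt f z)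
    (h0 : ∀ w, 0 ≤ (f w).im) : (f z).im ≠ 0 := by
  intro hz
  obtain ⟨R, hR, hS, h⟩ := hf
  obtain ⟨ψ, h1, h2, h3⟩ := h (R / 2) (by linarith) (by linarith)
  have hi : ∀ θ, 0 ≤ Real.sin (ψ θ).im := by
    intro θ
    have hm : circleMap (z : ℂ) (R / 2) θ ∈ S := hS (by
      rw [mem_ball_iff_norm, norm_circleMap_sub' (by linarith)]; linarith)
    have h4 := congrArg Complex.im (h3 θ ⟨_, hm⟩ rfl)
    rw [Complex.exp_im, Complex.sub_im, hz, sub_zero] at h4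
    have h5 := h0 ⟨_, hm⟩
    rw [h4] at h5
    exact nonneg_of_mul_nonneg_right h5 (Real.exp_pos _)
  have h5 : (ψ (2 * Real.pi)).im = (ψ 0).im + 2 * Real.pi := by
    rw [h2]; simp
  have hpi := Real.pi_pos
  -- The imaginary part of `ψ` increases by `2π`, so it takes some value `3π/2 + 2πn`. There the
  -- sine is `-1`, and the increment of `f` would point into the lower half plane.
  let n : ℤ := ⌈((ψ 0).im - 3 * Real.pi / 2) / (2 * Real.pi)⌉
  have hn1 : ((ψ 0).im - 3 * Real.pi / 2) / (2 * Real.pi) ≤ n := Int.le_ceil _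
  have hn2 : (n : ℝ) < ((ψ 0).im - 3 * Real.pi / 2) / (2 * Real.pi) + 1 := Int.ceil_lt_add_one _
  rw [div_le_iff₀ (by positivity)] at hn1
  rw [← sub_lt_iff_lt_add, lt_div_iff₀ (by positivity)] at hn2
  obtain ⟨θ, -, hθ⟩ := intermediate_value_Icc (f := fun θ => (ψ θ).im) (a := 0)
    (b := 2 * Real.pi) (by linarith) (by fun_prop) (show 3 * Real.pi / 2 + n * (2 * Real.pi) ∈ _ by
      simp only [h5, mem_Icc]
      constructor <;> linarith)
  have h6 := hi θ
  simp only at hθ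
  rw [hθ, Real.sin_add_int_mul_two_pi, show 3 * Real.pi / 2 = Real.pi / 2 + Real.pi by ring,
    Real.sin_add_pi, Real.sin_pi_div_two] at h6
  linarith

/-! ### Barycentric coordinates on the standard triangle -/

/-- The barycentric coordinates on the standard triangle. -/
def bary (i : Fin 3) (z : ℂ) : ℝ := ![1 - z.re - z.im, z.re, z.im] i

/-- The point with given barycentric coordinates for the corners `i + 1` and `i + 2`. -/
noncomputable def ofBary (i : Fin 3) (a b : ℝ) : ℂ :=
  ((1 - a - b : ℝ) : ℂ) * corner i + (a : ℂ) * corner (i + 1) + (b : ℂ) * corner (i + 2)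

theorem fin3_11 (i : Fin 3) : i + 1 + 1 = i + 2 := by fin_cases i <;> rfl
theorem fin3_12 (i : Fin 3) : i + 1 + 2 = i := by fin_cases i <;> rfl
theorem fin3_21 (i : Fin 3) : i + 2 + 1 = i := by fin_cases i <;> rfl
theorem fin3_22 (i : Fin 3) : i + 2 + 2 = i + 1 := by fin_cases i <;> rfl
theorem fin3_cases (i j : Fin 3) : j = i ∨ j = i + 1 ∨ j = i + 2 := by
  fin_cases i <;> fin_cases j <;> simp
theorem fin3_ne1 (i : Fin 3) : i + 1 ≠ i := by fin_cases i <;> simp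
theorem fin3_ne2 (i : Fin 3) : i + 2 ≠ i := by fin_cases i <;> simp
theorem fin3_ne12 (i : Fin 3) : i + 1 ≠ i + 2 := by fin_cases i <;> simp
theorem fin3_forall {p : Fin 3 → Prop} (i : Fin 3) (h0 : p i) (h1 : p (i + 1)) (h2 : p (i + 2))
    (j : Fin 3) : p j := by
  rcases fin3_cases i j with rfl | rfl | rfl <;> assumption

@[fun_prop] theorem continuous_bary (i : Fin 3) : Continuous (bary i) := by
  fin_cases i
  · exact (continuous_const.sub Complex.continuous_re).sub Complex.continuous_im
  · exact Complex.continuous_re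
  · exact Complex.continuous_im

theorem bary_sum (i : Fin 3) (z : ℂ) : bary i z + bary (i + 1) z + bary (i + 2) z = 1 := by
  fin_cases i <;> simp [bary]
  ring

theorem ofBary_bary (i : Fin 3) (z : ℂ) : ofBary i (bary (i + 1) z) (bary (i + 2) z) = z := by
  apply Complex.ext <;> fin_cases i <;> simp [bary, ofBary, corner]
  ring

theorem bary_ofBary (i : Fin 3) (a b : ℝ) : bary i (ofBary i a b) = 1 - a - b := by
  fin_cases i <;> simp [bary, ofBary, corner]

theorem bary_ofBary_one (i : Fin 3) (a b : ℝ) : bary (i + 1) (ofBary i a b) = a := by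
  fin_cases i <;> simp [bary, ofBary, corner]

theorem bary_ofBary_two (i : Fin 3) (a b : ℝ) : bary (i + 2) (ofBary i a b) = b := by
  fin_cases i <;> simp [bary, ofBary, corner]
  ring

theorem eq_of_bary (i : Fin 3) {z w : ℂ} (h1 : bary (i + 1) z = bary (i + 1) w)
    (h2 : bary (i + 2) z = bary (i + 2) w) : z = w := by
  rw [← ofBary_bary i z, h1, h2, ofBary_bary]

theorem mem_Tri {z : ℂ} : z ∈ Tri ↔ ∀ i, 0 ≤ bary i z := by
  constructor
  · intro h i
    have : Tri ⊆ {z | 0 ≤ bary i z} := by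
      refine convexHull_min ?_ ?_
      · rintro _ ⟨j, rfl⟩
        fin_cases i <;> fin_cases j <;> simp [bary, corner]
      · intro x hx y hy a b ha hb hab
        have : bary i (a • x + b • y) = a * bary i x + b * bary i y := by
          obtain rfl : b = 1 - a := by linarith
          fin_cases i <;> simp [bary]
          ring
        simp only [mem_ofPred_eq, this] at *
        positivity
    exact this h
  · intro h
    have h1 := (convex_convexHull ℝ (range corner)).sum_mem (t := Finset.univ)
      (w := fun i => bary i z) (z := corner) (fun i _ => h i)
      (by simpa [Fin.sum_univ_three] using bary_sum 0 z)
      (fun i _ => subset_convexHull ℝ _ (mem_range_self i))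
    convert! h1 using 1
    apply Complex.ext <;> simp [Fin.sum_univ_three, bary, corner]

theorem bary_nonneg (z : Tri) (i : Fin 3) : 0 ≤ bary i z := mem_Tri.1 z.2 i

theorem bary_le_one (z : Tri) (i : Fin 3) : bary i z ≤ 1 := by
  linarith [bary_sum i z, bary_nonneg z (i + 1), bary_nonneg z (i + 2)]

instance : CompactSpace Tri :=
  isCompact_iff_compactSpace.1 ((finite_range corner).isCompact_convexHull (𝕜 := ℝ))

theorem mem_interior_Tri {z : ℂ} : z ∈ interior Tri ↔ ∀ i, 0 < bary i z := by
  constructor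
  · intro h i
    obtain ⟨ε, hε, hb⟩ := Metric.mem_nhds_iff.1 (mem_interior_iff_mem_nhds.1 h)
    by_contra h0
    have h0 : bary i z ≤ 0 := not_lt.1 h0
    have hz := mem_Tri.1 (interior_subset h)
    have h0 : bary i z = 0 := le_antisymm h0 (hz i)
    -- A small move in a direction along which the coordinate `i` decreases would leave the triangle
    -- if that coordinate vanished at `z`.
    let w : ℂ := z + (ε / 4 : ℝ) * (if i = 0 then 1 else if i = 1 then -1 else -Complex.I)
    have hw : w ∈ Tri := hb (by
      rw [mem_ball_iff_norm]
      simp only [w, add_sub_cancel_left, norm_mul, Complex.norm_real, Real.norm_eq_abs]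
      rw [abs_of_pos (by linarith)]
      split_ifs <;> simp <;> linarith)
    have := mem_Tri.1 hw i
    revert this h0
    fin_cases i <;> simp [bary, w] <;> intros <;> linarith
  · intro h
    have : ⋂ i, {z | 0 < bary i z} ⊆ interior Tri := by
      refine interior_maximal ?_ (isOpen_iInter_of_finite fun i =>
        isOpen_lt continuous_const (continuous_bary i))
      intro w hw
      simp only [mem_iInter, mem_ofPred_eq] at hw
      exact mem_Tri.2 fun i => (hw i).le
    exact this (by simpa using h)

theorem Tri_mem_nhds {z : Tri} (hz : (z : ℂ) ∈ interior Tri) : Tri ∈ 𝓝 (z : ℂ) :=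
  mem_interior_iff_mem_nhds.1 hz

theorem bary_edgePt (i : Fin 3) (x : unitInterval) : bary i (edgePt i x) = 0 := by
  fin_cases i <;> simp [bary, edgePt, corner]

theorem bary_edgePt_one (i : Fin 3) (x : unitInterval) : bary (i + 1) (edgePt i x) = 1 - x := by
  fin_cases i <;> simp [bary, edgePt, corner]

theorem bary_edgePt_two (i : Fin 3) (x : unitInterval) : bary (i + 2) (edgePt i x) = x := by
  fin_cases i <;> simp [bary, edgePt, corner]

theorem bary_cornerPt (i : Fin 3) : bary i (cornerPt i) = 1 := by
  fin_cases i <;> simp [bary, cornerPt, corner]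

theorem bary_cornerPt_one (i : Fin 3) : bary (i + 1) (cornerPt i) = 0 := by
  fin_cases i <;> simp [bary, cornerPt, corner]

theorem bary_cornerPt_two (i : Fin 3) : bary (i + 2) (cornerPt i) = 0 := by
  fin_cases i <;> simp [bary, cornerPt, corner]

theorem edgePt_zero (i : Fin 3) : edgePt i 0 = cornerPt (i + 1) := by
  ext1; simp [edgePt, cornerPt]

theorem edgePt_one (i : Fin 3) : edgePt i 1 = cornerPt (i + 2) := by
  ext1; simp [edgePt, cornerPt]

theorem eq_edgePt {i : Fin 3} {z : Tri} (h : bary i z = 0) :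
    z = edgePt i ⟨bary (i + 2) z, bary_nonneg z _, bary_le_one z _⟩ := by
  refine Subtype.ext (eq_of_bary (i := i + 1) ?_ ?_)
  · rw [fin3_11, bary_edgePt_two]
  · rw [fin3_12, bary_edgePt, h]

theorem eq_cornerPt {i : Fin 3} {z : Tri} (h : bary i z = 1) : z = cornerPt i := by
  have := bary_sum i z
  have := bary_nonneg z (i + 1)
  have := bary_nonneg z (i + 2)
  refine Subtype.ext (eq_of_bary (i := i) ?_ ?_)
  · rw [bary_cornerPt_one]; linarith
  · rw [bary_cornerPt_two]; linarith

@[fun_prop] theorem continuous_edgePt (i : Fin 3) : Continuous (edgePt i) := by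
  unfold edgePt
  fun_prop

theorem edgePt_injective {i j : Fin 3} {x y : unitInterval} (hx : 0 < (x : ℝ)) (hx1 : (x : ℝ) < 1)
    (h : edgePt i x = edgePt j y) : i = j ∧ x = y := by
  have hi : i = j := by
    rcases fin3_cases j i with h' | rfl | rfl
    · exact h'
    · have := bary_edgePt_two (j + 1) x
      rw [fin3_12, h, bary_edgePt] at this
      linarith
    · have := bary_edgePt_one (j + 2) x
      rw [fin3_21, h, bary_edgePt] at this
      linarith
  subst hi
  refine ⟨rfl, Subtype.ext ?_⟩
  rw [← bary_edgePt_two i x, h, bary_edgePt_two]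

theorem cornerPt_injective {i j : Fin 3} (h : cornerPt i = cornerPt j) : i = j := by
  rcases fin3_cases j i with h' | rfl | rfl
  · exact h'
  · have := bary_cornerPt_two (j + 1); rw [fin3_12, h, bary_cornerPt] at this; linarith
  · have := bary_cornerPt_one (j + 2); rw [fin3_21, h, bary_cornerPt] at this; linarith

theorem edgePt_ne_cornerPt {i j : Fin 3} {x : unitInterval} (hx : 0 < (x : ℝ)) (hx1 : (x : ℝ) < 1) :
    edgePt i x ≠ cornerPt j := by
  intro h
  have h0 := bary_cornerPt j
  rw [← h] at h0
  rcases fin3_cases i j with rfl | rfl | rfl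
  · rw [bary_edgePt] at h0; linarith
  · rw [bary_edgePt_one] at h0; linarith
  · rw [bary_edgePt_two] at h0; linarith

instance : ConnectedSpace Tri :=
  isConnected_iff_connectedSpace.1
    ⟨⟨_, (cornerPt 0).2⟩, (convex_convexHull ℝ _).isPreconnected⟩

/-! ### Gluing triangles along their sides -/

section Gluing

variable {T : Type} {mate : T × Fin 3 → T × Fin 3}

/-- The corner `c` of one of the triangles of a disjoint union of triangles. -/
def cornerAt (c : T × Fin 3) : TriSum T := ⟨c.1, cornerPt c.2⟩

/-- The corner which follows `c` in counterclockwise order around a vertex. -/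
def nextCorner (mate : T × Fin 3 → T × Fin 3) (c : T × Fin 3) : T × Fin 3 :=
  ((mate (c.1, c.2 + 1)).1, (mate (c.1, c.2 + 1)).2 + 1)

/-- The corners `c` and `d` are identified by the gluing of sides. -/
def CornerRel (mate : T × Fin 3 → T × Fin 3) : T × Fin 3 → T × Fin 3 → Prop :=
  Relation.EqvGen fun c d => mate (c.1, c.2 + 1) ≠ (c.1, c.2 + 1) ∧ d = nextCorner mate c

theorem sidePt_zero (p : T × Fin 3) : sidePt p 0 = cornerAt (p.1, p.2 + 1) := by
  simp [sidePt, cornerAt, edgePt_zero]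

theorem sidePt_one (p : T × Fin 3) : sidePt p 1 = cornerAt (p.1, p.2 + 2) := by
  simp [sidePt, cornerAt, edgePt_one]

theorem sidePt_injective {p q : T × Fin 3} {x y : unitInterval} (hx : 0 < (x : ℝ))
    (hx1 : (x : ℝ) < 1) (h : sidePt p x = sidePt q y) : p = q ∧ x = y := by
  simp only [sidePt, Sigma.mk.injEq, heq_eq_eq] at h
  obtain ⟨h1, h2⟩ := edgePt_injective hx hx1 h.2
  exact ⟨Prod.ext h.1 h1, h2⟩

theorem cornerAt_injective {c d : T × Fin 3} (h : cornerAt c = cornerAt d) : c = d := by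
  simp only [cornerAt, Sigma.mk.injEq, heq_eq_eq] at h
  exact Prod.ext h.1 (cornerPt_injective h.2)

theorem sidePt_ne_cornerAt {p c : T × Fin 3} {x : unitInterval} (hx : 0 < (x : ℝ))
    (hx1 : (x : ℝ) < 1) : sidePt p x ≠ cornerAt c := by
  intro h
  simp only [sidePt, cornerAt, Sigma.mk.injEq, heq_eq_eq] at h
  exact edgePt_ne_cornerPt hx hx1 h.2

@[fun_prop] theorem continuous_sidePt (p : T × Fin 3) : Continuous (sidePt p : _ → TriSum T) :=
  continuous_sigmaMk.comp (continuous_edgePt p.2)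

/-- Interior points of the side `p` and of its mate are identified. -/
def EdgeRel (mate : T × Fin 3 → T × Fin 3) (a b : TriSum T) : Prop :=
  ∃ p, ∃ x : unitInterval, mate p ≠ p ∧ 0 < (x : ℝ) ∧ (x : ℝ) < 1 ∧ a = sidePt p x ∧
    b = sidePt (mate p) (unitInterval.symm x)

/-- The end points of a side are separated from its interior points: gluing two sides identifies the
corners at their ends in the order of `nextCorner`. -/
theorem sideGlue_cases (hm : ∀ p, mate (mate p) = p) {a b : TriSum T}
    (h : SideGlue mate univ a b) :
    EdgeRel mate a b ∨ ∃ c d, a = cornerAt c ∧ b = cornerAt d ∧ CornerRel mate c d := by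
  obtain ⟨p, -, hp, x, rfl, rfl⟩ := h
  rcases (show (0 : ℝ) ≤ x from x.2.1).eq_or_lt with h0 | h0
  · obtain rfl : x = 0 := Subtype.ext h0.symm
    right
    refine ⟨_, ((mate p).1, (mate p).2 + 2), sidePt_zero p, ?_, ?_⟩
    · rw [unitInterval.symm_zero]; exact sidePt_one _
    · refine .symm _ _ (.rel _ _ ⟨?_, ?_⟩)
      · simp only [fin3_21, Prod.mk.eta, hm]
        exact hp.symm
      · simp only [nextCorner, fin3_21, Prod.mk.eta, hm]
  · rcases (show (x : ℝ) ≤ 1 from x.2.2).eq_or_lt with h1 | h1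
    · obtain rfl : x = 1 := Subtype.ext h1
      right
      refine ⟨_, ((mate p).1, (mate p).2 + 1), sidePt_one p, ?_, ?_⟩
      · rw [unitInterval.symm_one]; exact sidePt_zero _
      · refine .rel _ _ ⟨?_, ?_⟩
        · simpa only [fin3_21, Prod.mk.eta] using hp
        · simp only [nextCorner, fin3_21, Prod.mk.eta]
    · exact .inl ⟨p, x, hp, h0, h1, rfl, rfl⟩

/-- An interior point of a side has exactly one possible partner, since `mate` is an involution, so
composing two side identifications leads back to the starting point. Long chains of identifications
occur only among corners. -/
theorem eqvGen_sideGlue_cases (hm : ∀ p, mate (mate p) = p) {a b : TriSum T}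
    (h : Relation.EqvGen (SideGlue mate univ) a b) :
    a = b ∨ EdgeRel mate a b ∨ ∃ c d, a = cornerAt c ∧ b = cornerAt d ∧ CornerRel mate c d := by
  induction h with
  | rel a b h => exact .inr (sideGlue_cases hm h)
  | refl a => exact .inl rfl
  | symm a b _ ih =>
    rcases ih with rfl | ⟨p, x, hp, h0, h1, rfl, rfl⟩ | ⟨c, d, rfl, rfl, h⟩
    · exact .inl rfl
    · refine .inr (.inl ⟨mate p, unitInterval.symm x, ?_, ?_, ?_, rfl, ?_⟩)
      · rw [hm]; exact hp.symm
      · simpa using h1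
      · simpa using h0
      · simp [hm]
    · exact .inr (.inr ⟨d, c, rfl, rfl, .symm _ _ h⟩)
  | trans a b c _ _ ih1 ih2 =>
    rcases ih1 with rfl | ⟨p, x, hp, h0, h1, rfl, rfl⟩ | ⟨c, d, rfl, rfl, h⟩
    · exact ih2
    · rcases ih2 with rfl | ⟨p', x', hp', h0', h1', h, rfl⟩ | ⟨c', d', h, rfl, h'⟩
      · exact .inr (.inl ⟨p, x, hp, h0, h1, rfl, rfl⟩)
      · obtain ⟨rfl, rfl⟩ := sidePt_injective h0' h1' h.symm
        left
        simp [hm]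
      · exact absurd h (sidePt_ne_cornerAt (by simpa using h1) (by simpa using h0))
    · rcases ih2 with rfl | ⟨p', x', hp', h0', h1', h, rfl⟩ | ⟨c', d', h'', rfl, h'⟩
      · exact .inr (.inr ⟨c, d, rfl, rfl, h⟩)
      · exact absurd h.symm (sidePt_ne_cornerAt h0' h1')
      · obtain rfl := cornerAt_injective h''
        exact .inr (.inr ⟨c, d', rfl, rfl, .trans _ _ _ h h'⟩)

theorem eqvGen_of_cornerRel {c d : T × Fin 3} (h : CornerRel mate c d) :
    Relation.EqvGen (SideGlue mate univ) (cornerAt c) (cornerAt d) := by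
  induction h with
  | rel c d h =>
    obtain ⟨h, rfl⟩ := h
    refine .rel _ _ ⟨(c.1, c.2 + 1), mem_univ _, h, 1, ?_, ?_⟩
    · rw [sidePt_one, fin3_12]
    · rw [unitInterval.symm_one, sidePt_zero]; rfl
  | refl c => exact .refl _
  | symm c d _ ih => exact .symm _ _ ih
  | trans a b c _ _ h1 h2 => exact .trans _ _ _ h1 h2

theorem eqvGen_invariant {α β : Type*} {r : α → α → Prop} {f : α → β}
    (hf : ∀ a b, r a b → f a = f b) {a b : α} (h : Relation.EqvGen r a b) : f a = f b := by
  induction h with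
  | rel a b h => exact hf a b h
  | refl a => rfl
  | symm a b _ ih => exact ih.symm
  | trans a b c _ _ h1 h2 => exact h1.trans h2

/-- By the classification of glued pairs, the relation is the union of the diagonal, finitely many
compact curves that come from the sides, and a finite set of pairs of corners. -/
theorem isClosed_eqvGen_sideGlue [Finite T] (hm : ∀ p, mate (mate p) = p) :
    IsClosed {x : TriSum T × TriSum T | Relation.EqvGen (SideGlue mate univ) x.1 x.2} := by
  have : {x : TriSum T × TriSum T | Relation.EqvGen (SideGlue mate univ) x.1 x.2} =
      diagonal (TriSum T) ∪
      ((⋃ p ∈ {p | mate p ≠ p}, range fun x => (sidePt p x, sidePt (mate p) (unitInterval.symm x))) ∪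
      (fun x : (T × Fin 3) × (T × Fin 3) => (cornerAt x.1, cornerAt x.2)) ''
        {x | CornerRel mate x.1 x.2}) := by
    ext ⟨a, b⟩
    constructor
    · intro h
      rcases eqvGen_sideGlue_cases hm h with h | ⟨p, x, hp, -, -, rfl, rfl⟩ | ⟨c, d, rfl, rfl, h'⟩
      · exact .inl h
      · exact .inr (.inl (mem_biUnion (x := p) hp ⟨x, rfl⟩))
      · exact .inr (.inr ⟨(c, d), h', rfl⟩)
    · rintro (h | h | ⟨⟨c, d⟩, h, h'⟩)
      · obtain rfl : a = b := h
        exact .refl _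
      · obtain ⟨p, hp, x, hx⟩ := mem_iUnion₂.1 h
        simp only [Prod.mk.injEq] at hx
        exact .rel _ _ ⟨p, mem_univ _, hp, x, hx.1.symm, hx.2.symm⟩
      · simp only [Prod.mk.injEq] at h'
        obtain ⟨rfl, rfl⟩ := h'
        exact eqvGen_of_cornerRel h
  rw [this]
  refine isClosed_diagonal.union (.union ?_ (Set.toFinite _).isClosed)
  refine (Set.toFinite _).isClosed_biUnion fun p _ => (isCompact_range ?_).isClosed
  fun_prop

/-- The saturation of a closed set is the projection of a compact set, so the quotient map is
closed; normality then separates the fibres, which are closed. -/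
theorem t2Space_quotient_of_isClosed {A : Type*} [TopologicalSpace A] [CompactSpace A] [T2Space A]
    (s : Setoid A) (h : IsClosed {x : A × A | s x.1 x.2}) : T2Space (Quotient s) := by
  have hq : IsQuotientMap (Quotient.mk s) := isQuotientMap_quotient_mk'
  have hc : IsClosedMap (Quotient.mk s) := by
    intro C hC
    rw [← hq.isClosed_preimage]
    have : Quotient.mk s ⁻¹' (Quotient.mk s '' C) =
        Prod.snd '' ({x : A × A | s x.1 x.2} ∩ Prod.fst ⁻¹' C) := by
      ext a
      constructor
      · rintro ⟨c, hc, h⟩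
        exact ⟨(c, a), ⟨Quotient.exact h, hc⟩, rfl⟩
      · rintro ⟨⟨c, _⟩, ⟨h, hc⟩, rfl⟩
        exact ⟨c, hc, Quotient.sound h⟩
    rw [this]
    exact ((h.inter (hC.preimage continuous_fst)).isCompact.image continuous_snd).isClosed
  refine ⟨fun x y hxy => ?_⟩
  have hs : ∀ z : Quotient s, IsClosed (Quotient.mk s ⁻¹' {z}) := fun z => by
    obtain ⟨a, rfl⟩ := Quotient.exists_rep z
    refine IsClosed.preimage hq.continuous ?_
    simpa using hc {a} isClosed_singleton
  obtain ⟨U, V, hU, hV, hxU, hyV, hUV⟩ := normal_separation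
    (hs x) (hs y) (Disjoint.preimage _ (by simpa using hxy))
  refine ⟨(Quotient.mk s '' Uᶜ)ᶜ, (Quotient.mk s '' Vᶜ)ᶜ, (hc _ hU.isClosed_compl).isOpen_compl,
    (hc _ hV.isClosed_compl).isOpen_compl, ?_, ?_, ?_⟩
  · rintro ⟨a, ha, h⟩; exact ha (hxU h)
  · rintro ⟨a, ha, h⟩; exact ha (hyV h)
  · rw [Set.disjoint_left]
    intro z hz1 hz2
    obtain ⟨a, rfl⟩ := Quotient.exists_rep z
    have h1 : a ∈ U := by by_contra h; exact hz1 ⟨a, h, rfl⟩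
    have h2 : a ∈ V := by by_contra h; exact hz2 ⟨a, h, rfl⟩
    exact Set.disjoint_left.1 hUV h1 h2

/-- The space `Y` is obtained from triangles by gluing some of their sides in pairs. -/
structure IsGluing {Y : Type*} [TopologicalSpace Y] (mate : T × Fin 3 → T × Fin 3)
    (χ : TriSum T → Y) : Prop where
  mate_mate : ∀ p, mate (mate p) = p
  continuous : Continuous χ
  surjective : Function.Surjective χ
  eq_iff : ∀ a b, χ a = χ b ↔ Relation.EqvGen (SideGlue mate univ) a b

namespace IsGluing

variable {Y : Type*} [TopologicalSpace Y] {χ : TriSum T → Y} (h : IsGluing mate χ)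

include h

theorem cases {a b : TriSum T} (hab : χ a = χ b) :
    a = b ∨ EdgeRel mate a b ∨ ∃ c d, a = cornerAt c ∧ b = cornerAt d ∧ CornerRel mate c d :=
  eqvGen_sideGlue_cases h.mate_mate ((h.eq_iff _ _).1 hab)

theorem invariant {β : Type*} {f : TriSum T → β}
    (hf : ∀ p x, mate p ≠ p → f (sidePt p x) = f (sidePt (mate p) (unitInterval.symm x)))
    {a b : TriSum T} (hab : χ a = χ b) : f a = f b := by
  refine eqvGen_invariant (r := SideGlue mate univ) ?_ ((h.eq_iff _ _).1 hab)
  rintro a b ⟨p, -, hp, x, rfl, rfl⟩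
  exact hf p x hp

theorem glue (p : T × Fin 3) (hp : mate p ≠ p) (x : unitInterval) :
    χ (sidePt p x) = χ (sidePt (mate p) (unitInterval.symm x)) :=
  (h.eq_iff _ _).2 (.rel _ _ ⟨p, mem_univ _, hp, x, rfl, rfl⟩)

theorem corner_iff {c d : T × Fin 3} : χ (cornerAt c) = χ (cornerAt d) ↔ CornerRel mate c d := by
  refine ⟨fun hcd => ?_, fun hcd => (h.eq_iff _ _).2 (eqvGen_of_cornerRel hcd)⟩
  rcases h.cases hcd with e | ⟨p, x, -, h0, h1, e, -⟩ | ⟨c', d', h1, h2, h3⟩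
  · rw [cornerAt_injective e]; exact .refl _
  · exact absurd e.symm (sidePt_ne_cornerAt h0 h1)
  · rwa [cornerAt_injective h1, cornerAt_injective h2]

theorem eq_of_side {p : T × Fin 3} {x : unitInterval} (h0 : 0 < (x : ℝ)) (h1 : (x : ℝ) < 1)
    {b : TriSum T} (hab : χ (sidePt p x) = χ b) :
    b = sidePt p x ∨ mate p ≠ p ∧ b = sidePt (mate p) (unitInterval.symm x) := by
  rcases h.cases hab with e | ⟨p', x', hp, h0', h1', e, e'⟩ | ⟨c', d', e, h2, h3⟩
  · exact .inl e.symm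
  · obtain ⟨rfl, rfl⟩ := sidePt_injective h0 h1 e
    exact .inr ⟨hp, e'⟩
  · exact absurd e (sidePt_ne_cornerAt h0 h1)

theorem eq_of_corner {c : T × Fin 3} {b : TriSum T} (hab : χ (cornerAt c) = χ b) :
    ∃ d, b = cornerAt d ∧ CornerRel mate c d := by
  rcases h.cases hab with e | ⟨p', x', hp, h0', h1', e, e'⟩ | ⟨c', d', e, h2, h3⟩
  · exact ⟨c, e.symm, .refl _⟩
  · exact absurd e.symm (sidePt_ne_cornerAt h0' h1')
  · rw [cornerAt_injective e]; exact ⟨d', h2, h3⟩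

/-- A side is determined by its image, up to passing to the mate. -/
theorem eq_of_range_eq {p q : T × Fin 3}
    (hpq : (range fun x => χ (sidePt p x)) = range fun x => χ (sidePt q x)) :
    q = p ∨ q = mate p := by
  -- The midpoint is an interior point of the side, so its fibre meets only `p` and its mate.
  let x : unitInterval := ⟨1 / 2, by norm_num, by norm_num⟩
  obtain ⟨y, hy⟩ : χ (sidePt p x) ∈ range fun x => χ (sidePt q x) := by
    rw [← hpq]; exact ⟨x, rfl⟩
  rcases h.eq_of_side (by norm_num [x]) (by norm_num [x]) hy.symm with e | ⟨-, e⟩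
  · exact .inl (sidePt_injective (by norm_num [x]) (by norm_num [x]) e.symm).1.symm
  · exact .inr (sidePt_injective (by norm_num [x]) (by norm_num [x]) e.symm).1.symm

theorem range_mate (p : T × Fin 3) :
    (range fun x => χ (sidePt (mate p) x)) = range fun x => χ (sidePt p x) := by
  by_cases hp : mate p = p
  · rw [hp]
  ext y
  constructor
  · rintro ⟨x, rfl⟩
    exact ⟨unitInterval.symm x, by simp [h.glue p hp]⟩
  · rintro ⟨x, rfl⟩
    exact ⟨unitInterval.symm x, by simp [h.glue p hp]⟩

variable [Finite T] [T2Space Y]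

theorem isQuotientMap : IsQuotientMap χ :=
  h.continuous.isClosedMap.isQuotientMap h.continuous h.surjective

/-- The map `χ` goes from a compact space to a Hausdorff space, hence is a quotient map, and
compatibility with the glued pairs makes `U` saturated. -/
theorem isOpen_image {U : Set (TriSum T)} (hU : IsOpen U)
    (hs : ∀ p x, mate p ≠ p → (sidePt p x ∈ U ↔ sidePt (mate p) (unitInterval.symm x) ∈ U)) :
    IsOpen (χ '' U) ∧ χ ⁻¹' (χ '' U) = U := by
  have : χ ⁻¹' (χ '' U) = U := by
    refine subset_antisymm ?_ (subset_preimage_image _ _)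
    rintro a ⟨b, hb, hab⟩
    have := h.invariant (f := (· ∈ U)) (fun p x hp => propext (hs p x hp)) hab
    exact this.mp hb
  exact ⟨by rw [← h.isQuotientMap.isOpen_preimage, this]; exact hU, this⟩

omit [T2Space Y] [Finite T] in
/-- The glued space is connected if the triangles cannot be split into two classes without glued
sides in common. -/
theorem preconnectedSpace (hf : ∀ f : T → Prop, (∀ p, f p.1 ↔ f (mate p).1) → ∀ s t, f s → f t) :
    PreconnectedSpace Y := by
  rw [preconnectedSpace_iff_clopen]
  intro U hU
  -- Each triangle is connected, so a clopen set contains its whole image or none of it.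
  have hc : ∀ t (z w : Tri), χ ⟨t, z⟩ ∈ U → χ ⟨t, w⟩ ∈ U := by
    intro t z w hz
    have : IsClopen ((fun z : Tri => χ ⟨t, z⟩) ⁻¹' U) :=
      hU.preimage (h.continuous.comp continuous_sigmaMk)
    rcases isClopen_iff.1 this with e | e
    · exact absurd (show z ∈ ((fun z : Tri => χ ⟨t, z⟩) ⁻¹' U) from hz) (by rw [e]; simp)
    · exact show w ∈ ((fun z : Tri => χ ⟨t, z⟩) ⁻¹' U) by rw [e]; trivial
  by_cases hne : U.Nonempty
  · right
    obtain ⟨y, hy⟩ := hne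
    obtain ⟨⟨s, z⟩, rfl⟩ := h.surjective y
    ext y
    simp only [mem_univ, iff_true]
    obtain ⟨⟨t, w⟩, rfl⟩ := h.surjective y
    refine hc t (cornerPt 0) _ (hf (fun t => χ ⟨t, cornerPt 0⟩ ∈ U) ?_ s t (hc s z _ hy))
    intro p
    by_cases hp : mate p = p
    · rw [hp]
    have e := h.glue p hp 0
    constructor
    · intro hU
      refine hc _ _ _ (?_ : χ (sidePt (mate p) (unitInterval.symm 0)) ∈ U)
      rw [← e]; exact hc _ _ _ hU
    · intro hU
      refine hc _ _ _ (?_ : χ (sidePt p 0) ∈ U)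
      rw [e]; exact hc _ _ _ hU
  · exact .inl (not_nonempty_iff_eq_empty.1 hne)

/-- Converse of `preconnectedSpace`: the triangles on which `f` holds and those on which it fails
have saturated open unions, whose images are complementary. -/
theorem eq_of_preconnected [PreconnectedSpace Y] (f : T → Prop) (hf : ∀ p, f p.1 ↔ f (mate p).1)
    (s t : T) (hs : f s) : f t := by
  have hU : IsOpen {a : TriSum T | f a.1} := by
    rw [isOpen_sigma_iff]
    intro t
    by_cases ht : f t <;> simp [ht]
  have hU' : IsOpen {a : TriSum T | ¬ f a.1} := by
    rw [isOpen_sigma_iff]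
    intro t
    by_cases ht : f t <;> simp [ht]
  obtain ⟨h1, h2⟩ := h.isOpen_image hU fun p x _ => hf p
  obtain ⟨h1', h2'⟩ := h.isOpen_image hU' fun p x _ => not_congr (hf p)
  have : IsClopen (χ '' {a : TriSum T | f a.1}) := by
    refine ⟨⟨?_⟩, h1⟩
    convert h1' using 1
    ext y
    obtain ⟨a, rfl⟩ := h.surjective y
    rw [mem_compl_iff, ← mem_preimage, h2, ← mem_preimage, h2']
    rfl
  rcases isClopen_iff.1 this with e | e
  · exact absurd (mem_image_of_mem χ (show (⟨s, cornerPt 0⟩ : TriSum T) ∈ {a : TriSum T | f a.1}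
      from hs)) (by rw [e]; simp)
  · have : χ ⟨t, cornerPt 0⟩ ∈ χ '' {a : TriSum T | f a.1} := by rw [e]; trivial
    rw [← mem_preimage, h2] at this
    exact this

end IsGluing

end Gluing

/-! ### Charts on a glued space from functions on the triangles -/

theorem PositiveAt.of_eventuallyEq {S : Set ℂ} {f : S → ℂ} {z : S} {F : ℂ → ℂ}
    (hS : S ∈ 𝓝 (z : ℂ)) (hF : IsPositiveAt F z) (h : ∀ᶠ w : S in 𝓝 z, f w = F w) :
    PositiveAt f z := by
  rw [positiveAt_iff]
  refine ⟨hS, hF.congr ?_⟩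
  rw [← map_nhds_subtype_coe_eq_nhds z.2 hS]
  change ∀ᶠ w : S in 𝓝 z, F w = extendZero f w
  filter_upwards [h] with w hw
  rw [extendZero_apply, hw]

/-- A continuous injective map on a compact set is a homeomorphism on each open subset whose
image is open. -/
theorem exists_openPartialHomeomorph {Y Z : Type*} [TopologicalSpace Y] [TopologicalSpace Z]
    [T2Space Z] [Nonempty Y] {f : Y → Z} {U K : Set Y} (hK : IsCompact K) (hf : ContinuousOn f K)
    (hi : InjOn f K) (hU : IsOpen U) (hUK : U ⊆ K) (hfU : IsOpen (f '' U)) :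
    ∃ e : OpenPartialHomeomorph Y Z, e.source = U ∧ ∀ y, e y = f y := by
  refine ⟨OpenPartialHomeomorph.ofContinuousOpenRestrict ((hi.mono hUK).toPartialEquiv f U)
    (hf.mono hUK) ?_ hU, rfl, fun y => rfl⟩
  intro W hW
  obtain ⟨W', hW', rfl⟩ := isOpen_induced_iff.1 hW
  -- By injectivity, the image of an open part of `U` is the open set `f '' U` minus the image of a
  -- compact set, which is closed.
  have : (U.domRestrict f) '' (Subtype.val ⁻¹' W') = f '' U \ f '' (K \ W') := by
    ext z
    constructor
    · rintro ⟨y, hy, rfl⟩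
      refine ⟨⟨y, y.2, rfl⟩, ?_⟩
      rintro ⟨y', hy', h⟩
      have := hi hy'.1 (hUK y.2) h
      subst this
      exact hy'.2 hy
    · rintro ⟨⟨y, hy, rfl⟩, h⟩
      refine ⟨⟨y, hy⟩, ?_, rfl⟩
      by_contra hn
      exact h ⟨y, ⟨hUK hy, hn⟩, rfl⟩
  change IsOpen ((U.domRestrict f) '' (Subtype.val ⁻¹' W'))
  rw [this]
  exact hfU.sdiff ((hK.diff hW').image_of_continuousOn (hf.mono sdiff_subset)).isClosed

section Charts

variable {T : Type} {mate : T × Fin 3 → T × Fin 3} {Y : Type*} [TopologicalSpace Y]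
  {χ : TriSum T → Y}

/-- A set of points of the triangles which is compatible with the gluing of sides. -/
def Saturated (mate : T × Fin 3 → T × Fin 3) (U : Set (TriSum T)) : Prop :=
  ∀ p x, mate p ≠ p → sidePt p x ∈ U → sidePt (mate p) (unitInterval.symm x) ∈ U

theorem Saturated.iff (hm : ∀ p, mate (mate p) = p) {U : Set (TriSum T)} (hU : Saturated mate U)
    (p : T × Fin 3) (x : unitInterval) (hp : mate p ≠ p) :
    sidePt p x ∈ U ↔ sidePt (mate p) (unitInterval.symm x) ∈ U := by
  refine ⟨hU p x hp, fun h => ?_⟩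
  have := hU _ _ (by rw [hm]; exact hp.symm) h
  simpa [hm] using this

/-- The charts which are compatible with the orientations of the triangles. -/
def positiveAtlas (χ : TriSum T → Y) : Set (OpenPartialHomeomorph Y HalfPlane) :=
  {e | ∀ (t : T) (z : Tri), (z : ℂ) ∈ interior Tri → χ ⟨t, z⟩ ∈ e.source →
    PositiveAt (fun w => (e (χ ⟨t, w⟩) : ℂ)) z}

theorem eventually_of_isOpen_sigma {U : Set (TriSum T)} (hU : IsOpen U) {t : T} {z : Tri}
    (hz : (⟨t, z⟩ : TriSum T) ∈ U) : ∀ᶠ w : Tri in 𝓝 z, (⟨t, w⟩ : TriSum T) ∈ U :=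
  (hU.preimage continuous_sigmaMk).mem_nhds hz

variable [Finite T] [T2Space Y]

/-- Common recipe for the charts at interior points, sides and vertices. The function `g` is given
on a saturated open set `U'`, respects the gluing, and is injective modulo the gluing. The compact
set `K` between `U` and `U'` makes the inverse continuous. The image of `U` is the trace on the half
plane of an open set `V`, hence open there even at boundary points. -/
theorem IsGluing.exists_chart [Nonempty Y] (h : IsGluing mate χ) {g : TriSum T → ℂ} {U' K U : Set (TriSum T)}
    (hU'o : IsOpen U') (hU's : Saturated mate U') (hUo : IsOpen U) (hUs : Saturated mate U)
    (hK : IsCompact K) (hUK : U ⊆ K) (hKU : K ⊆ U') (hg : ContinuousOn g U')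
    (hg0 : ∀ a ∈ U', 0 ≤ (g a).im)
    (hgs : ∀ p x, mate p ≠ p → sidePt p x ∈ U' →
      g (sidePt p x) = g (sidePt (mate p) (unitInterval.symm x)))
    (hgi : ∀ a ∈ U', ∀ b ∈ U', g a = g b → χ a = χ b)
    {V : Set ℂ} (hV : IsOpen V) (hgV : ∀ w : ℂ, w ∈ V → 0 ≤ w.im → ∃ a ∈ U, g a = w)
    (hgV' : ∀ a ∈ U, g a ∈ V)
    (hp : ∀ (t : T) (z : Tri), (z : ℂ) ∈ interior Tri → (⟨t, z⟩ : TriSum T) ∈ U →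
      PositiveAt (fun w => g ⟨t, w⟩) z) :
    ∃ e ∈ positiveAtlas χ, e.source = χ '' U ∧ ∀ a ∈ U, (e (χ a) : ℂ) = g a := by
  classical
  -- The value `0` outside `U'` is arbitrary; since `U'` is saturated, the extension still respects
  -- the gluing and so factors through `χ`.
  let G : TriSum T → HalfPlane := fun a => if ha : a ∈ U' then ⟨g a, hg0 a ha⟩ else
    ⟨0, show 0 ≤ (0 : ℂ).im by simp⟩
  have hG : ∀ a ∈ U', (G a : ℂ) = g a := fun a ha => by simp [G, ha]
  have hGinv : ∀ {a b}, χ a = χ b → G a = G b := by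
    intro a b hab
    refine h.invariant (f := G) (fun p x hp => ?_) hab
    have := hU's.iff h.mate_mate p x hp
    by_cases hx : sidePt p x ∈ U'
    · ext1
      rw [hG _ hx, hG _ (this.1 hx), hgs p x hp hx]
    · simp [G, hx, mt this.2 hx]
  let f : Y → HalfPlane := fun y => G (Function.surjInv h.surjective y)
  have hf : ∀ a, f (χ a) = G a := fun a => hGinv (Function.surjInv_eq h.surjective _)
  obtain ⟨hU'1, hU'2⟩ := h.isOpen_image hU'o (hU's.iff h.mate_mate)
  obtain ⟨hU1, hU2⟩ := h.isOpen_image hUo (hUs.iff h.mate_mate)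
  have hfc : ContinuousOn f (χ '' U') := by
    rw [h.isQuotientMap.continuousOn_isOpen_iff hU'1, hU'2]
    have : f ∘ χ = G := funext hf
    rw [this, Topology.IsEmbedding.subtypeVal.continuousOn_iff]
    exact hg.congr hG
  obtain ⟨e, he1, he2⟩ := exists_openPartialHomeomorph (f := f) (U := χ '' U) (K := χ '' K)
    (hK.image h.continuous) (hfc.mono (image_mono hKU)) (by
      rintro _ ⟨a, ha, rfl⟩ _ ⟨b, hb, rfl⟩ hab
      rw [hf, hf] at hab
      exact hgi a (hKU ha) b (hKU hb) (by rw [← hG a (hKU ha), hab, hG b (hKU hb)]))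
    hU1 (image_mono hUK) (by
      have : f '' (χ '' U) = Subtype.val ⁻¹' V := by
        ext w
        constructor
        · rintro ⟨_, ⟨a, ha, rfl⟩, rfl⟩
          rw [hf, mem_preimage, hG a (hKU (hUK ha))]
          exact hgV' a ha
        · intro hw
          obtain ⟨a, ha, haw⟩ := hgV w hw w.2
          refine ⟨χ a, ⟨a, ha, rfl⟩, ?_⟩
          rw [hf]
          ext1
          rw [hG a (hKU (hUK ha)), haw]
      rw [this]
      exact hV.preimage continuous_subtype_val)
  have he3 : ∀ a ∈ U, (e (χ a) : ℂ) = g a := fun a ha => by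
    rw [he2, hf, hG a (hKU (hUK ha))]
  refine ⟨e, fun t z hz hs => ?_, he1, he3⟩
  have hzU : (⟨t, z⟩ : TriSum T) ∈ U := by
    rw [he1, ← mem_preimage, hU2] at hs
    exact hs
  have := positiveAt_iff.1 (hp t z hz hzU)
  refine PositiveAt.of_eventuallyEq this.1 this.2 ?_
  filter_upwards [eventually_of_isOpen_sigma hUo hzU] with w hw
  rw [he3 _ hw, extendZero_apply]

/-! #### Charts in the interior of a triangle -/

theorem IsGluing.exists_chart_interior (h : IsGluing mate χ) {t : T} {z : Tri}
    (hz : (z : ℂ) ∈ interior Tri) : ∃ e ∈ positiveAtlas χ, χ ⟨t, z⟩ ∈ e.source := by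
  classical
  have : Nonempty Y := ⟨χ ⟨t, z⟩⟩
  rw [mem_interior_Tri] at hz
  -- A margin `ε` below all the coordinates of `z` leaves room for the compact set `ε ≤ bary i`
  -- inside the interior of the triangle.
  obtain ⟨ε, hε, hεz⟩ : ∃ ε > 0, ∀ i, ε < bary i z := by
    obtain ⟨i, hi⟩ := Finite.exists_min fun i => bary i z
    exact ⟨bary i z / 2, by linarith [hz i], fun j => by linarith [hz i, hi j]⟩
  have hns : ∀ ε' ≥ 0, Saturated mate (Sigma.mk t '' {z : Tri | ∀ i, ε' < bary i z}) := by
    rintro ε' hε' p x hp ⟨z', hz', h'⟩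
    simp only [sidePt, Sigma.mk.injEq, heq_eq_eq] at h'
    have := hz' p.2
    rw [h'.2, bary_edgePt] at this
    linarith
  have ho : ∀ ε', IsOpen (Sigma.mk t '' {z : Tri | ∀ i, ε' < bary i z} : Set (TriSum T)) := by
    intro ε'
    refine isOpenMap_sigmaMk _ ?_
    simp only [ofPred_forall]
    exact isOpen_iInter_of_finite fun i => isOpen_lt continuous_const (by fun_prop)
  obtain ⟨e, he, hs, -⟩ := h.exists_chart (g := fun a => (a.2 : ℂ))
    (U' := Sigma.mk t '' {z : Tri | ∀ i, 0 < bary i z})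
    (U := Sigma.mk t '' {z : Tri | ∀ i, ε < bary i z})
    (K := Sigma.mk t '' {z : Tri | ∀ i, ε ≤ bary i z})
    (V := {w | ∀ i, ε < bary i w})
    (ho 0) (hns 0 le_rfl) (ho ε) (hns ε hε.le)
    (by
      refine IsCompact.image (IsClosed.isCompact ?_) continuous_sigmaMk
      simp only [ofPred_forall]
      exact isClosed_iInter fun i => isClosed_le continuous_const (by fun_prop))
    (image_mono fun z hz i => (hz i).le) (image_mono fun z hz i => hε.trans_le (hz i))
    (continuous_sigma fun _ => continuous_subtype_val).continuousOn
    (by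
      rintro _ ⟨z, hz, rfl⟩
      exact (hz 2).le)
    (fun p x hp hx => by
      obtain ⟨z', hz', h'⟩ := hx
      simp only [sidePt, Sigma.mk.injEq, heq_eq_eq] at h'
      have := hz' p.2
      rw [h'.2, bary_edgePt] at this
      exact absurd this (lt_irrefl _))
    (by
      rintro _ ⟨z, hz, rfl⟩ _ ⟨w, hw, rfl⟩ hzw
      exact congrArg (fun z => χ ⟨t, z⟩) (Subtype.ext hzw))
    (by
      simp only [ofPred_forall]
      exact isOpen_iInter_of_finite fun i => isOpen_lt continuous_const (by fun_prop))
    (fun w hw _ => ⟨⟨t, w, mem_Tri.2 fun i => (hε.trans (hw i)).le⟩, ⟨_, hw, rfl⟩, rfl⟩)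
    (by
      rintro _ ⟨z, hz, rfl⟩
      exact hz)
    (fun t z hz _ => PositiveAt.of_eventuallyEq (Tri_mem_nhds hz)
      (isPositiveAt_mul_add (a := 1) (b := 0) one_ne_zero) (.of_forall fun w => by simp))
  exact ⟨e, he, by rw [hs]; exact ⟨_, ⟨z, hεz, rfl⟩, rfl⟩⟩

/-! #### Charts around a side -/

/-- Coordinates for which the side `i` lies on the real line, between `-1` and `1`. -/
noncomputable def sideCoord (i : Fin 3) (z : ℂ) : ℂ :=
  ((bary (i + 2) z - bary (i + 1) z : ℝ) : ℂ) + (bary i z : ℂ) * Complex.I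

theorem sideCoord_re (i : Fin 3) (z : ℂ) : (sideCoord i z).re = bary (i + 2) z - bary (i + 1) z := by
  simp [sideCoord]

theorem sideCoord_im (i : Fin 3) (z : ℂ) : (sideCoord i z).im = bary i z := by simp [sideCoord]

@[fun_prop] theorem continuous_sideCoord (i : Fin 3) : Continuous (sideCoord i) := by
  unfold sideCoord; fun_prop

theorem sideCoord_injective (i : Fin 3) : Function.Injective (sideCoord i) := by
  intro z w hzw
  have h1 := congrArg Complex.re hzw
  have h2 := congrArg Complex.im hzw
  rw [sideCoord_re, sideCoord_re] at h1
  rw [sideCoord_im, sideCoord_im] at h2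
  have := bary_sum i z
  have := bary_sum i w
  exact eq_of_bary i (by linarith) (by linarith)

theorem isPositiveAt_sideCoord (i : Fin 3) (z : ℂ) : IsPositiveAt (sideCoord i) z := by
  fin_cases i
  · refine isPositiveAt_affine (a := -1) (b := 1) (c := -1) (d := -1) (e := 0) (f := 1)
      (fun z => ?_) (by norm_num) z
    apply Complex.ext <;> simp [sideCoord, bary] <;> ring
  · refine isPositiveAt_affine (a := -1) (b := -2) (c := 1) (d := 0) (e := 1) (f := 0)
      (fun z => ?_) (by norm_num) z
    apply Complex.ext <;> simp [sideCoord, bary]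
    ring
  · refine isPositiveAt_affine (a := 2) (b := 1) (c := 0) (d := 1) (e := -1) (f := 0)
      (fun z => ?_) (by norm_num) z
    apply Complex.ext <;> simp [sideCoord, bary]
    ring

/-- The point of the plane with given coordinates with respect to the side `i`. -/
noncomputable def ofSideCoord (i : Fin 3) (w : ℂ) : ℂ :=
  ofBary i ((1 - w.im - w.re) / 2) ((1 - w.im + w.re) / 2)

theorem sideCoord_ofSideCoord (i : Fin 3) (w : ℂ) : sideCoord i (ofSideCoord i w) = w := by
  apply Complex.ext
  · rw [sideCoord_re, ofSideCoord, bary_ofBary_one, bary_ofBary_two]; ring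
  · rw [sideCoord_im, ofSideCoord, bary_ofBary]; ring

theorem ofSideCoord_sideCoord (i : Fin 3) (z : ℂ) : ofSideCoord i (sideCoord i z) = z :=
  sideCoord_injective i (sideCoord_ofSideCoord i _)

theorem ofSideCoord_mem {i : Fin 3} {w : ℂ} (h0 : 0 ≤ w.im) (h1 : |w.re| + w.im ≤ 1) :
    ofSideCoord i w ∈ Tri := by
  have := le_abs_self w.re
  have := neg_abs_le w.re
  refine mem_Tri.2 (fin3_forall i ?_ ?_ ?_)
  · rw [ofSideCoord, bary_ofBary]; linarith
  · rw [ofSideCoord, bary_ofBary_one]; linarith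
  · rw [ofSideCoord, bary_ofBary_two]; linarith

theorem bary_one_eq (i : Fin 3) (z : ℂ) :
    bary (i + 1) z = (1 - (sideCoord i z).im - (sideCoord i z).re) / 2 := by
  rw [sideCoord_re, sideCoord_im]; linarith [bary_sum i z]

theorem bary_two_eq (i : Fin 3) (z : ℂ) :
    bary (i + 2) z = (1 - (sideCoord i z).im + (sideCoord i z).re) / 2 := by
  rw [sideCoord_re, sideCoord_im]; linarith [bary_sum i z]

/-- The points of a triangle which are closest to the side `p`. -/
def nearSide (ε : ℝ) (p : T × Fin 3) : Set (TriSum T) :=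
  Sigma.mk p.1 '' {z : Tri | bary p.2 z + ε < bary (p.2 + 1) z ∧ bary p.2 z + ε < bary (p.2 + 2) z}

omit [Finite T] in
theorem isOpen_nearSide (ε : ℝ) (p : T × Fin 3) : IsOpen (nearSide ε p) :=
  isOpenMap_sigmaMk _ ((isOpen_lt (f := fun z : Tri => bary p.2 z + ε)
    (g := fun z : Tri => bary (p.2 + 1) z) (by fun_prop) (by fun_prop)).and
    (isOpen_lt (by fun_prop) (by fun_prop)))

omit [Finite T] in
theorem nearSide_mono {ε ε' : ℝ} (hε : ε ≤ ε') (p : T × Fin 3) : nearSide ε' p ⊆ nearSide ε p :=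
  image_mono fun z hz => ⟨by linarith [hz.1], by linarith [hz.2]⟩

omit [Finite T] in
theorem sidePt_mem_nearSide {ε : ℝ} (hε : 0 ≤ ε) {p q : T × Fin 3} {x : unitInterval} :
    sidePt q x ∈ nearSide ε p ↔ q = p ∧ ε < x ∧ ε < 1 - x := by
  constructor
  · rintro ⟨z, ⟨h1, h2⟩, h⟩
    simp only [sidePt, Sigma.mk.injEq, heq_eq_eq] at h
    obtain ⟨h3, rfl⟩ := h
    have h0 := bary_nonneg (edgePt q.2 x) p.2
    have : q.2 = p.2 := by
      rcases fin3_cases p.2 q.2 with h' | h' | h'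
      · exact h'
      · have := bary_edgePt q.2 x; rw [← h'] at h1; linarith
      · have := bary_edgePt q.2 x; rw [← h'] at h2; linarith
    obtain rfl : q = p := Prod.ext h3.symm this
    rw [bary_edgePt, bary_edgePt_one] at h1
    rw [bary_edgePt, bary_edgePt_two] at h2
    exact ⟨rfl, by linarith, by linarith⟩
  · rintro ⟨rfl, h1, h2⟩
    refine ⟨edgePt q.2 x, ⟨?_, ?_⟩, rfl⟩
    · rw [bary_edgePt, bary_edgePt_one]; linarith
    · rw [bary_edgePt, bary_edgePt_two]; linarith

omit [Finite T] in
theorem eq_of_mem_nearSide {p q : T × Fin 3} {a : TriSum T} (hp : a ∈ nearSide 0 p)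
    (hq : a ∈ nearSide 0 q) : p = q := by
  obtain ⟨z, ⟨h1, h2⟩, rfl⟩ := hp
  obtain ⟨w, ⟨h3, h4⟩, h⟩ := hq
  simp only [Sigma.mk.injEq, heq_eq_eq] at h
  obtain ⟨h5, rfl⟩ := h
  refine Prod.ext h5.symm ?_
  rcases fin3_cases q.2 p.2 with h' | h' | h'
  · exact h'
  · rw [h'] at h1 h2; rw [fin3_12] at h2; linarith
  · rw [h'] at h1 h2; rw [fin3_21] at h1; linarith

omit [Finite T] in
theorem saturated_nearSide (hm : ∀ p, mate (mate p) = p) {ε : ℝ} (hε : 0 ≤ ε) (p : T × Fin 3) :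
    Saturated mate (nearSide ε p ∪ nearSide ε (mate p)) := by
  rintro q x - (h | h)
  · obtain ⟨rfl, h1, h2⟩ := (sidePt_mem_nearSide hε).1 h
    exact .inr ((sidePt_mem_nearSide hε).2 ⟨rfl, by simpa using h2, by simpa using h1⟩)
  · obtain ⟨rfl, h1, h2⟩ := (sidePt_mem_nearSide hε).1 h
    exact .inl ((sidePt_mem_nearSide hε).2 ⟨hm p, by simpa using h2, by simpa using h1⟩)

open Classical in
/-- The height at which a side is placed in the upper half plane: zero for boundary segments. -/
noncomputable def sideHeight (mate : T × Fin 3 → T × Fin 3) (p : T × Fin 3) : ℝ :=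
  -- The coordinates of a triangle have height at most one above its side, so at height `2` there is
  -- room below for the rotated copy of the neighbouring triangle, while an unglued side must lie on
  -- the real line.
  if mate p = p then 0 else 2

omit [Finite T] in
theorem sideHeight_eq {p : T × Fin 3} (hp : mate p = p) : sideHeight mate p = 0 := if_pos hp

omit [Finite T] in
theorem sideHeight_ne {p : T × Fin 3} (hp : mate p ≠ p) : sideHeight mate p = 2 := if_neg hp

omit [Finite T] in
theorem sideHeight_nonneg (p : T × Fin 3) : 0 ≤ sideHeight mate p := by
  unfold sideHeight; split_ifs <;> norm_num

open Classical in
/-- Coordinates around the side `p`. -/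
noncomputable def sideChart (mate : T × Fin 3 → T × Fin 3) (p : T × Fin 3) (a : TriSum T) : ℂ :=
  sideHeight mate p * Complex.I +
    if a ∈ nearSide 0 p then sideCoord p.2 a.2 else -sideCoord (mate p).2 a.2

omit [Finite T] in
theorem sideChart_eq {p : T × Fin 3} {a : TriSum T} (ha : a ∈ nearSide 0 p) :
    sideChart mate p a = sideHeight mate p * Complex.I + sideCoord p.2 a.2 := by
  simp [sideChart, ha]

omit [Finite T] in
theorem sideChart_eq_mate {p : T × Fin 3} (hp : mate p ≠ p) {a : TriSum T}
    (ha : a ∈ nearSide 0 (mate p)) :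
    sideChart mate p a = 2 * Complex.I - sideCoord (mate p).2 a.2 := by
  have : a ∉ nearSide 0 p := fun ha' => hp (eq_of_mem_nearSide ha ha')
  simp [sideChart, this, sideHeight_ne hp, sub_eq_add_neg]

omit [Finite T] in
theorem nearSide_cases {p : T × Fin 3} {a : TriSum T} {ε : ℝ}
    (ha : a ∈ nearSide ε p ∪ nearSide ε (mate p)) :
    a ∈ nearSide ε p ∨ mate p ≠ p ∧ a ∈ nearSide ε (mate p) := by
  by_cases hpm : mate p = p
  · rw [hpm, union_self] at ha; exact .inl ha
  · exact ha.imp_right fun h => ⟨hpm, h⟩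

omit [Finite T] in
theorem continuous_sideCoord_snd (i : Fin 3) :
    Continuous fun a : TriSum T => sideCoord i a.2 :=
  (continuous_sideCoord i).comp (continuous_sigma fun _ => continuous_subtype_val)

omit [Finite T] in
theorem continuousOn_sideChart (p : T × Fin 3) :
    ContinuousOn (sideChart mate p) (nearSide 0 p ∪ nearSide 0 (mate p)) := by
  intro a ha
  refine ContinuousAt.continuousWithinAt ?_
  rcases nearSide_cases ha with ha | ⟨hpm, ha⟩
  · exact (continuous_const.add (continuous_sideCoord_snd p.2)).continuousAt.congr
      (Filter.eventuallyEq_of_mem ((isOpen_nearSide 0 p).mem_nhds ha)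
        fun b hb => (sideChart_eq hb).symm)
  · exact (continuous_const.sub (continuous_sideCoord_snd (mate p).2)).continuousAt.congr
      (Filter.eventuallyEq_of_mem ((isOpen_nearSide 0 _).mem_nhds ha)
        fun b hb => (sideChart_eq_mate hpm hb).symm)

omit [Finite T] in
theorem sideChart_im_nonneg {p : T × Fin 3} {a : TriSum T}
    (ha : a ∈ nearSide 0 p ∪ nearSide 0 (mate p)) : 0 ≤ (sideChart mate p a).im := by
  rcases nearSide_cases ha with ha | ⟨hpm, ha⟩
  · rw [sideChart_eq ha, Complex.add_im, sideCoord_im]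
    have := bary_nonneg a.2 p.2
    have := sideHeight_nonneg (mate := mate) p
    simp; linarith
  · rw [sideChart_eq_mate hpm ha, Complex.sub_im, sideCoord_im]
    have := bary_le_one a.2 (mate p).2
    simp; linarith

omit [Finite T] in
-- The point at `x` on the side `p` has real coordinate `2x - 1`. Its mate is rotated by a half turn
-- and traversed backwards, which gives `-(2(1 - x) - 1)`, the same number.
theorem sideChart_glue (hm : ∀ p, mate (mate p) = p) {p q : T × Fin 3} {x : unitInterval}
    (hq : mate q ≠ q) (hx : sidePt q x ∈ nearSide 0 p ∪ nearSide 0 (mate p)) :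
    sideChart mate p (sidePt q x) = sideChart mate p (sidePt (mate q) (unitInterval.symm x)) := by
  have key : ∀ x : unitInterval, mate p ≠ p → sidePt p x ∈ nearSide 0 p →
      sideChart mate p (sidePt p x) =
        sideChart mate p (sidePt (mate p) (unitInterval.symm x)) := by
    intro x hpm hx
    have hx' := (sidePt_mem_nearSide le_rfl).1 hx
    rw [sideChart_eq hx, sideChart_eq_mate hpm ((sidePt_mem_nearSide le_rfl).2 ⟨rfl,
      by simpa using hx'.2.2, by simpa using hx'.2.1⟩)]
    simp only [sideCoord, sidePt, bary_edgePt, bary_edgePt_one, bary_edgePt_two, sideHeight_ne hpm]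
    simp
    ring
  rcases hx with hx | hx
  · obtain ⟨rfl, -⟩ := (sidePt_mem_nearSide le_rfl).1 hx
    exact key x hq hx
  · obtain ⟨rfl, h1, h2⟩ := (sidePt_mem_nearSide le_rfl).1 hx
    rw [hm] at hq ⊢
    have := key (unitInterval.symm x) hq.symm ((sidePt_mem_nearSide le_rfl).2
      ⟨rfl, by simpa using h2, by simpa using h1⟩)
    rw [unitInterval.symm_symm] at this
    exact this.symm

omit [Finite T] [T2Space Y] in
-- The triangle of `p` lies above the height `2` and the triangle of its mate below it, so the two
-- images meet only along the glued side.
theorem IsGluing.eq_of_sideChart_eq (h : IsGluing mate χ) {p : T × Fin 3} {a b : TriSum T}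
    (ha : a ∈ nearSide 0 p ∪ nearSide 0 (mate p)) (hb : b ∈ nearSide 0 p ∪ nearSide 0 (mate p))
    (hab : sideChart mate p a = sideChart mate p b) : χ a = χ b := by
  have key : mate p ≠ p → ∀ a ∈ nearSide 0 p, ∀ b ∈ nearSide 0 (mate p),
      sideChart mate p a = sideChart mate p b → χ a = χ b := by
    intro hpm a ha b hb hab
    rw [sideChart_eq ha, sideChart_eq_mate hpm hb, sideHeight_ne hpm] at hab
    obtain ⟨z, hz, rfl⟩ := ha
    obtain ⟨w, hw, rfl⟩ := hb
    have e1 := congrArg Complex.re hab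
    have e2 := congrArg Complex.im hab
    simp [sideCoord] at e1 e2
    have := bary_nonneg z p.2
    have := bary_nonneg w (mate p).2
    have e3 : bary p.2 z = 0 := by linarith
    have e4 : bary (mate p).2 w = 0 := by linarith
    have e5 := bary_sum p.2 z
    have e6 := bary_sum (mate p).2 w
    have := h.glue p hpm ⟨bary (p.2 + 2) z, bary_nonneg z _, bary_le_one z _⟩
    rw [eq_edgePt e3, eq_edgePt e4]
    refine this.trans (congrArg χ (congrArg (sidePt (mate p)) (Subtype.ext ?_)))
    simp
    linarith
  rcases nearSide_cases ha with ha | ⟨hpm, ha⟩ <;> rcases nearSide_cases hb with hb | ⟨hpm, hb⟩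
  · rw [sideChart_eq ha, sideChart_eq hb] at hab
    obtain ⟨z, hz, rfl⟩ := ha
    obtain ⟨w, hw, rfl⟩ := hb
    exact congrArg (fun z => χ ⟨_, z⟩) (Subtype.ext (sideCoord_injective _ (add_left_cancel hab)))
  · exact key hpm a ha b hb hab
  · exact (key hpm b hb a ha hab.symm).symm
  · rw [sideChart_eq_mate hpm ha, sideChart_eq_mate hpm hb] at hab
    obtain ⟨z, hz, rfl⟩ := ha
    obtain ⟨w, hw, rfl⟩ := hb
    exact congrArg (fun z => χ ⟨_, z⟩) (Subtype.ext (sideCoord_injective _ (sub_right_injective hab)))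

/-- The image of the coordinates around a side. -/
def sideTarget (mate : T × Fin 3 → T × Fin 3) (p : T × Fin 3) (ε : ℝ) : Set ℂ :=
  -- At distance `y` from the side, the condition `y + ε < (1 - y ± x) / 2` that defines `nearSide`
  -- reads `3 * y ∓ x < 1 - 2 * ε`.
  {w | |w.re| + 3 * |w.im - sideHeight mate p| < 1 - 2 * ε}

omit [Finite T] in
theorem exists_sideChart_eq {p : T × Fin 3} {ε : ℝ} (hε : 0 < ε) {w : ℂ}
    (hw : w ∈ sideTarget mate p ε) (hw0 : 0 ≤ w.im) :
    ∃ a ∈ nearSide ε p ∪ nearSide ε (mate p), sideChart mate p a = w := by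
  have hmem : ∀ (q : T × Fin 3) (v : ℂ), 0 ≤ v.im → |v.re| + 3 * v.im < 1 - 2 * ε →
      ∃ a ∈ nearSide ε q, sideCoord q.2 a.2 = v := by
    intro q v h0 hv
    have := abs_nonneg v.re
    refine ⟨⟨q.1, ofSideCoord q.2 v, ofSideCoord_mem h0 (by linarith)⟩, ⟨_, ⟨?_, ?_⟩, rfl⟩,
      sideCoord_ofSideCoord _ _⟩
    · simp only [ofSideCoord, bary_ofBary, bary_ofBary_one]
      linarith [le_abs_self v.re]
    · simp only [ofSideCoord, bary_ofBary, bary_ofBary_two]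
      linarith [neg_abs_le v.re]
  simp only [sideTarget, mem_ofPred_eq] at hw
  by_cases hpm : mate p = p
  · rw [sideHeight_eq hpm, sub_zero, abs_of_nonneg hw0] at hw
    obtain ⟨a, ha, hav⟩ := hmem p w hw0 hw
    refine ⟨a, .inl ha, ?_⟩
    rw [sideChart_eq (nearSide_mono hε.le p ha), hav, sideHeight_eq hpm]
    simp
  · rw [sideHeight_ne hpm] at hw
    rcases le_total 2 w.im with h2 | h2
    · rw [abs_of_nonneg (a := w.im - 2) (by linarith)] at hw
      obtain ⟨a, ha, hav⟩ := hmem p (w - 2 * Complex.I) (by simpa using h2) (by simpa using hw)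
      refine ⟨a, .inl ha, ?_⟩
      rw [sideChart_eq (nearSide_mono hε.le p ha), hav, sideHeight_ne hpm]
      push_cast; ring
    · rw [abs_of_nonpos (a := w.im - 2) (by linarith)] at hw
      obtain ⟨a, ha, hav⟩ := hmem (mate p) (2 * Complex.I - w) (by simpa using h2)
        (by simpa using hw)
      refine ⟨a, .inr ha, ?_⟩
      rw [sideChart_eq_mate hpm (nearSide_mono hε.le _ ha), hav]
      ring

omit [Finite T] in
theorem sideChart_mem_sideTarget {p : T × Fin 3} {ε : ℝ} (hε : 0 < ε) {a : TriSum T}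
    (ha : a ∈ nearSide ε p ∪ nearSide ε (mate p)) : sideChart mate p a ∈ sideTarget mate p ε := by
  rw [sideTarget, mem_ofPred_eq]
  rcases nearSide_cases ha with ha | ⟨hpm, ha⟩
  · rw [sideChart_eq (nearSide_mono hε.le p ha)]
    obtain ⟨z, ⟨h1, h2⟩, rfl⟩ := ha
    have e : (sideHeight mate p * Complex.I + sideCoord p.2 z : ℂ).im - sideHeight mate p =
        bary p.2 z := by
      simp [sideCoord]
    have e' : (sideHeight mate p * Complex.I + sideCoord p.2 z : ℂ).re =
        bary (p.2 + 2) z - bary (p.2 + 1) z := by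
      simp [sideCoord]
    rw [e, e', abs_of_nonneg (bary_nonneg z _)]
    have := bary_sum p.2 z
    rcases abs_cases (bary (p.2 + 2) z - bary (p.2 + 1) z) with h | h <;> linarith
  · rw [sideChart_eq_mate hpm (nearSide_mono hε.le _ ha), sideHeight_ne hpm]
    obtain ⟨z, ⟨h1, h2⟩, rfl⟩ := ha
    rw [show (2 * Complex.I - sideCoord (mate p).2 z).im - 2 = -bary (mate p).2 z by
      simp [sideCoord], show (2 * Complex.I - sideCoord (mate p).2 z).re =
        -(bary ((mate p).2 + 2) z - bary ((mate p).2 + 1) z) by simp [sideCoord],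
      abs_neg, abs_neg, abs_of_nonneg (bary_nonneg z _)]
    have := bary_sum (mate p).2 z
    rcases abs_cases (bary ((mate p).2 + 2) z - bary ((mate p).2 + 1) z) with h | h <;> linarith

omit [Finite T] in
theorem positiveAt_sideChart {p : T × Fin 3} {t : T} {z : Tri} (hz : (z : ℂ) ∈ interior Tri)
    (ha : (⟨t, z⟩ : TriSum T) ∈ nearSide 0 p ∪ nearSide 0 (mate p)) :
    PositiveAt (fun w => sideChart mate p ⟨t, w⟩) z := by
  rcases nearSide_cases ha with ha | ⟨hpm, ha⟩
  · refine PositiveAt.of_eventuallyEq (Tri_mem_nhds hz)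
      (F := fun w => 1 * sideCoord p.2 w + sideHeight mate p * Complex.I)
      ((isPositiveAt_mul_add one_ne_zero).comp (F := fun w => 1 * w + _)
        (isPositiveAt_sideCoord p.2 z) (by fun_prop) (.of_forall fun w => by fun_prop)) ?_
    filter_upwards [eventually_of_isOpen_sigma (isOpen_nearSide _ _) ha] with w hw
    rw [sideChart_eq hw]
    ring
  · refine PositiveAt.of_eventuallyEq (Tri_mem_nhds hz)
      (F := fun w => -1 * sideCoord (mate p).2 w + 2 * Complex.I)
      ((isPositiveAt_mul_add (by norm_num)).comp (F := fun w => -1 * w + _)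
        (isPositiveAt_sideCoord (mate p).2 z) (by fun_prop) (.of_forall fun w => by fun_prop)) ?_
    filter_upwards [eventually_of_isOpen_sigma (isOpen_nearSide _ _) ha] with w hw
    rw [sideChart_eq_mate hpm hw]
    ring

/-- The points of a triangle which are closest to the side `p`, as a closed set. -/
def nearSideClosed (ε : ℝ) (p : T × Fin 3) : Set (TriSum T) :=
  Sigma.mk p.1 '' {z : Tri | bary p.2 z + ε ≤ bary (p.2 + 1) z ∧ bary p.2 z + ε ≤ bary (p.2 + 2) z}

omit [Finite T] in
theorem isCompact_nearSideClosed (ε : ℝ) (p : T × Fin 3) : IsCompact (nearSideClosed ε p) :=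
  ((isClosed_le (f := fun z : Tri => bary p.2 z + ε) (g := fun z : Tri => bary (p.2 + 1) z)
    (by fun_prop) (by fun_prop)).inter (isClosed_le (f := fun z : Tri => bary p.2 z + ε)
    (g := fun z : Tri => bary (p.2 + 2) z) (by fun_prop) (by fun_prop))).isCompact.image
    continuous_sigmaMk

omit [Finite T] in
theorem nearSide_subset_closed (ε : ℝ) (p : T × Fin 3) : nearSide ε p ⊆ nearSideClosed ε p :=
  image_mono fun _ hz => ⟨hz.1.le, hz.2.le⟩

omit [Finite T] in
theorem nearSideClosed_subset {ε : ℝ} (hε : 0 < ε) (p : T × Fin 3) :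
    nearSideClosed ε p ⊆ nearSide 0 p :=
  image_mono fun _ hz => ⟨by linarith [hz.1], by linarith [hz.2]⟩

theorem IsGluing.exists_chart_side (h : IsGluing mate χ) (p : T × Fin 3) {ε : ℝ} (hε : 0 < ε) :
    ∃ e ∈ positiveAtlas χ, e.source = χ '' (nearSide ε p ∪ nearSide ε (mate p)) ∧
      ∀ a ∈ nearSide ε p ∪ nearSide ε (mate p), (e (χ a) : ℂ) = sideChart mate p a := by
  have : Nonempty Y := ⟨χ ⟨p.1, cornerPt 0⟩⟩
  exact h.exists_chart
    ((isOpen_nearSide 0 p).union (isOpen_nearSide 0 (mate p)))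
    (saturated_nearSide h.mate_mate le_rfl p)
    ((isOpen_nearSide ε p).union (isOpen_nearSide ε (mate p)))
    (saturated_nearSide h.mate_mate hε.le p)
    ((isCompact_nearSideClosed ε p).union (isCompact_nearSideClosed ε (mate p)))
    (union_subset_union (nearSide_subset_closed _ _) (nearSide_subset_closed _ _))
    (union_subset_union (nearSideClosed_subset hε _) (nearSideClosed_subset hε _))
    (continuousOn_sideChart p) (fun a => sideChart_im_nonneg)
    (fun q x hq hx => sideChart_glue h.mate_mate hq hx)
    (fun a ha b hb => h.eq_of_sideChart_eq ha hb)
    (isOpen_lt (by fun_prop) continuous_const)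
    (fun w hw hw0 => exists_sideChart_eq hε hw hw0)
    (fun a ha => sideChart_mem_sideTarget hε ha)
    (fun t z hz ha => positiveAt_sideChart hz
      (union_subset_union (nearSide_mono hε.le _) (nearSide_mono hε.le _) ha))

end Charts

/-! #### The corners at a vertex -/

section Corners

variable {T : Type} {mate : T × Fin 3 → T × Fin 3}

/-- The corner which precedes `c` in counterclockwise order around a vertex. -/
def prevCorner (mate : T × Fin 3 → T × Fin 3) (c : T × Fin 3) : T × Fin 3 :=
  ((mate (c.1, c.2 + 2)).1, (mate (c.1, c.2 + 2)).2 + 2)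

/-- The corner `c` is not followed by another one. -/
def IsLastCorner (mate : T × Fin 3 → T × Fin 3) (c : T × Fin 3) : Prop :=
  mate (c.1, c.2 + 1) = (c.1, c.2 + 1)

/-- The corner `c` is not preceded by another one. -/
def IsFirstCorner (mate : T × Fin 3 → T × Fin 3) (c : T × Fin 3) : Prop :=
  mate (c.1, c.2 + 2) = (c.1, c.2 + 2)

/-- This holds at the ends of the sequences too, where `mate` fixes the side: `nextCorner` is a
permutation of all the corners, which continues from a last corner to a first one. -/
theorem prevCorner_nextCorner (hm : ∀ p, mate (mate p) = p) (c : T × Fin 3) :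
    prevCorner mate (nextCorner mate c) = c := by
  simp [prevCorner, nextCorner, fin3_12, hm]

theorem nextCorner_prevCorner (hm : ∀ p, mate (mate p) = p) (c : T × Fin 3) :
    nextCorner mate (prevCorner mate c) = c := by
  simp [prevCorner, nextCorner, fin3_21, hm]

theorem isFirstCorner_nextCorner (hm : ∀ p, mate (mate p) = p) (c : T × Fin 3) :
    IsFirstCorner mate (nextCorner mate c) ↔ IsLastCorner mate c := by
  simp only [IsFirstCorner, IsLastCorner, nextCorner, fin3_12, Prod.mk.eta, hm]
  exact eq_comm

theorem isLastCorner_prevCorner (hm : ∀ p, mate (mate p) = p) (c : T × Fin 3) :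
    IsLastCorner mate (prevCorner mate c) ↔ IsFirstCorner mate c := by
  rw [← isFirstCorner_nextCorner hm, nextCorner_prevCorner hm]

/-- Each corner lies in a linear sequence of corners, which ends at a boundary segment. -/
def IsLinear (mate : T × Fin 3 → T × Fin 3) : Prop :=
  ∀ c, ∃ k, IsLastCorner mate ((nextCorner mate)^[k] c)

/-- On a finite set the orbit of `c` under the permutation `nextCorner` is a cycle. The successor of
a last corner is a first corner, and it is reached backwards by going around the rest of the cycle.
-/
theorem exists_isFirstCorner [Finite T] (hm : ∀ p, mate (mate p) = p) {c : T × Fin 3}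
    (hl : ∃ k, IsLastCorner mate ((nextCorner mate)^[k] c)) :
    ∃ k, IsFirstCorner mate ((prevCorner mate)^[k] c) := by
  obtain ⟨k, hk⟩ := hl
  rw [← isFirstCorner_nextCorner hm, ← Function.iterate_succ_apply' (nextCorner mate)] at hk
  have hinj : Function.Injective (nextCorner mate) :=
    Function.LeftInverse.injective (prevCorner_nextCorner hm)
  obtain ⟨N, hN, hc⟩ := hinj.mem_periodicPts c
  have hc' : (nextCorner mate)^[N * (k + 1)] c = c := (hc.mul_const (k + 1)).eq
  obtain ⟨j, hj⟩ := Nat.exists_eq_add_of_le (Nat.le_mul_of_pos_left (k + 1) hN)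
  refine ⟨j, ?_⟩
  have : (prevCorner mate)^[j] c = (nextCorner mate)^[k + 1] c := by
    conv_lhs => rw [← hc', hj, add_comm, Function.iterate_add_apply]
    exact (Function.LeftInverse.iterate (prevCorner_nextCorner hm) j) _
  rw [this]
  exact hk

/-- Positions in linear sequences of corners: `pos c` is the number of corners before `c`, and
`rem c` the number of corners after `c`. -/
structure CornerOrder (mate : T × Fin 3 → T × Fin 3) where
  root : T × Fin 3 → T × Fin 3
  pos : T × Fin 3 → ℕ
  rem : T × Fin 3 → ℕ
  root_next : ∀ c, ¬ IsLastCorner mate c → root (nextCorner mate c) = root c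
  pos_next : ∀ c, ¬ IsLastCorner mate c → pos (nextCorner mate c) = pos c + 1
  rem_next : ∀ c, ¬ IsLastCorner mate c → rem c = rem (nextCorner mate c) + 1
  rem_eq_zero : ∀ c, rem c = 0 ↔ IsLastCorner mate c
  pos_eq_zero : ∀ c, pos c = 0 ↔ IsFirstCorner mate c
  root_first : ∀ c, IsFirstCorner mate c → root c = c

/-- The position and the remainder of a corner are the least numbers of steps back to a first corner
and forward to a last one. -/
theorem IsLinear.exists_cornerOrder [Finite T] (hm : ∀ p, mate (mate p) = p)
    (hl : IsLinear mate) : Nonempty (CornerOrder mate) := by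
  classical
  have hf := fun c => exists_isFirstCorner hm (hl c)
  have hpos : ∀ c, ¬ IsLastCorner mate c →
      Nat.find (hf (nextCorner mate c)) = Nat.find (hf c) + 1 := by
    intro c hc
    have h2 : ∃ m, IsFirstCorner mate ((prevCorner mate)^[m + 1] (nextCorner mate c)) := by
      obtain ⟨m, hm'⟩ := hf c
      refine ⟨m, ?_⟩
      rwa [Function.iterate_succ_apply, prevCorner_nextCorner hm]
    rw [Nat.find_comp_succ _ h2]
    · congr 1
      refine Nat.find_congr' (fun {n} => ?_)
      rw [Function.iterate_succ_apply, prevCorner_nextCorner hm]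
    · rw [Function.iterate_zero, id, isFirstCorner_nextCorner hm]; exact hc
  refine ⟨{
    root := fun c => (prevCorner mate)^[Nat.find (hf c)] c
    pos := fun c => Nat.find (hf c)
    rem := fun c => Nat.find (hl c)
    root_next := fun c hc => ?_
    pos_next := hpos
    rem_next := fun c hc => ?_
    rem_eq_zero := fun c => Nat.find_eq_zero _
    pos_eq_zero := fun c => Nat.find_eq_zero _
    root_first := fun c hc => ?_ }⟩
  · rw [hpos c hc, Function.iterate_succ_apply, prevCorner_nextCorner hm]
  · exact Nat.find_comp_succ _ (hl (nextCorner mate c)) hc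
  · rw [(Nat.find_eq_zero _).2 hc]; rfl

namespace CornerOrder

variable (o : CornerOrder mate) (hm : ∀ p, mate (mate p) = p)

include hm

theorem cases_of_pos_succ {c : T × Fin 3} {k : ℕ} (hc : o.pos c = k + 1) :
    ∃ d, ¬ IsLastCorner mate d ∧ nextCorner mate d = c ∧ o.pos d = k ∧ o.root d = o.root c := by
  have h1 : ¬ IsFirstCorner mate c := fun h => by rw [← o.pos_eq_zero c] at h; omega
  rw [← isLastCorner_prevCorner hm] at h1
  have e := nextCorner_prevCorner hm c
  refine ⟨prevCorner mate c, h1, e, ?_, ?_⟩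
  · have := o.pos_next _ h1; rw [e] at this; omega
  · have := o.root_next _ h1; rw [e] at this; exact this.symm

theorem eq_of_root_pos {c d : T × Fin 3} (h : o.root c = o.root d) (h' : o.pos c = o.pos d) :
    c = d := by
  induction hk : o.pos c generalizing c d with
  | zero =>
    rw [← o.root_first c ((o.pos_eq_zero c).1 hk), h,
      o.root_first d ((o.pos_eq_zero d).1 (h' ▸ hk))]
  | succ k ih =>
    obtain ⟨c', -, rfl, h2, h3⟩ := o.cases_of_pos_succ hm hk
    obtain ⟨d', -, rfl, h5, h6⟩ := o.cases_of_pos_succ hm (h' ▸ hk)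
    rw [ih (h3.trans (h.trans h6.symm)) (h2.trans h5.symm) h2]

theorem root_spec (c : T × Fin 3) : IsFirstCorner mate (o.root c) ∧
    o.pos c + o.rem c = o.rem (o.root c) ∧ CornerRel mate (o.root c) c := by
  induction hk : o.pos c generalizing c with
  | zero =>
    have h1 := (o.pos_eq_zero c).1 hk
    rw [o.root_first c h1]
    exact ⟨h1, by omega, .refl _⟩
  | succ k ih =>
    obtain ⟨c', h1, rfl, h2, h3⟩ := o.cases_of_pos_succ hm hk
    obtain ⟨h4, h5, h6⟩ := ih c' h2
    rw [h3] at h4 h5 h6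
    exact ⟨h4, by have := o.rem_next _ h1; omega, .trans _ _ _ h6 (.rel _ _ ⟨h1, rfl⟩)⟩

theorem exists_of_le {r : T × Fin 3} (hr : IsFirstCorner mate r) {k : ℕ} (hk : k ≤ o.rem r) :
    ∃ c, o.root c = r ∧ o.pos c = k := by
  induction k with
  | zero => exact ⟨r, o.root_first r hr, (o.pos_eq_zero r).2 hr⟩
  | succ k ih =>
    obtain ⟨c, h1, h2⟩ := ih (by omega)
    have h3 := (o.root_spec hm c).2.1
    rw [h1] at h3
    have h4 : ¬ IsLastCorner mate c := fun h => by rw [← o.rem_eq_zero c] at h; omega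
    exact ⟨_, (o.root_next c h4).trans h1, (o.pos_next c h4).trans (by rw [h2])⟩

end CornerOrder

end Corners

/-! #### Charts around a vertex -/

/-- Polar coordinates on a sector: the quadrant `0 ≤ a, b` is mapped to the sector between the
angles `κ k` and `κ (k + 1)`. -/
noncomputable def sectorMap (κ k a b : ℝ) : ℂ :=
  ((a + b : ℝ) : ℂ) * Complex.exp ((κ * (k + b / (a + b)) : ℝ) * Complex.I)

theorem norm_sectorMap {κ k a b : ℝ} (h : 0 ≤ a + b) : ‖sectorMap κ k a b‖ = a + b := by
  rw [sectorMap, norm_mul, Complex.norm_exp_ofReal_mul_I, mul_one, Complex.norm_real,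
    Real.norm_of_nonneg h]

theorem sectorMap_im {κ k a b : ℝ} :
    (sectorMap κ k a b).im = (a + b) * Real.sin (κ * (k + b / (a + b))) := by
  rw [sectorMap, Complex.im_ofReal_mul, Complex.exp_ofReal_mul_I_im]

theorem div_add_mem {a b : ℝ} (ha : 0 ≤ a) (hb : 0 ≤ b) : b / (a + b) ∈ Icc (0 : ℝ) 1 :=
  ⟨by positivity, div_le_one_of_le₀ (by linarith) (by linarith)⟩

/-- At the apex the angle has no limit, but the modulus `a + b` tends to zero; elsewhere the formula
is continuous. -/
theorem continuousAt_sectorMap {A : Type*} [TopologicalSpace A] {κ k : ℝ} {f g : A → ℝ} {x : A}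
    (hf : ContinuousAt f x) (hg : ContinuousAt g x) (hf0 : ∀ᶠ y in 𝓝 x, 0 ≤ f y + g y) :
    ContinuousAt (fun y => sectorMap κ k (f y) (g y)) x := by
  rcases hf0.self_of_nhds.eq_or_lt with h | h
  · rw [ContinuousAt]
    have : sectorMap κ k (f x) (g x) = 0 := by rw [← norm_eq_zero, norm_sectorMap h.le, ← h]
    rw [this, ← tendsto_zero_iff_norm_tendsto_zero.symm]
    have h2 : Filter.Tendsto (fun y => f y + g y) (𝓝 x) (𝓝 0) := by
      rw [h]; exact hf.add hg
    refine h2.congr' ?_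
    filter_upwards [hf0] with y hy
    rw [norm_sectorMap hy]
  · have : f x + g x ≠ 0 := h.ne'
    unfold sectorMap
    fun_prop (disch := assumption)

theorem mul_exp_injective {s s' α β : ℝ} (hs : 0 ≤ s) (hs' : 0 ≤ s') (hα : α ∈ Icc 0 Real.pi)
    (hβ : β ∈ Icc 0 Real.pi)
    (h : (s : ℂ) * Complex.exp (α * Complex.I) = s' * Complex.exp (β * Complex.I)) :
    s = s' ∧ (s = 0 ∨ α = β) := by
  have h1 := congrArg norm h
  rw [norm_mul, norm_mul, Complex.norm_exp_ofReal_mul_I, Complex.norm_exp_ofReal_mul_I, mul_one,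
    mul_one, Complex.norm_real, Complex.norm_real, Real.norm_of_nonneg hs,
    Real.norm_of_nonneg hs'] at h1
  refine ⟨h1, ?_⟩
  by_cases h0 : s = 0
  · exact .inl h0
  right
  rw [← h1] at h
  have h2 := congrArg Complex.re (mul_left_cancel₀ (by exact_mod_cast h0) h)
  rw [Complex.exp_ofReal_mul_I_re, Complex.exp_ofReal_mul_I_re] at h2
  exact Real.injOn_cos hα hβ h2

/-- The quotient of the increments of `F` and of its linear approximation tends to `1`, which lies
in the slit plane. -/
theorem isPositiveAt_of_hasDerivAt {F : ℂ → ℂ} {z d : ℂ} (hF : HasDerivAt F d z) (hd : d ≠ 0)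
    (hFc : ∀ᶠ w in 𝓝 z, ContinuousAt F w) : IsPositiveAt F z := by
  refine (isPositiveAt_mul_add (b := 0) hd).of_slitPlane hFc (.of_forall fun w => by fun_prop) ?_
  have h1 := hasDerivAt_iff_tendsto_slope.1 hF
  have h2 : Filter.Tendsto (fun w => slope F z w / d) (𝓝[≠] z) (𝓝 1) := by
    have := h1.div_const d
    rwa [div_self hd] at this
  have h3 := h2.eventually (Complex.isOpen_slitPlane.mem_nhds (by simp))
  rw [eventually_nhdsWithin_iff] at h3
  filter_upwards [h3] with w hw hne
  have := hw hne
  rw [slope_def_field, div_div, mul_comm (w - z)] at this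
  rwa [add_zero, add_zero, ← mul_sub]

theorem isPositiveAt_baryPair (i : Fin 3) (z : ℂ) : IsPositiveAt
    (fun w => ((bary (i + 1) w + bary (i + 2) w : ℝ) : ℂ) + (bary (i + 2) w : ℂ) * Complex.I) z := by
  fin_cases i
  · refine isPositiveAt_affine (a := 1) (b := 1) (c := 0) (d := 1) (e := 0) (f := 0)
      (fun z => ?_) (by norm_num) z
    apply Complex.ext <;> simp [bary]
  · refine isPositiveAt_affine (a := -1) (b := 0) (c := -1) (d := -1) (e := 1) (f := 1)
      (fun z => ?_) (by norm_num) z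
    apply Complex.ext <;> simp [bary] <;> ring
  · refine isPositiveAt_affine (a := 0) (b := -1) (c := 1) (d := 0) (e := 1) (f := 0)
      (fun z => ?_) (by norm_num) z
    apply Complex.ext <;> simp [bary]
    ring

/-- The sector map is the exponential of `Q`, the logarithm of the radius plus `i` times the angle.
The map `Q` is compared with the affine map `(a + b, b)`: the real part is increasing in `a + b`,
and for fixed `a + b` the imaginary part is increasing in `b`. -/
theorem isPositiveAt_sectorMap {κ k : ℝ} (hκ : 0 < κ) {i : Fin 3} {z : ℂ}
    (h1 : 0 < bary (i + 1) z) (h2 : 0 < bary (i + 2) z) :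
    IsPositiveAt (fun w => sectorMap κ k (bary (i + 1) w) (bary (i + 2) w)) z := by
  let Q : ℂ → ℂ := fun w => (Real.log (bary (i + 1) w + bary (i + 2) w) : ℂ) +
    (κ * (k + bary (i + 2) w / (bary (i + 1) w + bary (i + 2) w)) : ℝ) * Complex.I
  have hpos : ∀ᶠ w in 𝓝 z, 0 < bary (i + 1) w + bary (i + 2) w :=
    ((by fun_prop : Continuous fun w => bary (i + 1) w + bary (i + 2) w).tendsto z).eventually
      (lt_mem_nhds (by linarith))
  have hQc : ∀ᶠ w in 𝓝 z, ContinuousAt Q w := by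
    filter_upwards [hpos] with w hw
    have hne := hw.ne'
    simp only [Q]
    fun_prop (disch := assumption)
  have hQ : IsPositiveAt Q z := by
    refine (isPositiveAt_baryPair i z).of_slitPlane hQc (.of_forall fun w => by fun_prop) ?_
    filter_upwards [hpos] with w hw hne
    have hz : 0 < bary (i + 1) z + bary (i + 2) z := by linarith
    have hre : ∀ x y : ℝ, ((x : ℂ) + (y : ℂ) * Complex.I).re = x := by simp
    have him : ∀ x y : ℝ, ((x : ℂ) + (y : ℂ) * Complex.I).im = y := by simp
    refine div_mem_slitPlane_of_re (fun h => ?_) fun h => ?_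
    · simp only [Q, Complex.sub_re, hre] at h ⊢
      rcases lt_or_gt_of_ne (sub_ne_zero.1 h) with h | h
      · have := Real.log_lt_log hw h
        nlinarith
      · have := Real.log_lt_log hz h
        nlinarith
    · simp only [Q, Complex.sub_re, Complex.sub_im, hre, him] at h ⊢
      have hs : bary (i + 1) w + bary (i + 2) w = bary (i + 1) z + bary (i + 2) z := by linarith
      have hb : bary (i + 2) w - bary (i + 2) z ≠ 0 := fun hb =>
        hne (eq_of_bary i (by linarith) (by linarith))
      rw [hs]
      have : (κ * (k + bary (i + 2) w / (bary (i + 1) z + bary (i + 2) z)) -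
          κ * (k + bary (i + 2) z / (bary (i + 1) z + bary (i + 2) z))) *
          (bary (i + 2) w - bary (i + 2) z) =
          κ / (bary (i + 1) z + bary (i + 2) z) * (bary (i + 2) w - bary (i + 2) z) ^ 2 := by
        field_simp
        ring
      rw [this]
      positivity
  refine ((isPositiveAt_of_hasDerivAt (Complex.hasDerivAt_exp (Q z)) (Complex.exp_ne_zero _)
    (.of_forall fun w => by fun_prop)).comp hQ hQc.self_of_nhds
    (.of_forall fun w => by fun_prop)).congr ?_
  filter_upwards [hpos] with w hw
  simp only [Q]
  rw [Complex.exp_add, ← Complex.ofReal_exp, Real.exp_log hw, sectorMap]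

section VertexChart

variable {T : Type} {mate : T × Fin 3 → T × Fin 3} (o : CornerOrder mate) (r : T × Fin 3)

/-- The points of the triangles which are close to one of the corners in the sequence of `r`. -/
def nearCorner (δ : ℝ) : Set (TriSum T) := {a | ∃ i, o.root (a.1, i) = r ∧ δ < bary i a.2}

/-- The points of the triangles which are close to one of the corners in the sequence of `r`, as a
closed set. -/
def nearCornerClosed (δ : ℝ) : Set (TriSum T) := {a | ∃ i, o.root (a.1, i) = r ∧ δ ≤ bary i a.2}

/-- The angle of the sectors around a vertex. -/
noncomputable def sectorAngle : ℝ := Real.pi / (o.rem r + 1)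

open Classical in
/-- Coordinates around a vertex. -/
noncomputable def cornerChart (a : TriSum T) : ℂ :=
  -- At most one barycentric coordinate exceeds `1/2`, so the sum has at most one nonzero term, even
  -- if a triangle has several corners in the sequence.
  ∑ i, if o.root (a.1, i) = r ∧ 1 / 2 < bary i a.2 then
    sectorMap (sectorAngle o r) (o.pos (a.1, i)) (bary (i + 1) a.2) (bary (i + 2) a.2) else 0

variable {o r}

theorem isOpen_nearCorner (δ : ℝ) : IsOpen (nearCorner o r δ) := by
  rw [isOpen_sigma_iff]
  intro t
  have : Sigma.mk t ⁻¹' nearCorner o r δ = ⋃ i ∈ {i | o.root (t, i) = r}, {z : Tri | δ < bary i z} := by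
    ext z; simp [nearCorner]
  rw [this]
  exact isOpen_biUnion fun i _ => isOpen_lt continuous_const (by fun_prop)

theorem isClosed_nearCornerClosed (δ : ℝ) : IsClosed (nearCornerClosed o r δ) := by
  rw [isClosed_sigma_iff]
  intro t
  have : Sigma.mk t ⁻¹' nearCornerClosed o r δ =
      ⋃ i ∈ {i | o.root (t, i) = r}, {z : Tri | δ ≤ bary i z} := by
    ext z; simp [nearCornerClosed]
  rw [this]
  exact (Set.toFinite _).isClosed_biUnion fun i _ => isClosed_le continuous_const (by fun_prop)

theorem bary_unique {i j : Fin 3} {z : Tri} (hi : 1 / 2 < bary i z) (hj : 1 / 2 < bary j z) :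
    i = j := by
  have := bary_sum j z
  have := bary_nonneg z (j + 1)
  have := bary_nonneg z (j + 2)
  rcases fin3_cases j i with h | rfl | rfl
  · exact h
  · linarith
  · linarith

theorem cornerChart_eq {t : T} {i : Fin 3} {z : Tri} (h : o.root (t, i) = r)
    (hi : 1 / 2 < bary i z) : cornerChart o r ⟨t, z⟩ =
      sectorMap (sectorAngle o r) (o.pos (t, i)) (bary (i + 1) z) (bary (i + 2) z) := by
  classical
  rw [cornerChart, Finset.sum_eq_single i]
  · rw [if_pos ⟨h, hi⟩]
  · intro j _ hj
    rw [if_neg]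
    rintro ⟨-, h'⟩
    exact hj (bary_unique h' hi)
  · simp

theorem eventually_cornerChart_eq {t : T} {i : Fin 3} {z : Tri} (h : o.root (t, i) = r)
    (hi : 1 / 2 < bary i z) : ∀ᶠ w : Tri in 𝓝 z, cornerChart o r ⟨t, w⟩ =
      sectorMap (sectorAngle o r) (o.pos (t, i)) (bary (i + 1) w) (bary (i + 2) w) := by
  filter_upwards [((by fun_prop : Continuous fun w : Tri => bary i w).tendsto z).eventually
    (lt_mem_nhds hi)] with w hw
  exact cornerChart_eq h hw

theorem sectorAngle_pos : 0 < sectorAngle o r := div_pos Real.pi_pos (by positivity)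

theorem continuousOn_cornerChart : ContinuousOn (cornerChart o r) (nearCorner o r (1 / 2)) := by
  rintro ⟨t, z⟩ ⟨i, h, hi⟩
  refine ContinuousAt.continuousWithinAt ?_
  rw [ContinuousAt, Sigma.nhds_mk, Filter.tendsto_map'_iff]
  have := continuousAt_sectorMap (κ := sectorAngle o r) (k := o.pos (t, i)) (x := z)
    (f := fun w : Tri => bary (i + 1) w) (g := fun w : Tri => bary (i + 2) w) (by fun_prop)
    (by fun_prop) (.of_forall fun w => add_nonneg (bary_nonneg w _) (bary_nonneg w _))
  rw [ContinuousAt, ← cornerChart_eq h hi] at this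
  exact this.congr' ((eventually_cornerChart_eq h hi).mono fun w hw => hw.symm)

variable (hm : ∀ p, mate (mate p) = p)

include hm

theorem pos_le_rem {c : T × Fin 3} (hc : o.root c = r) : o.pos c ≤ o.rem r := by
  have := (o.root_spec hm c).2.1
  rw [hc] at this
  omega

theorem angle_mem {c : T × Fin 3} (hc : o.root c = r) {x : ℝ} (hx : x ∈ Icc (0 : ℝ) 1) :
    sectorAngle o r * (o.pos c + x) ∈ Icc 0 Real.pi := by
  have h1 : (o.pos c : ℝ) ≤ o.rem r := by exact_mod_cast pos_le_rem hm hc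
  refine ⟨mul_nonneg sectorAngle_pos.le (by have := hx.1; positivity), ?_⟩
  rw [sectorAngle, div_mul_eq_mul_div, div_le_iff₀ (by positivity)]
  exact mul_le_mul_of_nonneg_left (by linarith [hx.2]) Real.pi_pos.le

theorem cornerChart_im_nonneg {a : TriSum T} (ha : a ∈ nearCorner o r (1 / 2)) :
    0 ≤ (cornerChart o r a).im := by
  obtain ⟨t, z⟩ := a
  obtain ⟨i, h, hi⟩ := ha
  rw [cornerChart_eq h hi, sectorMap_im]
  have h1 := bary_nonneg z (i + 1)
  have h2 := bary_nonneg z (i + 2)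
  have := angle_mem hm h (div_add_mem h1 h2)
  exact mul_nonneg (by linarith) (Real.sin_nonneg_of_nonneg_of_le_pi this.1 this.2)

/-- Crossing a glued side counterclockwise leads from the end of one sector, where `b / (a + b) =
1`, to the start of the next, where this fraction is `0` and the position has grown by one. Crossing
in the other direction is the same statement for the mate. -/
theorem nearCorner_glue {δ : ℝ} (hδ : 1 / 2 ≤ δ) {p : T × Fin 3} (hp : mate p ≠ p)
    {x : unitInterval} (hx : sidePt p x ∈ nearCorner o r δ) :
    sidePt (mate p) (unitInterval.symm x) ∈ nearCorner o r δ ∧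
    cornerChart o r (sidePt p x) = cornerChart o r (sidePt (mate p) (unitInterval.symm x)) := by
  have key : ∀ q : T × Fin 3, ∀ y : unitInterval, mate q ≠ q → o.root (q.1, q.2 + 2) = r →
      δ < y → sidePt (mate q) (unitInterval.symm y) ∈ nearCorner o r δ ∧
      sidePt q y ∈ nearCorner o r δ ∧
      cornerChart o r (sidePt q y) = cornerChart o r (sidePt (mate q) (unitInterval.symm y)) := by
    intro q y hq hr hy
    have h1 : ¬ IsLastCorner mate (q.1, q.2 + 2) := by
      simpa only [IsLastCorner, fin3_21, Prod.mk.eta] using hq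
    have h2 : nextCorner mate (q.1, q.2 + 2) = ((mate q).1, (mate q).2 + 1) := by
      simp only [nextCorner, fin3_21, Prod.mk.eta]
    have h3 := o.root_next _ h1
    have h4 := o.pos_next _ h1
    rw [h2] at h3 h4
    have h5 : bary ((mate q).2 + 1) (edgePt (mate q).2 (unitInterval.symm y)) = y := by
      rw [bary_edgePt_one]; simp
    have h6 := bary_edgePt_two q.2 y
    refine ⟨⟨(mate q).2 + 1, h3.trans hr, ?_⟩, ⟨q.2 + 2, hr, ?_⟩, ?_⟩
    · exact h5.symm ▸ hy
    · exact h6.symm ▸ hy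
    · rw [sidePt, sidePt, cornerChart_eq hr (h6.symm ▸ hδ.trans_lt hy),
        cornerChart_eq (h3.trans hr) (h5.symm ▸ hδ.trans_lt hy)]
      simp only [fin3_21, fin3_22, fin3_11, fin3_12, bary_edgePt, bary_edgePt_one,
        bary_edgePt_two, h4, sectorMap, unitInterval.coe_symm_eq, zero_add, add_zero, zero_div]
      by_cases h0 : 1 - (y : ℝ) = 0
      · simp [h0]
      · rw [div_self h0]; push_cast; simp
  obtain ⟨i, hi, hi'⟩ := hx
  simp only [sidePt] at hi hi'
  rcases fin3_cases p.2 i with rfl | rfl | rfl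
  · rw [bary_edgePt] at hi'; linarith
  · rw [bary_edgePt_one] at hi'
    have h1 : nextCorner mate ((mate p).1, (mate p).2 + 2) = (p.1, p.2 + 1) := by
      simp only [nextCorner, fin3_21, Prod.mk.eta, hm]
    have h2 : ¬ IsLastCorner mate ((mate p).1, (mate p).2 + 2) := by
      simpa only [IsLastCorner, fin3_21, Prod.mk.eta, hm] using hp.symm
    have h3 := o.root_next _ h2
    rw [h1, hi] at h3
    have := key (mate p) (unitInterval.symm x) (by rw [hm]; exact hp.symm) h3.symm (by simpa using hi')
    rw [hm, unitInterval.symm_symm] at this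
    exact ⟨this.2.1, this.2.2.symm⟩
  · rw [bary_edgePt_two] at hi'
    have := key p x hp hi hi'
    exact ⟨this.1, this.2.2⟩

/-- Radius and angle are determined by the value, because all the angles lie in `[0, π]`. Equal
angles at different positions force consecutive positions with fractions `1` and `0`, so the two
points lie on a side that is glued. At radius zero both points are corners of the same sequence. -/
theorem IsGluing.eq_of_cornerChart_eq {Y : Type*} [TopologicalSpace Y] {χ : TriSum T → Y}
    (h : IsGluing mate χ) {a b : TriSum T} (ha : a ∈ nearCorner o r (1 / 2))
    (hb : b ∈ nearCorner o r (1 / 2)) (hab : cornerChart o r a = cornerChart o r b) :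
    χ a = χ b := by
  obtain ⟨t, z⟩ := a
  obtain ⟨t', z'⟩ := b
  obtain ⟨i, hr, hi⟩ := ha
  obtain ⟨i', hr', hi'⟩ := hb
  rw [cornerChart_eq hr hi, cornerChart_eq hr' hi'] at hab
  have h1 := bary_nonneg z (i + 1)
  have h2 := bary_nonneg z (i + 2)
  have h1' := bary_nonneg z' (i' + 1)
  have h2' := bary_nonneg z' (i' + 2)
  have hs := bary_sum i z
  have hs' := bary_sum i' z'
  simp only at hr hr' hi hi'
  obtain ⟨e1, e2⟩ := mul_exp_injective (add_nonneg h1 h2) (add_nonneg h1' h2')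
    (angle_mem hm hr (div_add_mem h1 h2)) (angle_mem hm hr' (div_add_mem h1' h2')) hab
  rcases e2 with e2 | e2
  · have hz := eq_cornerPt (i := i) (z := z) (by linarith)
    have hz' := eq_cornerPt (i := i') (z := z') (by linarith)
    subst hz hz'
    refine (h.corner_iff (c := (t, i)) (d := (t', i'))).2 ?_
    have h3 := (o.root_spec hm (t, i)).2.2
    have h4 := (o.root_spec hm (t', i')).2.2
    rw [hr] at h3
    rw [hr'] at h4
    exact .trans _ _ _ (.symm _ _ h3) h4
  · have e3 := mul_left_cancel₀ sectorAngle_pos.ne' e2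
    have key : ∀ {t t' : T} {i i' : Fin 3} {z z' : Tri}, o.root (t, i) = r → o.root (t', i') = r →
        0 < bary (i + 1) z + bary (i + 2) z →
        bary (i + 1) z + bary (i + 2) z = bary (i' + 1) z' + bary (i' + 2) z' →
        (o.pos (t, i) + bary (i + 2) z / (bary (i + 1) z + bary (i + 2) z) : ℝ) =
          o.pos (t', i') + bary (i' + 2) z' / (bary (i' + 1) z' + bary (i' + 2) z') →
        o.pos (t, i) < o.pos (t', i') → χ ⟨t, z⟩ = χ ⟨t', z'⟩ := by
      clear * - hm h
      intro t t' i i' z z' hr hr' h0 hs heq hlt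
      have h1 := bary_nonneg z (i + 1)
      have h2 := bary_nonneg z (i + 2)
      have h1' := bary_nonneg z' (i' + 1)
      have h2' := bary_nonneg z' (i' + 2)
      have hd := (div_add_mem h1 h2).2
      have hd' := (div_add_mem h1' h2').1
      have hlt' : ((o.pos (t, i) + 1 : ℕ) : ℝ) ≤ o.pos (t', i') := by exact_mod_cast hlt
      push_cast at hlt'
      have hp : o.pos (t', i') = o.pos (t, i) + 1 := by
        have : (o.pos (t', i') : ℝ) = o.pos (t, i) + 1 := by linarith
        exact_mod_cast this
      have hd1 : bary (i + 2) z / (bary (i + 1) z + bary (i + 2) z) = 1 := by linarith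
      have hd2 : bary (i' + 2) z' / (bary (i' + 1) z' + bary (i' + 2) z') = 0 := by linarith
      rw [div_eq_one_iff_eq h0.ne'] at hd1
      rw [div_eq_zero_iff, ← hs] at hd2
      have hb' : bary (i' + 2) z' = 0 := hd2.resolve_right h0.ne'
      have hb : bary (i + 1) z = 0 := by linarith
      have hl : ¬ IsLastCorner mate (t, i) := by
        rw [← o.rem_eq_zero]
        have e1 := (o.root_spec hm (t, i)).2.1
        have e2 := (o.root_spec hm (t', i')).2.1
        rw [hr] at e1
        rw [hr'] at e2
        omega
      have hn : (t', i') = nextCorner mate (t, i) :=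
        o.eq_of_root_pos hm (by rw [o.root_next _ hl, hr, hr']) (by rw [o.pos_next _ hl, hp])
      have hg := h.glue (t, i + 1) hl ⟨bary (i + 1 + 2) z, bary_nonneg z _, bary_le_one z _⟩
      have e1 := eq_edgePt hb
      have e2 := eq_edgePt hb'
      have hm2 : mate (t, i + 1) = (t', i' + 2) := by
        simp only [nextCorner, Prod.mk.injEq] at hn
        refine Prod.ext hn.1.symm ?_
        simp only [hn.2, fin3_12]
      have e3 : (⟨t, z⟩ : TriSum T) = sidePt (t, i + 1) ⟨bary (i + 1 + 2) z, bary_nonneg z _, bary_le_one z _⟩ :=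
        congrArg (Sigma.mk t) e1
      rw [e3, hg, hm2]
      refine congrArg (fun w => χ ⟨t', w⟩) ?_
      conv_rhs => rw [e2]
      congr 1
      ext1
      have hs1 := bary_sum i z
      have hs2 := bary_sum i' z'
      simp only [unitInterval.coe_symm_eq, fin3_12, fin3_22]
      linarith
    by_cases h0 : bary (i + 1) z + bary (i + 2) z = 0
    · have hz := eq_cornerPt (i := i) (z := z) (by linarith)
      have hz' := eq_cornerPt (i := i') (z := z') (by linarith)
      subst hz hz'
      refine (h.corner_iff (c := (t, i)) (d := (t', i'))).2 ?_
      have h3 := (o.root_spec hm (t, i)).2.2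
      have h4 := (o.root_spec hm (t', i')).2.2
      rw [hr] at h3
      rw [hr'] at h4
      exact .trans _ _ _ (.symm _ _ h3) h4
    have h0' : 0 < bary (i + 1) z + bary (i + 2) z := lt_of_le_of_ne (add_nonneg h1 h2) (Ne.symm h0)
    rcases lt_trichotomy (o.pos (t, i)) (o.pos (t', i')) with hlt | heq | hlt
    · exact key hr hr' h0' e1 e3 hlt
    · have hc := o.eq_of_root_pos hm (hr.trans hr'.symm) heq
      simp only [Prod.mk.injEq] at hc
      obtain ⟨rfl, rfl⟩ := hc
      have e4 := add_left_cancel e3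
      rw [← e1, div_left_inj' h0'.ne'] at e4
      exact congrArg (fun w => χ ⟨t, w⟩) (Subtype.ext (eq_of_bary i (by linarith) e4))
    · exact (key hr' hr (e1 ▸ h0') e1.symm e3.symm hlt).symm

theorem exists_cornerChart_eq (hr : IsFirstCorner mate r) {w : ℂ} (hw : ‖w‖ < 1 / 3)
    (hw0 : 0 ≤ w.im) : ∃ a ∈ nearCorner o r (2 / 3), cornerChart o r a = w := by
  have hκ := sectorAngle_pos (o := o) (r := r)
  let x : ℝ := w.arg / sectorAngle o r
  have hx0 : 0 ≤ x := div_nonneg (Complex.arg_nonneg_iff.2 hw0) hκ.le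
  have hxn : x ≤ o.rem r + 1 := by
    rw [div_le_iff₀ hκ, sectorAngle, mul_div_cancel₀ _ (by positivity)]
    exact Complex.arg_le_pi w
  -- The sector that contains the angle is found by rounding down, except on the final ray of angle
  -- `π`, which belongs to the last sector.
  obtain ⟨k, hk, hk1, hk2⟩ : ∃ k : ℕ, k ≤ o.rem r ∧ (k : ℝ) ≤ x ∧ x ≤ k + 1 := by
    by_cases h : x < o.rem r
    · exact ⟨⌊x⌋₊, (Nat.floor_lt hx0).2 h |>.le, Nat.floor_le hx0, (Nat.lt_floor_add_one x).le⟩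
    · exact ⟨o.rem r, le_rfl, not_lt.1 h, hxn⟩
  obtain ⟨⟨t, i⟩, hc1, hc2⟩ := o.exists_of_le hm hr hk
  have hn := norm_nonneg w
  let z : ℂ := ofBary i (‖w‖ * (1 - (x - k))) (‖w‖ * (x - k))
  have hb0 : bary i z = 1 - ‖w‖ := by rw [bary_ofBary]; ring
  have hb1 : bary (i + 1) z = ‖w‖ * (1 - (x - k)) := bary_ofBary_one _ _ _
  have hb2 : bary (i + 2) z = ‖w‖ * (x - k) := bary_ofBary_two _ _ _
  have hz : z ∈ Tri := by
    refine mem_Tri.2 (fin3_forall i ?_ ?_ ?_)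
    · rw [hb0]; linarith
    · rw [hb1]; exact mul_nonneg hn (by linarith)
    · rw [hb2]; exact mul_nonneg hn (by linarith)
  refine ⟨⟨t, z, hz⟩, ⟨i, hc1, ?_⟩, ?_⟩
  · change 2 / 3 < bary i z
    rw [hb0]; linarith
  · rw [cornerChart_eq hc1 (show 1 / 2 < bary i z by rw [hb0]; linarith)]
    simp only [hb1, hb2, sectorMap, hc2]
    by_cases h0 : ‖w‖ = 0
    · rw [norm_eq_zero] at h0
      simp [h0]
    · have e : ‖w‖ * (1 - (x - k)) + ‖w‖ * (x - k) = ‖w‖ := by ring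
      rw [e, mul_div_cancel_left₀ _ h0, add_sub_cancel]
      simp only [x]
      rw [mul_div_cancel₀ _ hκ.ne']
      exact Complex.norm_mul_exp_arg_mul_I w

omit hm in
theorem norm_cornerChart_lt {a : TriSum T} (ha : a ∈ nearCorner o r (2 / 3)) :
    ‖cornerChart o r a‖ < 1 / 3 := by
  obtain ⟨t, z⟩ := a
  obtain ⟨i, hr, hi⟩ := ha
  simp only at hr hi
  rw [cornerChart_eq hr (by linarith),
    norm_sectorMap (add_nonneg (bary_nonneg z _) (bary_nonneg z _))]
  linarith [bary_sum i z]

omit hm in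
theorem positiveAt_cornerChart {t : T} {z : Tri} (hz : (z : ℂ) ∈ interior Tri)
    (ha : (⟨t, z⟩ : TriSum T) ∈ nearCorner o r (1 / 2)) :
    PositiveAt (fun w => cornerChart o r ⟨t, w⟩) z := by
  obtain ⟨i, hr, hi⟩ := ha
  rw [mem_interior_Tri] at hz
  exact PositiveAt.of_eventuallyEq (Tri_mem_nhds (mem_interior_Tri.2 hz))
    (isPositiveAt_sectorMap (k := o.pos (t, i)) sectorAngle_pos (hz (i + 1)) (hz (i + 2)))
    (eventually_cornerChart_eq hr hi)

omit hm in
theorem nearCorner_mono {δ δ' : ℝ} (h : δ' ≤ δ) : nearCorner o r δ ⊆ nearCorner o r δ' :=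
  fun _ ⟨i, h1, h2⟩ => ⟨i, h1, h.trans_lt h2⟩

omit hm in
-- The sectors of angle `π / (rem + 1)` fill the upper half plane. The modulus of the coordinate is
-- one minus the barycentric coordinate of the corner, so the bound `2/3` on the triangles
-- corresponds to the ball of radius `1/3`.
theorem IsGluing.exists_chart_vertex [Finite T] {Y : Type*} [TopologicalSpace Y] [T2Space Y]
    {χ : TriSum T → Y} (h : IsGluing mate χ) (o : CornerOrder mate) (c : T × Fin 3) :
    ∃ e ∈ positiveAtlas χ, χ (cornerAt c) ∈ e.source ∧ (e (χ (cornerAt c)) : ℂ) = 0 := by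
  have : Nonempty Y := ⟨χ (cornerAt c)⟩
  obtain ⟨e, he, hs, hv⟩ := h.exists_chart (isOpen_nearCorner (o := o) (r := o.root c) (1 / 2))
    (fun p x hp hx => (nearCorner_glue h.mate_mate le_rfl hp hx).1)
    (isOpen_nearCorner (2 / 3))
    (fun p x hp hx => (nearCorner_glue h.mate_mate (by norm_num) hp hx).1)
    (isClosed_nearCornerClosed (2 / 3)).isCompact
    (fun _ ⟨i, h1, h2⟩ => ⟨i, h1, h2.le⟩)
    (fun _ ⟨i, h1, h2⟩ => ⟨i, h1, lt_of_lt_of_le (by norm_num) h2⟩)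
    continuousOn_cornerChart
    (fun a ha => cornerChart_im_nonneg h.mate_mate ha)
    (fun p x hp hx => (nearCorner_glue h.mate_mate le_rfl hp hx).2)
    (fun a ha b hb => h.eq_of_cornerChart_eq h.mate_mate ha hb)
    (Metric.isOpen_ball (x := 0) (ε := 1 / 3))
    (fun w hw hw0 => exists_cornerChart_eq h.mate_mate (o.root_spec h.mate_mate c).1
      (mem_ball_zero_iff.1 hw) hw0)
    (fun a ha => mem_ball_zero_iff.2 (norm_cornerChart_lt ha))
    (fun t z hz ha => positiveAt_cornerChart hz (nearCorner_mono (by norm_num) ha))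
  have hc : cornerAt c ∈ nearCorner o (o.root c) (2 / 3) :=
    ⟨c.2, rfl, by simp only [cornerAt, bary_cornerPt]; norm_num⟩
  refine ⟨e, he, by rw [hs]; exact ⟨_, hc, rfl⟩, ?_⟩
  rw [hv _ hc, cornerAt, cornerChart_eq (i := c.2) rfl (by rw [bary_cornerPt]; norm_num)]
  simp [bary_cornerPt_one, bary_cornerPt_two, sectorMap]

end VertexChart

/-! ### Transition maps and the oriented surface of a gluing -/

theorem exists_mem_interior_Tri {U : Set Tri} (hU : IsOpen U) (hne : U.Nonempty) :
    ∃ z ∈ U, (z : ℂ) ∈ interior Tri := by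
  obtain ⟨V, hV, rfl⟩ := isOpen_induced_iff.1 hU
  obtain ⟨z, hz⟩ := hne
  have h0 : (interior Tri).Nonempty := ⟨ofBary 0 (1 / 3) (1 / 3), mem_interior_Tri.2
    (fin3_forall 0 (by rw [bary_ofBary]; norm_num) (by rw [bary_ofBary_one]; norm_num)
      (by rw [bary_ofBary_two]; norm_num))⟩
  have h1 : (z : ℂ) ∈ closure (interior Tri) := by
    have h2 : closure (interior Tri) = closure Tri :=
      Convex.closure_interior_eq_closure_of_nonempty_interior (convex_convexHull ℝ (range corner)) h0
    rw [h2]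
    exact subset_closure z.2
  obtain ⟨w, hw1, hw2⟩ := mem_closure_iff.1 h1 V hV hz
  exact ⟨⟨w, interior_subset hw2⟩, hw1, hw2⟩

theorem HalfPlane_mem_nhds {z : ℂ} (hz : 0 < z.im) : HalfPlane ∈ 𝓝 z :=
  Filter.mem_of_superset ((isOpen_lt continuous_const Complex.continuous_im).mem_nhds hz)
    fun w (hw : 0 < w.im) => hw.le

section

variable {T : Type} {mate : T × Fin 3 → T × Fin 3} {Y : Type u} [TopologicalSpace Y]
  {χ : TriSum T → Y}

/-- The transition map is continuous and injective on a ball, so by `IsPositiveAt.of_injOn` one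
point of the ball suffices. A point that comes from the interior of a triangle is available by
density. There both charts have degree one when composed with `χ`, and `IsPositiveAt.comp_iff`
cancels the first one. -/
theorem transition_positive (hχ : Continuous χ) (hsurj : Function.Surjective χ)
    {e e' : OpenPartialHomeomorph Y HalfPlane} (he : e ∈ positiveAtlas χ) (he' : e' ∈ positiveAtlas χ)
    (z₀ : HalfPlane) (hz₀ : 0 < (z₀ : ℂ).im) (hs : z₀ ∈ (e.symm.trans e').source) :
    PositiveAt (fun w => (e' (e.symm w) : ℂ)) z₀ := by
  set f : HalfPlane → ℂ := fun w => (e' (e.symm w) : ℂ) with hf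
  set S := (e.symm.trans e').source with hS
  have hSo : IsOpen S := (e.symm.trans e').open_source
  rw [positiveAt_iff]
  refine ⟨HalfPlane_mem_nhds hz₀, ?_⟩
  obtain ⟨R, hR, hb⟩ : ∃ R > 0, ∀ w ∈ Metric.ball (z₀ : ℂ) R, 0 < w.im ∧
      ∀ hw : w ∈ HalfPlane, (⟨w, hw⟩ : HalfPlane) ∈ S := by
    have h1 : ∀ᶠ w in 𝓝 (z₀ : ℂ), 0 < w.im :=
      (isOpen_lt continuous_const Complex.continuous_im).mem_nhds hz₀
    have h2 : ∀ᶠ w in 𝓝 (z₀ : ℂ), ∀ hw : w ∈ HalfPlane, (⟨w, hw⟩ : HalfPlane) ∈ S := by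
      rw [← map_nhds_subtype_coe_eq_nhds z₀.2 (HalfPlane_mem_nhds hz₀), Filter.eventually_map]
      filter_upwards [hSo.mem_nhds hs] with w hw _
      exact hw
    exact Metric.eventually_nhds_iff_ball.1 (h1.and h2)
  have hbS : ∀ w : HalfPlane, (w : ℂ) ∈ Metric.ball (z₀ : ℂ) R → w ∈ S := fun w hw =>
    (hb w hw).2 w.2
  have hFc : ContinuousOn (extendZero f) (Metric.ball (z₀ : ℂ) R) := by
    intro w hw
    have hw0 := (hb w hw).1
    refine (continuousAt_extendZero (z := ⟨w, hw0.le⟩) (HalfPlane_mem_nhds hw0) ?_).continuousWithinAt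
    exact continuous_subtype_val.continuousAt.comp
      ((e.symm.trans e').continuousAt (hbS ⟨w, hw0.le⟩ hw))
  have hFi : InjOn (extendZero f) (Metric.ball (z₀ : ℂ) R) := by
    intro w hw w' hw' h
    have e1 := extendZero_apply f ⟨w, (hb w hw).1.le⟩
    have e2 := extendZero_apply f ⟨w', (hb w' hw').1.le⟩
    simp only at e1 e2
    rw [e1, e2] at h
    exact congrArg Subtype.val ((e.symm.trans e').injOn (hbS ⟨w, (hb w hw).1.le⟩ hw)
      (hbS ⟨w', (hb w' hw').1.le⟩ hw') (Subtype.ext h))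
  let A : Set Y := e.source ∩ e ⁻¹' (Subtype.val ⁻¹' Metric.ball (z₀ : ℂ) R)
  have hA : IsOpen A := e.isOpen_inter_preimage (Metric.isOpen_ball.preimage continuous_subtype_val)
  have hs1 : z₀ ∈ e.target := by
    have := hs; simp only [hS, mfld_simps] at this; exact this.1
  obtain ⟨⟨t, z⟩, hz⟩ := hsurj (e.symm z₀)
  obtain ⟨z₁, hz₁, hz₁i⟩ := exists_mem_interior_Tri
    (U := (fun w => χ ⟨t, w⟩) ⁻¹' A) (hA.preimage (hχ.comp continuous_sigmaMk))
    ⟨z, by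
      change χ ⟨t, z⟩ ∈ A
      rw [hz]
      exact ⟨e.map_target hs1, by simp [e.right_inv hs1, hR]⟩⟩
  have hw₁ : (e (χ ⟨t, z₁⟩) : ℂ) ∈ Metric.ball (z₀ : ℂ) R := hz₁.2
  have hw₁S := hbS _ hw₁
  have hs2 : χ ⟨t, z₁⟩ ∈ e'.source := by
    simp only [hS, mfld_simps] at hw₁S
    have := hw₁S.2
    rwa [e.left_inv hz₁.1] at this
  set f₁ : Tri → ℂ := fun w => (e (χ ⟨t, w⟩) : ℂ) with hf₁
  have hp1 := positiveAt_iff.1 (he t z₁ hz₁i hz₁.1)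
  have hp2 := positiveAt_iff.1 (he' t z₁ hz₁i hs2)
  have hev : ∀ᶠ w : Tri in 𝓝 z₁, χ ⟨t, w⟩ ∈ e.source :=
    (e.open_source.preimage (hχ.comp continuous_sigmaMk)).mem_nhds hz₁.1
  have hf₁c : ContinuousAt f₁ z₁ := by
    refine continuous_subtype_val.continuousAt.comp
      (ContinuousAt.comp (f := fun w => χ ⟨t, w⟩) (e.continuousAt hz₁.1) ?_)
    exact (hχ.comp continuous_sigmaMk).continuousAt
  have hval : extendZero f₁ z₁ = e (χ ⟨t, z₁⟩) := extendZero_apply f₁ z₁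
  have hR' : 0 < R - dist (e (χ ⟨t, z₁⟩) : ℂ) z₀ := by
    rw [Metric.mem_ball] at hw₁; linarith
  have hsub : Metric.ball (extendZero f₁ z₁) (R - dist (e (χ ⟨t, z₁⟩) : ℂ) z₀) ⊆
      Metric.ball (z₀ : ℂ) R := by
    rw [hval]
    exact Metric.ball_subset_ball' (by linarith)
  -- Composing the transition map with `e ∘ χ` gives `e' ∘ χ` near `z₁`.
  have hpos : IsPositiveAt (extendZero f) (extendZero f₁ z₁) := by
    refine (hp1.2.comp_iff (continuousAt_extendZero hp1.1 hf₁c) hR' (hFc.mono hsub)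
      fun w hw hne heq => hne (hFi (hsub hw) (hval ▸ hw₁) heq)).2 (hp2.2.congr ?_)
    rw [← map_nhds_subtype_coe_eq_nhds z₁.2 hp1.1]
    change ∀ᶠ w : Tri in 𝓝 z₁, _
    filter_upwards [hev] with w hw
    rw [extendZero_apply, extendZero_apply]
    have := extendZero_apply f (e (χ ⟨t, w⟩))
    rw [this, hf]
    simp only [e.left_inv hw]
  rw [hval] at hpos
  exact hpos.of_injOn hFc hFi hw₁ (Metric.mem_ball_self hR)

theorem IsGluing.exists_chart_at [Finite T] [T2Space Y] (h : IsGluing mate χ) (hl : IsLinear mate)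
    (y : Y) : ∃ e ∈ positiveAtlas χ, y ∈ e.source := by
  obtain ⟨o⟩ := hl.exists_cornerOrder h.mate_mate
  obtain ⟨⟨t, z⟩, rfl⟩ := h.surjective y
  by_cases hz : ∀ i, 0 < bary i z
  · exact h.exists_chart_interior (mem_interior_Tri.2 hz)
  push Not at hz
  obtain ⟨i, hi⟩ := hz
  have hi : bary i z = 0 := le_antisymm hi (bary_nonneg z i)
  obtain ⟨x, rfl⟩ : ∃ x, z = edgePt i x := ⟨_, eq_edgePt hi⟩
  rcases (show (0 : ℝ) ≤ x from x.2.1).eq_or_lt with h0 | h0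
  · obtain rfl : x = 0 := Subtype.ext h0.symm
    obtain ⟨e, he, hs, -⟩ := h.exists_chart_vertex o (t, i + 1)
    exact ⟨e, he, by rwa [edgePt_zero]⟩
  · rcases (show (x : ℝ) ≤ 1 from x.2.2).eq_or_lt with h1 | h1
    · obtain rfl : x = 1 := Subtype.ext h1
      obtain ⟨e, he, hs, -⟩ := h.exists_chart_vertex o (t, i + 2)
      exact ⟨e, he, by rwa [edgePt_one]⟩
    · have hm : 0 < min (x : ℝ) (1 - x) := lt_min h0 (by linarith)
      have := min_le_left (x : ℝ) (1 - x)
      have := min_le_right (x : ℝ) (1 - x)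
      obtain ⟨e, he, hs, -⟩ := h.exists_chart_side (t, i)
        (ε := min (x : ℝ) (1 - x) / 2) (by linarith)
      refine ⟨e, he, ?_⟩
      rw [hs]
      exact ⟨sidePt (t, i) x, .inl ((sidePt_mem_nearSide (by linarith)).2
        ⟨rfl, by linarith, by linarith⟩), rfl⟩

/-- A space obtained from triangles by gluing is an oriented surface if the corners around each
vertex form a linear sequence. -/
theorem IsGluing.exists_orientedSurface [Finite T] [T2Space Y] (h : IsGluing mate χ)
    (hl : IsLinear mate) : ∃ O : OrientedSurface Y, O.atlas = positiveAtlas χ ∧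
      ∀ p, mate p = p → ∀ x, χ (sidePt p x) ∈ O.boundary := by
  choose e he hs using h.exists_chart_at hl
  let O : OrientedSurface Y :=
    { atlas := positiveAtlas χ
      chartAt := e
      mem_chart_source := hs
      chart_mem_atlas := he
      positive := fun e he e' he' z hz hs =>
        transition_positive h.continuous h.surjective he he' z hz hs }
  refine ⟨O, rfl, fun p hp x => ?_⟩
  obtain ⟨o⟩ := hl.exists_cornerOrder h.mate_mate
  have hc : ∀ c, χ (cornerAt c) ∈ O.boundary := fun c => by
    obtain ⟨e, he, hs, h0⟩ := h.exists_chart_vertex o c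
    exact ⟨e, he, hs, by rw [h0]; rfl⟩
  rcases (show (0 : ℝ) ≤ x from x.2.1).eq_or_lt with h0 | h0
  · obtain rfl : x = 0 := Subtype.ext h0.symm
    rw [sidePt_zero]; exact hc _
  · rcases (show (x : ℝ) ≤ 1 from x.2.2).eq_or_lt with h1 | h1
    · obtain rfl : x = 1 := Subtype.ext h1
      rw [sidePt_one]; exact hc _
    · have hm : 0 < min (x : ℝ) (1 - x) := lt_min h0 (by linarith)
      have := min_le_left (x : ℝ) (1 - x)
      have := min_le_right (x : ℝ) (1 - x)
      obtain ⟨e, he, hs, hv⟩ := h.exists_chart_side p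
        (ε := min (x : ℝ) (1 - x) / 2) (by linarith)
      have hx : sidePt p x ∈ nearSide (min (x : ℝ) (1 - x) / 2) p :=
        (sidePt_mem_nearSide (by linarith)).2 ⟨rfl, by linarith, by linarith⟩
      refine ⟨e, he, by rw [hs]; exact ⟨_, .inl hx, rfl⟩, ?_⟩
      rw [hv _ (.inl hx), sideChart_eq (nearSide_mono (by linarith) p hx), sideHeight_eq hp]
      simp [sideCoord_im, sidePt, bary_edgePt]

end

/-! ### The boundary of a triangulated surface -/

section

/-- An injective continuous function on an interval is strictly monotone, so the intermediate value
theorem gives all values on both sides of `f r₀`. -/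
theorem exists_re_eq {f : ℝ → ℝ} {r₀ ρ : ℝ} (hρ : 0 < ρ) (hc : ContinuousOn f (Icc (r₀ - ρ) (r₀ + ρ)))
    (hi : InjOn f (Icc (r₀ - ρ) (r₀ + ρ))) :
    ∃ η > 0, ∀ v, |v - f r₀| < η → ∃ x ∈ Icc (r₀ - ρ) (r₀ + ρ), f x = v := by
  have h1 : r₀ - ρ ∈ Icc (r₀ - ρ) (r₀ + ρ) := ⟨le_rfl, by linarith⟩
  have h2 : r₀ ∈ Icc (r₀ - ρ) (r₀ + ρ) := ⟨by linarith, by linarith⟩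
  have h3 : r₀ + ρ ∈ Icc (r₀ - ρ) (r₀ + ρ) := ⟨by linarith, le_rfl⟩
  have h12 : r₀ - ρ < r₀ := by linarith
  have h23 : r₀ < r₀ + ρ := by linarith
  rcases hc.strictMonoOn_of_injOn_Icc' (by linarith) hi with hm | hm
  · have a1 := hm h1 h2 h12
    have a2 := hm h2 h3 h23
    refine ⟨min (f r₀ - f (r₀ - ρ)) (f (r₀ + ρ) - f r₀), lt_min (by linarith) (by linarith),
      fun v hv => ?_⟩
    rw [lt_min_iff, abs_lt, abs_lt] at hv
    exact intermediate_value_Icc (by linarith) hc ⟨by linarith [hv.1.1], by linarith [hv.2.2]⟩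
  · have a1 := hm h1 h2 h12
    have a2 := hm h2 h3 h23
    refine ⟨min (f (r₀ - ρ) - f r₀) (f r₀ - f (r₀ + ρ)), lt_min (by linarith) (by linarith),
      fun v hv => ?_⟩
    rw [lt_min_iff, abs_lt, abs_lt] at hv
    exact intermediate_value_Icc' (by linarith) hc ⟨by linarith [hv.2.1], by linarith [hv.1.2]⟩

/-- An embedding of a half disc which maps the diameter into a line is not open at the centre. -/
theorem image_halfDisc_not_mem_nhds {F : ℂ → ℂ} {r₀ ρ c : ℝ} (hρ : 0 < ρ)
    (hc : ContinuousOn F (Metric.ball (r₀ : ℂ) ρ ∩ HalfPlane))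
    (hi : InjOn F (Metric.ball (r₀ : ℂ) ρ ∩ HalfPlane))
    (hl : ∀ x : ℝ, |x - r₀| < ρ → (F x).im = c) :
    ∃ δ, 0 < δ ∧ δ ≤ ρ ∧ F '' (Metric.ball (r₀ : ℂ) δ ∩ HalfPlane) ∉ 𝓝 (F r₀) := by
  by_contra! hn
  have hmem : ∀ x : ℝ, |x - r₀| < ρ → (x : ℂ) ∈ Metric.ball (r₀ : ℂ) ρ ∩ HalfPlane := fun x hx =>
    ⟨by rwa [mem_ball_iff_norm, ← Complex.ofReal_sub, Complex.norm_real], by simp [HalfPlane]⟩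
  have hmem' : ∀ x ∈ Icc (r₀ - ρ / 2) (r₀ + ρ / 2), |x - r₀| < ρ := fun x hx =>
    abs_lt.2 ⟨by linarith [hx.1], by linarith [hx.2]⟩
  have hr0 : |r₀ - r₀| < ρ := by simpa using hρ
  obtain ⟨η, hη, hv⟩ := exists_re_eq (f := fun x : ℝ => (F x).re) (r₀ := r₀) (half_pos hρ)
    (Complex.continuous_re.comp_continuousOn (hc.comp Complex.continuous_ofReal.continuousOn
      fun x hx => hmem x (hmem' x hx)))
    (fun x hx y hy hxy => Complex.ofReal_injective (hi (hmem x (hmem' x hx)) (hmem y (hmem' y hy))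
      (Complex.ext hxy ((hl x (hmem' x hx)).trans (hl y (hmem' y hy)).symm))))
  obtain ⟨δ', hδ', hd⟩ := Metric.continuousWithinAt_iff.1 (hc _ (hmem r₀ hr0)) η hη
  set δ := min δ' ρ
  have hδ : 0 < δ := lt_min hδ' hρ
  have hsub : Metric.ball (r₀ : ℂ) δ ⊆ Metric.ball (r₀ : ℂ) ρ := Metric.ball_subset_ball (min_le_right _ _)
  -- Points of the line close to `F r₀` are already values on the diameter, so by injectivity the
  -- open half disc avoids the line.
  have hne : ∀ w ∈ Metric.ball (r₀ : ℂ) δ, 0 < w.im → (F w).im - c ≠ 0 := by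
    intro w hw hw0 h0
    have h1 := hd ⟨hsub hw, hw0.le⟩ (lt_of_lt_of_le hw (min_le_left _ _))
    rw [dist_eq_norm] at h1
    obtain ⟨x, hx, hx'⟩ := hv (F w).re (by
      have := Complex.abs_re_le_norm (F w - F r₀)
      rw [Complex.sub_re] at this
      exact this.trans_lt h1)
    have := hi (hmem x (hmem' x hx)) ⟨hsub hw, hw0.le⟩
      (Complex.ext hx' ((hl x (hmem' x hx)).trans (by linarith)))
    rw [← this] at hw0
    simp at hw0
  have hpre : IsPreconnected (Metric.ball (r₀ : ℂ) δ ∩ {w : ℂ | 0 < w.im}) :=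
    ((convex_ball _ _).inter (convex_halfSpace_im_gt 0)).isPreconnected
  have hcont : ContinuousOn (fun w => (F w).im - c) (Metric.ball (r₀ : ℂ) δ ∩ {w : ℂ | 0 < w.im}) :=
    (Complex.continuous_im.comp_continuousOn (hc.mono fun w (hw : _ ∧ 0 < w.im) => ⟨hsub hw.1, hw.2.le⟩)).sub
      continuousOn_const
  -- The open half disc is connected, so its image lies on one side of the line and cannot be a
  -- neighbourhood of a point of the line.
  have hsign : (∀ w ∈ Metric.ball (r₀ : ℂ) δ ∩ HalfPlane, 0 ≤ (F w).im - c) ∨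
      ∀ w ∈ Metric.ball (r₀ : ℂ) δ ∩ HalfPlane, (F w).im - c ≤ 0 := by
    have hb : ∀ w ∈ Metric.ball (r₀ : ℂ) δ ∩ HalfPlane, ¬ 0 < w.im → (F w).im - c = 0 := by
      intro w hw hw0
      have h0 : w.im = 0 := le_antisymm (not_lt.1 hw0) hw.2
      have e : ((w.re : ℝ) : ℂ) = w := Complex.ext rfl (by simp [h0])
      have := hl w.re (by
        have := hsub hw.1
        rwa [← e, mem_ball_iff_norm, ← Complex.ofReal_sub, Complex.norm_real] at this)
      rw [e] at this
      linarith
    by_contra! hcon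
    obtain ⟨⟨w, hw, hw1⟩, w', hw', hw2⟩ := hcon
    have p1 : 0 < w.im := by
      by_contra h; linarith [hb w hw h]
    have p2 : 0 < w'.im := by
      by_contra h; linarith [hb w' hw' h]
    obtain ⟨u, hu, hu0⟩ := hpre.intermediate_value ⟨hw.1, p1⟩ ⟨hw'.1, p2⟩ hcont
      (show (0 : ℝ) ∈ Icc _ _ from ⟨hw1.le, hw2.le⟩)
    exact hne u hu.1 hu.2 hu0
  obtain ⟨s, hs, hball⟩ := Metric.mem_nhds_iff.1 (hn δ hδ (min_le_right _ _))
  have hF0 := hl r₀ hr0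
  have key : ∀ t : ℝ, |t| < s → ∃ w ∈ Metric.ball (r₀ : ℂ) δ ∩ HalfPlane, (F w).im = c + t := by
    intro t ht
    obtain ⟨w, hw, e⟩ := hball (show F r₀ + t * Complex.I ∈ _ by
      rw [mem_ball_iff_norm]; simpa using ht)
    exact ⟨w, hw, by rw [e]; simp [hF0]⟩
  rcases hsign with h | h
  · obtain ⟨w, hw, e⟩ := key (-(s / 2)) (by rw [abs_neg, abs_of_pos (by linarith)]; linarith)
    linarith [h w hw]
  · obtain ⟨w, hw, e⟩ := key (s / 2) (by rw [abs_of_pos (by linarith)]; linarith)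
    linarith [h w hw]

variable {T : Type} {mate : T × Fin 3 → T × Fin 3} {Y : Type u} [TopologicalSpace Y]
  {χ : TriSum T → Y} (O : OrientedSurface Y)
  (hpos : ∀ (t : T) (z : Tri), (z : ℂ) ∈ interior Tri → ∀ e ∈ O.atlas,
    χ ⟨t, z⟩ ∈ e.source → PositiveAt (fun w => (e (χ ⟨t, w⟩) : ℂ)) z)

include hpos

/-- A chart has values in the closed half plane, and a loop in a closed half plane cannot wind
around a point of its edge. -/
theorem interior_notMem_boundary {t : T} {z : Tri} (hz : (z : ℂ) ∈ interior Tri) :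
    χ ⟨t, z⟩ ∉ O.boundary := by
  rintro ⟨e, he, hs, h0⟩
  exact (hpos t z hz e he hs).im_ne_zero (fun w => (e (χ ⟨t, w⟩)).2) h0

variable [Finite T] [T2Space Y] (h : IsGluing mate χ)

include h

/-- Suppose that a chart `e` of the surface sends the point to the real line. Composed with the side
chart `E`, its inverse embeds a half disc and sends the diameter to boundary points. Near the side
these are confined to the side itself, that is, to the line of height `2`. But this height is
positive, so the image of the half disc under the homeomorphism is a neighbourhood in the plane,
against `image_halfDisc_not_mem_nhds`. -/
theorem IsGluing.glued_notMem_boundary {p : T × Fin 3} (hp : mate p ≠ p) {x : unitInterval}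
    (h0 : 0 < (x : ℝ)) (h1 : (x : ℝ) < 1) : χ (sidePt p x) ∉ O.boundary := by
  rintro ⟨e, he, hs, him⟩
  have := min_le_left (x : ℝ) (1 - x)
  have := min_le_right (x : ℝ) (1 - x)
  have hm : 0 < min (x : ℝ) (1 - x) := lt_min h0 (by linarith)
  obtain ⟨E, -, hEs, hE⟩ := h.exists_chart_side p (ε := min (x : ℝ) (1 - x) / 2) (by linarith)
  set ε := min (x : ℝ) (1 - x) / 2
  have hε : 0 < ε := by simp only [ε]; linarith
  have hεx : ε < min (x : ℝ) (1 - x) := by simp only [ε]; linarith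
  have hxn : sidePt p x ∈ nearSide ε p :=
    (sidePt_mem_nearSide (by linarith)).2 ⟨rfl, by linarith, by linarith⟩
  have hxE : χ (sidePt p x) ∈ E.source := by rw [hEs]; exact ⟨_, .inl hxn, rfl⟩
  set G := e.symm.trans E
  set z₀ := e (χ (sidePt p x))
  have hz₀ : z₀ ∈ G.source := by
    simp only [G, z₀, mfld_simps]
    exact ⟨e.map_source hs, by rwa [e.left_inv hs]⟩
  set r₀ : ℝ := (z₀ : ℂ).re
  have hr₀ : (r₀ : ℂ) = z₀ := Complex.ext rfl (by simp [z₀, him])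
  set f : HalfPlane → ℂ := fun w => (G w : ℂ) with hf
  obtain ⟨V, hV, hVs⟩ := isOpen_induced_iff.1 G.open_source
  obtain ⟨ρ, hρ, hb⟩ := Metric.isOpen_iff.1 hV (r₀ : ℂ) (by
    rw [hr₀]; exact (show z₀ ∈ Subtype.val ⁻¹' V from hVs ▸ hz₀))
  have hsrc : ∀ w : HalfPlane, (w : ℂ) ∈ Metric.ball (r₀ : ℂ) ρ → w ∈ G.source := fun w hw => by
    rw [← hVs]; exact hb hw
  -- A boundary point in the domain of `E` is not interior to a triangle, so its coordinate
  -- transverse to the side vanishes.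
  have hEim : ∀ y ∈ E.source, y ∈ O.boundary → (E y : ℂ).im = 2 := by
    intro y hy hyb
    rw [hEs] at hy
    obtain ⟨a, ha, rfl⟩ := hy
    rw [hE a ha]
    have hz : ∀ q, a ∈ nearSide ε q → (sideCoord q.2 a.2).im = 0 := by
      rintro q ⟨z, ⟨b1, b2⟩, rfl⟩
      rw [sideCoord_im]
      refine le_antisymm (not_lt.1 fun hlt => ?_) (bary_nonneg z _)
      exact interior_notMem_boundary O hpos (mem_interior_Tri.2
        (fin3_forall q.2 hlt (by linarith) (by linarith))) hyb
    rcases nearSide_cases ha with ha | ⟨-, ha⟩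
    · rw [sideChart_eq (nearSide_mono hε.le p ha), sideHeight_ne hp]
      simp [hz _ ha]
    · rw [sideChart_eq_mate hp (nearSide_mono hε.le _ ha)]
      simp [hz _ ha]
  obtain ⟨δ, hδ, hδρ, hn⟩ := image_halfDisc_not_mem_nhds (F := extendZero f) (c := 2) hρ
    (by
      rintro w ⟨hw, hw0⟩
      have : ContinuousAt f ⟨w, hw0⟩ :=
        continuous_subtype_val.continuousAt.comp (G.continuousAt (hsrc ⟨w, hw0⟩ hw))
      have h2 : ContinuousWithinAt (extendZero f) HalfPlane w := by
        rw [continuousWithinAt_iff_continuousAt_domRestrict (h := hw0)]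
        have e : HalfPlane.domRestrict (extendZero f) = f := funext fun w => extendZero_apply f w
        rw [e]; exact this
      exact h2.mono inter_subset_right)
    (by
      rintro w ⟨hw, hw0⟩ w' ⟨hw', hw0'⟩ hww
      have e1 := extendZero_apply f ⟨w, hw0⟩
      have e2 := extendZero_apply f ⟨w', hw0'⟩
      simp only at e1 e2
      rw [e1, e2] at hww
      exact congrArg Subtype.val (G.injOn (hsrc ⟨w, hw0⟩ hw) (hsrc ⟨w', hw0'⟩ hw') (Subtype.ext hww)))
    (by
      intro y hy
      have hy0 : (y : ℂ) ∈ HalfPlane := by simp [HalfPlane]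
      have e1 := extendZero_apply f ⟨y, hy0⟩
      simp only at e1
      rw [e1]
      have hys := hsrc ⟨y, hy0⟩ (by
        rwa [mem_ball_iff_norm, ← Complex.ofReal_sub, Complex.norm_real])
      simp only [G, mfld_simps] at hys
      exact hEim _ hys.2 ⟨e, he, e.map_target hys.1,
        (congrArg (fun w : HalfPlane => (w : ℂ).im) (e.right_inv hys.1)).trans (by simp)⟩)
  apply hn
  have e1 := extendZero_apply f z₀
  rw [hr₀, e1]
  have hop : IsOpen (G '' (Subtype.val ⁻¹' Metric.ball (z₀ : ℂ) δ)) := by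
    refine G.isOpen_image_of_subset_source (Metric.isOpen_ball.preimage continuous_subtype_val)
      fun w hw => hsrc w (Metric.ball_subset_ball hδρ (by rw [hr₀]; exact hw))
  have him2 : (f z₀).im = 2 := by
    have : G z₀ = E (χ (sidePt p x)) := by
      simp only [G, z₀, OpenPartialHomeomorph.coe_trans, Function.comp]
      rw [e.left_inv hs]
    rw [hf]
    simp only [this]
    exact hEim _ hxE ⟨e, he, hs, him⟩
  have hmem : Subtype.val '' (G '' (Subtype.val ⁻¹' Metric.ball (z₀ : ℂ) δ)) ∈ 𝓝 (f z₀) := by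
    rw [← map_nhds_subtype_coe_eq_nhds (G z₀).2 (HalfPlane_mem_nhds (him2.symm ▸ two_pos))]
    exact Filter.image_mem_map (hop.mem_nhds ⟨z₀, by simp [hδ], rfl⟩)
  refine Filter.mem_of_superset hmem ?_
  rintro _ ⟨_, ⟨w, hw, rfl⟩, rfl⟩
  exact ⟨w, ⟨hw, w.2⟩, extendZero_apply f w⟩

/-- There are boundary segments near each point of the boundary. -/
theorem IsGluing.exists_unglued_of_mem_boundary {x : Y} (hx : x ∈ O.boundary) {W : Set Y}
    (hW : IsOpen W) (hxW : x ∈ W) :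
    ∃ (p : T × Fin 3) (s : unitInterval), mate p = p ∧ χ (sidePt p s) ∈ W := by
  obtain ⟨e, he, hs, him⟩ := hx
  have hop : IsOpen (e.symm ⁻¹' W ∩ e.target) := by
    rw [inter_comm]; exact e.isOpen_inter_preimage_symm hW
  obtain ⟨V, hV, hVs⟩ := isOpen_induced_iff.1 hop
  have hmem : (e x : ℂ) ∈ V := by
    have : e x ∈ Subtype.val ⁻¹' V := by
      rw [hVs]; exact ⟨by simpa [e.left_inv hs] using hxW, e.map_source hs⟩
    exact this
  have hr₀ : (((e x : ℂ).re : ℝ) : ℂ) = e x := Complex.ext rfl (by simp [him])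
  have hopen : IsOpen {r : ℝ | (r : ℂ) ∈ V} := hV.preimage Complex.continuous_ofReal
  -- The real line in the chart gives infinitely many boundary points in `W`. One of them is not a
  -- corner; it lies inside a side, which cannot be glued.
  have hinf : {r : ℝ | (r : ℂ) ∈ V}.Infinite :=
    infinite_of_mem_nhds _ (hopen.mem_nhds (show _ ∈ V by rw [hr₀]; exact hmem))
  let g : ℝ → Y := fun r => e.symm ⟨r, by simp [HalfPlane]⟩
  have hg : ∀ r : ℝ, (r : ℂ) ∈ V → g r ∈ W ∧ g r ∈ O.boundary ∧
      (⟨r, by simp [HalfPlane]⟩ : HalfPlane) ∈ e.target := by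
    intro r hr
    have h1 : (⟨r, by simp [HalfPlane]⟩ : HalfPlane) ∈ Subtype.val ⁻¹' V := hr
    rw [hVs] at h1
    exact ⟨h1.1, ⟨e, he, e.map_target h1.2, by rw [e.right_inv h1.2]; simp⟩, h1.2⟩
  have hgi : InjOn g {r : ℝ | (r : ℂ) ∈ V} := by
    intro r hr r' hr' hrr
    have := e.symm.injOn (hg r hr).2.2 (hg r' hr').2.2 hrr
    exact Complex.ofReal_injective (congrArg Subtype.val this)
  obtain ⟨_, ⟨r, hr, rfl⟩, hnot⟩ := (hinf.image hgi).exists_notMem_finite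
    (finite_range fun c : T × Fin 3 => χ (cornerAt c))
  obtain ⟨h1, h2, -⟩ := hg r hr
  obtain ⟨⟨t, z⟩, hz⟩ := h.surjective (g r)
  rw [← hz] at h1 h2 hnot
  have hzi : ¬ ∀ i, 0 < bary i z := fun hi =>
    interior_notMem_boundary O hpos (mem_interior_Tri.2 hi) h2
  push Not at hzi
  obtain ⟨i, hi⟩ := hzi
  have hi : bary i z = 0 := le_antisymm hi (bary_nonneg z i)
  obtain ⟨s, rfl⟩ : ∃ s, z = edgePt i s := ⟨_, eq_edgePt hi⟩
  have hs0 : s ≠ 0 := by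
    rintro rfl; exact hnot ⟨(t, i + 1), by simp [cornerAt, edgePt_zero]⟩
  have hs1 : s ≠ 1 := by
    rintro rfl; exact hnot ⟨(t, i + 2), by simp [cornerAt, edgePt_one]⟩
  refine ⟨(t, i), s, ?_, h1⟩
  by_contra hp
  exact h.glued_notMem_boundary O hpos hp (unitInterval.pos_iff_ne_zero.2 hs0)
    (unitInterval.lt_one_iff_ne_one.2 hs1) h2

/-- The points close to the corners identified with `c` form a saturated open set, so its image
contains a point of an unglued side. That side is adjacent to one of these corners, whose sequence
is therefore not a closed cycle of glued sides; the property passes to all identified corners. -/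
theorem IsGluing.isLast_of_mem_boundary {c : T × Fin 3} (hc : χ (cornerAt c) ∈ O.boundary) :
    ∃ k, IsLastCorner mate ((nextCorner mate)^[k] c) := by
  let U : Set (TriSum T) := {a | ∃ d, CornerRel mate c d ∧ d.1 = a.1 ∧ 1 / 2 < bary d.2 a.2}
  have hUo : IsOpen U := by
    rw [isOpen_sigma_iff]
    intro t
    have : Sigma.mk t ⁻¹' U = ⋃ d ∈ {d : T × Fin 3 | CornerRel mate c d ∧ d.1 = t},
        {z : Tri | 1 / 2 < bary d.2 z} := by
      ext z
      simp [U, and_assoc]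
    rw [this]
    exact isOpen_biUnion fun d _ => isOpen_lt (by fun_prop) (by fun_prop)
  have hcase : ∀ (p : T × Fin 3) (x : unitInterval) (d : T × Fin 3), d.1 = p.1 →
      1 / 2 < bary d.2 (edgePt p.2 x) → (d = (p.1, p.2 + 1) ∧ 1 / 2 < 1 - (x : ℝ)) ∨
        (d = (p.1, p.2 + 2) ∧ 1 / 2 < (x : ℝ)) := by
    rintro p x ⟨t, j⟩ rfl hx
    simp only at hx
    rcases fin3_cases p.2 j with rfl | rfl | rfl
    · rw [bary_edgePt] at hx; norm_num at hx
    · rw [bary_edgePt_one] at hx; exact .inl ⟨rfl, hx⟩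
    · rw [bary_edgePt_two] at hx; exact .inr ⟨rfl, hx⟩
  have hUs : Saturated mate U := by
    rintro p x hp ⟨d, hd, hd1, hd2⟩
    rcases hcase p x d hd1 hd2 with ⟨rfl, hx⟩ | ⟨rfl, hx⟩
    · refine ⟨((mate p).1, (mate p).2 + 2), hd.trans _ _ _ (.symm _ _ (.rel _ _ ⟨?_, ?_⟩)), rfl, ?_⟩
      · simp only [fin3_21, Prod.mk.eta, h.mate_mate]; exact hp.symm
      · simp [nextCorner, fin3_21, h.mate_mate]
      · simp only [sidePt, bary_edgePt_two, unitInterval.coe_symm_eq]; exact hx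
    · refine ⟨((mate p).1, (mate p).2 + 1), hd.trans _ _ _ (.rel _ _ ⟨?_, ?_⟩), rfl, ?_⟩
      · simpa [fin3_21] using hp
      · simp [nextCorner, fin3_21]
      · simp only [sidePt, bary_edgePt_one, unitInterval.coe_symm_eq]; linarith
  obtain ⟨hWo, hW⟩ := h.isOpen_image hUo (hUs.iff h.mate_mate)
  obtain ⟨p, s, hp, hs⟩ := h.exists_unglued_of_mem_boundary O hpos hc hWo
    ⟨cornerAt c, ⟨c, .refl _, rfl, by simp only [cornerAt, bary_cornerPt]; norm_num⟩, rfl⟩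
  rw [← mem_preimage, hW] at hs
  obtain ⟨d, hd, hd1, hd2⟩ := hs
  have hinj : Function.Injective (nextCorner mate) :=
    Function.LeftInverse.injective (prevCorner_nextCorner h.mate_mate)
  have hlast : ∃ k, IsLastCorner mate ((nextCorner mate)^[k] d) := by
    rcases hcase p s d hd1 hd2 with ⟨rfl, hx⟩ | ⟨rfl, hx⟩
    -- Here the unglued side precedes the corner, which is a first corner. Its predecessor in the
    -- cycle of the permutation `nextCorner` is a last corner.
    · obtain ⟨N, hN, hc⟩ := hinj.mem_periodicPts (p.1, p.2 + 1)
      refine ⟨N - 1, ?_⟩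
      rw [← isFirstCorner_nextCorner h.mate_mate, ← Function.iterate_succ_apply' (nextCorner mate),
        Nat.succ_eq_add_one, Nat.sub_add_cancel hN, hc.eq]
      simpa [IsFirstCorner, fin3_12] using hp
    · exact ⟨0, by simpa [IsLastCorner, fin3_21] using hp⟩
  have := eqvGen_invariant (r := fun c d : T × Fin 3 => mate (c.1, c.2 + 1) ≠ (c.1, c.2 + 1) ∧
      d = nextCorner mate c)
    (f := fun c => ∃ k, IsLastCorner mate ((nextCorner mate)^[k] c)) (by
      rintro a _ ⟨ha, rfl⟩
      refine propext ⟨?_, fun ⟨k, hk⟩ => ⟨k + 1, hk⟩⟩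
      rintro ⟨_ | k, hk⟩
      · exact absurd hk ha
      · exact ⟨k, hk⟩) hd
  exact this.mpr hlast

end

/-! ### Self-folded triangles -/

section Disc

variable {T : Type} {mate : T × Fin 3 → T × Fin 3} {Y : Type*} [TopologicalSpace Y]
  {χ : TriSum T → Y}

theorem sectorMap_zero_right (κ a : ℝ) : sectorMap κ 0 a 0 = a := by simp [sectorMap]

theorem sectorMap_zero_left (b : ℝ) : sectorMap (2 * Real.pi) 0 0 b = b := by
  rcases eq_or_ne b 0 with rfl | hb
  · simp [sectorMap]
  · simp [sectorMap, hb]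

/-- A sector of angle `2π` only brings its two bounding rays together: the fractions `b / (a + b)`
and `b' / (a + b)` lie in `[0, 1]` and differ by an integer, so this integer is `-1`, `0` or `1`. -/
theorem sectorMap_two_pi_cases {a b a' b' : ℝ} (ha : 0 ≤ a) (hb : 0 ≤ b) (ha' : 0 ≤ a')
    (hb' : 0 ≤ b') (h : sectorMap (2 * Real.pi) 0 a b = sectorMap (2 * Real.pi) 0 a' b') :
    (a = a' ∧ b = b') ∨ (a = 0 ∧ b' = 0 ∧ b = a') ∨ (b = 0 ∧ a' = 0 ∧ a = b') := by
  have hs : a + b = a' + b' := by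
    rw [← norm_sectorMap (κ := 2 * Real.pi) (k := 0) (add_nonneg ha hb), h,
      norm_sectorMap (add_nonneg ha' hb')]
  rcases (add_nonneg ha hb).eq_or_lt with h0 | h0
  · left; constructor <;> linarith
  simp only [sectorMap, ← hs] at h
  have hne : ((a + b : ℝ) : ℂ) ≠ 0 := Complex.ofReal_ne_zero.2 h0.ne'
  obtain ⟨n, hn⟩ := Complex.exp_eq_exp_iff_exists_int.1 (mul_left_cancel₀ hne h)
  have hn2 : 2 * Real.pi * (0 + b / (a + b)) = 2 * Real.pi * (0 + b' / (a + b)) + n * (2 * Real.pi) := by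
    have e : (n : ℂ) * (2 * Real.pi * Complex.I) = (n * (2 * Real.pi) : ℝ) * Complex.I := by
      push_cast; ring
    rw [e, ← add_mul, ← Complex.ofReal_add] at hn
    exact Complex.ofReal_injective (mul_right_cancel₀ Complex.I_ne_zero hn)
  have hn3 : b = b' + n * (a + b) := by
    have hpi := Real.pi_pos
    have : b / (a + b) = b' / (a + b) + n := by
      refine mul_left_cancel₀ (two_mul_pi_ne_zero) ?_
      linear_combination hn2
    field_simp at this
    linarith
  have h1 : (n : ℝ) ≤ 1 := by
    by_contra! hlt; nlinarith
  have h2 : (-1 : ℝ) ≤ n := by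
    by_contra! hlt; nlinarith
  have h1' : n ≤ 1 := by exact_mod_cast h1
  have h2' : -1 ≤ n := by exact_mod_cast h2
  interval_cases n
  · right; right; simp at hn3; refine ⟨?_, ?_, ?_⟩ <;> linarith
  · left; simp at hn3; constructor <;> linarith
  · right; left; simp at hn3; refine ⟨?_, ?_, ?_⟩ <;> linarith
where
  two_mul_pi_ne_zero : 2 * Real.pi ≠ 0 := by positivity

theorem exists_sectorMap_eq {w : ℂ} (hw : ‖w‖ ≤ 1) :
    ∃ a b : ℝ, 0 ≤ a ∧ 0 ≤ b ∧ a + b ≤ 1 ∧ sectorMap (2 * Real.pi) 0 a b = w := by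
  set u := Int.fract (w.arg / (2 * Real.pi)) with hu
  have h0 : 0 ≤ u := Int.fract_nonneg _
  have h1 : u < 1 := Int.fract_lt_one _
  refine ⟨‖w‖ * (1 - u), ‖w‖ * u, by have := norm_nonneg w; nlinarith, by positivity, by linarith, ?_⟩
  rcases eq_or_ne w 0 with rfl | hw0
  · simp [sectorMap]
  have e : ‖w‖ * (1 - u) + ‖w‖ * u = ‖w‖ := by ring
  have hn := norm_ne_zero_iff.2 hw0
  rw [sectorMap, e, mul_div_cancel_left₀ _ hn]
  conv_rhs => rw [← Complex.norm_mul_exp_arg_mul_I w]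
  congr 1
  rw [Complex.exp_eq_exp_iff_exists_int]
  refine ⟨-⌊w.arg / (2 * Real.pi)⌋, ?_⟩
  have : w.arg = 2 * Real.pi * u + ⌊w.arg / (2 * Real.pi)⌋ * (2 * Real.pi) := by
    rw [hu, Int.fract]
    have := Real.pi_pos
    field_simp
    ring
  generalize ⌊w.arg / (2 * Real.pi)⌋ = n at this
  rw [this]
  push_cast
  ring

/-- A triangle with two sides glued to each other is a disc. -/
theorem IsGluing.nonempty_homeomorph_disc [T2Space Y] (h : IsGluing mate χ) {t : T} {i : Fin 3}
    (ht : ∀ s, s = t) (hf : mate (t, i + 1) = (t, i + 2)) (hl : mate (t, i) = (t, i)) :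
    Nonempty (Y ≃ₜ Metric.closedBall (0 : ℂ) 1) := by
  have hfin : Finite T := by
    have : Subsingleton T := ⟨fun a b => (ht a).trans (ht b).symm⟩
    infer_instance
  have : CompactSpace Y := by
    rw [← isCompact_univ_iff, ← h.surjective.range_eq]
    exact isCompact_range h.continuous
  -- Polar coordinates at the corner `i` wrap the triangle once around the disc: the two glued sides
  -- become a radius, and the opposite side becomes the circle.
  let g : TriSum T → Metric.closedBall (0 : ℂ) 1 := fun a =>
    ⟨sectorMap (2 * Real.pi) 0 (bary (i + 1) a.2) (bary (i + 2) a.2), by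
      have := bary_sum i a.2
      have := bary_nonneg a.2
      rw [mem_closedBall_zero_iff, norm_sectorMap (add_nonneg (this _) (this _))]
      linarith [this i]⟩
  have hg : Continuous g := by
    refine Continuous.subtype_mk (continuous_sigma fun s => ?_) _
    refine continuous_iff_continuousAt.2 fun z => continuousAt_sectorMap (by fun_prop) (by fun_prop) ?_
    exact .of_forall fun z => add_nonneg (bary_nonneg z _) (bary_nonneg z _)
  have hinv : ∀ a b, χ a = χ b → g a = g b := by
    intro a b hab
    have key : ∀ x, g (sidePt (t, i + 1) x) = g (sidePt (t, i + 2) (unitInterval.symm x)) := by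
      intro x
      refine Subtype.ext ?_
      have e1 := bary_edgePt (i + 1) x
      have e2 := bary_edgePt_one (i + 1) x
      have e3 := bary_edgePt (i + 2) (unitInterval.symm x)
      have e4 := bary_edgePt_two (i + 2) (unitInterval.symm x)
      rw [fin3_11] at e2
      rw [fin3_22] at e4
      simp only [g, sidePt, e1, e2, e3, e4, sectorMap_zero_left, sectorMap_zero_right,
        unitInterval.coe_symm_eq]
    refine h.invariant (f := g) (fun p x hp => ?_) hab
    obtain ⟨s, j⟩ := p
    obtain rfl := ht s
    rcases fin3_cases i j with rfl | rfl | rfl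
    · exact absurd hl hp
    · rw [hf]; exact key x
    · have := h.mate_mate (s, i + 1)
      rw [hf] at this
      rw [this, key, unitInterval.symm_symm]
  let f : Y → Metric.closedBall (0 : ℂ) 1 := fun y => g (Function.surjInv h.surjective y)
  have hfχ : ∀ a, f (χ a) = g a := fun a => hinv _ _ (Function.surjInv_eq h.surjective _)
  have hfc : Continuous f := h.isQuotientMap.continuous_iff.2 (hg.congr fun a => (hfχ a).symm)
  have hbij : Function.Bijective f := by
    constructor
    · intro y y' hyy
      obtain ⟨⟨s, z⟩, rfl⟩ := h.surjective y
      obtain ⟨⟨s', z'⟩, rfl⟩ := h.surjective y'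
      obtain rfl := ht s
      obtain rfl := ht s'
      rw [hfχ, hfχ] at hyy
      have key : ∀ z z' : Tri, bary (i + 1) z = 0 → bary (i + 2) z' = 0 →
          bary (i + 2) z = bary (i + 1) z' → χ ⟨s', z⟩ = χ ⟨s', z'⟩ := by
        intro z z' h1 h2 h3
        obtain ⟨x, rfl⟩ : ∃ x, z = edgePt (i + 1) x := ⟨_, eq_edgePt h1⟩
        obtain ⟨y, rfl⟩ : ∃ y, z' = edgePt (i + 2) y := ⟨_, eq_edgePt h2⟩
        have e2 := bary_edgePt_one (i + 1) x
        have e4 := bary_edgePt_two (i + 2) y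
        rw [fin3_11] at e2
        rw [fin3_22] at e4
        have := h.glue (s', i + 1) (by rw [hf]; simp [(fin3_ne12 i).symm]) x
        rw [hf] at this
        rw [show y = unitInterval.symm x from Subtype.ext (by
          rw [unitInterval.coe_symm_eq]; linarith)]
        exact this
      rcases sectorMap_two_pi_cases (bary_nonneg z _) (bary_nonneg z _) (bary_nonneg z' _)
        (bary_nonneg z' _) (congrArg Subtype.val hyy) with ⟨h1, h2⟩ | ⟨h1, h2, h3⟩ | ⟨h1, h2, h3⟩
      · rw [Subtype.ext (eq_of_bary i h1 h2)]
      · exact key _ _ h1 h2 h3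
      · exact (key _ _ h2 h1 h3.symm).symm
    · rintro ⟨w, hw⟩
      obtain ⟨a, b, ha, hb, hab, e⟩ := exists_sectorMap_eq (mem_closedBall_zero_iff.1 hw)
      have hmem : ofBary i a b ∈ Tri := mem_Tri.2 (fin3_forall i (by rw [bary_ofBary]; linarith)
        (by rwa [bary_ofBary_one]) (by rwa [bary_ofBary_two]))
      refine ⟨χ ⟨t, _, hmem⟩, ?_⟩
      rw [hfχ]
      refine Subtype.ext ?_
      simp only [g, bary_ofBary_one, bary_ofBary_two]
      exact e
  exact ⟨Continuous.homeoOfEquivCompactToT2 (f := Equiv.ofBijective f hbij) hfc⟩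

end Disc

namespace IdealTriangulation

section

variable {X : Type u} [TopologicalSpace X] {O : OrientedSurface X} {V : Set X}
  (τ : IdealTriangulation O V)

theorem isGluing : IsGluing τ.mate τ.χ :=
  ⟨τ.mate_mate, τ.χ.continuous, τ.surjective, τ.eq_iff⟩

variable {τ}

theorem IsFolded.mate_two {t : τ.T} {i : Fin 3} (h : τ.IsFolded (t, i)) :
    τ.mate (t, i + 2) = (t, i + 1) := by
  have := τ.mate_mate (t, i + 1)
  rwa [show τ.mate (t, i + 1) = (t, i + 2) from h] at this

theorem IsFolded.mate_one {t : τ.T} {i : Fin 3} (h : τ.IsFolded (t, i)) :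
    τ.mate (t, i + 1) = (t, i + 2) := h

theorem IsFolded.unique {t : τ.T} {i j : Fin 3} (h : τ.IsFolded (t, i)) (h' : τ.IsFolded (t, j)) :
    j = i := by
  have h1 := h.mate_one
  have h2 := h.mate_two
  rcases fin3_cases i j with rfl | rfl | rfl
  · rfl
  · have := h'.mate_one
    rw [fin3_11, fin3_12, h2] at this
    exact absurd (congrArg Prod.snd this) (fin3_ne1 i)
  · have := h'.mate_two
    rw [fin3_21, fin3_22, h1] at this
    exact absurd (congrArg Prod.snd this) (fin3_ne2 i)

theorem Folded.ext {q q' : τ.Folded} (h : q.1.1 = q'.1.1) : q = q' := by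
  obtain ⟨⟨t, i⟩, hq⟩ := q
  obtain ⟨⟨t', j⟩, hq'⟩ := q'
  obtain rfl : t = t' := h
  obtain rfl := IsFolded.unique hq hq'
  rfl

/-- A corner at an enclosed puncture follows itself, so its sequence never reaches the boundary;
this is what separates punctures from marked points. -/
theorem IsFolded.nextCorner {c : τ.T × Fin 3} (h : τ.IsFolded c) : nextCorner τ.mate c = c := by
  obtain ⟨t, i⟩ := c
  simp [_root_.nextCorner, h.mate_one, fin3_21]

theorem IsFolded.not_isLast {c : τ.T × Fin 3} (h : τ.IsFolded c) : ¬ IsLastCorner τ.mate c := by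
  obtain ⟨t, i⟩ := c
  simp [IsLastCorner, h.mate_one, (fin3_ne12 i).symm]

theorem IsFolded.not_exists_isLast {c : τ.T × Fin 3} (h : τ.IsFolded c) :
    ¬ ∃ k, IsLastCorner τ.mate ((_root_.nextCorner τ.mate)^[k] c) := by
  rintro ⟨k, hk⟩
  rw [Function.iterate_fixed h.nextCorner] at hk
  exact h.not_isLast hk

theorem IsFolded.eq_of_cornerRel {c d : τ.T × Fin 3} (h : CornerRel τ.mate c d)
    (hc : τ.IsFolded c) : c = d := by
  have := eqvGen_invariant (r := fun c d : τ.T × Fin 3 => τ.mate (c.1, c.2 + 1) ≠ (c.1, c.2 + 1) ∧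
      d = _root_.nextCorner τ.mate c) (f := fun d => d = c) (by
    rintro a _ ⟨-, rfl⟩
    refine propext ⟨fun e => by rw [e, hc.nextCorner], fun e => ?_⟩
    rw [← hc.nextCorner] at e
    exact Function.LeftInverse.injective (prevCorner_nextCorner τ.mate_mate) e) h
  exact ((this.mp rfl) : d = c).symm

/-- The combinatorial properties of a triangulation whose self-folded triangles enclose all the
punctures, and lie in different triangles. -/
structure IsTame (τ : IdealTriangulation O V) (M : Set X) : Prop where
  loop_mate : ∀ q : τ.Folded, ∀ i, ¬ τ.IsFolded ((τ.mate q.1).1, i)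
  share : ∀ q q' : τ.Folded, (τ.mate q.1).1 = (τ.mate q'.1).1 → q = q'
  linear : ∀ c, ¬ τ.IsFolded c → ∃ k, IsLastCorner τ.mate ((nextCorner τ.mate)^[k] c)
  connected : ∀ f : τ.T → Prop, (∀ p, f p.1 ↔ f (τ.mate p).1) → ∀ s t, f s → f t
  nonempty : Nonempty τ.Folded
  unglued : ∃ p, τ.mate p = p
  marked : ∀ c, τ.χ (cornerAt c) ∈ M ↔ ¬ τ.IsFolded c
  exists_corner : ∀ x ∈ M, ∃ c, x = τ.χ (cornerAt c)

/-- A folded corner is not marked, because the corners at a marked point lead to an unglued side. A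
corner that is not folded is not a puncture, because each puncture is the folded corner of some
self-folded triangle, and a folded corner is identified only with itself. -/
theorem isTame {M P : Set X} (τ : IdealTriangulation O (M ∪ P)) (hX : O.IsMarkedSurface M P)
    (hP : P.Nonempty)
    (hmonogon : ¬ (Nonempty (X ≃ₜ Metric.closedBall (0 : ℂ) 1) ∧ M.ncard = 1 ∧ P.ncard = 1))
    (hfold : ∀ x ∈ P, ∃ q : τ.Folded, τ.χ ⟨q.1.1, cornerPt q.1.2⟩ = x)
    (hshare : ∀ q q' : τ.Folded, (τ.mate q.1).1 = (τ.mate q'.1).1 → q = q') : τ.IsTame M := by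
  have := hX.t2
  have := hX.compact
  have := hX.connected
  have := τ.finite
  have hg := τ.isGluing
  have hV : ∀ c, τ.χ (cornerAt c) ∈ M ∪ P := fun c => τ.vertices.subset ⟨c, rfl⟩
  have hlin : ∀ c, τ.χ (cornerAt c) ∈ M → ∃ k, IsLastCorner τ.mate ((nextCorner τ.mate)^[k] c) :=
    fun c hc => hg.isLast_of_mem_boundary O τ.positive (hX.marked_subset hc)
  have hmark : ∀ c, τ.χ (cornerAt c) ∈ M ↔ ¬ τ.IsFolded c := by
    refine fun c => ⟨fun hc hf => hf.not_exists_isLast (hlin c hc), fun hc => ?_⟩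
    refine (hV c).resolve_right fun hcP => ?_
    obtain ⟨q, hq⟩ := hfold _ hcP
    have := IsFolded.eq_of_cornerRel ((hg.corner_iff (c := q.1) (d := c)).1 hq) q.2
    exact hc (this ▸ q.2)
  have hconn : ∀ f : τ.T → Prop, (∀ p, f p.1 ↔ f (τ.mate p).1) → ∀ s t, f s → f t :=
    fun f hf s t hs => hg.eq_of_preconnected f hf s t hs
  have hungl : ∃ p, τ.mate p = p := by
    obtain ⟨x, hx⟩ := hX.boundary_nonempty
    obtain ⟨p, -, hp, -⟩ := hg.exists_unglued_of_mem_boundary O τ.positive hx isOpen_univ trivial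
    exact ⟨p, hp⟩
  -- If a loop were a boundary segment, its triangle would be glued only to itself. By connectedness
  -- the surface would consist of this triangle alone, that is, be the excluded once-punctured
  -- monogon.
  have hne : ∀ q : τ.Folded, τ.mate q.1 ≠ q.1 := by
    rintro ⟨⟨t, i⟩, hq⟩ hl
    simp only at hl
    have hT : ∀ s, s = t := by
      refine fun s => hconn (fun s => s = t) ?_ t s rfl
      rintro ⟨s, j⟩
      have key : ∀ j, (τ.mate (t, j)).1 = t := fun j => by
        rcases fin3_cases i j with rfl | rfl | rfl
        · rw [hl]
        · rw [hq.mate_one]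
        · rw [hq.mate_two]
      constructor
      · rintro rfl; exact key _
      · intro h
        have h2 := key (τ.mate (s, j)).2
        rw [← h, Prod.mk.eta, τ.mate_mate] at h2
        exact h2.trans h
    refine hmonogon ⟨hg.nonempty_homeomorph_disc hT hq.mate_one hl, ?_, ?_⟩
    · have e : τ.χ (cornerAt (t, i + 2)) = τ.χ (cornerAt (t, i + 1)) := by
        have := hg.glue (t, i + 1) (by simp [hq.mate_one, (fin3_ne12 i).symm]) 0
        rwa [hq.mate_one, sidePt_zero, unitInterval.symm_zero, sidePt_one, fin3_11, fin3_22] at this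
      rw [ncard_eq_one]
      refine ⟨τ.χ (cornerAt (t, i + 1)), subset_antisymm ?_ ?_⟩
      · intro x hx
        obtain ⟨⟨s, j⟩, rfl⟩ := τ.vertices.superset (.inl hx)
        obtain rfl := hT s
        rcases fin3_cases i j with rfl | rfl | rfl
        · exact absurd hq ((hmark _).1 hx)
        · rfl
        · exact e
      · rintro _ rfl
        exact (hmark _).2 fun h => fin3_ne1 i (hq.unique h)
    · obtain ⟨x, hx⟩ := hP
      rw [ncard_eq_one]
      refine ⟨x, subset_antisymm (fun y hy => ?_) (by simpa using hx)⟩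
      obtain ⟨q, rfl⟩ := hfold x hx
      obtain ⟨q', rfl⟩ := hfold y hy
      rw [Folded.ext (q := q') (q' := q) ((hT _).trans (hT _).symm)]
      rfl
  refine ⟨fun q i hi => ?_, hshare, fun c hc => hlin c ((hmark c).2 hc), hconn, ?_, hungl, hmark, ?_⟩
  · obtain ⟨⟨t, j⟩, hq⟩ := q
    simp only at hi
    have hmm := τ.mate_mate (t, j)
    obtain ⟨⟨t', i'⟩, hm⟩ : ∃ p, τ.mate (t, j) = p := ⟨_, rfl⟩
    rw [hm] at hi hmm
    simp only at hi
    have hne' := hne ⟨_, hq⟩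
    simp only [hm] at hne'
    rcases fin3_cases i i' with rfl | rfl | rfl
    · obtain ⟨p, hp⟩ := hungl
      -- Two self-folded triangles glued along their loops have all their sides glued, so by
      -- connectedness there would be no boundary.
      have key : ∀ s k, s = t ∨ s = t' →
          τ.mate (s, k) ≠ (s, k) ∧ ((τ.mate (s, k)).1 = t ∨ (τ.mate (s, k)).1 = t') := by
        rintro s k (rfl | rfl)
        · rcases fin3_cases j k with rfl | rfl | rfl
          · rw [hm]; exact ⟨hne', .inr rfl⟩
          · rw [hq.mate_one]; exact ⟨by simp [(fin3_ne12 j).symm], .inl rfl⟩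
          · rw [hq.mate_two]; exact ⟨by simp [fin3_ne12 j], .inl rfl⟩
        · rcases fin3_cases i' k with rfl | rfl | rfl
          · rw [hmm]; exact ⟨hne'.symm, .inl rfl⟩
          · rw [hi.mate_one]; exact ⟨by simp [(fin3_ne12 i').symm], .inr rfl⟩
          · rw [hi.mate_two]; exact ⟨by simp [fin3_ne12 i'], .inr rfl⟩
      have hT : ∀ s, s = t ∨ s = t' := by
        refine fun s => hconn (fun s => s = t ∨ s = t') (fun p => ⟨fun h => (key p.1 p.2 h).2,
          fun h => ?_⟩) t s (.inl rfl)
        have := (key (τ.mate p).1 (τ.mate p).2 h).2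
        rwa [Prod.mk.eta, τ.mate_mate] at this
      exact (key p.1 p.2 (hT p.1)).1 hp
    · rw [hi.mate_one, Prod.mk.injEq] at hmm
      obtain ⟨rfl, rfl⟩ := hmm
      exact fin3_ne2 i (hi.unique hq)
    · rw [hi.mate_two, Prod.mk.injEq] at hmm
      obtain ⟨rfl, rfl⟩ := hmm
      exact fin3_ne1 i (hi.unique hq)
  · obtain ⟨x, hx⟩ := hP
    obtain ⟨q, -⟩ := hfold x hx
    exact ⟨q⟩
  · intro x hx
    obtain ⟨c, rfl⟩ := τ.vertices.superset (.inl hx)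
    exact ⟨c, rfl⟩

end

end IdealTriangulation

/-! ### Merging the two triangles on the sides of a loop -/

section Merge

/-- A map which restricts to an increasing homeomorphism of the interval from `-1` to `1`. -/
structure IsStretch (g : ℝ → ℝ) : Prop where
  continuous : Continuous g
  strictMonoOn : StrictMonoOn g (Icc (-1) 1)
  neg_one : g (-1) = -1
  one : g 1 = 1
  bounded : ∀ v, |g v| ≤ 1

/-- The map of the plane which squeezes a square to its upper half, along vertical lines. -/
noncomputable def squeeze (w : ℂ) : ℂ := (w.re : ℂ) + ((w.im + 1 - |w.re|) / 2 : ℝ) * Complex.I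

/-- The map of a triangle which stretches each horizontal segment by means of `g`. -/
noncomputable def stretch (g : ℝ → ℝ) (w : ℂ) : ℂ :=
  ((1 - w.im) * g (w.re / (1 - w.im)) : ℝ) + (w.im : ℂ) * Complex.I

/-- A homeomorphism from the square `|re w| + |im w| ≤ 1` to its upper half. -/
noncomputable def collarMap (g : ℝ → ℝ) (w : ℂ) : ℂ := stretch g (squeeze w)

theorem squeeze_re (w : ℂ) : (squeeze w).re = w.re := by simp [squeeze]

theorem squeeze_im (w : ℂ) : (squeeze w).im = (w.im + 1 - |w.re|) / 2 := by
  rw [squeeze, Complex.add_im, Complex.ofReal_im, Complex.im_ofReal_mul]; simp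

theorem stretch_re (g : ℝ → ℝ) (w : ℂ) :
    (stretch g w).re = (1 - w.im) * g (w.re / (1 - w.im)) := by simp [stretch]

theorem stretch_im (g : ℝ → ℝ) (w : ℂ) : (stretch g w).im = w.im := by simp [stretch]

theorem collarMap_re (g : ℝ → ℝ) (w : ℂ) : (collarMap g w).re =
    (1 - (w.im + 1 - |w.re|) / 2) * g (w.re / (1 - (w.im + 1 - |w.re|) / 2)) := by
  rw [collarMap, stretch_re, squeeze_re, squeeze_im]

theorem collarMap_im (g : ℝ → ℝ) (w : ℂ) : (collarMap g w).im = (w.im + 1 - |w.re|) / 2 := by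
  rw [collarMap, stretch_im, squeeze_im]

theorem continuous_squeeze : Continuous squeeze := by unfold squeeze; fun_prop

namespace IsStretch

variable {g : ℝ → ℝ} (hg : IsStretch g)

include hg

theorem exists_eq {v : ℝ} (hv : |v| ≤ 1) : ∃ u, |u| ≤ 1 ∧ g u = v := by
  rw [abs_le] at hv
  obtain ⟨u, hu, e⟩ := intermediate_value_Icc (by norm_num : (-1 : ℝ) ≤ 1)
    hg.continuous.continuousOn (show v ∈ _ by rw [hg.neg_one, hg.one]; exact hv)
  exact ⟨u, abs_le.2 hu, e⟩

theorem injective {u v : ℝ} (hu : |u| ≤ 1) (hv : |v| ≤ 1) (h : g u = g v) : u = v :=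
  hg.strictMonoOn.injOn (abs_le.1 hu) (abs_le.1 hv) h

theorem abs_lt {u : ℝ} (hu : |u| < 1) : |g u| < 1 := by
  rw [_root_.abs_lt] at hu ⊢
  have h1 := hg.strictMonoOn (show (-1 : ℝ) ∈ Icc (-1 : ℝ) 1 by norm_num) ⟨hu.1.le, hu.2.le⟩ hu.1
  have h2 := hg.strictMonoOn ⟨hu.1.le, hu.2.le⟩ (show (1 : ℝ) ∈ Icc (-1 : ℝ) 1 by norm_num) hu.2
  rw [hg.neg_one] at h1
  rw [hg.one] at h2
  exact ⟨h1, h2⟩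

theorem continuous_stretch : Continuous (stretch g) := by
  unfold stretch
  refine .add (Complex.continuous_ofReal.comp (continuous_iff_continuousAt.2 fun w => ?_)) (by fun_prop)
  -- At height one the quotient is meaningless, but `g` is bounded by one, so the real part is at
  -- most `|1 - im|` in absolute value and tends to zero.
  by_cases h : 1 - w.im = 0
  · rw [ContinuousAt]
    simp only [h, zero_mul]
    refine squeeze_zero_norm (a := fun w : ℂ => |1 - w.im|) (fun w => ?_) ?_
    · rw [Real.norm_eq_abs, abs_mul]
      exact mul_le_of_le_one_right (abs_nonneg _) (hg.bounded _)
    · have : ContinuousAt (fun w : ℂ => |1 - w.im|) w := by fun_prop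
      simpa [ContinuousAt, h] using this
  · have := hg.continuous
    have h2 : ContinuousAt (fun w : ℂ => w.re / (1 - w.im)) w := by fun_prop (disch := assumption)
    exact ContinuousAt.mul (by fun_prop) (this.continuousAt.comp h2)

theorem continuous_collarMap : Continuous (collarMap g) :=
  hg.continuous_stretch.comp continuous_squeeze

theorem collarMap_mem {w : ℂ} (hw : |w.re| + |w.im| ≤ 1) :
    0 ≤ (collarMap g w).im ∧ |(collarMap g w).re| + (collarMap g w).im ≤ 1 := by
  have h1 := le_abs_self w.im
  have h2 := neg_abs_le w.im
  have h3 := abs_nonneg w.re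
  rw [collarMap_re, collarMap_im, abs_mul, abs_of_nonneg (by linarith : 0 ≤ 1 - (w.im + 1 - |w.re|) / 2)]
  have := mul_le_of_le_one_right (by linarith : 0 ≤ 1 - (w.im + 1 - |w.re|) / 2)
    (hg.bounded (w.re / (1 - (w.im + 1 - |w.re|) / 2)))
  constructor <;> linarith

theorem collarMap_mem_interior {w : ℂ} (hw : |w.re| + |w.im| < 1) :
    0 < (collarMap g w).im ∧ |(collarMap g w).re| + (collarMap g w).im < 1 := by
  have h1 := le_abs_self w.im
  have h2 := neg_abs_le w.im
  have h3 := abs_nonneg w.re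
  have hpos : 0 < 1 - (w.im + 1 - |w.re|) / 2 := by linarith
  rw [collarMap_re, collarMap_im, abs_mul, abs_of_pos hpos]
  have := mul_lt_of_lt_one_right hpos (hg.abs_lt (u := w.re / (1 - (w.im + 1 - |w.re|) / 2)) (by
    rw [abs_div, abs_of_pos hpos, div_lt_one hpos]; linarith))
  constructor <;> linarith

/-- On these edges the squeeze is the identity and the horizontal stretch only sees the end points
`±1`. Thus merging does not disturb the two sides of the neighbouring triangle other than the loop.
-/
theorem collarMap_of_upper {w : ℂ} (h1 : |w.re| + w.im = 1) : collarMap g w = w := by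
  have e : (w.im + 1 - |w.re|) / 2 = w.im := by linarith
  apply Complex.ext
  · rw [collarMap_re, e]
    rcases eq_or_ne w.re 0 with h | h
    · simp [h] at h1 ⊢; left; linarith
    · have h2 : 1 - w.im = |w.re| := by linarith
      rw [h2]
      rcases abs_cases w.re with ⟨h3, -⟩ | ⟨h3, -⟩
      · rw [h3, div_self h, hg.one, mul_one]
      · rw [h3, div_neg, div_self h, hg.neg_one]; ring
  · rw [collarMap_im, e]

omit hg in
-- The squeeze sends the lower edges to height zero, where the stretch is `g` itself: the two copies
-- of a folded side become one straight side, with the parametrization `g`.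
theorem collarMap_of_lower {w : ℂ} (h0 : w.im = |w.re| - 1) : collarMap g w = g w.re := by
  apply Complex.ext
  · rw [collarMap_re, h0]; simp
  · rw [collarMap_im, h0]; simp

theorem collarMap_injOn : InjOn (collarMap g) {w | |w.re| + |w.im| ≤ 1} := by
  intro w hw w' hw' h
  have key : ∀ w : ℂ, |w.re| + |w.im| ≤ 1 → |w.re| ≤ 1 - (w.im + 1 - |w.re|) / 2 := fun w hw => by
    have := le_abs_self w.im; linarith
  have k1 := key w hw
  have k2 := key w' hw'
  have h1 := congrArg Complex.re h
  have h2 := congrArg Complex.im h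
  rw [collarMap_re, collarMap_re] at h1
  rw [collarMap_im, collarMap_im] at h2
  rw [← h2] at h1 k2
  set c := 1 - (w.im + 1 - |w.re|) / 2
  have hre : w.re = w'.re := by
    rcases ((abs_nonneg _).trans k1).eq_or_lt with h0 | h0
    · rw [← h0] at k1 k2
      rw [abs_nonpos_iff.1 k1, abs_nonpos_iff.1 k2]
    · have := hg.injective (by rwa [abs_div, abs_of_pos h0, div_le_one h0])
        (by rwa [abs_div, abs_of_pos h0, div_le_one h0]) (mul_left_cancel₀ h0.ne' h1)
      field_simp at this
      exact this
  rw [hre] at h2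
  exact Complex.ext hre (by linarith)

theorem collarMap_surjOn {w : ℂ} (h0 : 0 ≤ w.im) (h1 : |w.re| + w.im ≤ 1) :
    ∃ w', |w'.re| + |w'.im| ≤ 1 ∧ collarMap g w' = w := by
  have h2 := abs_nonneg w.re
  obtain ⟨v, hv, e⟩ := hg.exists_eq (v := w.re / (1 - w.im)) (by
    rw [abs_div, abs_of_nonneg (by linarith : 0 ≤ 1 - w.im)]
    exact div_le_one_of_le₀ (by linarith) (by linarith))
  have hv' : |(1 - w.im) * v| ≤ 1 - w.im := by
    rw [abs_mul, abs_of_nonneg (by linarith : 0 ≤ 1 - w.im)]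
    exact mul_le_of_le_one_right (by linarith) hv
  refine ⟨⟨(1 - w.im) * v, 2 * w.im - 1 + |(1 - w.im) * v|⟩, ?_, ?_⟩
  · simp only
    generalize |(1 - w.im) * v| = x at hv'
    have : |2 * w.im - 1 + x| ≤ 1 - x := by rw [abs_le]; constructor <;> linarith
    linarith
  · have e' : (2 * w.im - 1 + |(1 - w.im) * v| + 1 - |(1 - w.im) * v|) / 2 = w.im := by ring
    apply Complex.ext
    · rw [collarMap_re]
      simp only [e']
      rcases eq_or_ne (1 - w.im) 0 with h | h
      · rw [h, zero_mul]
        exact (abs_nonpos_iff.1 (by linarith)).symm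
      · rw [mul_div_cancel_left₀ _ h, e, mul_div_cancel₀ _ h]
    · rw [collarMap_im]
      exact e'

/-- The squeeze is increasing on vertical lines, the stretch is increasing on horizontal segments,
and each preserves the other coordinate. -/
theorem isPositiveAt_collarMap {w : ℂ} (hw : |w.re| + |w.im| < 1) :
    IsPositiveAt (collarMap g) w := by
  have h1 := le_abs_self w.im
  have h3 := abs_nonneg w.re
  refine IsPositiveAt.comp (F := stretch g) (f := squeeze) ?_ ?_ continuous_squeeze.continuousAt
    (.of_forall fun w => hg.continuous_stretch.continuousAt)
  · set u := squeeze w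
    have hu : |u.re| < 1 - u.im := by
      rw [squeeze_re, squeeze_im]; linarith
    refine isPositiveAt_of_horizontal (.of_forall fun w => hg.continuous_stretch.continuousAt)
      (.of_forall fun w => stretch_im g w) ?_
    have ho : ∀ᶠ v in 𝓝 u, |v.re| < 1 - v.im :=
      (isOpen_lt (by fun_prop) (by fun_prop)).mem_nhds hu
    filter_upwards [ho] with v hv him hne
    have hc : 0 < 1 - u.im := (abs_nonneg _).trans_lt hu
    rw [him] at hv
    have hmem : ∀ x : ℝ, |x| < 1 - u.im → x / (1 - u.im) ∈ Icc (-1 : ℝ) 1 := fun x hx => by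
      rw [mem_Icc, ← abs_le, abs_div, abs_of_pos hc]; exact div_le_one_of_le₀ hx.le hc.le
    rw [stretch_re, stretch_re, him, ← mul_sub]
    rcases lt_or_gt_of_ne (fun e => hne (Complex.ext e him) : v.re ≠ u.re) with h | h
    · have := hg.strictMonoOn (hmem _ hv) (hmem _ hu) (div_lt_div_of_pos_right h hc)
      exact mul_pos_of_neg_of_neg (mul_neg_of_pos_of_neg hc (by linarith)) (by linarith)
    · have := hg.strictMonoOn (hmem _ hu) (hmem _ hv) (div_lt_div_of_pos_right h hc)
      exact mul_pos (mul_pos hc (by linarith)) (by linarith)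
  · refine isPositiveAt_of_vertical (.of_forall fun w => continuous_squeeze.continuousAt)
      (.of_forall squeeze_re) (.of_forall fun v h hne => ?_)
    rw [squeeze_im, squeeze_im, h]
    have : v.im - w.im ≠ 0 := fun e => hne (Complex.ext h (by linarith))
    have := mul_self_pos.2 this
    linarith

end IsStretch

theorem sideCoord_mem (i : Fin 3) (z : Tri) :
    0 ≤ (sideCoord i z).im ∧ |(sideCoord i z).re| + (sideCoord i z).im ≤ 1 := by
  have h0 := bary_nonneg z i
  have h1 := bary_nonneg z (i + 1)
  have h2 := bary_nonneg z (i + 2)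
  have h3 := bary_sum i z
  rw [sideCoord_re, sideCoord_im]
  refine ⟨h0, ?_⟩
  have : |bary (i + 2) z - bary (i + 1) z| ≤ 1 - bary i z := by
    rw [abs_le]; constructor <;> linarith
  linarith

theorem mem_interior_iff_sideCoord (i : Fin 3) {z : ℂ} : z ∈ interior Tri ↔
    0 < (sideCoord i z).im ∧ |(sideCoord i z).re| + (sideCoord i z).im < 1 := by
  rw [mem_interior_Tri]
  constructor
  · intro h
    have h3 := bary_sum i z
    rw [sideCoord_re, sideCoord_im]
    refine ⟨h i, ?_⟩
    have : |bary (i + 2) z - bary (i + 1) z| < 1 - bary i z := by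
      rw [abs_lt]; constructor <;> linarith [h (i + 1), h (i + 2)]
    linarith
  · rintro ⟨h0, h1⟩
    have := le_abs_self (sideCoord i z).re
    have := neg_abs_le (sideCoord i z).re
    refine fin3_forall i (by rwa [sideCoord_im] at h0) ?_ ?_
    · rw [bary_one_eq]; linarith
    · rw [bary_two_eq]; linarith

theorem isPositiveAt_ofSideCoord (i : Fin 3) (w : ℂ) : IsPositiveAt (ofSideCoord i) w := by
  fin_cases i
  · refine isPositiveAt_affine (a := -1 / 2) (b := -1 / 2) (c := 1 / 2) (d := -1 / 2) (e := 1 / 2)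
      (f := 1 / 2) (fun z => ?_) (by norm_num) w
    apply Complex.ext <;> simp [ofSideCoord, ofBary, corner] <;> ring
  · refine isPositiveAt_affine (a := 0) (b := 1) (c := -1 / 2) (d := -1 / 2) (e := 0) (f := 1 / 2)
      (fun z => ?_) (by norm_num) w
    apply Complex.ext <;> simp [ofSideCoord, ofBary, corner] <;> ring
  · refine isPositiveAt_affine (a := 1 / 2) (b := -1 / 2) (c := 0) (d := 1) (e := 1 / 2) (f := 0)
      (fun z => ?_) (by norm_num) w
    apply Complex.ext <;> simp [ofSideCoord, ofBary, corner] <;> ring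

theorem continuous_ofSideCoord (i : Fin 3) : Continuous (ofSideCoord i) := by
  unfold ofSideCoord ofBary
  fin_cases i <;> simp <;> fun_prop

/-- A map from a triangle with a loop `k` to the triangle obtained by merging the two triangles on
the sides of the loop, whose base is the side `i`. The sign `c` tells on which side of the loop the
triangle lies. -/
noncomputable def mergeMap (g : ℝ → ℝ) (i : Fin 3) (c : ℝ) (k : Fin 3) (z : ℂ) : ℂ :=
  ofSideCoord i (collarMap g (c * sideCoord k z))

variable {g : ℝ → ℝ} (hg : IsStretch g) {i k : Fin 3} {c : ℝ} (hc : |c| = 1)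

include hc in
theorem abs_mul_add_abs (w : ℂ) :
    |((c : ℂ) * w).re| + |((c : ℂ) * w).im| = |w.re| + |w.im| := by
  rw [Complex.re_ofReal_mul, Complex.im_ofReal_mul, abs_mul, abs_mul, hc, one_mul, one_mul]

include hc in
theorem mul_sideCoord_mem (z : Tri) :
    |((c : ℂ) * sideCoord k z).re| + |((c : ℂ) * sideCoord k z).im| ≤ 1 := by
  have := sideCoord_mem k z
  rw [abs_mul_add_abs hc, abs_of_nonneg this.1]
  exact this.2

include hg

theorem continuous_mergeMap : Continuous (mergeMap g i c k) := by
  have := hg.continuous_collarMap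
  have := continuous_ofSideCoord i
  unfold mergeMap
  fun_prop

include hc

theorem mergeMap_mem (z : Tri) : mergeMap g i c k z ∈ Tri := by
  have := hg.collarMap_mem (mul_sideCoord_mem hc (k := k) z)
  exact ofSideCoord_mem this.1 this.2

theorem mergeMap_mem_interior {z : ℂ} (hz : z ∈ interior Tri) :
    mergeMap g i c k z ∈ interior Tri := by
  rw [mem_interior_iff_sideCoord k] at hz
  rw [mem_interior_iff_sideCoord i, mergeMap, sideCoord_ofSideCoord]
  apply hg.collarMap_mem_interior
  rw [abs_mul_add_abs hc, abs_of_pos hz.1]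
  exact hz.2

theorem isPositiveAt_mergeMap {z : ℂ} (hz : z ∈ interior Tri) :
    IsPositiveAt (mergeMap g i c k) z := by
  rw [mem_interior_iff_sideCoord k] at hz
  have hc0 : (c : ℂ) ≠ 0 := by
    rintro h
    rw [Complex.ofReal_eq_zero.1 h] at hc
    simp at hc
  refine IsPositiveAt.comp (F := ofSideCoord i) (f := fun z => collarMap g (c * sideCoord k z))
    (isPositiveAt_ofSideCoord i _) ?_ ?_ (.of_forall fun w => (continuous_ofSideCoord i).continuousAt)
  · refine IsPositiveAt.comp (F := collarMap g) (f := fun z => c * sideCoord k z)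
      (hg.isPositiveAt_collarMap ?_) ?_ (by fun_prop)
      (.of_forall fun w => hg.continuous_collarMap.continuousAt)
    · rw [abs_mul_add_abs hc, abs_of_pos hz.1]
      exact hz.2
    · refine IsPositiveAt.comp (F := fun w => c * w) (f := sideCoord k) ?_
        (isPositiveAt_sideCoord k z) (by fun_prop) (.of_forall fun w => by fun_prop)
      simpa using isPositiveAt_mul_add (b := 0) hc0
  · have := hg.continuous_collarMap
    exact Continuous.continuousAt (by fun_prop)

end Merge

/-! ### The parametrization of the segments of the cut surface -/

/-- The hypotheses do not exclude `F (-1) = F 1` directly; this is ruled out because an interval is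
not a circle. Then `F` is injective, hence monotone, and the sign `s` makes it increasing. -/
theorem IsStretch.of_parametrization {F : ℝ → ℝ} (hF : Continuous F) (h01 : ∀ v, F v ∈ Icc (0 : ℝ) 1)
    (hs : ∀ y ∈ Icc (0 : ℝ) 1, ∃ v ∈ Icc (-1 : ℝ) 1, F v = y)
    (hi : ∀ v ∈ Ioo (-1 : ℝ) 1, ∀ v' ∈ Icc (-1 : ℝ) 1, F v = F v' → v = v') :
    ∃ s : ℝ, |s| = 1 ∧ IsStretch fun v => s * (2 * F v - 1) := by
  have hm1 : (-1 : ℝ) ∈ Icc (-1 : ℝ) 1 := by norm_num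
  have hp1 : (1 : ℝ) ∈ Icc (-1 : ℝ) 1 := by norm_num
  have h0 : (0 : ℝ) ∈ Ioo (-1 : ℝ) 1 := by norm_num
  -- If the ends had the same image, each value strictly between `F (-1)` and `F 0` would be taken
  -- on both halves of `[-1, 1]`.
  have hends : F (-1) ≠ F 1 := by
    intro he
    have h01' : F 0 ≠ F (-1) := fun h => by
      have := hi 0 h0 (-1) hm1 h; norm_num at this
    have key : ∀ c, c ∈ uIcc (F (-1)) (F 0) → c ≠ F (-1) → c ≠ F 0 → False := by
      intro c hc hc1 hc0
      obtain ⟨x, hx, hxc⟩ := intermediate_value_uIcc (f := F) (a := -1) (b := 0) hF.continuousOn hc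
      obtain ⟨y, hy, hyc⟩ := intermediate_value_uIcc (f := F) (a := 1) (b := 0) hF.continuousOn
        (by rw [← he]; exact hc)
      rw [uIcc_of_le (by norm_num)] at hx
      rw [uIcc_of_ge (by norm_num)] at hy
      have hx1 : x ≠ -1 := by rintro rfl; exact hc1 hxc.symm
      have hx0 : x ≠ 0 := by rintro rfl; exact hc0 hxc.symm
      have hx2 : x < 0 := lt_of_le_of_ne hx.2 hx0
      have := hi x ⟨lt_of_le_of_ne hx.1 hx1.symm, by linarith⟩ y ⟨by linarith [hy.1], hy.2⟩
        (hxc.trans hyc.symm)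
      linarith [hy.1]
    refine key ((F (-1) + F 0) / 2) ?_ (fun h => h01' (by linarith)) (fun h => h01' (by linarith))
    rcases le_total (F (-1)) (F 0) with h | h
    · rw [uIcc_of_le h]; constructor <;> linarith
    · rw [uIcc_of_ge h]; constructor <;> linarith
  have hinj : InjOn F (Icc (-1) 1) := by
    intro v hv v' hv' h
    by_cases h1 : v ∈ Ioo (-1 : ℝ) 1
    · exact hi v h1 v' hv' h
    by_cases h2 : v' ∈ Ioo (-1 : ℝ) 1
    · exact (hi v' h2 v hv h.symm).symm
    have hend : ∀ v ∈ Icc (-1 : ℝ) 1, v ∉ Ioo (-1 : ℝ) 1 → v = -1 ∨ v = 1 := by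
      intro v hv hn
      by_contra! hne
      exact hn ⟨lt_of_le_of_ne hv.1 hne.1.symm, lt_of_le_of_ne hv.2 hne.2⟩
    rcases hend v hv h1 with rfl | rfl <;> rcases hend v' hv' h2 with rfl | rfl
    · rfl
    · exact absurd h hends
    · exact absurd h.symm hends
    · rfl
  have hb : ∀ s : ℝ, |s| = 1 → ∀ v, |s * (2 * F v - 1)| ≤ 1 := fun s hs v => by
    rw [abs_mul, hs, one_mul, abs_le]
    constructor <;> linarith [(h01 v).1, (h01 v).2]
  obtain ⟨a, ha, ha0⟩ := hs 0 (by norm_num)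
  obtain ⟨b, hb', hb1⟩ := hs 1 (by norm_num)
  rcases hF.continuousOn.strictMonoOn_of_injOn_Icc' (by norm_num) hinj with hm | hm
  · refine ⟨1, abs_one, by fun_prop, fun x hx y hy h => ?_, ?_, ?_, hb 1 abs_one⟩
    · have := hm hx hy h
      linarith
    · have := hm.monotoneOn hm1 ha ha.1
      linarith [(h01 (-1)).1]
    · have := hm.monotoneOn hb' hp1 hb'.2
      linarith [(h01 1).2]
  · have h1 : |(-1 : ℝ)| = 1 := by norm_num
    refine ⟨-1, h1, by fun_prop, fun x hx y hy h => ?_, ?_, ?_, hb (-1) h1⟩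
    · have := hm hx hy h
      linarith
    · have := hm.antitoneOn hm1 hb' hb'.1
      linarith [(h01 (-1)).2]
    · have := hm.antitoneOn ha hp1 ha.2
      linarith [(h01 1).1]

/-- A parametrization of the union of the sides `j + 1` and `j + 2` of a triangle. -/
noncomputable def foldedPt (j : Fin 3) (v : ℝ) : Tri :=
  if v ≤ 0 then edgePt (j + 1) (projIcc 0 1 zero_le_one (1 + v))
  else edgePt (j + 2) (projIcc 0 1 zero_le_one v)

theorem continuous_foldedPt (j : Fin 3) : Continuous (foldedPt j) := by
  unfold foldedPt
  refine Continuous.if_le ((continuous_edgePt _).comp (continuous_projIcc.comp (by fun_prop)))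
    ((continuous_edgePt _).comp continuous_projIcc) continuous_id continuous_const ?_
  rintro v rfl
  have h1 : projIcc (0 : ℝ) 1 zero_le_one (1 + 0) = 1 := by rw [add_zero]; exact projIcc_right _
  have h0 : projIcc (0 : ℝ) 1 zero_le_one 0 = 0 := projIcc_left _
  rw [h1, h0, edgePt_one, edgePt_zero, fin3_12, fin3_21]

theorem edgePt_one_eq_foldedPt (j : Fin 3) (x : unitInterval) :
    edgePt (j + 1) x = foldedPt j (x - 1) := by
  rw [foldedPt, if_pos (by linarith [x.2.2]), add_sub_cancel, projIcc_val]

theorem edgePt_two_eq_foldedPt (j : Fin 3) (x : unitInterval) :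
    edgePt (j + 2) x = foldedPt j x := by
  rw [foldedPt]
  split_ifs with h
  · have h0 : x = 0 := Subtype.ext (le_antisymm h x.2.1)
    have h1 : projIcc (0 : ℝ) 1 zero_le_one (1 + 0) = 1 := by rw [add_zero]; exact projIcc_right _
    rw [h0, Icc.coe_zero, h1, edgePt_one, edgePt_zero, fin3_12, fin3_21]
  · rw [projIcc_val]

/-- With the loop as base, the folded sides are the upper edges of the triangle. The half turn that
places the self-folded triangle below the loop moves them to the lower edges of the square, where
the parameter `v` becomes the real part. -/
theorem sideCoord_foldedPt (j : Fin 3) {v : ℝ} (hv : |v| ≤ 1) :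
    sideCoord j (foldedPt j v) = (-v : ℝ) + ((1 - |v| : ℝ) : ℂ) * Complex.I := by
  rw [abs_le] at hv
  rw [foldedPt]
  split_ifs with h
  · rw [projIcc_of_mem zero_le_one (show 1 + v ∈ Icc (0 : ℝ) 1 from ⟨by linarith, by linarith⟩)]
    have e1 := bary_edgePt (j + 1) ⟨1 + v, by linarith, by linarith⟩
    have e2 := bary_edgePt_one (j + 1) ⟨1 + v, by linarith, by linarith⟩
    have e3 := bary_edgePt_two (j + 1) ⟨1 + v, by linarith, by linarith⟩
    rw [fin3_11] at e2
    rw [fin3_12] at e3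
    rw [sideCoord, e1, e2, e3, abs_of_nonpos h]
    simp
  · rw [projIcc_of_mem zero_le_one (show v ∈ Icc (0 : ℝ) 1 from ⟨by linarith, by linarith⟩)]
    have e1 := bary_edgePt (j + 2) ⟨v, by linarith, by linarith⟩
    have e2 := bary_edgePt_one (j + 2) ⟨v, by linarith, by linarith⟩
    have e3 := bary_edgePt_two (j + 2) ⟨v, by linarith, by linarith⟩
    rw [fin3_21] at e2
    rw [fin3_22] at e3
    rw [sideCoord, e1, e2, e3, abs_of_nonneg (by linarith)]
    simp

theorem foldedPt_injective (j : Fin 3) {v w : ℝ} (hv : |v| ≤ 1) (hw : |w| ≤ 1)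
    (h : foldedPt j v = foldedPt j w) : v = w := by
  have := congrArg (fun z : Tri => (sideCoord j z).re) h
  simp only [sideCoord_foldedPt j hv, sideCoord_foldedPt j hw] at this
  simpa using this

namespace IdealTriangulation

section

variable {X : Type u} [TopologicalSpace X] {O : OrientedSurface X} {V : Set X}
  (τ : IdealTriangulation O V)

theorem isFoldedSide_mate {p : τ.T × Fin 3} (h : τ.IsFoldedSide p) : τ.IsFoldedSide (τ.mate p) := by
  obtain ⟨⟨⟨t, j⟩, hq⟩, rfl | rfl⟩ := h
  · exact ⟨⟨_, hq⟩, .inr hq.mate_one⟩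
  · exact ⟨⟨_, hq⟩, .inl hq.mate_two⟩

theorem cutMk_eq_iff {a b : TriSum τ.T} : τ.cutMk a = τ.cutMk b ↔
    Relation.EqvGen (SideGlue τ.mate {p | ¬ τ.IsFoldedSide p}) a b := Quotient.eq (r := τ.cutSetoid)

theorem continuous_cutMk : Continuous τ.cutMk := continuous_quotient_mk'

theorem cutMk_surjective : Function.Surjective τ.cutMk := Quotient.mk_surjective

theorem cutMk_glue {p : τ.T × Fin 3} (hp : ¬ τ.IsFoldedSide p) (hm : τ.mate p ≠ p) (x : unitInterval) :
    τ.cutMk (sidePt p x) = τ.cutMk (sidePt (τ.mate p) (unitInterval.symm x)) :=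
  τ.cutMk_eq_iff.2 (.rel _ _ ⟨p, hp, hm, x, rfl, rfl⟩)

/-- The points of the segment of the cut surface which comes from a folded side. -/
noncomputable def segmentPt (q : τ.Folded) (v : ℝ) : τ.segment q :=
  ⟨τ.cutMk ⟨q.1.1, foldedPt q.1.2 v⟩, by
    rw [foldedPt]
    split_ifs
    · exact .inl ⟨_, rfl⟩
    · exact .inr ⟨_, rfl⟩⟩

theorem continuous_segmentPt (q : τ.Folded) : Continuous (τ.segmentPt q) :=
  (τ.continuous_cutMk.comp (continuous_sigmaMk.comp (continuous_foldedPt _))).subtype_mk _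

theorem exists_segmentPt_eq {q : τ.Folded} (y : τ.segment q) :
    ∃ v ∈ Icc (-1 : ℝ) 1, τ.segmentPt q v = y := by
  obtain ⟨y, ⟨x, rfl⟩ | ⟨x, rfl⟩⟩ := y
  · refine ⟨x - 1, ⟨by linarith [x.2.1], by linarith [x.2.2]⟩, Subtype.ext ?_⟩
    simp only [segmentPt, sidePt, edgePt_one_eq_foldedPt]
  · refine ⟨x, ⟨by linarith [x.2.1], x.2.2⟩, Subtype.ext ?_⟩
    simp only [segmentPt, sidePt, edgePt_two_eq_foldedPt]

/-- The interior points of a folded side are not identified with other points in the cut surface. -/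
theorem eq_of_cutMk_foldedPt {q : τ.Folded} {v : ℝ} (hv : v ∈ Ioo (-1 : ℝ) 1) {a : TriSum τ.T}
    (h : τ.cutMk ⟨q.1.1, foldedPt q.1.2 v⟩ = τ.cutMk a) : a = ⟨q.1.1, foldedPt q.1.2 v⟩ := by
  have hne : ∀ (p : τ.T × Fin 3) x, ¬ τ.IsFoldedSide p →
      (sidePt p x : TriSum τ.T) ≠ ⟨q.1.1, foldedPt q.1.2 v⟩ := by
    intro p x hp he
    simp only [sidePt, Sigma.mk.injEq, heq_eq_eq] at he
    have hj : p.2 = q.1.2 := by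
      rcases fin3_cases q.1.2 p.2 with h | h | h
      · exact h
      · exact absurd ⟨q, .inl (Prod.ext he.1 h)⟩ hp
      · exact absurd ⟨q, .inr (Prod.ext he.1 h)⟩ hp
    have h1 := bary_edgePt p.2 x
    rw [he.2, hj, ← sideCoord_im, sideCoord_foldedPt _ (abs_le.2 ⟨hv.1.le, hv.2.le⟩)] at h1
    simp only [Complex.add_im, Complex.ofReal_im, Complex.im_ofReal_mul, Complex.I_im] at h1
    have := abs_lt.2 hv
    linarith
  have := eqvGen_invariant (r := SideGlue τ.mate {p | ¬ τ.IsFoldedSide p})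
    (f := fun a => a = ⟨q.1.1, foldedPt q.1.2 v⟩) (by
      rintro _ _ ⟨p, hp, -, x, rfl, rfl⟩
      refine propext ⟨fun h => absurd h (hne _ _ hp), fun h => absurd h (hne _ _ fun hp' => hp ?_)⟩
      have := τ.isFoldedSide_mate hp'
      rwa [τ.mate_mate] at this) (τ.cutMk_eq_iff.1 h)
  exact this.mp rfl

variable (φ : ∀ q : τ.Folded, τ.segment q ≃ₜ unitInterval)

theorem exists_foldSign (q : τ.Folded) : ∃ s : ℝ, |s| = 1 ∧
    IsStretch fun v => s * (2 * (φ q (τ.segmentPt q v) : ℝ) - 1) := by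
  refine IsStretch.of_parametrization (F := fun v => (φ q (τ.segmentPt q v) : ℝ))
    (continuous_subtype_val.comp ((φ q).continuous.comp (τ.continuous_segmentPt q)))
    (fun v => (φ q (τ.segmentPt q v)).2) ?_ ?_
  · intro y hy
    obtain ⟨v, hv, e⟩ := τ.exists_segmentPt_eq ((φ q).symm ⟨y, hy⟩)
    exact ⟨v, hv, by rw [e, Homeomorph.apply_symm_apply]⟩
  · intro v hv v' hv' h
    have := (φ q).injective (Subtype.ext h)
    have := τ.eq_of_cutMk_foldedPt hv (congrArg Subtype.val this)
    simp only [Sigma.mk.injEq, heq_eq_eq, true_and] at this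
    exact (foldedPt_injective _ (abs_le.2 hv') (abs_le.2 ⟨hv.1.le, hv.2.le⟩) this).symm

/-- The sign which tells whether the parametrization of a segment preserves the orientation. -/
noncomputable def foldSign (q : τ.Folded) : ℝ := (τ.exists_foldSign φ q).choose

/-- The parametrization of a segment, normalized to an increasing map. -/
noncomputable def foldStretch (q : τ.Folded) (v : ℝ) : ℝ :=
  τ.foldSign φ q * (2 * (φ q (τ.segmentPt q v) : ℝ) - 1)

theorem abs_foldSign (q : τ.Folded) : |τ.foldSign φ q| = 1 := (τ.exists_foldSign φ q).choose_spec.1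

theorem isStretch_foldStretch (q : τ.Folded) : IsStretch (τ.foldStretch φ q) :=
  (τ.exists_foldSign φ q).choose_spec.2

/-- The normalizing sign cancels: whichever direction the parametrization has, `t ↦ 1 - t` becomes a
change of sign of the stretched coordinate. -/
theorem segmentPt_symm_iff {q : τ.Folded} {v w : ℝ} :
    φ q (τ.segmentPt q w) = unitInterval.symm (φ q (τ.segmentPt q v)) ↔
      τ.foldStretch φ q w = - τ.foldStretch φ q v := by
  have hs : τ.foldSign φ q ≠ 0 := fun h => by
    have := τ.abs_foldSign φ q; rw [h] at this; simp at this
  rw [foldStretch, foldStretch, ← mul_neg, mul_right_inj' hs, Subtype.ext_iff,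
    unitInterval.coe_symm_eq]
  constructor <;> intro h <;> linarith

end

end IdealTriangulation

/-! ### The double is obtained from triangles by gluing -/

theorem sideCoord_edgePt (i : Fin 3) (x : unitInterval) :
    sideCoord i (edgePt i x) = ((2 * x - 1 : ℝ) : ℂ) := by
  rw [sideCoord, bary_edgePt, bary_edgePt_one, bary_edgePt_two]
  push_cast
  ring

namespace IdealTriangulation

section

variable {X : Type u} [TopologicalSpace X] {O : OrientedSurface X} {V : Set X}
  (τ : IdealTriangulation O V)

/-- The triangles which are not self-folded. -/
def PlainTri : Type := {t : τ.T // ∀ i, ¬ τ.IsFolded (t, i)}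

/-- The side `p` is glued to the loop of a self-folded triangle. -/
def IsLoopSide (p : τ.T × Fin 3) : Prop := ∃ q : τ.Folded, τ.mate q.1 = p

open Classical in
/-- The self-folded triangle which is equal or adjacent to the triangle `t`. -/
noncomputable def enclosed (t : τ.T) : Option τ.Folded :=
  if h : ∃ q : τ.Folded, (τ.mate q.1).1 = t ∨ q.1.1 = t then some h.choose else none

/-- The triangle which is merged with a self-folded triangle, if `t` is self-folded, and `t`
otherwise. -/
noncomputable def base (t : τ.T) : τ.T := (τ.enclosed t).elim t fun q => (τ.mate q.1).1

variable (φ : ∀ q : τ.Folded, τ.segment q ≃ₜ unitInterval)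

open Classical in
/-- The map from the triangle `t` to the triangle with which it is merged. -/
noncomputable def mergeTri (t : τ.T) (z : ℂ) : ℂ :=
  (τ.enclosed t).elim z fun q => mergeMap (τ.foldStretch φ q) (τ.mate q.1).2
    (if t = q.1.1 then -1 else 1) (if t = q.1.1 then q.1.2 else (τ.mate q.1).2) z

variable {τ} {M : Set X} (hτ : τ.IsTame M)

namespace IsTame

include hτ

theorem mate_ne (q q' : τ.Folded) : (τ.mate q.1).1 ≠ q'.1.1 := fun h =>
  hτ.loop_mate q q'.1.2 (by rw [h]; exact q'.2)

theorem enclosed_folded (q : τ.Folded) : τ.enclosed q.1.1 = some q := by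
  have h : ∃ q' : τ.Folded, (τ.mate q'.1).1 = q.1.1 ∨ q'.1.1 = q.1.1 := ⟨q, .inr rfl⟩
  rw [enclosed, dif_pos h]
  rcases h.choose_spec with h' | h'
  · exact absurd h' (hτ.mate_ne _ _)
  · rw [Folded.ext h']

theorem enclosed_mate (q : τ.Folded) : τ.enclosed (τ.mate q.1).1 = some q := by
  have h : ∃ q' : τ.Folded, (τ.mate q'.1).1 = (τ.mate q.1).1 ∨ q'.1.1 = (τ.mate q.1).1 :=
    ⟨q, .inl rfl⟩
  rw [enclosed, dif_pos h]
  rcases h.choose_spec with h' | h'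
  · rw [hτ.share _ _ h']
  · exact absurd h'.symm (hτ.mate_ne _ _)

omit hτ in
theorem enclosed_cases (t : τ.T) : (τ.enclosed t = none ∧ ∀ q : τ.Folded, (τ.mate q.1).1 ≠ t ∧ q.1.1 ≠ t) ∨
    ∃ q : τ.Folded, t = (τ.mate q.1).1 ∨ t = q.1.1 := by
  by_cases h : ∃ q : τ.Folded, (τ.mate q.1).1 = t ∨ q.1.1 = t
  · obtain ⟨q, h⟩ := h
    exact .inr ⟨q, h.imp Eq.symm Eq.symm⟩
  · left
    rw [enclosed, dif_neg h]
    push Not at h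
    exact ⟨rfl, h⟩

theorem base_folded (q : τ.Folded) : τ.base q.1.1 = (τ.mate q.1).1 := by
  rw [base, hτ.enclosed_folded]; rfl

theorem base_mate (q : τ.Folded) : τ.base (τ.mate q.1).1 = (τ.mate q.1).1 := by
  rw [base, hτ.enclosed_mate]; rfl

theorem base_plain {t : τ.T} (ht : ∀ i, ¬ τ.IsFolded (t, i)) : τ.base t = t := by
  rcases enclosed_cases t with ⟨h, -⟩ | ⟨q, rfl | rfl⟩
  · rw [base, h]; rfl
  · exact hτ.base_mate q
  · exact absurd q.2 (ht _)

theorem not_isFolded_base (t : τ.T) (i : Fin 3) : ¬ τ.IsFolded (τ.base t, i) := by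
  rcases enclosed_cases t with ⟨h, h'⟩ | ⟨q, rfl | rfl⟩
  · rw [base, h]; exact fun hi => (h' ⟨_, hi⟩).2 rfl
  · rw [hτ.base_mate]; exact hτ.loop_mate q i
  · rw [hτ.base_folded]; exact hτ.loop_mate q i

/-- The triangle of the double in which the triangle `t` is contained. -/
noncomputable def baseTri (t : τ.T) : τ.PlainTri := ⟨τ.base t, hτ.not_isFolded_base t⟩

theorem baseTri_eq (t : τ.PlainTri) : hτ.baseTri t.1 = t := Subtype.ext (hτ.base_plain t.2)

theorem baseTri_folded (q : τ.Folded) : hτ.baseTri q.1.1 = hτ.baseTri (τ.mate q.1).1 :=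
  Subtype.ext ((hτ.base_folded q).trans (hτ.base_mate q).symm)

omit hτ in
theorem mergeTri_none {t : τ.T} (h : τ.enclosed t = none) (z : ℂ) : τ.mergeTri φ t z = z := by
  rw [mergeTri, h]; rfl

theorem mergeTri_folded (q : τ.Folded) (z : ℂ) : τ.mergeTri φ q.1.1 z =
    mergeMap (τ.foldStretch φ q) (τ.mate q.1).2 (-1) q.1.2 z := by
  simp [mergeTri, hτ.enclosed_folded]

theorem mergeTri_mate (q : τ.Folded) (z : ℂ) : τ.mergeTri φ (τ.mate q.1).1 z =
    mergeMap (τ.foldStretch φ q) (τ.mate q.1).2 1 (τ.mate q.1).2 z := by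
  simp [mergeTri, hτ.enclosed_mate, hτ.mate_ne]

theorem mergeTri_mem (t : τ.T) (z : Tri) : τ.mergeTri φ t z ∈ Tri := by
  rcases enclosed_cases t with ⟨h, -⟩ | ⟨q, rfl | rfl⟩
  · rw [mergeTri_none φ h]; exact z.2
  · rw [hτ.mergeTri_mate]; exact mergeMap_mem (τ.isStretch_foldStretch φ q) (by norm_num) z
  · rw [hτ.mergeTri_folded]; exact mergeMap_mem (τ.isStretch_foldStretch φ q) (by norm_num) z

theorem mergeTri_mem_interior (t : τ.T) {z : ℂ} (hz : z ∈ interior Tri) :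
    τ.mergeTri φ t z ∈ interior Tri := by
  rcases enclosed_cases t with ⟨h, -⟩ | ⟨q, rfl | rfl⟩
  · rwa [mergeTri_none φ h]
  · rw [hτ.mergeTri_mate]
    exact mergeMap_mem_interior (τ.isStretch_foldStretch φ q) (by norm_num) hz
  · rw [hτ.mergeTri_folded]
    exact mergeMap_mem_interior (τ.isStretch_foldStretch φ q) (by norm_num) hz

theorem isPositiveAt_mergeTri (t : τ.T) {z : ℂ} (hz : z ∈ interior Tri) :
    IsPositiveAt (τ.mergeTri φ t) z := by
  rcases enclosed_cases t with ⟨h, -⟩ | ⟨q, rfl | rfl⟩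
  · rw [funext (mergeTri_none φ h)]
    simpa using isPositiveAt_mul_add (b := 0) (z := z) one_ne_zero
  · rw [funext (hτ.mergeTri_mate φ q)]
    exact isPositiveAt_mergeMap (τ.isStretch_foldStretch φ q) (by norm_num) hz
  · rw [funext (hτ.mergeTri_folded φ q)]
    exact isPositiveAt_mergeMap (τ.isStretch_foldStretch φ q) (by norm_num) hz

theorem continuous_mergeTri (t : τ.T) : Continuous (τ.mergeTri φ t) := by
  rcases enclosed_cases t with ⟨h, -⟩ | ⟨q, rfl | rfl⟩
  · rw [funext (mergeTri_none φ h)]; exact continuous_id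
  · rw [funext (hτ.mergeTri_mate φ q)]
    exact continuous_mergeMap (τ.isStretch_foldStretch φ q)
  · rw [funext (hτ.mergeTri_folded φ q)]
    exact continuous_mergeMap (τ.isStretch_foldStretch φ q)

theorem isLoopSide_unique {t : τ.T} {i j : Fin 3} (hi : τ.IsLoopSide (t, i)) (hj : τ.IsLoopSide (t, j)) :
    i = j := by
  obtain ⟨q, hq⟩ := hi
  obtain ⟨q', hq'⟩ := hj
  rw [hτ.share q q' (by rw [hq, hq']), hq'] at hq
  exact (congrArg Prod.snd hq).symm

omit hτ in
theorem plain_mate {p : τ.T × Fin 3} (hp : ∀ i, ¬ τ.IsFolded (p.1, i)) (hl : ¬ τ.IsLoopSide p) (i : Fin 3) :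
    ¬ τ.IsFolded ((τ.mate p).1, i) := by
  intro hi
  have hm := τ.mate_mate p
  obtain ⟨⟨t', j⟩, e⟩ : ∃ p', τ.mate p = p' := ⟨_, rfl⟩
  rw [e] at hi hm
  rcases fin3_cases i j with rfl | rfl | rfl
  · exact hl ⟨⟨_, hi⟩, hm⟩
  · rw [hi.mate_one] at hm
    exact hp i (by rw [← hm]; exact hi)
  · rw [hi.mate_two] at hm
    exact hp i (by rw [← hm]; exact hi)

omit hτ in
theorem not_isLoopSide_mate {p : τ.T × Fin 3} (hp : ∀ i, ¬ τ.IsFolded (p.1, i)) :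
    ¬ τ.IsLoopSide (τ.mate p) := by
  rintro ⟨q, hq⟩
  have := congrArg τ.mate hq
  rw [τ.mate_mate, τ.mate_mate] at this
  exact hp _ (this ▸ q.2)

open Classical in
/-- The sides of the triangulation of the double which are glued to each other. -/
noncomputable def doubleMate (p : (Bool × τ.PlainTri) × Fin 3) : (Bool × τ.PlainTri) × Fin 3 :=
  -- After merging, a side glued to a loop becomes the segment along which the two copies are glued.
  -- For the other sides the mate already lies in a triangle that is not self-folded, so `baseTri`
  -- does not change it.
  if τ.IsLoopSide (p.1.2.1, p.2) then ((!p.1.1, p.1.2), p.2)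
  else ((p.1.1, hτ.baseTri (τ.mate (p.1.2.1, p.2)).1), (τ.mate (p.1.2.1, p.2)).2)

theorem doubleMate_loop {p : (Bool × τ.PlainTri) × Fin 3} (h : τ.IsLoopSide (p.1.2.1, p.2)) :
    hτ.doubleMate p = ((!p.1.1, p.1.2), p.2) := if_pos h

theorem doubleMate_not {p : (Bool × τ.PlainTri) × Fin 3} (h : ¬ τ.IsLoopSide (p.1.2.1, p.2)) :
    hτ.doubleMate p = ((p.1.1, hτ.baseTri (τ.mate (p.1.2.1, p.2)).1), (τ.mate (p.1.2.1, p.2)).2) :=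
  if_neg h

theorem doubleMate_not_snd {p : (Bool × τ.PlainTri) × Fin 3} (h : ¬ τ.IsLoopSide (p.1.2.1, p.2)) :
    ((hτ.doubleMate p).1.2.1, (hτ.doubleMate p).2) = τ.mate (p.1.2.1, p.2) := by
  rw [hτ.doubleMate_not h]
  exact Prod.ext (hτ.base_plain (plain_mate p.1.2.2 h)) rfl

theorem doubleMate_doubleMate (p : (Bool × τ.PlainTri) × Fin 3) :
    hτ.doubleMate (hτ.doubleMate p) = p := by
  by_cases h : τ.IsLoopSide (p.1.2.1, p.2)
  · rw [hτ.doubleMate_loop h, hτ.doubleMate_loop (p := ((!p.1.1, p.1.2), p.2)) h, Bool.not_not]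
  · have e := hτ.doubleMate_not_snd h
    have h' : ¬ τ.IsLoopSide ((hτ.doubleMate p).1.2.1, (hτ.doubleMate p).2) := by
      rw [e]; exact not_isLoopSide_mate p.1.2.2
    rw [hτ.doubleMate_not h', e, τ.mate_mate, hτ.doubleMate_not h]
    simp only [hτ.baseTri_eq]

/-- The map from the triangles of the two copies of the cut surface to the triangles of the
double. -/
noncomputable def doubleTri (a : Bool × TriSum τ.T) : TriSum (Bool × τ.PlainTri) :=
  ⟨(a.1, hτ.baseTri a.2.1), ⟨τ.mergeTri φ a.2.1 a.2.2, hτ.mergeTri_mem φ a.2.1 a.2.2⟩⟩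

theorem continuous_doubleTri : Continuous (hτ.doubleTri φ) := by
  have : ∀ ε, Continuous fun a => hτ.doubleTri φ (ε, a) := fun ε => continuous_sigma fun t => by
    have h : Continuous fun z : Tri => (⟨τ.mergeTri φ t z, hτ.mergeTri_mem φ t z⟩ : Tri) :=
      ((hτ.continuous_mergeTri φ t).comp continuous_subtype_val).subtype_mk _
    exact (continuous_sigmaMk (i := ((ε, hτ.baseTri t) : Bool × τ.PlainTri))).comp h
  rw [continuous_prod_of_discrete_left]
  exact this

/-- Two points of the disjoint union of triangles are equal if their coordinates are. -/
theorem doubleTri_eq_iff {a : Bool × TriSum τ.T} {b : TriSum (Bool × τ.PlainTri)} :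
    hτ.doubleTri φ a = b ↔ a.1 = b.1.1 ∧ τ.base a.2.1 = b.1.2.1 ∧ τ.mergeTri φ a.2.1 a.2.2 = b.2 := by
  obtain ⟨⟨ε, t⟩, z⟩ := b
  constructor
  · intro h
    simp only [doubleTri, Sigma.mk.injEq, heq_eq_eq] at h
    exact ⟨congrArg Prod.fst h.1, congrArg (fun y => y.2.1) h.1, congrArg Subtype.val h.2⟩
  · rintro ⟨rfl, h2, h3⟩
    obtain rfl : hτ.baseTri a.2.1 = t := Subtype.ext h2
    exact congrArg (Sigma.mk _) (Subtype.ext h3)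

/-- If the triangle is merged with a self-folded one, its sides other than the loop side lie on the
upper edges of the square, which `collarMap` fixes. -/
theorem doubleTri_side {p : (Bool × τ.PlainTri) × Fin 3} (h : ¬ τ.IsLoopSide (p.1.2.1, p.2))
    (x : unitInterval) : hτ.doubleTri φ (p.1.1, sidePt (p.1.2.1, p.2) x) = sidePt p x := by
  obtain ⟨⟨ε, t, ht⟩, i⟩ := p
  refine (hτ.doubleTri_eq_iff φ).2 ⟨rfl, hτ.base_plain ht, ?_⟩
  change τ.mergeTri φ t (edgePt i x) = edgePt i x
  rcases enclosed_cases t with ⟨h, -⟩ | ⟨q, rfl | rfl⟩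
  · rw [mergeTri_none φ h]
  · rw [hτ.mergeTri_mate, mergeMap, Complex.ofReal_one, one_mul,
      (τ.isStretch_foldStretch φ q).collarMap_of_upper, ofSideCoord_sideCoord]
    set k := (τ.mate q.1).2
    have hk : i ≠ k := fun e => h ⟨q, Prod.ext rfl e.symm⟩
    have h1 := bary_nonneg (edgePt i x) (k + 1)
    have h2 := bary_nonneg (edgePt i x) (k + 2)
    have h3 := bary_sum k (edgePt i x)
    rw [sideCoord_re, sideCoord_im]
    rcases fin3_cases k i with e | e | e
    · exact absurd e hk
    · have h0 : bary (k + 1) (edgePt i x) = 0 := by rw [← e, bary_edgePt]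
      rw [h0, sub_zero, abs_of_nonneg h2]
      linarith
    · have h0 : bary (k + 2) (edgePt i x) = 0 := by rw [← e, bary_edgePt]
      rw [h0, zero_sub, abs_neg, abs_of_nonneg h1]
      linarith
  · exact absurd q.2 (ht _)

/-- The two triangles are placed on opposite sides of the loop by a half turn, and their coordinates
agree on the loop. -/
theorem doubleTri_loop (ε : Bool) (q : τ.Folded) (x : unitInterval) :
    hτ.doubleTri φ (ε, sidePt q.1 x) =
      hτ.doubleTri φ (ε, sidePt (τ.mate q.1) (unitInterval.symm x)) := by
  refine (hτ.doubleTri_eq_iff φ).2 ⟨rfl, ?_, ?_⟩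
  · exact (hτ.base_folded q).trans (hτ.base_mate q).symm
  · change τ.mergeTri φ q.1.1 (edgePt _ _) = τ.mergeTri φ (τ.mate q.1).1 (edgePt _ _)
    rw [hτ.mergeTri_mate, hτ.mergeTri_folded, mergeMap, mergeMap, sideCoord_edgePt, sideCoord_edgePt,
      unitInterval.coe_symm_eq]
    congr 2
    push_cast
    ring

/-- The folded sides are placed on the lower edges of the square, which `collarMap` carries to the
base by `foldStretch`. -/
theorem doubleTri_foldedPt (ε : Bool) (q : τ.Folded) {v : ℝ} (hv : |v| ≤ 1) {x : unitInterval}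
    (hx : τ.foldStretch φ q v = 2 * x - 1) :
    hτ.doubleTri φ (ε, ⟨q.1.1, foldedPt q.1.2 v⟩) =
      sidePt ((ε, hτ.baseTri (τ.mate q.1).1), (τ.mate q.1).2) x := by
  refine (hτ.doubleTri_eq_iff φ).2 ⟨rfl, ?_, ?_⟩
  · exact (hτ.base_folded q).trans (hτ.base_mate q).symm
  · change τ.mergeTri φ q.1.1 (foldedPt _ _) = edgePt _ _
    rw [hτ.mergeTri_folded, mergeMap, sideCoord_foldedPt _ hv, IsStretch.collarMap_of_lower]
    · rw [← ofSideCoord_sideCoord (τ.mate q.1).2 (edgePt _ _), sideCoord_edgePt, ← hx]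
      simp
    · simp

theorem doubleTri_surjective : Function.Surjective (hτ.doubleTri φ) := by
  rintro ⟨⟨ε, t, ht⟩, z⟩
  rcases enclosed_cases t with ⟨h, -⟩ | ⟨q, rfl | rfl⟩
  · exact ⟨(ε, ⟨t, z⟩), (hτ.doubleTri_eq_iff φ).2 ⟨rfl, hτ.base_plain ht, mergeTri_none φ h z⟩⟩
  · set i := (τ.mate q.1).2
    have hz := sideCoord_mem i z
    obtain ⟨w, hw, e⟩ := (τ.isStretch_foldStretch φ q).collarMap_surjOn hz.1 hz.2
    -- The half of the square that contains `w` decides between the neighbouring triangle and the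
    -- self-folded one.
    rcases le_total 0 w.im with h0 | h0
    · have hm : ofSideCoord i w ∈ Tri := ofSideCoord_mem h0 (by rwa [abs_of_nonneg h0] at hw)
      refine ⟨(ε, ⟨_, _, hm⟩), (hτ.doubleTri_eq_iff φ).2 ⟨rfl, hτ.base_mate q, ?_⟩⟩
      change τ.mergeTri φ (τ.mate q.1).1 (ofSideCoord i w) = z
      rw [hτ.mergeTri_mate, mergeMap, sideCoord_ofSideCoord, Complex.ofReal_one, one_mul, e,
        ofSideCoord_sideCoord]
    · have hm : ofSideCoord q.1.2 (-w) ∈ Tri := ofSideCoord_mem (by simpa using h0) (by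
        rw [abs_of_nonpos h0] at hw; simpa using hw)
      refine ⟨(ε, ⟨q.1.1, _, hm⟩), (hτ.doubleTri_eq_iff φ).2 ⟨rfl, hτ.base_folded q, ?_⟩⟩
      change τ.mergeTri φ q.1.1 (ofSideCoord q.1.2 (-w)) = z
      rw [hτ.mergeTri_folded, mergeMap, sideCoord_ofSideCoord, Complex.ofReal_neg, Complex.ofReal_one,
        neg_one_mul, neg_neg, e, ofSideCoord_sideCoord]
  · exact absurd q.2 (ht _)

/-- The map to the triangles of the double identifies only points on the two sides of a loop. -/
theorem eq_of_doubleTri_eq {α : Type*} {f : Bool × TriSum τ.T → α}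
    (hf : ∀ ε (q : τ.Folded) x, f (ε, sidePt q.1 x) = f (ε, sidePt (τ.mate q.1) (unitInterval.symm x)))
    {a b : Bool × TriSum τ.T} (h : hτ.doubleTri φ a = hτ.doubleTri φ b) : f a = f b := by
  obtain ⟨ε, t, z⟩ := a
  obtain ⟨ε', t', z'⟩ := b
  obtain ⟨h1, h2, h3⟩ := (hτ.doubleTri_eq_iff φ).1 h
  obtain rfl : ε = ε' := h1
  replace h2 : τ.base t = τ.base t' := h2
  replace h3 : τ.mergeTri φ t z = τ.mergeTri φ t' z' := h3
  have hinj : ∀ q : τ.Folded, ∀ {i : Fin 3} {c c' : ℝ} {k k' : Fin 3} {z z' : Tri}, |c| = 1 → |c'| = 1 →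
      mergeMap (τ.foldStretch φ q) i c k z = mergeMap (τ.foldStretch φ q) i c' k' z' →
      c * sideCoord k z = c' * sideCoord k' z' := fun q i c c' k k' z z' hc hc' h => by
    have := congrArg (sideCoord i) h
    rw [mergeMap, mergeMap, sideCoord_ofSideCoord, sideCoord_ofSideCoord] at this
    exact (τ.isStretch_foldStretch φ q).collarMap_injOn (mul_sideCoord_mem hc z)
      (mul_sideCoord_mem hc' z') this
  have h11 : |(1 : ℝ)| = 1 := abs_one
  have h12 : |(-1 : ℝ)| = 1 := by norm_num
  have key : ∀ (q : τ.Folded) (z z' : Tri), τ.mergeTri φ q.1.1 z = τ.mergeTri φ (τ.mate q.1).1 z' →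
      f (ε, ⟨q.1.1, z⟩) = f (ε, ⟨(τ.mate q.1).1, z'⟩) := by
    intro q z z' h3
    rw [hτ.mergeTri_folded, hτ.mergeTri_mate] at h3
    have h4 := hinj q h12 h11 h3
    simp only [Complex.ofReal_neg, Complex.ofReal_one, neg_one_mul, one_mul] at h4
    have e1 := congrArg Complex.im h4
    have e2 := congrArg Complex.re h4
    have hz := bary_nonneg z q.1.2
    have hz' := bary_nonneg z' (τ.mate q.1).2
    rw [Complex.neg_im, sideCoord_im, sideCoord_im] at e1
    rw [Complex.neg_re, sideCoord_re, sideCoord_re] at e2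
    obtain ⟨x, rfl⟩ : ∃ x, z = edgePt q.1.2 x := ⟨_, eq_edgePt (by linarith)⟩
    obtain ⟨y, rfl⟩ : ∃ y, z' = edgePt (τ.mate q.1).2 y := ⟨_, eq_edgePt (by linarith)⟩
    rw [bary_edgePt_one, bary_edgePt_two, bary_edgePt_one, bary_edgePt_two] at e2
    obtain rfl : y = unitInterval.symm x := Subtype.ext (by rw [unitInterval.coe_symm_eq]; linarith)
    exact hf ε q x
  have hsame : ∀ (t : τ.T) (z z' : Tri), τ.mergeTri φ t z = τ.mergeTri φ t z' →
      f (ε, ⟨t, z⟩) = f (ε, ⟨t, z'⟩) := by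
    intro t z z' h3
    suffices z = z' by rw [this]
    rcases enclosed_cases t with ⟨h, -⟩ | ⟨q, rfl | rfl⟩
    · rw [mergeTri_none φ h, mergeTri_none φ h] at h3
      exact Subtype.ext h3
    · rw [hτ.mergeTri_mate, hτ.mergeTri_mate] at h3
      have := hinj q h11 h11 h3
      exact Subtype.ext (sideCoord_injective _ (by simpa using this))
    · rw [hτ.mergeTri_folded, hτ.mergeTri_folded] at h3
      have := hinj q h12 h12 h3
      exact Subtype.ext (sideCoord_injective _ (by simpa using this))
  by_cases ht : ∀ i, ¬ τ.IsFolded (t, i) <;> by_cases ht' : ∀ i, ¬ τ.IsFolded (t', i)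
  · rw [hτ.base_plain ht, hτ.base_plain ht'] at h2
    subst h2
    exact hsame _ _ _ h3
  · push Not at ht'
    obtain ⟨j, hj⟩ := ht'
    have hb := hτ.base_folded ⟨_, hj⟩
    rw [← h2, hτ.base_plain ht] at hb
    subst hb
    exact (key ⟨_, hj⟩ _ _ h3.symm).symm
  · push Not at ht
    obtain ⟨j, hj⟩ := ht
    have hb := hτ.base_folded ⟨_, hj⟩
    rw [h2, hτ.base_plain ht'] at hb
    subst hb
    exact key ⟨_, hj⟩ _ _ h3
  · push Not at ht ht'
    obtain ⟨j, hj⟩ := ht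
    obtain ⟨j', hj'⟩ := ht'
    have hb := hτ.base_folded ⟨_, hj⟩
    have hb' := hτ.base_folded ⟨_, hj'⟩
    have := hτ.share ⟨_, hj⟩ ⟨_, hj'⟩ (hb.symm.trans (h2.trans hb'))
    obtain rfl : t = t' := congrArg (fun q : τ.Folded => q.1.1) this
    exact hsame _ _ _ h3

end IsTame

end

end IdealTriangulation

/-! ### The gluing map of the double and its inverse -/

namespace IdealTriangulation

section

variable {X : Type u} [TopologicalSpace X] {O : OrientedSurface X} {V : Set X}
  {τ : IdealTriangulation O V} (φ : ∀ q : τ.Folded, τ.segment q ≃ₜ unitInterval)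

variable (τ) in
/-- The projection from the triangles of the two copies of the cut surface to the double. -/
def doublePt (a : Bool × TriSum τ.T) : τ.Double φ := τ.doubleMk φ (a.1, τ.cutMk a.2)

theorem continuous_doublePt : Continuous (τ.doublePt φ) := by
  have : Continuous (τ.doubleMk φ) := continuous_quotient_mk'
  exact this.comp (continuous_id.prodMap τ.continuous_cutMk)

theorem doublePt_surjective : Function.Surjective (τ.doublePt φ) := by
  intro y
  obtain ⟨⟨ε, x⟩, rfl⟩ := Quotient.exists_rep y
  obtain ⟨a, rfl⟩ := τ.cutMk_surjective x
  exact ⟨(ε, a), rfl⟩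

theorem doublePt_glue (ε : Bool) {p : τ.T × Fin 3} (hp : ¬ τ.IsFoldedSide p) (hm : τ.mate p ≠ p)
    (x : unitInterval) :
    τ.doublePt φ (ε, sidePt p x) = τ.doublePt φ (ε, sidePt (τ.mate p) (unitInterval.symm x)) := by
  rw [doublePt, doublePt, τ.cutMk_glue hp hm]

theorem doublePt_foldedPt (ε : Bool) (q : τ.Folded) {v w : ℝ}
    (h : τ.foldStretch φ q w = - τ.foldStretch φ q v) :
    τ.doublePt φ (ε, ⟨q.1.1, foldedPt q.1.2 v⟩) = τ.doublePt φ (!ε, ⟨q.1.1, foldedPt q.1.2 w⟩) := by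
  have key : ∀ v w : ℝ, τ.foldStretch φ q w = - τ.foldStretch φ q v →
      τ.doublePt φ (true, ⟨q.1.1, foldedPt q.1.2 v⟩) =
        τ.doublePt φ (false, ⟨q.1.1, foldedPt q.1.2 w⟩) := by
    intro v w h
    refine Quotient.sound (s := τ.doubleSetoid φ) (.rel _ _ ⟨q, τ.segmentPt q v, rfl, ?_⟩)
    rw [← (τ.segmentPt_symm_iff φ).2 h, Homeomorph.symm_apply_apply]
    rfl
  cases ε
  · exact (key w v (by rw [h, neg_neg])).symm
  · exact key v w h

theorem not_isFoldedSide {p : τ.T × Fin 3} (hp : ∀ i, ¬ τ.IsFolded (p.1, i)) : ¬ τ.IsFoldedSide p := by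
  rintro ⟨q, rfl | rfl⟩ <;> exact hp _ q.2

theorem eq_loop_of_not_isFoldedSide {p : τ.T × Fin 3} {i : Fin 3} (hi : τ.IsFolded (p.1, i))
    (hp : ¬ τ.IsFoldedSide p) : p = (p.1, i) := by
  rcases fin3_cases i p.2 with h | h | h
  · exact Prod.ext rfl h
  · exact absurd ⟨⟨_, hi⟩, .inl (Prod.ext rfl h)⟩ hp
  · exact absurd ⟨⟨_, hi⟩, .inr (Prod.ext rfl h)⟩ hp

namespace IsTame

variable {M : Set X} (hτ : τ.IsTame M)

instance : Finite τ.PlainTri := by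
  have := τ.finite
  exact inferInstanceAs (Finite {t : τ.T // ∀ i, ¬ τ.IsFolded (t, i)})

include hτ

theorem mate_loop_ne (q : τ.Folded) : τ.mate q.1 ≠ q.1 := fun h =>
  hτ.mate_ne q q (congrArg Prod.fst h)

omit hτ in
theorem not_isFoldedSide_loop (q : τ.Folded) : ¬ τ.IsFoldedSide q.1 := by
  rintro ⟨q', h | h⟩
  · have h1 : q.1.1 = q'.1.1 := by rw [h]
    obtain rfl := Folded.ext h1
    exact fin3_ne1 _ (congrArg Prod.snd h).symm
  · have h1 : q.1.1 = q'.1.1 := by rw [h]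
    obtain rfl := Folded.ext h1
    exact fin3_ne2 _ (congrArg Prod.snd h).symm

theorem doublePt_eq_of_doubleTri_eq {a b : Bool × TriSum τ.T}
    (h : hτ.doubleTri φ a = hτ.doubleTri φ b) : τ.doublePt φ a = τ.doublePt φ b :=
  hτ.eq_of_doubleTri_eq φ (fun ε q x =>
    doublePt_glue φ ε (not_isFoldedSide_loop q) (hτ.mate_loop_ne q) x) h

omit hτ in
theorem exists_foldedPt (q : τ.Folded) (x : unitInterval) :
    ∃ v, |v| ≤ 1 ∧ τ.foldStretch φ q v = 2 * x - 1 :=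
  (τ.isStretch_foldStretch φ q).exists_eq (by rw [abs_le]; constructor <;> linarith [x.2.1, x.2.2])

theorem doubleMate_ne {p : (Bool × τ.PlainTri) × Fin 3} (h : τ.IsLoopSide (p.1.2.1, p.2)) :
    hτ.doubleMate p ≠ p := by
  rw [hτ.doubleMate_loop h]
  intro e
  exact Bool.not_ne_self _ (congrArg (fun p => p.1.1) e)

theorem sidePt_doubleMate {p : (Bool × τ.PlainTri) × Fin 3} (h : ¬ τ.IsLoopSide (p.1.2.1, p.2))
    (x : unitInterval) : sidePt (hτ.doubleMate p) x =
      hτ.doubleTri φ (p.1.1, sidePt (τ.mate (p.1.2.1, p.2)) x) := by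
  have e := hτ.doubleMate_not_snd h
  rw [← e, ← hτ.doubleTri_side φ (p := hτ.doubleMate p) (by rw [e]; exact not_isLoopSide_mate p.1.2.2)]
  rw [hτ.doubleMate_not h]

/-- The gluing map from the triangles of the double. -/
noncomputable def doubleChi (b : TriSum (Bool × τ.PlainTri)) : τ.Double φ :=
  τ.doublePt φ (Function.surjInv (hτ.doubleTri_surjective φ) b)

theorem doubleChi_doubleTri (a : Bool × TriSum τ.T) :
    hτ.doubleChi φ (hτ.doubleTri φ a) = τ.doublePt φ a :=
  hτ.doublePt_eq_of_doubleTri_eq φ (Function.surjInv_eq _ _)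

theorem continuous_doubleChi : Continuous (hτ.doubleChi φ) := by
  have := τ.finite
  have hq : IsQuotientMap (hτ.doubleTri φ) :=
    (hτ.continuous_doubleTri φ).isClosedMap.isQuotientMap (hτ.continuous_doubleTri φ)
      (hτ.doubleTri_surjective φ)
  exact hq.continuous_iff.2 ((continuous_doublePt φ).congr fun a => (hτ.doubleChi_doubleTri φ a).symm)

/-- On a loop side, `x` and `1 - x` correspond to opposite values of the stretched coordinate, which
are exactly the points identified between the two copies. On the other sides this is the gluing of
the cut surface. -/
theorem doubleChi_glue (p : (Bool × τ.PlainTri) × Fin 3) (hp : hτ.doubleMate p ≠ p) (x : unitInterval) :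
    hτ.doubleChi φ (sidePt p x) = hτ.doubleChi φ (sidePt (hτ.doubleMate p) (unitInterval.symm x)) := by
  by_cases h : τ.IsLoopSide (p.1.2.1, p.2)
  · obtain ⟨q, hq⟩ := h
    obtain ⟨v, hv, hx⟩ := exists_foldedPt φ q x
    obtain ⟨w, hw, hx'⟩ := exists_foldedPt φ q (unitInterval.symm x)
    have e : ∀ ε, (((ε, hτ.baseTri (τ.mate q.1).1), (τ.mate q.1).2) : (Bool × τ.PlainTri) × Fin 3) =
        ((ε, p.1.2), p.2) := fun ε => by rw [hq]; simp only [hτ.baseTri_eq]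
    have h1 := hτ.doubleTri_foldedPt φ p.1.1 q hv hx
    have h2 := hτ.doubleTri_foldedPt φ (!p.1.1) q hw hx'
    rw [e] at h1 h2
    rw [hτ.doubleMate_loop ⟨q, hq⟩, ← h2]
    change hτ.doubleChi φ (sidePt ((p.1.1, p.1.2), p.2) x) = _
    rw [← h1, doubleChi_doubleTri, doubleChi_doubleTri]
    refine doublePt_foldedPt φ _ q ?_
    rw [hx, hx', unitInterval.coe_symm_eq]
    ring
  · rw [hτ.sidePt_doubleMate φ h, ← hτ.doubleTri_side φ h, doubleChi_doubleTri, doubleChi_doubleTri]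
    refine doublePt_glue φ _ (not_isFoldedSide p.1.2.2) (fun e => hp ?_) x
    have e' := hτ.doubleMate_not_snd h
    rw [e] at e'
    rw [hτ.doubleMate_not h, e, hτ.baseTri_eq]

/-- The setoid of the gluing of the triangles of the double. -/
def doubleGlue : Setoid (TriSum (Bool × τ.PlainTri)) :=
  Relation.EqvGen.setoid (SideGlue hτ.doubleMate univ)

theorem doubleTri_glue (ε : Bool) {p : τ.T × Fin 3} (hp : ¬ τ.IsFoldedSide p) (hm : τ.mate p ≠ p)
    (x : unitInterval) : hτ.doubleGlue (hτ.doubleTri φ (ε, sidePt p x))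
      (hτ.doubleTri φ (ε, sidePt (τ.mate p) (unitInterval.symm x))) := by
  by_cases hf : ∀ i, ¬ τ.IsFolded (p.1, i)
  · by_cases hl : τ.IsLoopSide p
    · obtain ⟨q, rfl⟩ := hl
      rw [τ.mate_mate, hτ.doubleTri_loop, unitInterval.symm_symm]
    · let p' : (Bool × τ.PlainTri) × Fin 3 := ((ε, ⟨p.1, hf⟩), p.2)
      have h1 := hτ.doubleTri_side φ (p := p') hl x
      have h2 := hτ.sidePt_doubleMate φ (p := p') hl (unitInterval.symm x)
      refine .rel _ _ ⟨p', mem_univ _, fun e => hm ?_, x, h1, h2.symm⟩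
      have := hτ.doubleMate_not_snd (p := p') hl
      rw [e] at this
      exact this.symm
  · push Not at hf
    obtain ⟨i, hi⟩ := hf
    have e := eq_loop_of_not_isFoldedSide hi hp
    have := hτ.doubleTri_loop φ ε ⟨_, hi⟩ x
    simp only [← e] at this
    rw [this]

/-- The map from the cut surface to the space obtained by gluing the triangles of the double. -/
noncomputable def cutLift (ε : Bool) : τ.Cut → Quotient hτ.doubleGlue :=
  Quotient.lift (s := τ.cutSetoid) (fun a => Quotient.mk hτ.doubleGlue (hτ.doubleTri φ (ε, a))) (by
    intro a b h
    refine eqvGen_invariant (r := SideGlue τ.mate {p | ¬ τ.IsFoldedSide p})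
      (f := fun a => Quotient.mk hτ.doubleGlue (hτ.doubleTri φ (ε, a))) ?_ h
    rintro _ _ ⟨p, hp, hm, x, rfl, rfl⟩
    exact Quotient.sound (hτ.doubleTri_glue φ ε hp hm x))

theorem continuous_cutLift (ε : Bool) : Continuous (hτ.cutLift φ ε) :=
  Continuous.quotient_lift (continuous_quotient_mk'.comp
    ((hτ.continuous_doubleTri φ).comp (by fun_prop))) _

/-- The map from the double to the space obtained by gluing the triangles of the double. -/
noncomputable def doubleLift : τ.Double φ → Quotient hτ.doubleGlue :=
  Quotient.lift (s := τ.doubleSetoid φ) (fun a => hτ.cutLift φ a.1 a.2) (by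
    intro a b h
    refine eqvGen_invariant (r := fun a b : Bool × τ.Cut => ∃ (q : τ.Folded) (x : τ.segment q),
      a = (true, x.1) ∧ b = (false, ((φ q).symm (unitInterval.symm (φ q x))).1))
      (f := fun a => hτ.cutLift φ a.1 a.2) ?_ h
    rintro _ _ ⟨q, x, rfl, rfl⟩
    obtain ⟨v, hv, rfl⟩ := τ.exists_segmentPt_eq x
    obtain ⟨w, hw, e⟩ := τ.exists_segmentPt_eq
      ((φ q).symm (unitInterval.symm (φ q (τ.segmentPt q v))))
    rw [← e]
    have hvw := (τ.segmentPt_symm_iff φ).1 ((congrArg (φ q) e).trans ((φ q).apply_symm_apply _))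
    have hb := abs_le.1 ((τ.isStretch_foldStretch φ q).bounded v)
    -- The position on the merged side whose coordinate `2X - 1` is the stretched coordinate of `v`.
    let X : unitInterval := ⟨(τ.foldStretch φ q v + 1) / 2, by linarith, by linarith⟩
    have h1 := hτ.doubleTri_foldedPt φ true q (abs_le.2 hv) (x := X) (by simp only [X]; ring)
    have h2 := hτ.doubleTri_foldedPt φ false q (abs_le.2 hw) (x := unitInterval.symm X) (by
      rw [unitInterval.coe_symm_eq, hvw]; simp only [X]; ring)
    refine Quotient.sound (s := hτ.doubleGlue) ?_
    rw [h1, h2]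
    have hl : τ.IsLoopSide ((hτ.baseTri (τ.mate q.1).1).1, (τ.mate q.1).2) :=
      ⟨q, Prod.ext (hτ.base_mate q).symm rfl⟩
    refine .rel _ _ ⟨((true, hτ.baseTri (τ.mate q.1).1), (τ.mate q.1).2), mem_univ _,
      hτ.doubleMate_ne hl, X, rfl, ?_⟩
    rw [hτ.doubleMate_loop hl]
    rfl)

theorem continuous_doubleLift : Continuous (hτ.doubleLift φ) :=
  Continuous.quotient_lift (continuous_prod_of_discrete_left.2 fun ε => hτ.continuous_cutLift φ ε) _

theorem doubleLift_doubleChi (b : TriSum (Bool × τ.PlainTri)) :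
    hτ.doubleLift φ (hτ.doubleChi φ b) = Quotient.mk hτ.doubleGlue b := by
  obtain ⟨a, rfl⟩ := hτ.doubleTri_surjective φ b
  rw [doubleChi_doubleTri]
  rfl

theorem doubleChi_surjective : Function.Surjective (hτ.doubleChi φ) := fun y => by
  obtain ⟨a, rfl⟩ := doublePt_surjective φ y
  exact ⟨_, hτ.doubleChi_doubleTri φ a⟩

/-- The double is obtained from triangles by gluing. -/
theorem isGluing_double : IsGluing hτ.doubleMate (hτ.doubleChi φ) where
  mate_mate := hτ.doubleMate_doubleMate
  continuous := hτ.continuous_doubleChi φ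
  surjective := hτ.doubleChi_surjective φ
  eq_iff a b := by
    constructor
    · intro h
      -- The map back to the abstract gluing shows that no further points are identified.
      have := congrArg (hτ.doubleLift φ) h
      rw [doubleLift_doubleChi, doubleLift_doubleChi] at this
      exact Quotient.exact this
    · refine eqvGen_invariant ?_
      rintro _ _ ⟨p, -, hp, x, rfl, rfl⟩
      exact hτ.doubleChi_glue φ p hp x

/-- The lift to the abstract gluing is continuous and injective, and the abstract gluing is
Hausdorff since its relation is closed. -/
theorem t2Space_double : T2Space (τ.Double φ) := by
  have := t2Space_quotient_of_isClosed hτ.doubleGlue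
    (isClosed_eqvGen_sideGlue hτ.doubleMate_doubleMate)
  refine T2Space.of_injective_continuous (f := hτ.doubleLift φ) (fun y y' h => ?_)
    (hτ.continuous_doubleLift φ)
  obtain ⟨b, rfl⟩ := hτ.doubleChi_surjective φ y
  obtain ⟨b', rfl⟩ := hτ.doubleChi_surjective φ y'
  rw [doubleLift_doubleChi, doubleLift_doubleChi] at h
  exact ((hτ.isGluing_double φ).eq_iff _ _).2 (Quotient.exact h)

theorem compactSpace_double : CompactSpace (τ.Double φ) := by
  have := τ.finite
  rw [← isCompact_univ_iff, ← (hτ.doubleChi_surjective φ).range_eq]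
  exact isCompact_range (hτ.continuous_doubleChi φ)

end IsTame

end

end IdealTriangulation

/-! ### Boundary components, corner sequences and marked points of the double -/

section

variable {T : Type} {mate : T × Fin 3 → T × Fin 3} {Y : Type u} [TopologicalSpace Y]
  {χ : TriSum T → Y}

theorem IsGluing.next_eq (h : IsGluing mate χ) {c : T × Fin 3} (hc : ¬ IsLastCorner mate c) :
    χ (cornerAt (nextCorner mate c)) = χ (cornerAt c) :=
  (h.corner_iff.2 (.rel _ _ ⟨hc, rfl⟩)).symm

theorem IsGluing.exists_unglued_of_corner (h : IsGluing mate χ) (hl : IsLinear mate) (c : T × Fin 3) :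
    ∃ p, mate p = p ∧ χ (cornerAt c) = χ (sidePt p 1) := by
  obtain ⟨k, hk⟩ := hl c
  induction k generalizing c with
  | zero => exact ⟨(c.1, c.2 + 1), hk, by rw [sidePt_one, fin3_12]⟩
  | succ k ih =>
    by_cases hc : IsLastCorner mate c
    · exact ⟨(c.1, c.2 + 1), hc, by rw [sidePt_one, fin3_12]⟩
    · rw [← h.next_eq hc]
      exact ih _ hk

/-- A boundary point is a corner or lies on an unglued side; in the latter case the side is a
connected subset of the boundary that joins the point to a corner. -/
theorem IsGluing.component_inter_corners [Finite T] [T2Space Y] (h : IsGluing mate χ)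
    (O : OrientedSurface Y) (hpos : ∀ (t : T) (z : Tri), (z : ℂ) ∈ interior Tri → ∀ e ∈ O.atlas,
      χ ⟨t, z⟩ ∈ e.source → PositiveAt (fun w => (e (χ ⟨t, w⟩) : ℂ)) z)
    (hb : ∀ p, mate p = p → ∀ x, χ (sidePt p x) ∈ O.boundary) {y : Y} (hy : y ∈ O.boundary) :
    (connectedComponentIn O.boundary y ∩ range fun c : T × Fin 3 => χ (cornerAt c)).Nonempty := by
  obtain ⟨⟨t, z⟩, rfl⟩ := h.surjective y
  have hzi : ¬ ∀ i, 0 < bary i z := fun hi =>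
    interior_notMem_boundary O hpos (mem_interior_Tri.2 hi) hy
  push Not at hzi
  obtain ⟨i, hi⟩ := hzi
  obtain ⟨s, rfl⟩ : ∃ s, z = edgePt i s := ⟨_, eq_edgePt (le_antisymm hi (bary_nonneg z i))⟩
  by_cases hp : mate (t, i) = (t, i)
  · refine ⟨χ (sidePt (t, i) 0), ?_, ⟨_, by rw [sidePt_zero]⟩⟩
    have hc : IsPreconnected (range fun x => χ (sidePt (t, i) x)) :=
      isPreconnected_range (h.continuous.comp (continuous_sidePt _))
    exact hc.subset_connectedComponentIn ⟨s, rfl⟩ (range_subset_iff.2 fun x => hb _ hp x) ⟨0, rfl⟩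
  · refine ⟨_, mem_connectedComponentIn hy, ?_⟩
    by_cases hs0 : s = 0
    · exact ⟨(t, i + 1), by rw [hs0, edgePt_zero]; rfl⟩
    by_cases hs1 : s = 1
    · exact ⟨(t, i + 2), by rw [hs1, edgePt_one]; rfl⟩
    exact absurd hy (h.glued_notMem_boundary O hpos hp (unitInterval.pos_iff_ne_zero.2 hs0)
      (unitInterval.lt_one_iff_ne_one.2 hs1))

end

namespace IdealTriangulation

section

variable {X : Type u} [TopologicalSpace X] {O : OrientedSurface X} {V : Set X}
  {τ : IdealTriangulation O V} (φ : ∀ q : τ.Folded, τ.segment q ≃ₜ unitInterval)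

theorem isLoopSide_mate_ne {p : τ.T × Fin 3} (hp : ∀ i, ¬ τ.IsFolded (p.1, i)) (hl : τ.IsLoopSide p) :
    τ.mate p ≠ p := by
  obtain ⟨q, rfl⟩ := hl
  rw [τ.mate_mate]
  exact fun e => hp q.1.2 (by rw [← e]; exact q.2)

namespace IsTame

variable {M : Set X} (hτ : τ.IsTame M)

include hτ

theorem plain_of_mate_eq {p : τ.T × Fin 3} (hp : τ.mate p = p) (i : Fin 3) :
    ¬ τ.IsFolded (p.1, i) := by
  intro hi
  have hfs : ¬ τ.IsFoldedSide p := by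
    rintro ⟨⟨⟨t, j⟩, hq⟩, rfl | rfl⟩
    · rw [hq.mate_one] at hp
      exact fin3_ne12 j (congrArg Prod.snd hp).symm
    · rw [hq.mate_two] at hp
      exact fin3_ne12 j (congrArg Prod.snd hp)
  have e := eq_loop_of_not_isFoldedSide hi hfs
  exact hτ.mate_loop_ne ⟨_, hi⟩ (by simp only [← e]; exact hp)

theorem doubleMate_eq_iff {p : (Bool × τ.PlainTri) × Fin 3} :
    hτ.doubleMate p = p ↔ τ.mate (p.1.2.1, p.2) = (p.1.2.1, p.2) := by
  by_cases h : τ.IsLoopSide (p.1.2.1, p.2)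
  · exact iff_of_false (hτ.doubleMate_ne h) (isLoopSide_mate_ne p.1.2.2 h)
  · constructor
    · intro e
      have := hτ.doubleMate_not_snd h
      rw [e] at this
      exact this.symm
    · intro e
      rw [hτ.doubleMate_not h, e, hτ.baseTri_eq]

/-- Induction on the number of steps to the boundary in the original triangulation. One step around
a vertex of the double is one step there, or three steps when it crosses a loop side: into the
self-folded triangle, across its folded side, and back out. -/
theorem isLinear_doubleMate : IsLinear hτ.doubleMate := by
  have key : ∀ (n : ℕ) (c : (Bool × τ.PlainTri) × Fin 3),
      IsLastCorner τ.mate ((nextCorner τ.mate)^[n] (c.1.2.1, c.2)) →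
      ∃ k, IsLastCorner hτ.doubleMate ((nextCorner hτ.doubleMate)^[k] c) := by
    intro n
    induction n using Nat.strong_induction_on with
    | _ n ih =>
      intro c hn
      by_cases hc : IsLastCorner hτ.doubleMate c
      · exact ⟨0, hc⟩
      suffices ∃ m < n, IsLastCorner τ.mate ((nextCorner τ.mate)^[m]
          ((nextCorner hτ.doubleMate c).1.2.1, (nextCorner hτ.doubleMate c).2)) by
        obtain ⟨m, hm, h⟩ := this
        obtain ⟨k, hk⟩ := ih m hm _ h
        exact ⟨k + 1, hk⟩
      have hc' : ¬ IsLastCorner τ.mate (c.1.2.1, c.2) := fun h =>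
        hc ((hτ.doubleMate_eq_iff (p := (c.1, c.2 + 1))).2 h)
      obtain _ | n := n
      · exact absurd hn hc'
      rw [Function.iterate_succ_apply] at hn
      by_cases hl : τ.IsLoopSide (c.1.2.1, c.2 + 1)
      -- The next two corners lie in the self-folded triangle and are followed by further ones; the
      -- third step returns to the triangle of `c`, at the corner reached in the other copy.
      · obtain ⟨q, hq⟩ := hl
        have hqm : τ.mate (c.1.2.1, c.2 + 1) = q.1 := by rw [← hq, τ.mate_mate]
        have n1 : nextCorner τ.mate (c.1.2.1, c.2) = (q.1.1, q.1.2 + 1) := by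
          simp [nextCorner, hqm]
        have hf2 : τ.mate (q.1.1, q.1.2 + 2) = (q.1.1, q.1.2 + 1) := IsFolded.mate_two q.2
        have n2 : nextCorner τ.mate (q.1.1, q.1.2 + 1) = (q.1.1, q.1.2 + 2) := by
          simp [nextCorner, fin3_11, hf2]
        have n3 : nextCorner τ.mate (q.1.1, q.1.2 + 2) =
            ((nextCorner hτ.doubleMate c).1.2.1, (nextCorner hτ.doubleMate c).2) := by
          have := hτ.doubleMate_loop (p := (c.1, c.2 + 1)) ⟨q, hq⟩
          simp only [nextCorner, fin3_21, Prod.mk.eta, hq, this]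
        rw [n1] at hn
        obtain _ | n := n
        · simp only [Function.iterate_zero, id, IsLastCorner, fin3_11, hf2] at hn
          exact absurd (congrArg Prod.snd hn) (fin3_ne12 _)
        rw [Function.iterate_succ_apply, n2] at hn
        obtain _ | n := n
        · simp only [Function.iterate_zero, id, IsLastCorner, fin3_21, Prod.mk.eta] at hn
          exact absurd hn (hτ.mate_loop_ne q)
        rw [Function.iterate_succ_apply, n3] at hn
        exact ⟨n, by omega, hn⟩
      · refine ⟨n, by omega, ?_⟩
        have := hτ.doubleMate_not_snd (p := (c.1, c.2 + 1)) hl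
        have e : nextCorner τ.mate (c.1.2.1, c.2) =
            ((nextCorner hτ.doubleMate c).1.2.1, (nextCorner hτ.doubleMate c).2) := by
          simp only [nextCorner, ← this]
        rwa [← e]
  intro c
  obtain ⟨n, hn⟩ := hτ.linear (c.1.2.1, c.2) (c.1.2.2 _)
  exact key n c hn

/-- Within one copy, merging keeps the triangles linked as in the original triangulation. The two
copies are linked through any loop side, and there is one because there is a puncture. -/
theorem connected_doubleMate (f : Bool × τ.PlainTri → Prop) (hf : ∀ p, f p.1 ↔ f (hτ.doubleMate p).1)
    (s t : Bool × τ.PlainTri) (hs : f s) : f t := by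
  have h1 : ∀ ε (s t : τ.T), f (ε, hτ.baseTri s) → f (ε, hτ.baseTri t) := fun ε => by
    refine hτ.connected (fun t => f (ε, hτ.baseTri t)) fun p => ?_
    by_cases hp : ∀ i, ¬ τ.IsFolded (p.1, i)
    · by_cases hl : τ.IsLoopSide p
      · obtain ⟨q, rfl⟩ := hl
        rw [τ.mate_mate, hτ.baseTri_folded]
      · have h2 := hf ((ε, ⟨p.1, hp⟩), p.2)
        rw [hτ.doubleMate_not (p := ((ε, ⟨p.1, hp⟩), p.2)) hl] at h2
        rw [show hτ.baseTri p.1 = ⟨p.1, hp⟩ from hτ.baseTri_eq ⟨p.1, hp⟩]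
        exact h2
    · push Not at hp
      obtain ⟨i, hi⟩ := hp
      by_cases hs : τ.IsFoldedSide p
      · obtain ⟨⟨⟨t, j⟩, hq⟩, rfl | rfl⟩ := hs
        · rw [hq.mate_one]
        · rw [hq.mate_two]
      · have e := eq_loop_of_not_isFoldedSide hi hs
        have := hτ.baseTri_folded ⟨_, hi⟩
        simp only [← e] at this
        rw [this]
  have h2 : ∀ s t : Bool × τ.PlainTri, s.1 = t.1 → f s → f t := by
    rintro ⟨ε, s⟩ ⟨ε', t⟩ rfl h
    rw [← hτ.baseTri_eq s] at h
    rw [← hτ.baseTri_eq t]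
    exact h1 _ _ _ h
  obtain ⟨q⟩ := hτ.nonempty
  have h3 : ∀ ε, f (ε, hτ.baseTri (τ.mate q.1).1) → f (!ε, hτ.baseTri (τ.mate q.1).1) := fun ε h => by
    have := (hf ((ε, hτ.baseTri (τ.mate q.1).1), (τ.mate q.1).2)).1 h
    rwa [hτ.doubleMate_loop ⟨q, Prod.ext (hτ.base_mate q).symm rfl⟩] at this
  by_cases h : s.1 = t.1
  · exact h2 s t h hs
  · refine h2 _ t ?_ (h3 s.1 (h2 s (s.1, _) rfl hs))
    cases hs1 : s.1 <;> cases ht1 : t.1 <;> simp_all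

theorem connectedSpace_double : ConnectedSpace (τ.Double φ) := by
  have := (hτ.isGluing_double φ).preconnectedSpace hτ.connected_doubleMate
  obtain ⟨q⟩ := hτ.nonempty
  exact ⟨⟨τ.doublePt φ (true, cornerAt q.1)⟩⟩

/-- At most one of the two sides at a corner is a loop side, and the merging map is the identity on
the other one. -/
theorem doubleTri_corner {c : (Bool × τ.PlainTri) × Fin 3} :
    hτ.doubleTri φ (c.1.1, cornerAt (c.1.2.1, c.2)) = cornerAt c := by
  by_cases h1 : τ.IsLoopSide (c.1.2.1, c.2 + 1)
  · have h2 : ¬ τ.IsLoopSide (c.1.2.1, c.2 + 2) := fun h2 =>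
      fin3_ne12 _ (hτ.isLoopSide_unique h1 h2)
    have := hτ.doubleTri_side φ (p := (c.1, c.2 + 2)) h2 0
    simpa [sidePt_zero, fin3_21] using this
  · have := hτ.doubleTri_side φ (p := (c.1, c.2 + 1)) h1 1
    simpa [sidePt_one, fin3_12] using this

theorem doubleChi_corner (c : (Bool × τ.PlainTri) × Fin 3) :
    hτ.doubleChi φ (cornerAt c) = τ.doublePt φ (c.1.1, cornerAt (c.1.2.1, c.2)) := by
  rw [← hτ.doubleTri_corner φ, doubleChi_doubleTri]

theorem exists_doubleChi_corner (ε : Bool) {d : τ.T × Fin 3} (hd : ¬ τ.IsFolded d) :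
    ∃ c, hτ.doubleChi φ (cornerAt c) = τ.doublePt φ (ε, cornerAt d) := by
  by_cases hp : ∀ i, ¬ τ.IsFolded (d.1, i)
  · exact ⟨((ε, ⟨d.1, hp⟩), d.2), hτ.doubleChi_corner φ _⟩
  push Not at hp
  obtain ⟨i, hi⟩ := hp
  obtain ⟨t, j⟩ := d
  simp only at hi
  have h0 := hτ.doubleTri_loop φ ε ⟨(t, i), hi⟩
  set m := τ.mate (t, i)
  have hmp : ∀ k, ¬ τ.IsFolded (m.1, k) := hτ.loop_mate ⟨(t, i), hi⟩
  rcases fin3_cases i j with rfl | rfl | rfl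
  · exact absurd hi hd
  · refine ⟨((ε, ⟨m.1, hmp⟩), m.2 + 2), ?_⟩
    have := h0 0
    simp only [sidePt_zero, unitInterval.symm_zero, sidePt_one] at this
    rw [hτ.doubleChi_corner, ← doubleChi_doubleTri φ hτ, ← doubleChi_doubleTri φ hτ, this]
  · refine ⟨((ε, ⟨m.1, hmp⟩), m.2 + 1), ?_⟩
    have := h0 1
    simp only [sidePt_zero, unitInterval.symm_one, sidePt_one] at this
    rw [hτ.doubleChi_corner, ← doubleChi_doubleTri φ hτ, ← doubleChi_doubleTri φ hτ, this]

omit hτ in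
theorem isEnd_iff {q : τ.Folded} {v : ℝ} : (τ.segmentPt q v = (φ q).symm 0 ∨
    τ.segmentPt q v = (φ q).symm 1) ↔ |τ.foldStretch φ q v| = 1 := by
  rw [Homeomorph.eq_symm_apply, Homeomorph.eq_symm_apply, foldStretch, abs_mul, τ.abs_foldSign, one_mul,
    Subtype.ext_iff, Subtype.ext_iff, abs_eq zero_le_one]
  simp only [Icc.coe_zero, Icc.coe_one]
  constructor
  · rintro (h | h) <;> rw [h] <;> norm_num
  · rintro (h | h)
    · right; linarith
    · left; linarith

omit hτ in
theorem foldedPt_one (j : Fin 3) : foldedPt j 1 = cornerPt (j + 1) := by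
  have := edgePt_two_eq_foldedPt j 1
  rw [edgePt_one, fin3_22] at this
  simpa using this.symm

omit hτ in
theorem foldedPt_neg_one (j : Fin 3) : foldedPt j (-1) = cornerPt (j + 2) := by
  have := edgePt_one_eq_foldedPt j 0
  rw [edgePt_zero, fin3_11] at this
  simpa using this.symm

omit hτ in
theorem cut_corner_end {q : τ.Folded} {y : τ.Cut} (hy : y = τ.cutMk (cornerAt (q.1.1, q.1.2 + 1)) ∨
    y = τ.cutMk (cornerAt (q.1.1, q.1.2 + 2))) : y = ((φ q).symm 0).1 ∨ y = ((φ q).symm 1).1 := by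
  obtain ⟨v, hv, rfl⟩ : ∃ v, |τ.foldStretch φ q v| = 1 ∧ y = (τ.segmentPt q v).1 := by
    rcases hy with rfl | rfl
    · refine ⟨1, by rw [(τ.isStretch_foldStretch φ q).one]; simp, ?_⟩
      change _ = τ.cutMk ⟨q.1.1, foldedPt q.1.2 1⟩
      rw [foldedPt_one]; rfl
    · refine ⟨-1, by rw [(τ.isStretch_foldStretch φ q).neg_one]; simp, ?_⟩
      change _ = τ.cutMk ⟨q.1.1, foldedPt q.1.2 (-1)⟩
      rw [foldedPt_neg_one]; rfl
  exact ((isEnd_iff φ).2 hv).imp (congrArg Subtype.val) (congrArg Subtype.val)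

omit hτ in
/-- After cutting, the corners at an end point of a folded side are linked to an end of one of the
segments. -/
theorem exists_cut_corner {q : τ.Folded} {d : τ.T × Fin 3}
    (h : CornerRel τ.mate (q.1.1, q.1.2 + 2) d) :
    ∃ q' : τ.Folded, τ.cutMk (cornerAt d) = τ.cutMk (cornerAt (q'.1.1, q'.1.2 + 1)) ∨
      τ.cutMk (cornerAt d) = τ.cutMk (cornerAt (q'.1.1, q'.1.2 + 2)) := by
  have := eqvGen_invariant (r := fun c d : τ.T × Fin 3 => τ.mate (c.1, c.2 + 1) ≠ (c.1, c.2 + 1) ∧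
      d = nextCorner τ.mate c) (f := fun d => ∃ q' : τ.Folded,
        τ.cutMk (cornerAt d) = τ.cutMk (cornerAt (q'.1.1, q'.1.2 + 1)) ∨
        τ.cutMk (cornerAt d) = τ.cutMk (cornerAt (q'.1.1, q'.1.2 + 2))) ?_ h
  · exact this.mp ⟨q, .inr rfl⟩
  · rintro ⟨t, i⟩ _ ⟨hc, rfl⟩
    -- Crossing a folded side either stays at the corner of the puncture or passes between the two
    -- ends of the same opened segment; crossing any other side does not change the point of the cut
    -- surface.
    by_cases hf : τ.IsFoldedSide (t, i + 1)
    · obtain ⟨⟨⟨t', j⟩, hq⟩, e | e⟩ := hf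
      · simp only [Prod.mk.injEq, add_left_inj] at e
        obtain ⟨rfl, rfl⟩ := e
        rw [hq.nextCorner]
      · simp only [Prod.mk.injEq] at e
        obtain ⟨rfl, e⟩ := e
        have ei : i = j + 1 := by rw [← fin3_12 i, e, fin3_22]
        subst ei
        have hn : nextCorner τ.mate (t, j + 1) = (t, j + 2) := by
          simp [nextCorner, fin3_11, hq.mate_two]
        rw [hn]
        exact propext ⟨fun _ => ⟨⟨_, hq⟩, .inr rfl⟩, fun _ => ⟨⟨_, hq⟩, .inl rfl⟩⟩
    · have := τ.cutMk_glue hf hc 1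
      rw [sidePt_one, unitInterval.symm_one, sidePt_zero, fin3_12] at this
      simp only [this, nextCorner]

/-- A corner at a marked point that no folded side reaches gives a point of `M⁺`. At an end point of
a folded side, every corner gives an end of some segment after cutting, by `exists_cut_corner`.
Conversely, the ends of the segments are the ends of the merged sides. -/
theorem range_doubleChi_corner : (range fun c => hτ.doubleChi φ (cornerAt c)) = τ.doubleMarked φ M := by
  refine subset_antisymm ?_ ?_
  · rintro _ ⟨⟨⟨ε, t⟩, i⟩, rfl⟩
    refine ⟨ε, τ.cutMk (cornerAt (t.1, i)), ?_, hτ.doubleChi_corner φ _⟩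
    by_cases hr : ∀ q : τ.Folded, τ.χ (cornerAt (t.1, i)) ∉ τ.radius q
    · exact .inl ⟨_, rfl, (hτ.marked _).2 (t.2 i), hr⟩
    · push Not at hr
      obtain ⟨q, x, hx⟩ := hr
      obtain ⟨d, hd, hcd⟩ := τ.isGluing.eq_of_corner hx.symm
      have hx' : x = 0 ∨ x = 1 := by
        by_contra! hne
        exact sidePt_ne_cornerAt (unitInterval.pos_iff_ne_zero.2 hne.1)
          (unitInterval.lt_one_iff_ne_one.2 hne.2) hd
      rcases hx' with rfl | rfl
      · rw [sidePt_zero] at hd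
        obtain rfl := cornerAt_injective hd
        simp only [fin3_11] at hcd
        obtain ⟨q', hq'⟩ := exists_cut_corner (hcd.symm _ _)
        exact .inr ⟨q', cut_corner_end φ hq'⟩
      · rw [sidePt_one] at hd
        obtain rfl := cornerAt_injective hd
        simp only [fin3_12] at hcd
        -- The end `x = 1` of the folded side is the puncture, which is not a corner of a triangle
        -- that is not self-folded.
        have := IsFolded.eq_of_cornerRel (hcd.symm _ _) q.2
        exact absurd (this ▸ q.2) (t.2 i)
  · rintro _ ⟨ε, y, ⟨a, rfl, ha, -⟩ | ⟨q, hq⟩, rfl⟩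
    · obtain ⟨c, hc⟩ := hτ.exists_corner _ ha
      obtain ⟨d, rfl, -⟩ := τ.isGluing.eq_of_corner hc.symm
      exact hτ.exists_doubleChi_corner φ ε ((hτ.marked d).1 ha)
    · obtain ⟨v, hv, e⟩ : ∃ v ∈ Icc (-1 : ℝ) 1, (τ.segmentPt q v).1 = y := by
        rcases hq with rfl | rfl <;> obtain ⟨v, hv, e⟩ := τ.exists_segmentPt_eq ((φ q).symm _) <;>
          exact ⟨v, hv, congrArg _ e⟩
      subst e
      have h1 := (isEnd_iff φ).1 (hq.imp Subtype.ext Subtype.ext)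
      have h2 : ∃ x : unitInterval, (x = 0 ∨ x = 1) ∧ τ.foldStretch φ q v = 2 * x - 1 := by
        rcases (abs_eq zero_le_one).1 h1 with h | h
        · exact ⟨1, .inr rfl, by rw [h]; norm_num⟩
        · exact ⟨0, .inl rfl, by rw [h]; norm_num⟩
      obtain ⟨x, hx01, hx⟩ := h2
      have h3 := hτ.doubleTri_foldedPt φ ε q (abs_le.2 hv) hx
      have h4 := hτ.doubleChi_doubleTri φ (ε, ⟨q.1.1, foldedPt q.1.2 v⟩)
      rw [h3] at h4
      rcases hx01 with rfl | rfl
      · rw [sidePt_zero] at h4; exact ⟨_, h4⟩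
      · rw [sidePt_one] at h4; exact ⟨_, h4⟩

end IsTame

end

end IdealTriangulation

/-! ### The triangulation of the double and its orientation -/

namespace IdealTriangulation

section

variable {X : Type u} [TopologicalSpace X] {O : OrientedSurface X} {V : Set X}
  {τ : IdealTriangulation O V} (φ : ∀ q : τ.Folded, τ.segment q ≃ₜ unitInterval)

namespace IsTame

variable {M : Set X} (hτ : τ.IsTame M)

include hτ

theorem doubleChi_side {p : (Bool × τ.PlainTri) × Fin 3} (h : ¬ τ.IsLoopSide (p.1.2.1, p.2))
    (x : unitInterval) :
    hτ.doubleChi φ (sidePt p x) = τ.doublePt φ (p.1.1, sidePt (p.1.2.1, p.2) x) := by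
  rw [← hτ.doubleTri_side φ h, doubleChi_doubleTri]

theorem range_doubleChi_side {p : (Bool × τ.PlainTri) × Fin 3} (h : ¬ τ.IsLoopSide (p.1.2.1, p.2)) :
    (range fun x => hτ.doubleChi φ (sidePt p x)) = τ.doubleArc φ p.1.1 (p.1.2.1, p.2) := by
  simp only [hτ.doubleChi_side φ h]
  rfl

theorem range_doubleChi_loop {p : (Bool × τ.PlainTri) × Fin 3} {q : τ.Folded}
    (h : τ.mate q.1 = (p.1.2.1, p.2)) :
    (range fun x => hτ.doubleChi φ (sidePt p x)) = τ.doubleSegment φ q := by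
  have key : ∀ p : (Bool × τ.PlainTri) × Fin 3, p.1.1 = true → τ.mate q.1 = (p.1.2.1, p.2) →
      (range fun x => hτ.doubleChi φ (sidePt p x)) = τ.doubleSegment φ q := by
    rintro ⟨⟨_, t⟩, i⟩ rfl h
    have e : (((true, hτ.baseTri (τ.mate q.1).1), (τ.mate q.1).2) : (Bool × τ.PlainTri) × Fin 3) =
        ((true, t), i) := by rw [h]; simp only [hτ.baseTri_eq]
    have hpt : ∀ v x, |v| ≤ 1 → τ.foldStretch φ q v = 2 * (x : unitInterval) - 1 →
        hτ.doubleChi φ (sidePt ((true, t), i) x) = τ.doubleMk φ (true, τ.segmentPt q v) := by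
      intro v x hv hx
      have h1 := hτ.doubleTri_foldedPt φ true q hv hx
      rw [e] at h1
      rw [← h1, doubleChi_doubleTri]
      rfl
    refine subset_antisymm ?_ ?_
    · rintro _ ⟨x, rfl⟩
      obtain ⟨v, hv, hx⟩ := exists_foldedPt φ q x
      exact ⟨_, (τ.segmentPt q v).2, (hpt v x hv hx).symm⟩
    · rintro _ ⟨y, hy, rfl⟩
      obtain ⟨v, hv, hy'⟩ := τ.exists_segmentPt_eq (q := q) ⟨y, hy⟩
      have hb := abs_le.1 ((τ.isStretch_foldStretch φ q).bounded v)
      refine ⟨⟨(τ.foldStretch φ q v + 1) / 2, by linarith, by linarith⟩, ?_⟩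
      have := hpt v ⟨(τ.foldStretch φ q v + 1) / 2, by linarith, by linarith⟩ (abs_le.2 hv)
        (by ring)
      simp only [this, hy']
  -- The segment is defined through `Σ⁺`; in the other copy it is the image of the mate, hence the
  -- same set.
  obtain ⟨⟨_ | _, t⟩, i⟩ := p
  · have hl : τ.IsLoopSide (t.1, i) := ⟨q, h⟩
    rw [← (hτ.isGluing_double φ).range_mate, hτ.doubleMate_loop (p := ((false, t), i)) hl]
    exact key _ rfl h
  · exact key _ rfl h

/-- The triangulation of the double. -/
noncomputable def doubleTriangulation {O' : OrientedSurface (τ.Double φ)}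
    (hO : O'.atlas = positiveAtlas (hτ.doubleChi φ)) :
    IdealTriangulation O' (τ.doubleMarked φ M) where
  T := Bool × τ.PlainTri
  finite := inferInstance
  mate := hτ.doubleMate
  mate_mate := hτ.doubleMate_doubleMate
  χ := ⟨hτ.doubleChi φ, hτ.continuous_doubleChi φ⟩
  surjective := hτ.doubleChi_surjective φ
  eq_iff := (hτ.isGluing_double φ).eq_iff
  vertices := hτ.range_doubleChi_corner φ
  positive t z hz e he hs := by
    rw [hO] at he
    exact he t z hz hs

theorem arcs_doubleTriangulation {O' : OrientedSurface (τ.Double φ)}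
    (hO : O'.atlas = positiveAtlas (hτ.doubleChi φ)) :
    (hτ.doubleTriangulation φ hO).arcs = τ.doubleArcs φ := by
  refine subset_antisymm ?_ ?_
  · rintro _ ⟨p, hp, rfl⟩
    by_cases hl : τ.IsLoopSide (p.1.2.1, p.2)
    · obtain ⟨q, hq⟩ := hl
      exact .inr ⟨q, hτ.range_doubleChi_loop φ hq⟩
    · refine .inl ⟨p.1.1, (p.1.2.1, p.2), ⟨fun e => hp (hτ.doubleMate_eq_iff.2 e), p.1.2.2,
        plain_mate p.1.2.2 hl⟩, hτ.range_doubleChi_side φ hl⟩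
  · rintro _ (⟨ε, p, ⟨h1, h2, h3⟩, rfl⟩ | ⟨q, rfl⟩)
    · have hl : ¬ τ.IsLoopSide p := by
        rintro ⟨q, rfl⟩
        rw [τ.mate_mate] at h3
        exact h3 _ q.2
      exact ⟨((ε, ⟨p.1, h2⟩), p.2), fun e => h1 (hτ.doubleMate_eq_iff.1 e),
        (hτ.range_doubleChi_side φ (p := ((ε, ⟨p.1, h2⟩), p.2)) hl).symm⟩
    · have hq : τ.mate q.1 = ((hτ.baseTri (τ.mate q.1).1).1, (τ.mate q.1).2) :=
        Prod.ext (hτ.base_mate q).symm rfl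
      exact ⟨((true, hτ.baseTri (τ.mate q.1).1), (τ.mate q.1).2), hτ.doubleMate_ne ⟨q, hq⟩,
        (hτ.range_doubleChi_loop φ (p := ((true, hτ.baseTri (τ.mate q.1).1), (τ.mate q.1).2)) hq).symm⟩

theorem isMarkedSurface_double {O' : OrientedSurface (τ.Double φ)}
    (hO : O'.atlas = positiveAtlas (hτ.doubleChi φ))
    (hb : ∀ p, hτ.doubleMate p = p → ∀ x, hτ.doubleChi φ (sidePt p x) ∈ O'.boundary) :
    O'.IsMarkedSurface (τ.doubleMarked φ M) ∅ := by
  have h := hτ.isGluing_double φ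
  have ht := hτ.t2Space_double φ
  refine ⟨ht, hτ.compactSpace_double φ, hτ.connectedSpace_double φ, ?_, ?_, ?_, ?_, finite_empty,
    empty_disjoint _⟩
  · obtain ⟨p, hp⟩ := hτ.unglued
    exact ⟨_, hb ((true, ⟨p.1, hτ.plain_of_mate_eq hp⟩), p.2) (hτ.doubleMate_eq_iff.2 hp) 0⟩
  · rw [← hτ.range_doubleChi_corner φ]
    exact finite_range _
  · rw [← hτ.range_doubleChi_corner φ]
    rintro _ ⟨c, rfl⟩
    obtain ⟨p, hp, e⟩ := h.exists_unglued_of_corner hτ.isLinear_doubleMate c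
    simp only [e]
    exact hb p hp 1
  · intro x hx
    rw [← hτ.range_doubleChi_corner φ]
    exact h.component_inter_corners O' (fun t z hz e he hs => by rw [hO] at he; exact he t z hz hs) hb hx

/-- An original triangle enters its merged triangle by a map of local degree one, and the charts
have local degree one on the merged triangles. -/
theorem isCompatible_double {O' : OrientedSurface (τ.Double φ)}
    (hO : O'.atlas = positiveAtlas (hτ.doubleChi φ)) : τ.IsCompatible φ O' := by
  intro ε t z hz e he hs
  rw [hO] at he
  let m : Tri → Tri := fun w => ⟨τ.mergeTri φ t w, hτ.mergeTri_mem φ t w⟩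
  have hm : ∀ w : Tri, τ.doubleMk φ (ε, τ.cutMk ⟨t, w⟩) = hτ.doubleChi φ ⟨(ε, hτ.baseTri t), m w⟩ :=
    fun w => (hτ.doubleChi_doubleTri φ (ε, ⟨t, w⟩)).symm
  have hmz : (m z : ℂ) ∈ interior Tri := hτ.mergeTri_mem_interior φ t hz
  rw [hm] at hs
  simp only [hm]
  set f : Tri → ℂ := fun w => (e (hτ.doubleChi φ ⟨(ε, hτ.baseTri t), w⟩) : ℂ) with hf
  have hpos : IsPositiveAt (extendZero f) (m z) := (positiveAt_iff.1 (he _ _ hmz hs)).2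
  refine .of_eventuallyEq (Tri_mem_nhds hz)
    (IsPositiveAt.comp (F := extendZero f) (f := τ.mergeTri φ t) hpos (hτ.isPositiveAt_mergeTri φ t hz)
      (hτ.continuous_mergeTri φ t).continuousAt ?_) (.of_forall fun w => (extendZero_apply f (m w)).symm)
  change ∀ᶠ w in 𝓝 ((m z : Tri) : ℂ), ContinuousAt (extendZero f) w
  have hc : Continuous fun w : Tri => hτ.doubleChi φ ⟨(ε, hτ.baseTri t), w⟩ :=
    (hτ.continuous_doubleChi φ).comp continuous_sigmaMk
  have hev : ∀ᶠ w : Tri in 𝓝 (m z), hτ.doubleChi φ ⟨(ε, hτ.baseTri t), w⟩ ∈ e.source :=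
    (e.open_source.preimage hc).mem_nhds hs
  have hint : ∀ᶠ w in 𝓝 ((m z : Tri) : ℂ), w ∈ interior Tri := isOpen_interior.mem_nhds hmz
  rw [← map_nhds_subtype_coe_eq_nhds (m z).2 (Tri_mem_nhds hmz), Filter.eventually_map] at hint ⊢
  filter_upwards [hev, hint] with w hw hw'
  refine continuousAt_extendZero (Tri_mem_nhds hw') ?_
  exact continuous_subtype_val.continuousAt.comp
    (ContinuousAt.comp (f := fun w => hτ.doubleChi φ ⟨(ε, hτ.baseTri t), w⟩) (e.continuousAt hw)
      hc.continuousAt)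

/-- The double is a marked surface, which is triangulated by the given arcs. -/
theorem exists_double : ∃ O' : OrientedSurface (τ.Double φ),
    O'.atlas = positiveAtlas (hτ.doubleChi φ) ∧ O'.IsMarkedSurface (τ.doubleMarked φ M) ∅ ∧
      τ.IsCompatible φ O' := by
  have := hτ.t2Space_double φ
  obtain ⟨O', hO, hb⟩ := (hτ.isGluing_double φ).exists_orientedSurface hτ.isLinear_doubleMate
  exact ⟨O', hO, hτ.isMarkedSurface_double φ hO hb, hτ.isCompatible_double φ hO⟩

end IsTame

end

end IdealTriangulation

/-! ### Computations in the skew group algebra -/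

section

namespace CPA

variable {k : Type v} [Field k] {Q : Quiv.{u}}

/-- A linear combination of paths of length zero. -/
def vert (g : Q.V → k) : CPA k Q := fun w => match w.arrows with
  | [] => g w.src
  | _ :: _ => 0

/-- A linear combination of arrows. -/
def arr (h : Q.A → k) : CPA k Q := fun w => match w.arrows with
  | [x] => h x
  | _ => 0

theorem vert_ne_nil (g : Q.V → k) {w : Q.Walk} (hw : w.arrows ≠ []) : vert g w = 0 := by
  obtain ⟨v, _ | ⟨x, l⟩, h⟩ := w
  · exact absurd rfl hw
  · rfl

theorem arr_length_ne (h : Q.A → k) {w : Q.Walk} (hw : w.length ≠ 1) : arr h w = 0 := by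
  obtain ⟨v, _ | ⟨x, _ | ⟨y, l⟩⟩, hl⟩ := w
  · rfl
  · exact absurd rfl hw
  · rfl

theorem vert_mul (g : Q.V → k) (f : CPA k Q) (w : Q.Walk) : (vert g * f) w = g w.tgt * f w := by
  rw [mul_apply, Finset.sum_eq_single 0]
  · simp [vert, Quiv.Walk.left, Quiv.Walk.right, Quiv.Walk.tgt]
  · intro n hn h0
    rw [vert_ne_nil, zero_mul]
    intro h
    simp only [Quiv.Walk.left, List.take_eq_nil_iff] at h
    simp only [Finset.mem_range, Quiv.Walk.length] at hn
    rcases h with h | h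
    · exact h0 h
    · simp [h] at hn; omega
  · simp

theorem mul_vert (g : Q.V → k) (f : CPA k Q) (w : Q.Walk) : (f * vert g) w = f w * g w.src := by
  rw [mul_apply, Finset.sum_eq_single w.length]
  · have : w.left w.length = w := by
      ext1 <;> simp [Quiv.Walk.left, Quiv.Walk.length, Quiv.endpt]
    rw [this]
    simp [vert, Quiv.Walk.right, Quiv.Walk.length]
  · intro n hn h0
    rw [vert_ne_nil, mul_zero]
    intro h
    simp only [Finset.mem_range, Quiv.Walk.length] at hn h0
    have := congrArg List.length h
    simp [Quiv.Walk.right] at this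
    omega
  · simp

theorem arr_mul_nil (h : Q.A → k) (f : CPA k Q) (v : Q.V) (hv : Q.IsWalk v []) :
    (arr h * f) ⟨v, [], hv⟩ = 0 := by
  rw [mul_apply]
  refine Finset.sum_eq_zero fun n _ => ?_
  rw [arr_length_ne, zero_mul]
  simp [Quiv.Walk.left, Quiv.Walk.length]

theorem arr_mul_cons (h : Q.A → k) (f : CPA k Q) {v : Q.V} {x : Q.A} {l : List Q.A}
    (hl : Q.IsWalk v (x :: l)) : (arr h * f) ⟨v, x :: l, hl⟩ = h x * f ⟨v, l, hl.2⟩ := by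
  rw [mul_apply, Finset.sum_eq_single 1]
  · rfl
  · intro n hn h1
    rw [arr_length_ne, zero_mul]
    simp only [Finset.mem_range, Quiv.Walk.length, List.length_cons] at hn
    simp only [Quiv.Walk.left, Quiv.Walk.length, List.length_take, List.length_cons]
    omega
  · simp [Quiv.Walk.length]

theorem vert_mul_arr (g : Q.V → k) (h : Q.A → k) : vert g * arr h = arr fun x => g (Q.t x) * h x := by
  ext w
  rw [vert_mul]
  obtain ⟨v, _ | ⟨x, _ | ⟨y, l⟩⟩, hl⟩ := w
  · simp [arr]
  · rfl
  · simp [arr]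

theorem arr_mul_vert (g : Q.V → k) (h : Q.A → k) : arr h * vert g = arr fun x => h x * g (Q.s x) := by
  ext w
  rw [mul_vert]
  obtain ⟨v, _ | ⟨x, _ | ⟨y, l⟩⟩, hl⟩ := w
  · simp [arr]
  · simp only [arr]
    have : Q.s x = v := hl.1
    rw [this]
  · simp [arr]

theorem smul_vert (c : k) (g : Q.V → k) : c • vert g = vert fun v => c * g v := by
  ext ⟨v, _ | ⟨x, l⟩, hl⟩ <;> simp [vert, smul_apply]

theorem add_vert (g g' : Q.V → k) : vert g + vert g' = vert fun v => g v + g' v := by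
  ext ⟨v, _ | ⟨x, l⟩, hl⟩ <;> simp [vert, add_apply]

theorem smul_arr (c : k) (h : Q.A → k) : c • arr h = arr fun x => c * h x := by
  ext ⟨v, _ | ⟨x, _ | ⟨y, l⟩⟩, hl⟩ <;> simp [arr, smul_apply]

theorem add_arr (h h' : Q.A → k) : arr h + arr h' = arr fun x => h x + h' x := by
  ext ⟨v, _ | ⟨x, _ | ⟨y, l⟩⟩, hl⟩ <;> simp [arr, add_apply]

open Classical in
theorem idem_eq (v : Q.V) : idem k v = vert fun u => if u = v then 1 else 0 := by
  ext ⟨u, _ | ⟨x, l⟩, hl⟩ <;> simp [vert, idem, ofWalk, Quiv.Walk.nil, Quiv.Walk.ext_iff]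

open Classical in
theorem ofWalk_single (a : Q.A) : ofWalk k (Quiv.Walk.single a) = arr fun x => if x = a then 1 else 0 := by
  ext ⟨u, _ | ⟨x, _ | ⟨y, l⟩⟩, hl⟩
  · simp [arr, ofWalk, Quiv.Walk.single, Quiv.Walk.ext_iff]
  · have : Q.s x = u := hl.1
    simp only [arr, ofWalk, Quiv.Walk.single, Quiv.Walk.ext_iff, List.cons.injEq, and_true]
    congr 1
    exact propext ⟨And.right, fun h => ⟨by rw [← this, h], h⟩⟩
  · simp [arr, ofWalk, Quiv.Walk.single, Quiv.Walk.ext_iff]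

end CPA

namespace Quiv.Involution

open CPA

variable {k : Type v} [Field k] {Q : Quiv.{u}} {σ : Q.Involution}

theorem walk_left (w : Q.Walk) (n : ℕ) : (σ.walk w).left n = σ.walk (w.left n) := by
  ext1
  · simp only [walk, Walk.left, ← List.map_drop, σ.endpt_map]
  · simp [walk, Walk.left]

theorem walk_right (w : Q.Walk) (n : ℕ) : (σ.walk w).right n = σ.walk (w.right n) := by
  ext1
  · rfl
  · simp [walk, Walk.right]

theorem act_mul (f g : CPA k Q) : σ.act (f * g) = σ.act f * σ.act g := by
  ext w
  rw [mul_apply]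
  change (f * g) (σ.walk w) = _
  rw [mul_apply, show (σ.walk w).length = w.length by simp [walk, Walk.length]]
  refine Finset.sum_congr rfl fun n _ => ?_
  rw [walk_left, walk_right]
  rfl

theorem act_vert (g : Q.V → k) : σ.act (vert g) = vert fun v => g (σ.v v) := by
  ext ⟨v, _ | ⟨x, l⟩, hl⟩ <;> rfl

theorem act_arr (h : Q.A → k) : σ.act (arr h) = arr fun x => h (σ.a x) := by
  ext ⟨v, _ | ⟨x, _ | ⟨y, l⟩⟩, hl⟩ <;> rfl

theorem act_smul (c : k) (f : CPA k Q) : σ.act (c • f) = c • σ.act f := rfl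

theorem act_zero : σ.act (0 : CPA k Q) = 0 := rfl

/-- Products of elements which are multiples of `1 ± σ`. -/
theorem smul_pair {y x : CPA k Q} {η η' ζ : k} (hx : σ.act x = ζ • x) (hη : η * η = 1)
    (h : η' * η * ζ = 1) :
    smul (σ := σ) (y, η' • y) (x, η • x) = ((2 : k) • (y * x), η • ((2 : k) • (y * x))) := by
  have h2 : η' * ζ = η := by
    calc η' * ζ = (η * η) * (η' * ζ) := by rw [hη, one_mul]
      _ = η * (η' * η * ζ) := by ring
      _ = η := by rw [h, mul_one]
  refine Prod.ext ?_ ?_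
  · simp only [smul, act_smul, hx, smul_mul_assoc, mul_smul_comm, smul_smul]
    rw [show η * ζ * η' = 1 by rw [← h]; ring, one_smul, two_smul]
  · simp only [smul, hx, smul_mul_assoc, mul_smul_comm, smul_smul]
    rw [mul_comm ζ η', h2, mul_two, add_smul]

variable (k) in
/-- The sign `±1` as an element of a field. -/
def sgn (ε : Bool) : k := if ε then 1 else -1

theorem sgn_mul_self (ε : Bool) : sgn k ε * sgn k ε = 1 := by cases ε <;> simp [sgn]

variable (k σ) in
open Classical in
/-- The sign of the idempotent attached to the vertex `v`. -/
noncomputable def vsign (ε : Bool) (v : Q.V) : k := if σ.v v = v then sgn k ε else 1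

theorem vsign_mul_self (ε : Bool) (v : Q.V) : vsign k σ ε v * vsign k σ ε v = 1 := by
  unfold vsign
  split_ifs
  · exact sgn_mul_self ε
  · exact one_mul 1

theorem vsign_v (ε : Bool) (v : Q.V) : vsign k σ ε (σ.v v) = vsign k σ ε v := by
  unfold vsign
  congr 1
  rw [σ.v_v]
  exact propext eq_comm

variable (k σ) in
open Classical in
/-- The characteristic function of the orbit of `v`. -/
noncomputable def orbitFun (v u : Q.V) : k := if u = v ∨ u = σ.v v then 1 else 0

theorem orbitFun_self (v : Q.V) : orbitFun k σ v v = 1 := if_pos (.inl rfl)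

theorem orbitFun_v (v : Q.V) : orbitFun k σ v (σ.v v) = 1 := if_pos (.inr rfl)

theorem v_eq_iff {v u : Q.V} : σ.v u = v ↔ u = σ.v v :=
  ⟨fun h => by rw [← h, σ.v_v], fun h => by rw [h, σ.v_v]⟩

theorem a_eq_iff {x y : Q.A} : σ.a y = x ↔ y = σ.a x :=
  ⟨fun h => by rw [← h, σ.a_a], fun h => by rw [h, σ.a_a]⟩

theorem orbitFun_v_right (v u : Q.V) : orbitFun k σ v (σ.v u) = orbitFun k σ v u := by
  unfold orbitFun
  congr 1
  rw [v_eq_iff, v_eq_iff, σ.v_v, or_comm]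

theorem orbitFun_v_left (v : Q.V) : orbitFun k σ (σ.v v) = orbitFun k σ v := by
  funext u
  unfold orbitFun
  congr 1
  rw [σ.v_v, or_comm]

theorem OrbitReps.rep_cases (o : σ.OrbitReps) (v : Q.V) : o.rep v = v ∨ o.rep v = σ.v v := by
  unfold OrbitReps.rep
  split_ifs
  · exact .inl rfl
  · exact .inr rfl

theorem OrbitReps.rep_v (o : σ.OrbitReps) (v : Q.V) : o.rep (σ.v v) = o.rep v := by
  unfold OrbitReps.rep
  by_cases h1 : v ∈ o.vRep <;> by_cases h2 : σ.v v ∈ o.vRep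
  · rw [if_pos h1, if_pos h2, o.v_unique v h1 h2]
  · rw [if_pos h1, if_neg h2, σ.v_v]
  · rw [if_neg h1, if_pos h2]
  · exact absurd (o.v_mem v) (by tauto)

theorem OrbitReps.vertex_v (o : σ.OrbitReps) (v : Q.V) (ε : Bool) :
    o.vertex (σ.v v) ε = o.vertex v ε := by
  classical
  simp only [OrbitReps.vertex, o.rep_v]
  congr

variable (o : σ.OrbitReps)

theorem skewIdem_eq (x : SkewVertex o) : skewIdem o k x =
    ((2⁻¹ : k) • vert (orbitFun k σ x.1.1),
      (if x.1.2 then (2⁻¹ : k) else -2⁻¹) • vert (orbitFun k σ x.1.1)) := by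
  classical
  have hf : (if σ.v x.1.1 = x.1.1 then CPA.idem k x.1.1
    else CPA.idem k x.1.1 + CPA.idem k (σ.v x.1.1)) = vert (orbitFun k σ x.1.1) := by
    split_ifs with h
    · rw [idem_eq]
      congr 1
      funext u
      unfold orbitFun
      simp [h]
    · rw [idem_eq, idem_eq, add_vert]
      congr 1
      funext u
      unfold orbitFun
      by_cases h1 : u = x.1.1
      · have : u ≠ σ.v x.1.1 := fun h2 => h (h2 ▸ h1)
        simp [h1, Ne.symm h]
      · by_cases h2 : u = σ.v x.1.1 <;> simp [h1, h2, h]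
  unfold skewIdem
  simp only [hf]

theorem skewIdem_vertex (v : Q.V) (ε : Bool) : skewIdem o k (o.vertex v ε) =
    ((2⁻¹ : k) • vert (orbitFun k σ v), vsign k σ ε v • ((2⁻¹ : k) • vert (orbitFun k σ v))) := by
  have h1 : orbitFun k σ (o.rep v) = orbitFun k σ v := by
    rcases o.rep_cases v with h | h
    · rw [h]
    · rw [h, orbitFun_v_left]
  have h2 : vsign k σ ε (o.rep v) = vsign k σ ε v := by
    rcases o.rep_cases v with h | h
    · rw [h]
    · rw [h, vsign_v]
  rw [skewIdem_eq, ← h2]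
  simp only [OrbitReps.vertex, h1, vsign, smul_smul]
  congr 2
  split_ifs <;> cases ε <;> simp_all [sgn]

open Classical in
variable (k) in
/-- The coefficients of an arrow of `Q_G` in the skew group algebra. -/
noncomputable def arrowCoeff (x : (skewQuiver o).A) (y : Q.A) : k :=
  2⁻¹ * 2⁻¹ * ((if y = x.1.1 then 1 else 0) +
    vsign k σ x.1.2 (Q.s x.1.1) * vsign k σ x.1.2 (Q.t x.1.1) * if σ.a y = x.1.1 then 1 else 0)

/-- With `a` and `b` the signs at the source and at the target, `½(1 + bσ) α ½(1 + aσ)` expands to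
`¼(α + ab σ(α)) (1 + aσ)`. The second component is thus a multiple of the first, which is the form
that `smul_pair` multiplies. -/
theorem skewArrow_eq (x : (skewQuiver o).A) : skewArrow o k x =
    (arr (arrowCoeff k o x), vsign k σ x.1.2 (Q.s x.1.1) • arr (arrowCoeff k o x)) := by
  classical
  have ht : skewIdem o k ((skewQuiver o).t x) = _ := skewIdem_vertex o (Q.t x.1.1) x.1.2
  have hs : skewIdem o k ((skewQuiver o).s x) = _ := skewIdem_vertex o (Q.s x.1.1) x.1.2
  rw [skewArrow, ht, hs, ofWalk_single]
  have e1 : vsign k σ x.1.2 (Q.s x.1.1) * vsign k σ x.1.2 (Q.s x.1.1) = 1 := vsign_mul_self _ _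
  have hy : ∀ y, (y = x.1.1 → orbitFun k σ (Q.t x.1.1) (Q.t y) = 1 ∧
      orbitFun k σ (Q.s x.1.1) (Q.s y) = 1) ∧ (σ.a y = x.1.1 → orbitFun k σ (Q.t x.1.1) (Q.t y) = 1 ∧
      orbitFun k σ (Q.s x.1.1) (Q.s y) = 1) := by
    intro y
    constructor
    · rintro h; rw [h]; exact ⟨orbitFun_self _, orbitFun_self _⟩
    · intro h
      rw [a_eq_iff.1 h, σ.t_a, σ.s_a]
      exact ⟨orbitFun_v _, orbitFun_v _⟩
  set a := vsign k σ x.1.2 (Q.s x.1.1)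
  set b := vsign k σ x.1.2 (Q.t x.1.1)
  refine Prod.ext ?_ ?_
  · simp only [smul, act_vert, act_arr, orbitFun_v_right, act_zero, mul_zero, add_zero, zero_add,
      smul_vert, vert_mul_arr, arr_mul_vert, add_arr]
    congr 1
    funext y
    rw [arrowCoeff]
    obtain ⟨h1, h2⟩ := hy y
    by_cases h3 : y = x.1.1 <;> by_cases h4 : σ.a y = x.1.1
    · simp [h3, h3 ▸ h4, orbitFun_self, a, b]; ring
    · simp [h3, h3 ▸ h4, orbitFun_self]
    · simp [h3, h4, h2 h4, a, b]; ring
    · simp [h3, h4]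
  · simp only [smul, act_vert, act_arr, orbitFun_v_right, act_zero, mul_zero, add_zero, zero_add,
      smul_vert, vert_mul_arr, arr_mul_vert, add_arr, smul_arr]
    congr 1
    funext y
    rw [arrowCoeff]
    obtain ⟨h1, h2⟩ := hy y
    by_cases h3 : y = x.1.1 <;> by_cases h4 : σ.a y = x.1.1
    · simp [h3, h3 ▸ h4, orbitFun_self, a, b]
      linear_combination (-(2⁻¹ * 2⁻¹ * b)) * e1
    · simp [h3, h3 ▸ h4, orbitFun_self]; ring
    · simp [h3, h4, h2 h4, a, b]
      linear_combination (-(2⁻¹ * 2⁻¹ * b)) * e1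
    · simp [h3, h4]

/-- The element `α + ab σ(α)` is an eigenvector of `σ` with eigenvalue `ab`, since `(ab)² = 1`. -/
theorem act_arr_arrowCoeff (x : (skewQuiver o).A) : σ.act (arr (arrowCoeff k o x)) =
    (vsign k σ x.1.2 (Q.s x.1.1) * vsign k σ x.1.2 (Q.t x.1.1)) • arr (arrowCoeff k o x) := by
  classical
  rw [act_arr, smul_arr]
  congr 1
  funext y
  have e1 : vsign k σ x.1.2 (Q.s x.1.1) * vsign k σ x.1.2 (Q.s x.1.1) = 1 := vsign_mul_self _ _
  have e2 : vsign k σ x.1.2 (Q.t x.1.1) * vsign k σ x.1.2 (Q.t x.1.1) = 1 := vsign_mul_self _ _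
  simp only [arrowCoeff, σ.a_a]
  set a := vsign k σ x.1.2 (Q.s x.1.1)
  set b := vsign k σ x.1.2 (Q.t x.1.1)
  have e : a * b * (a * b) = 1 := by linear_combination (b * b) * e1 + e2
  linear_combination (-(2⁻¹ * 2⁻¹ * (if σ.a y = x.1.1 then 1 else 0))) * e

end Quiv.Involution

end

/-! ### The potential on `Q_G` -/

section

open CPA

open Classical in
/-- The sum of the cyclic paths formed by arrows that come from the corners of one triangle, where
the arrow `x` comes from the corner `cor x`. -/
noncomputable def cornerPotential (k : Type v) [Field k] {Q : Quiv.{u}} {T : Type w}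
    (cor : Q.A → T × Fin 3) : CPA k Q := fun p =>
  if ∃ (t : T) (x y z : Q.A), cor x = (t, 0) ∧ cor y = (t, 2) ∧ cor z = (t, 1) ∧
      p.src = p.tgt ∧ p.arrows = [z, y, x] then 1 else 0

namespace Quiv.Involution

variable {k : Type v} [Field k] {Q : Quiv.{u}} {σ : Q.Involution}

/-- The action of `σ` preserves the corners from which the arrows come, and the corner of an arrow
determines its orbit and the orbits of its end points, at most one of which is not trivial. -/
structure IsCornerAction (σ : Q.Involution) {T : Type w} (cor : Q.A → T × Fin 3) : Prop where
  fixed : ∀ x, σ.v (Q.s x) = Q.s x ∨ σ.v (Q.t x) = Q.t x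
  a_eq : ∀ x, σ.v (Q.s x) = Q.s x → σ.v (Q.t x) = Q.t x → σ.a x = x
  cor_eq_iff : ∀ x y, cor x = cor y ↔ y = x ∨ y = σ.a x
  next : ∀ x y, cor y = ((cor x).1, (cor x).2 + 2) → Q.s y = Q.t x ∨ Q.s y = σ.v (Q.t x)

section Signs

variable (o : σ.OrbitReps)

variable (k) in
open Classical in
/-- The sign attached to the vertex `v`, with respect to the representative of its orbit. -/
noncomputable def repSign (ε : Bool) (v : Q.V) : k := if v ∈ o.vRep then 1 else sgn k ε

theorem repSign_true (v : Q.V) : repSign k o true v = 1 := by simp [repSign, sgn]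

theorem repSign_mul_self (ε : Bool) (v : Q.V) : repSign k o ε v * repSign k o ε v = 1 := by
  unfold repSign
  split_ifs
  · exact one_mul 1
  · exact sgn_mul_self ε

theorem repSign_ne_zero (ε : Bool) (v : Q.V) : repSign k o ε v ≠ 0 := fun h => by
  simpa [h] using repSign_mul_self (k := k) o ε v

theorem repSign_fixed (ε : Bool) {v : Q.V} (h : σ.v v = v) : repSign k o ε v = 1 :=
  if_pos ((o.v_mem v).elim id fun h' => h ▸ h')

theorem repSign_v (ε : Bool) {v : Q.V} (h : σ.v v ≠ v) :
    repSign k o ε (σ.v v) = sgn k ε * repSign k o ε v := by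
  unfold repSign
  by_cases h1 : v ∈ o.vRep <;> by_cases h2 : σ.v v ∈ o.vRep
  · exact absurd (o.v_unique v h1 h2) h
  · simp [h1, h2]
  · simp [h1, h2, sgn_mul_self]
  · exact absurd (o.v_mem v) (by tauto)

variable (k) in
open Classical in
/-- The scalars relating the arrows of `Q_G` to the arrows that come from the corners. -/
noncomputable def arrowScale (x : (skewQuiver o).A) : k :=
  (if σ.a x.1.1 = x.1.1 then 1 else 2) *
    (repSign k o x.1.2 (Q.s x.1.1) * repSign k o x.1.2 (Q.t x.1.1))

theorem arrowScale_ne_zero (hk : (2 : k) ≠ 0) (x : (skewQuiver o).A) : arrowScale k o x ≠ 0 := by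
  unfold arrowScale
  refine mul_ne_zero ?_ (mul_ne_zero (repSign_ne_zero o _ _) (repSign_ne_zero o _ _))
  split_ifs
  · exact one_ne_zero
  · exact hk

theorem arrowCoeff_eq_zero {x : (skewQuiver o).A} {y : Q.A} (h : y ≠ x.1.1)
    (h' : y ≠ σ.a x.1.1) : arrowCoeff k o x y = 0 := by
  unfold arrowCoeff
  rw [if_neg h, if_neg fun e => h' (a_eq_iff.1 e), mul_zero, add_zero, mul_zero]

variable {T : Type w} {cor : Q.A → T × Fin 3} (hc : IsCornerAction σ cor)
include hc

theorem IsCornerAction.cor_a (x : Q.A) : cor (σ.a x) = cor x :=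
  ((hc.cor_eq_iff x (σ.a x)).2 (.inr rfl)).symm

/-- After rescaling, the coefficients split into a sign at each end, so that along a path the signs
at intermediate vertices occur twice and disappear. For a fixed arrow both terms of `arrowCoeff`
fall on the same path, which explains the factor `1` instead of `2` in `arrowScale`. Otherwise
exactly one end is not fixed, and passing from `α` to `σ α` changes the sign at this end. -/
theorem IsCornerAction.arrowScale_mul_arrowCoeff (hk : (2 : k) ≠ 0) (x : (skewQuiver o).A)
    {y : Q.A} (hy : y = x.1.1 ∨ y = σ.a x.1.1) : arrowScale k o x * arrowCoeff k o x y =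
      2⁻¹ * (repSign k o x.1.2 (Q.s y) * repSign k o x.1.2 (Q.t y)) := by
  classical
  obtain ⟨⟨a, ε⟩, hx⟩ := x
  unfold arrowScale arrowCoeff
  simp only at hy ⊢
  by_cases ha : σ.a a = a
  · have hs : σ.v (Q.s a) = Q.s a := by rw [← σ.s_a, ha]
    have ht : σ.v (Q.t a) = Q.t a := by rw [← σ.t_a, ha]
    have hya : y = a := by rw [ha, or_self] at hy; exact hy
    rw [hya]
    simp only [ha, if_true, vsign, hs, ht, sgn_mul_self]
    field_simp
    ring
  · rcases hy with rfl | rfl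
    · simp only [ha, if_true, if_false]
      field_simp
      ring
    · rw [σ.a_a, if_neg ha, if_pos rfl, if_neg ha, σ.s_a, σ.t_a]
      rcases hc.fixed a with h | h
      · have h' : σ.v (Q.t a) ≠ Q.t a := fun h' => ha (hc.a_eq a h h')
        rw [repSign_v o ε h', h, vsign, if_pos h, vsign, if_neg h']
        field_simp
        ring
      · have h' : σ.v (Q.s a) ≠ Q.s a := fun h' => ha (hc.a_eq a h' h)
        rw [repSign_v o ε h', h, vsign, if_neg h', vsign, if_pos h]
        field_simp
        ring

end Signs

section Walks

variable (o : σ.OrbitReps)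

theorem vsign_rep (ε : Bool) (v : Q.V) : vsign k σ ε (o.rep v) = vsign k σ ε v := by
  rcases o.rep_cases v with h | h
  · rw [h]
  · rw [h, vsign_v]

theorem vsign_eq_of_vertex_eq {ε δ : Bool} {u v : Q.V} (h : o.vertex u ε = o.vertex v δ) :
    vsign k σ ε u = vsign k σ δ v := by
  have h1 : (o.rep u, _) = (o.rep v, _) := congrArg Subtype.val h
  rw [← vsign_rep o ε u, ← vsign_rep o δ v]
  obtain ⟨h2, h3⟩ := Prod.ext_iff.1 h1
  simp only at h2 h3
  rw [h2] at h3 ⊢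
  unfold vsign
  split_ifs with hv
  · simp only [hv, if_true] at h3
    rw [h3]
  · rfl

theorem smul_skewArrow_skewIdem (hk : (2 : k) ≠ 0) (x : (skewQuiver o).A) :
    smul (skewArrow o k x) (skewIdem o k ((skewQuiver o).s x)) = skewArrow o k x := by
  have hs : skewIdem o k ((skewQuiver o).s x) = _ := skewIdem_vertex o (Q.s x.1.1) x.1.2
  rw [hs, skewArrow_eq, smul_pair (ζ := 1)]
  · have : (2 : k) • (arr (arrowCoeff k o x) * (2⁻¹ : k) • vert (orbitFun k σ (Q.s x.1.1))) =
        arr (arrowCoeff k o x) := by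
      rw [mul_smul_comm, smul_smul, mul_inv_cancel₀ hk, one_smul, arr_mul_vert]
      congr 1
      funext y
      by_cases h1 : y = x.1.1
      · rw [h1, orbitFun_self, mul_one]
      · by_cases h2 : y = σ.a x.1.1
        · rw [h2, σ.s_a, orbitFun_v, mul_one]
        · rw [arrowCoeff_eq_zero o h1 h2, zero_mul]
    rw [this]
  · rw [act_smul, act_vert, one_smul]
    congr 2
    funext u
    exact orbitFun_v_right _ _
  · exact vsign_mul_self _ _
  · rw [mul_one]
    exact vsign_mul_self _ _

/-- Composability in `Q_G` makes the sign at the target of each arrow equal to the sign at the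
source of the next, so `smul_pair` applies. Each of the two products contributes a factor `2`. -/
theorem skewWalk_eq (hk : (2 : k) ≠ 0) {p : (skewQuiver o).Walk} {x y z : (skewQuiver o).A}
    (hp : p.arrows = [z, y, x]) : skewWalk o k p =
      ((4 : k) • (arr (arrowCoeff k o z) * (arr (arrowCoeff k o y) * arr (arrowCoeff k o x))),
        vsign k σ x.1.2 (Q.s x.1.1) • (4 : k) •
          (arr (arrowCoeff k o z) * (arr (arrowCoeff k o y) * arr (arrowCoeff k o x)))) := by
  obtain ⟨v, l, hl⟩ := p
  subst hp
  obtain ⟨h2, h1, h0, -⟩ := hl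
  have h0' : v = (skewQuiver o).s x := h0.symm
  have e1 : vsign k σ y.1.2 (Q.s y.1.1) = vsign k σ x.1.2 (Q.t x.1.1) :=
    vsign_eq_of_vertex_eq o h1
  have e2 : vsign k σ z.1.2 (Q.s z.1.1) = vsign k σ y.1.2 (Q.t y.1.1) :=
    vsign_eq_of_vertex_eq o h2
  have sx : vsign k σ x.1.2 (Q.s x.1.1) * vsign k σ x.1.2 (Q.s x.1.1) = 1 := vsign_mul_self _ _
  have tx : vsign k σ x.1.2 (Q.t x.1.1) * vsign k σ x.1.2 (Q.t x.1.1) = 1 := vsign_mul_self _ _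
  have ty : vsign k σ y.1.2 (Q.t y.1.1) * vsign k σ y.1.2 (Q.t y.1.1) = 1 := vsign_mul_self _ _
  simp only [skewWalk, List.foldr_cons, List.foldr_nil]
  rw [h0', smul_skewArrow_skewIdem o hk, skewArrow_eq o x, skewArrow_eq o y, skewArrow_eq o z,
    smul_pair (act_arr_arrowCoeff o x) sx, smul_pair (ζ :=
      vsign k σ y.1.2 (Q.s y.1.1) * vsign k σ y.1.2 (Q.t y.1.1) *
        (vsign k σ x.1.2 (Q.s x.1.1) * vsign k σ x.1.2 (Q.t x.1.1))) _ sx]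
  · have : (2 : k) • (arr (arrowCoeff k o z) *
        (2 : k) • (arr (arrowCoeff k o y) * arr (arrowCoeff k o x))) = (4 : k) •
          (arr (arrowCoeff k o z) * (arr (arrowCoeff k o y) * arr (arrowCoeff k o x))) := by
      rw [mul_smul_comm, smul_smul]
      norm_num
    rw [this]
  · rw [e1, e2]
    linear_combination (vsign k σ y.1.2 (Q.t y.1.1) * vsign k σ y.1.2 (Q.t y.1.1) *
      (vsign k σ x.1.2 (Q.t x.1.1) * vsign k σ x.1.2 (Q.t x.1.1))) * sx +
      (vsign k σ y.1.2 (Q.t y.1.1) * vsign k σ y.1.2 (Q.t y.1.1)) * tx + ty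
  · rw [act_smul, act_mul, act_arr_arrowCoeff, act_arr_arrowCoeff, smul_mul_smul_comm, smul_comm]
  · rw [e1]
    linear_combination (vsign k σ x.1.2 (Q.t x.1.1) * vsign k σ x.1.2 (Q.t x.1.1)) * sx + tx

theorem arr_mul_arr_mul_arr (h h' h'' : Q.A → k) {w : Q.Walk} {a b c : Q.A}
    (hw : w.arrows = [c, b, a]) : (arr h * (arr h' * arr h'')) w = h c * (h' b * h'' a) := by
  obtain ⟨v, l, hl⟩ := w
  subst hw
  rw [arr_mul_cons, arr_mul_cons]
  rfl

theorem exists_of_arr_mul_arr_mul_arr_ne_zero {h h' h'' : Q.A → k} {w : Q.Walk}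
    (hw : (arr h * (arr h' * arr h'')) w ≠ 0) :
    ∃ a b c, w.arrows = [c, b, a] ∧ h c ≠ 0 ∧ h' b ≠ 0 ∧ h'' a ≠ 0 := by
  obtain ⟨v, _ | ⟨c, _ | ⟨b, l⟩⟩, hl⟩ := w
  · exact absurd (arr_mul_nil _ _ _ _) hw
  · rw [arr_mul_cons, arr_mul_nil, mul_zero] at hw
    exact absurd rfl hw
  · rw [arr_mul_cons, arr_mul_cons] at hw
    have h1 := left_ne_zero_of_mul (right_ne_zero_of_mul hw)
    have h2 := right_ne_zero_of_mul (right_ne_zero_of_mul hw)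
    obtain _ | ⟨a, _ | ⟨d, l⟩⟩ := l
    · exact absurd rfl h2
    · exact ⟨a, b, c, rfl, left_ne_zero_of_mul hw, h1, h2⟩
    · exact absurd rfl h2

end Walks

end Quiv.Involution

end

section

open CPA

theorem CPA.sum_apply {k : Type v} [Field k] {Q : Quiv.{u}} {ι : Type*} (s : Finset ι)
    (f : ι → CPA k Q) (p : Q.Walk) : (∑ i ∈ s, f i) p = ∑ i ∈ s, f i p :=
  map_sum (⟨⟨fun f : CPA k Q => f p, rfl⟩, fun _ _ => rfl⟩ : CPA k Q →+ k) f s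

namespace Quiv.Involution

variable {k : Type v} [Field k] {Q : Quiv.{u}} {σ : Q.Involution}

section Unit

variable (o : σ.OrbitReps)

theorem OrbitReps.rep_eq_of_mem {v : Q.V} (h : v ∈ o.vRep) : o.rep v = v := if_pos h

theorem OrbitReps.vertex_self (x : SkewVertex o) : o.vertex x.1.1 x.1.2 = x := by
  classical
  refine Subtype.ext (Prod.ext (o.rep_eq_of_mem x.2.1) ?_)
  simp only [OrbitReps.vertex, o.rep_eq_of_mem x.2.1]
  split_ifs with h
  · rfl
  · exact (x.2.2 h).symm

theorem OrbitReps.vertex_true_or_false {u : Q.V} (x : SkewVertex o)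
    (h : orbitFun k σ x.1.1 u ≠ 0) : x = o.vertex u true ∨ x = o.vertex u false := by
  have hu : u = x.1.1 ∨ u = σ.v x.1.1 := by
    by_contra h'
    exact h (if_neg h')
  have : o.vertex u x.1.2 = x := by
    rcases hu with h | h
    · rw [h, o.vertex_self]
    · rw [h, o.vertex_v, o.vertex_self]
  rw [← this]
  cases x.1.2
  · exact .inr rfl
  · exact .inl rfl

theorem orbitFun_rep (u : Q.V) : orbitFun k σ (o.rep u) u = 1 := by
  rcases o.rep_cases u with h | h
  · rw [h, orbitFun_self]
  · rw [h, orbitFun_v_left, orbitFun_self]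

theorem OrbitReps.fixed_rep_iff (u : Q.V) : σ.v (o.rep u) = o.rep u ↔ σ.v u = u := by
  rcases o.rep_cases u with h | h
  · rw [h]
  · rw [h, σ.v_v, eq_comm]

open Classical in
theorem finsum_vertex [Finite Q.V] (u : Q.V) (c : Bool → k) :
    ∑ᶠ x : SkewVertex o, c x.1.2 * orbitFun k σ x.1.1 u =
      if σ.v u = u then c true + c false else c true := by
  classical
  rw [finsum_eq_sum_of_support_subset (s := {o.vertex u true, o.vertex u false})]
  · split_ifs with h
    · have hr := (o.fixed_rep_iff u).2 h
      have ht : (o.vertex u true).1 = (o.rep u, true) := Prod.ext rfl (if_pos hr)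
      have hf : (o.vertex u false).1 = (o.rep u, false) := Prod.ext rfl (if_pos hr)
      rw [Finset.sum_pair, ht, hf, orbitFun_rep, mul_one, mul_one]
      intro e
      rw [e, hf] at ht
      simp at ht
    · have hr := fun h' => h ((o.fixed_rep_iff u).1 h')
      have ht : (o.vertex u true).1 = (o.rep u, true) := Prod.ext rfl (if_neg hr)
      have hf : o.vertex u false = o.vertex u true := Subtype.ext <| by
        rw [ht]; exact Prod.ext rfl (if_neg hr)
      rw [hf, Finset.pair_eq_singleton, Finset.sum_singleton, ht, orbitFun_rep, mul_one]
  · intro x hx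
    simpa using o.vertex_true_or_false x (right_ne_zero_of_mul hx)

instance [Finite Q.V] : Finite (SkewVertex o) := inferInstanceAs (Finite (Subtype _))

open Classical in
-- At a fixed vertex the idempotents with the two signs add up to `e_i ⊗ 1`; an orbit with two
-- elements contributes only `½(e_j + e_{σj}) ⊗ (1 + σ)`.
theorem skewUnit_eq [Finite Q.V] (hk : (2 : k) ≠ 0) :
    skewUnit o k = (vert fun v => if σ.v v = v then 1 else 2⁻¹,
      vert fun v => if σ.v v = v then 0 else 2⁻¹) := by
  classical
  have := Fintype.ofFinite (SkewVertex o)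
  rw [skewUnit, finsum_eq_sum_of_fintype]
  refine Prod.ext ?_ ?_
  · rw [Prod.fst_sum]
    ext p
    rw [CPA.sum_apply]
    simp only [skewIdem_eq, smul_vert]
    obtain ⟨u, _ | ⟨x, l⟩, hl⟩ := p
    · have := finsum_vertex (k := k) o u fun _ => 2⁻¹
      rw [finsum_eq_sum_of_fintype] at this
      refine this.trans ?_
      simp only [vert]
      split_ifs
      · rw [← two_mul, mul_inv_cancel₀ hk]
      · rfl
    · exact Finset.sum_eq_zero fun _ _ => rfl
  · rw [Prod.snd_sum]
    ext p
    rw [CPA.sum_apply]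
    simp only [skewIdem_eq, smul_vert]
    obtain ⟨u, _ | ⟨x, l⟩, hl⟩ := p
    · have := finsum_vertex (k := k) o u fun ε => if ε then 2⁻¹ else -2⁻¹
      rw [finsum_eq_sum_of_fintype] at this
      refine this.trans ?_
      simp only [vert]
      split_ifs <;> simp_all
    · exact Finset.sum_eq_zero fun _ _ => rfl

open Classical in
/-- The element `ι'(S)` for an invariant potential `S`. -/
theorem iota'_eq [Finite Q.V] (hk : (2 : k) ≠ 0) {S : CPA k Q}
    (hS : ∀ p, S (σ.walk p) = S p) (hS' : ∀ p, p.src ≠ p.tgt → S p = 0) :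
    iota' o S = (S, fun p => if σ.v p.src = p.src then 0 else S p) := by
  unfold iota' iota
  obtain ⟨f, hf⟩ : ∃ f : CPA k Q, f = fun p => if σ.v p.src = p.src then S p else 2 * S p :=
    ⟨_, rfl⟩
  rw [← hf]
  have hfa : σ.act f = f := by
    ext p
    have h1 : (σ.v (σ.walk p).src = (σ.walk p).src) ↔ σ.v p.src = p.src := by
      simp only [walk, σ.v_v, eq_comm]
    change f (σ.walk p) = f p
    simp only [hf, hS]
    simp only [h1]
  rw [skewUnit_eq o hk]
  have e : ∀ (c : k), (fun v => if σ.v (σ.v v) = σ.v v then c else 2⁻¹) =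
      fun v => if σ.v v = v then c else 2⁻¹ := fun c => by
    funext v
    have h1 : (σ.v (σ.v v) = σ.v v) ↔ σ.v v = v := by rw [σ.v_v, eq_comm]
    simp only [h1]
  refine Prod.ext ?_ ?_
  · ext p
    simp only [smul, act_zero, mul_zero, add_zero, zero_add, hfa, act_vert, e, CPA.add_apply, mul_vert,
      vert_mul]
    -- At a vertex that is not fixed, the two outer factors `½(1 + σ)` combine to `½(1 + σ)`, since
    -- `f` is invariant; the factor `2` in `iota'` compensates. At a fixed vertex both outer factors
    -- act as the identity.
    by_cases hp : p.src = p.tgt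
    · rw [← hp]
      simp only [hf]
      split_ifs
      · ring
      · field_simp
        ring
    · simp [hf, hS' p hp]
  · ext p
    simp only [smul, act_zero, mul_zero, add_zero, zero_add, hfa, act_vert, e, CPA.add_apply, mul_vert,
      vert_mul]
    by_cases hp : p.src = p.tgt
    · rw [← hp]
      simp only [hf]
      split_ifs
      · ring
      · field_simp
        ring
    · simp [hf, hS' p hp]

end Unit

section Potential

variable {T : Type w} {cor : Q.A → T × Fin 3}

theorem cornerPotential_walk (hc : IsCornerAction σ cor) (p : Q.Walk) :
    cornerPotential k cor (σ.walk p) = cornerPotential k cor p := by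
  have key : ∀ p : Q.Walk, (∃ (t : T) (x y z : Q.A), cor x = (t, 0) ∧ cor y = (t, 2) ∧
      cor z = (t, 1) ∧ p.src = p.tgt ∧ p.arrows = [z, y, x]) →
      ∃ (t : T) (x y z : Q.A), cor x = (t, 0) ∧ cor y = (t, 2) ∧ cor z = (t, 1) ∧
        (σ.walk p).src = (σ.walk p).tgt ∧ (σ.walk p).arrows = [z, y, x] := by
    rintro p ⟨t, x, y, z, hx, hy, hz, h, h'⟩
    refine ⟨t, σ.a x, σ.a y, σ.a z, by rw [hc.cor_a, hx], by rw [hc.cor_a, hy],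
      by rw [hc.cor_a, hz], ?_, by simp [walk, h']⟩
    simp only [walk, Walk.tgt, σ.endpt_map]
    exact congrArg σ.v h
  have hw : σ.walk (σ.walk p) = p := by
    ext1
    · exact σ.v_v _
    · simp only [walk, List.map_map]
      rw [show σ.a ∘ σ.a = id from funext σ.a_a, List.map_id]
  unfold cornerPotential
  congr 1
  exact propext ⟨fun h => hw ▸ key _ h, key p⟩

variable (o : σ.OrbitReps)

/-- The corner from which an arrow of `Q_G` comes, in one of the two copies of its triangle. -/
def skewCorner (cor : Q.A → T × Fin 3) (x : (skewQuiver o).A) : (Bool × T) × Fin 3 :=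
  ((x.1.2, (cor x.1.1).1), (cor x.1.1).2)

variable (k) in
/-- The potential on `Q_G` that corresponds to the sum of the cycles in the triangles. -/
noncomputable def skewCornerPotential (cor : Q.A → T × Fin 3) : CPA k (skewQuiver o) := fun p =>
  (p.arrows.map (arrowScale k o)).prod * cornerPotential k (skewCorner o cor) p

variable {o}

theorem OrbitReps.exists_aRep (o : σ.OrbitReps) (a : Q.A) :
    ∃ x ∈ o.aRep, a = x ∨ a = σ.a x := by
  rcases o.a_mem a with h | h
  · exact ⟨a, h, .inl rfl⟩
  · exact ⟨σ.a a, h, .inr (σ.a_a a).symm⟩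

theorem arrowCoeff_ne_zero {x : (skewQuiver o).A} {y : Q.A} (h : arrowCoeff k o x y ≠ 0) :
    y = x.1.1 ∨ y = σ.a x.1.1 := by
  by_contra h'
  push Not at h'
  exact h (arrowCoeff_eq_zero o h'.1 h'.2)

theorem OrbitReps.aRep_ext (o : σ.OrbitReps) {x y a : Q.A} (hx : x ∈ o.aRep) (hy : y ∈ o.aRep)
    (h : a = x ∨ a = σ.a x) (h' : a = y ∨ a = σ.a y) : x = y := by
  have : y = x ∨ y = σ.a x := by
    rcases h with rfl | rfl <;> rcases h' with h' | h'
    · exact .inl h'.symm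
    · exact .inr (a_eq_iff.1 h'.symm)
    · exact .inr h'.symm
    · exact .inl (by rw [← σ.a_a y, ← h', σ.a_a])
  rcases this with rfl | rfl
  · rfl
  · exact (o.a_unique x hx hy).symm

theorem OrbitReps.vertex_s (o : σ.OrbitReps) {x a : Q.A} (h : a = x ∨ a = σ.a x) (ε : Bool) :
    o.vertex (Q.s x) ε = o.vertex (Q.s a) ε := by
  rcases h with rfl | rfl
  · rfl
  · rw [σ.s_a, o.vertex_v]

theorem OrbitReps.vertex_t (o : σ.OrbitReps) {x a : Q.A} (h : a = x ∨ a = σ.a x) (ε : Bool) :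
    o.vertex (Q.t x) ε = o.vertex (Q.t a) ε := by
  rcases h with rfl | rfl
  · rfl
  · rw [σ.t_a, o.vertex_v]

theorem vsign_s {x a : Q.A} (h : a = x ∨ a = σ.a x) (ε : Bool) :
    vsign k σ ε (Q.s x) = vsign k σ ε (Q.s a) := by
  rcases h with rfl | rfl
  · rfl
  · rw [σ.s_a, vsign_v]

theorem exists_of_skewCornerPotential_ne_zero {p : (skewQuiver o).Walk}
    (h : skewCornerPotential k o cor p ≠ 0) : ∃ (t : T) (ε : Bool) (x y z : (skewQuiver o).A),
      cor x.1.1 = (t, 0) ∧ cor y.1.1 = (t, 2) ∧ cor z.1.1 = (t, 1) ∧ x.1.2 = ε ∧ y.1.2 = ε ∧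
      z.1.2 = ε ∧ p.arrows = [z, y, x] := by
  have h1 := right_ne_zero_of_mul h
  unfold cornerPotential at h1
  obtain ⟨⟨ε, t⟩, x, y, z, hx, hy, hz, -, hp⟩ := of_not_not fun h2 => h1 (if_neg h2)
  simp only [skewCorner, Prod.ext_iff] at hx hy hz
  exact ⟨t, ε, x, y, z, Prod.ext hx.1.2 hx.2, Prod.ext hy.1.2 hy.2, Prod.ext hz.1.2 hz.2,
    hx.1.1, hy.1.1, hz.1.1, hp⟩

open Classical in
/-- The image in the skew group algebra of the sum of the cycles in the triangles. -/
theorem skewEval_skewCornerPotential (hc : IsCornerAction σ cor) (hk : (2 : k) ≠ 0) :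
    skewEval o (skewCornerPotential k o cor) = (cornerPotential k cor,
      fun p => if σ.v p.src = p.src then 0 else cornerPotential k cor p) := by
  -- the terms that contribute
  have hterm : ∀ (p : (skewQuiver o).Walk) (w : Q.Walk),
      skewCornerPotential k o cor p * (skewWalk o k p).1 w ≠ 0 ∨
        skewCornerPotential k o cor p * (skewWalk o k p).2 w ≠ 0 →
      ∃ (t : T) (ε : Bool) (x y z : (skewQuiver o).A) (a b c : Q.A),
        cor x.1.1 = (t, 0) ∧ cor y.1.1 = (t, 2) ∧ cor z.1.1 = (t, 1) ∧ x.1.2 = ε ∧ y.1.2 = ε ∧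
        z.1.2 = ε ∧ p.arrows = [z, y, x] ∧ w.arrows = [c, b, a] ∧
        (a = x.1.1 ∨ a = σ.a x.1.1) ∧ (b = y.1.1 ∨ b = σ.a y.1.1) ∧
        (c = z.1.1 ∨ c = σ.a z.1.1) := by
    intro p w h
    have hS : skewCornerPotential k o cor p ≠ 0 := by
      rcases h with h | h <;> exact left_ne_zero_of_mul h
    obtain ⟨t, ε, x, y, z, hx, hy, hz, ex, ey, ez, hp⟩ :=
      exists_of_skewCornerPotential_ne_zero hS
    rw [skewWalk_eq o hk hp] at h
    have h' : (arr (arrowCoeff k o z) * (arr (arrowCoeff k o y) * arr (arrowCoeff k o x))) w ≠ 0 := by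
      simp only [CPA.smul_apply] at h
      rcases h with h | h
      · exact right_ne_zero_of_mul (right_ne_zero_of_mul h)
      · exact right_ne_zero_of_mul (right_ne_zero_of_mul (right_ne_zero_of_mul h))
    obtain ⟨a, b, c, hw, h1, h2, h3⟩ := exists_of_arr_mul_arr_mul_arr_ne_zero h'
    exact ⟨t, ε, x, y, z, a, b, c, hx, hy, hz, ex, ey, ez, hp, hw, arrowCoeff_ne_zero h3,
      arrowCoeff_ne_zero h2, arrowCoeff_ne_zero h1⟩
  have hcor : ∀ {x a : Q.A}, (a = x ∨ a = σ.a x) → cor a = cor x := by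
    rintro x a (rfl | rfl)
    · rfl
    · exact hc.cor_a _
  have main : ∀ w : Q.Walk,
      ∑ᶠ p, skewCornerPotential k o cor p * (skewWalk o k p).1 w = cornerPotential k cor w ∧
      ∑ᶠ p, skewCornerPotential k o cor p * (skewWalk o k p).2 w =
        if σ.v w.src = w.src then 0 else cornerPotential k cor w := by
    intro w
    -- The path need not be closed here: a path around a triangle may end at the image under `σ` of
    -- its starting point, and its coefficient must then be shown to vanish. The contributing paths
    -- of `Q_G` are the two lifts `p true` and `p false`.
    by_cases hw : ∃ (t : T) (a b c : Q.A), cor a = (t, 0) ∧ cor b = (t, 2) ∧ cor c = (t, 1) ∧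
      w.arrows = [c, b, a]
    · obtain ⟨t, a, b, c, ha, hb, hcc, hw⟩ := hw
      obtain ⟨v, l, hl⟩ := w
      subst hw
      obtain ⟨x, hx, hax⟩ := o.exists_aRep a
      obtain ⟨y, hy, hby⟩ := o.exists_aRep b
      obtain ⟨z, hz, hcz⟩ := o.exists_aRep c
      have hcx : cor x = (t, 0) := by rw [← hcor hax, ha]
      have hcy : cor y = (t, 2) := by rw [← hcor hby, hb]
      have hcz' : cor z = (t, 1) := by rw [← hcor hcz, hcc]
      obtain ⟨h2, h1, h0, -⟩ := hl
      have hv : Q.s a = v := h0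
      have hba : Q.s b = Q.t a := h1
      have hcb : Q.s c = Q.t b := h2
      have hac : Q.s a = Q.t c ∨ Q.s a = σ.v (Q.t c) := hc.next c a (by rw [ha, hcc]; rfl)
      have hA : ∀ (u : Q.A) (ε : Bool), σ.v (Q.s u) ≠ Q.s u → σ.v (Q.t u) ≠ Q.t u → ε = true :=
        fun u ε h h' => ((hc.fixed u).elim h h').elim
      let X : Bool → (skewQuiver o).A := fun ε => ⟨(x, ε), hx, hA x ε⟩
      let Y : Bool → (skewQuiver o).A := fun ε => ⟨(y, ε), hy, hA y ε⟩
      let Z : Bool → (skewQuiver o).A := fun ε => ⟨(z, ε), hz, hA z ε⟩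
      let p : Bool → (skewQuiver o).Walk := fun ε => ⟨o.vertex (Q.s x) ε, [Z ε, Y ε, X ε],
        show o.vertex (Q.s z) ε = o.vertex (Q.t y) ε by
          rw [o.vertex_s hcz, o.vertex_t hby, hcb],
        show o.vertex (Q.s y) ε = o.vertex (Q.t x) ε by
          rw [o.vertex_s hby, o.vertex_t hax, hba], rfl, trivial⟩
      have hcyc : ∀ ε, (p ε).src = (p ε).tgt := fun ε => by
        change o.vertex (Q.s x) ε = o.vertex (Q.t z) ε
        rw [o.vertex_s hax, o.vertex_t hcz]
        rcases hac with h | h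
        · rw [h]
        · rw [h, o.vertex_v]
      have hp : p true ≠ p false := fun h => by
        have := congrArg Walk.arrows h
        simp only [p, List.cons.injEq] at this
        have := congrArg (fun u : (skewQuiver o).A => u.1.2) this.1
        simp [Z] at this
      have hsupp : ∀ q : (skewQuiver o).Walk,
          skewCornerPotential k o cor q * (skewWalk o k q).1 ⟨v, [c, b, a], h2, h1, h0, trivial⟩ ≠ 0 ∨
          skewCornerPotential k o cor q * (skewWalk o k q).2 ⟨v, [c, b, a], h2, h1, h0, trivial⟩ ≠ 0 →
          q = p true ∨ q = p false := by
        intro q hq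
        obtain ⟨-, ε, x', y', z', a', b', c', -, -, -, ex, ey, ez, hq', hl, ha', hb', hc'⟩ :=
          hterm q _ hq
        simp only [List.cons.injEq, and_true] at hl
        obtain ⟨rfl, rfl, rfl⟩ := hl
        have e1 : x' = X ε := Subtype.ext (Prod.ext (o.aRep_ext x'.2.1 hx ha' hax) ex)
        have e2 : y' = Y ε := Subtype.ext (Prod.ext (o.aRep_ext y'.2.1 hy hb' hby) ey)
        have e3 : z' = Z ε := Subtype.ext (Prod.ext (o.aRep_ext z'.2.1 hz hc' hcz) ez)
        have : q = p ε := by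
          obtain ⟨u, l, hl⟩ := q
          simp only at hq'
          subst hq'
          ext1
          · have : (skewQuiver o).s x' = u := hl.2.2.1
            exact this.symm.trans (congrArg (skewQuiver o).s e1)
          · simp only [p, e1, e2, e3]
        rw [this]
        cases ε
        · exact .inr rfl
        · exact .inl rfl
      have hone : ∀ ε, cornerPotential k (skewCorner o cor) (p ε) = 1 := fun ε =>
        if_pos ⟨(ε, t), X ε, Y ε, Z ε, by simp [skewCorner, X, hcx], by simp [skewCorner, Y, hcy],
          by simp [skewCorner, Z, hcz'], hcyc ε, rfl⟩
      have hval : ∀ ε, skewCornerPotential k o cor (p ε) *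
          (skewWalk o k (p ε)).1 ⟨v, [c, b, a], h2, h1, h0, trivial⟩ =
            2⁻¹ * (repSign k o ε (Q.s a) * repSign k o ε (Q.t c)) := fun ε => by
        rw [skewWalk_eq o hk rfl, skewCornerPotential, hone]
        dsimp only
        rw [CPA.smul_apply, arr_mul_arr_mul_arr _ _ _ rfl]
        have i1 := hc.arrowScale_mul_arrowCoeff o hk (X ε) hax
        have i2 := hc.arrowScale_mul_arrowCoeff o hk (Y ε) hby
        have i3 := hc.arrowScale_mul_arrowCoeff o hk (Z ε) hcz
        rw [hba] at i2
        rw [hcb] at i3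
        have j1 := repSign_mul_self (k := k) o ε (Q.t a)
        have j2 := repSign_mul_self (k := k) o ε (Q.t b)
        simp only [p, List.map_cons, List.map_nil, List.prod_cons, List.prod_nil]
        have h4 : (4 : k) * 2⁻¹ * 2⁻¹ = 1 := by
          field_simp
          norm_num
        -- Each scalar is grouped with the coefficient of its arrow; the signs at the two
        -- intermediate vertices then appear squared.
        calc _ = 4 * (arrowScale k o (X ε) * arrowCoeff k o (X ε) a) *
              (arrowScale k o (Y ε) * arrowCoeff k o (Y ε) b) *
              (arrowScale k o (Z ε) * arrowCoeff k o (Z ε) c) := by ring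
          _ = (4 * 2⁻¹ * 2⁻¹) * (repSign k o ε (Q.t a) * repSign k o ε (Q.t a)) *
              (repSign k o ε (Q.t b) * repSign k o ε (Q.t b)) *
              (2⁻¹ * (repSign k o ε (Q.s a) * repSign k o ε (Q.t c))) := by
            rw [i1, i2, i3]; ring
          _ = _ := by rw [j1, j2, h4, one_mul, one_mul, one_mul]
      have hval2 : ∀ ε, skewCornerPotential k o cor (p ε) *
          (skewWalk o k (p ε)).2 ⟨v, [c, b, a], h2, h1, h0, trivial⟩ =
            vsign k σ ε (Q.s a) * (2⁻¹ * (repSign k o ε (Q.s a) * repSign k o ε (Q.t c))) := by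
        intro ε
        rw [← hval, skewWalk_eq o hk rfl]
        dsimp only
        rw [CPA.smul_apply, ← vsign_s hax]
        ring
      have hsum : ∀ F : (skewQuiver o).Walk → k, (∀ q, F q ≠ 0 → q = p true ∨ q = p false) →
          ∑ᶠ q, F q = F (p true) + F (p false) := fun F hF => by
        rw [finsum_eq_sum_of_support_subset (s := {p true, p false}), Finset.sum_pair hp]
        intro q hq
        simpa using hF q hq
      have hpot : cornerPotential k cor ⟨v, [c, b, a], h2, h1, h0, trivial⟩ =
          if Q.s a = Q.t c then 1 else 0 := by
        unfold cornerPotential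
        congr 1
        refine propext ⟨fun ⟨_, _, _, _, _, _, _, h, _⟩ => hv.trans h, fun h => ?_⟩
        exact ⟨t, a, b, c, ha, hb, hcc, hv.symm.trans h, rfl⟩
      have hhalf : (2⁻¹ : k) + 2⁻¹ = 1 := by rw [← two_mul, mul_inv_cancel₀ hk]
      rw [hsum _ fun q hq => hsupp q (.inl hq), hsum _ fun q hq => hsupp q (.inr hq), hval, hval,
        hval2, hval2, hpot, repSign_true, repSign_true]
      change _ ∧ _ = if σ.v v = v then _ else _
      rw [← hv]
      -- At a fixed starting point each lift contributes `½` to the first component, and the two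
      -- lifts contribute opposite signs to the second. Otherwise both components receive `½ + ½` if
      -- the path is closed, and `½ - ½` if it ends at the other point of the orbit.
      by_cases hfix : σ.v (Q.s a) = Q.s a
      · have htc : Q.s a = Q.t c := by
          rcases hac with h | h
          · exact h
          · rw [h, σ.v_v] at hfix
            rw [h, ← hfix]
        rw [← htc]
        simp only [repSign_fixed o _ hfix, vsign, hfix, sgn]
        simp [hhalf]
      · rcases hac with h | h
        · rw [← h, repSign_mul_self]
          simp [vsign, hfix, hhalf]
        · have h' : σ.v (Q.t c) ≠ Q.t c := fun h' => hfix (by rw [h, σ.v_v, h'])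
          have h'' : Q.s a ≠ Q.t c := fun h'' => h' (by rw [← h, h''])
          rw [h, repSign_v o _ h', mul_assoc, repSign_mul_self, ← h]
          simp [vsign, hfix, h'', sgn]
    · have hz : cornerPotential k cor w = 0 := if_neg fun ⟨t, a, b, c, ha, hb, hcc, _, hw'⟩ =>
        hw ⟨t, a, b, c, ha, hb, hcc, hw'⟩
      have hno : ∀ q : (skewQuiver o).Walk,
          ¬ (skewCornerPotential k o cor q * (skewWalk o k q).1 w ≠ 0 ∨
          skewCornerPotential k o cor q * (skewWalk o k q).2 w ≠ 0) := fun q hq => by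
        obtain ⟨t, -, x, y, z, a, b, c, hx, hy, hz, -, -, -, -, hw', ha, hb, hc'⟩ := hterm q w hq
        exact hw ⟨t, a, b, c, by rw [hcor ha, hx], by rw [hcor hb, hy], by rw [hcor hc', hz], hw'⟩
      rw [hz, ite_self]
      push Not at hno
      simp only [hno, finsum_zero, and_self]
  refine Prod.ext ?_ ?_
  · ext w
    exact (main w).1
  · ext w
    exact (main w).2

/-- The sum of the cycles in the triangles, on `Q` and on `Q_G`. -/
theorem isSkewPotential_skewCornerPotential [Finite Q.V] (hc : IsCornerAction σ cor)
    (hk : (2 : k) ≠ 0) :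
    IsSkewPotential o (cornerPotential k cor) (skewCornerPotential k o cor) := by
  refine (skewEval_skewCornerPotential hc hk).trans
    (iota'_eq o hk (cornerPotential_walk hc) fun p hp => if_neg ?_).symm
  rintro ⟨_, _, _, _, _, _, _, h, _⟩
  exact hp h

end Potential

end Quiv.Involution

end

/-! ### Isomorphisms of quivers with potential -/

section

namespace Quiv

/-- A morphism of quivers. -/
structure Hom (Q : Quiv.{u}) (Q' : Quiv.{w}) where
  v : Q.V → Q'.V
  a : Q.A → Q'.A
  s_a : ∀ x, Q'.s (a x) = v (Q.s x)
  t_a : ∀ x, Q'.t (a x) = v (Q.t x)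

namespace Hom

variable {k : Type v} [Field k] {Q : Quiv.{u}} {Q' : Quiv.{w}} (η : Q.Hom Q')

theorem endpt_map (i : Q.V) (l : List Q.A) : Q'.endpt (η.v i) (l.map η.a) = η.v (Q.endpt i l) := by
  cases l with
  | nil => rfl
  | cons a l => simp [endpt, η.t_a]

theorem isWalk_map {i : Q.V} {l : List Q.A} (h : Q.IsWalk i l) :
    Q'.IsWalk (η.v i) (l.map η.a) := by
  induction l with
  | nil => trivial
  | cons a l ih => exact ⟨by rw [η.s_a, endpt_map, h.1], ih h.2⟩

/-- The image of a path. -/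
def walk (p : Q.Walk) : Q'.Walk := ⟨η.v p.src, p.arrows.map η.a, η.isWalk_map p.isWalk⟩

theorem walk_left (p : Q.Walk) (n : ℕ) : (η.walk p).left n = η.walk (p.left n) := by
  ext1
  · simp only [walk, Walk.left, ← List.map_drop, η.endpt_map]
  · simp [walk, Walk.left]

theorem walk_right (p : Q.Walk) (n : ℕ) : (η.walk p).right n = η.walk (p.right n) := by
  ext1
  · rfl
  · simp [walk, Walk.right]

/-- The pullback of formal linear combinations of paths, where each arrow is multiplied by a
scalar. -/
noncomputable def pullback (c : Q.A → k) : CPA k Q' →ₐ[k] CPA k Q :=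
  AlgHom.ofLinearMap
    { toFun := fun f p => (p.arrows.map c).prod * f (η.walk p)
      map_add' := fun f g => CPA.ext fun p => mul_add _ (f (η.walk p)) (g (η.walk p))
      map_smul' := fun r f => CPA.ext fun p => mul_left_comm _ r (f (η.walk p)) }
    (by
      ext p
      change (p.arrows.map c).prod * (1 : CPA k Q') (η.walk p) = _
      obtain ⟨v, _ | ⟨x, l⟩, hl⟩ := p <;> simp [CPA.one_apply, walk])
    (fun f g => by
      ext p
      change _ * (f * g) (η.walk p) = _
      rw [CPA.mul_apply, CPA.mul_apply, show (η.walk p).length = p.length by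
        simp [walk, Walk.length], Finset.mul_sum]
      refine Finset.sum_congr rfl fun n _ => ?_
      have : (p.arrows.map c).prod =
          ((p.left n).arrows.map c).prod * ((p.right n).arrows.map c).prod := by
        rw [← List.prod_append, ← List.map_append]
        simp [Walk.left, Walk.right]
      rw [this, walk_left, walk_right]
      exact mul_mul_mul_comm _ _ _ _)

theorem pullback_apply (c : Q.A → k) (f : CPA k Q') (p : Q.Walk) :
    η.pullback c f p = (p.arrows.map c).prod * f (η.walk p) := rfl

theorem pullback_pullback {η : Q.Hom Q'} {η' : Q'.Hom Q} (hv : ∀ v, η'.v (η.v v) = v)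
    (ha : ∀ x, η'.a (η.a x) = x) {c : Q.A → k} {c' : Q'.A → k} (hc : ∀ x, c x * c' (η.a x) = 1)
    (f : CPA k Q) : η.pullback c (η'.pullback c' f) = f := by
  ext p
  rw [pullback_apply, pullback_apply, ← mul_assoc]
  have h1 : η'.walk (η.walk p) = p := by
    ext1
    · exact hv _
    · simp only [walk, List.map_map]
      rw [show η'.a ∘ η.a = id from funext ha, List.map_id]
  have h2 : (p.arrows.map c).prod * ((η.walk p).arrows.map c').prod = 1 := by
    simp only [walk, List.map_map]
    rw [← List.prod_map_mul, List.prod_eq_one]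
    intro y hy
    obtain ⟨x, -, rfl⟩ := List.mem_map.1 hy
    exact hc x
  rw [h1, h2, one_mul]

end Hom

end Quiv

namespace CPA

variable {k : Type v} [Field k] {Q : Quiv.{u}} {Q' : Quiv.{w}}

theorem CyclicEquiv.refl (S : CPA k Q) : CyclicEquiv S S := fun n =>
  ⟨0, Submodule.zero_mem _, fun w _ => by rw [sub_self]⟩

/-- An isomorphism of quivers and a rescaling of the arrows give a right equivalence. -/
theorem rightEquiv_of_equiv (θ : Q.V ≃ Q'.V) (ψ : Q.A ≃ Q'.A) (hs : ∀ x, Q'.s (ψ x) = θ (Q.s x))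
    (ht : ∀ x, Q'.t (ψ x) = θ (Q.t x)) {c : Q'.A → k} (hc : ∀ x, c x ≠ 0) {S : CPA k Q}
    {S' : CPA k Q'} (hS : ∀ p : Q.Walk, S' ((⟨θ, ψ, hs, ht⟩ : Q.Hom Q').walk p) =
      (p.arrows.map fun x => c (ψ x)).prod * S p) : RightEquiv θ S S' := by
  let η : Q.Hom Q' := ⟨θ, ψ, hs, ht⟩
  let η' : Q'.Hom Q := ⟨θ.symm, ψ.symm, fun x => by
    rw [Equiv.eq_symm_apply, ← hs, ψ.apply_symm_apply], fun x => by
    rw [Equiv.eq_symm_apply, ← ht, ψ.apply_symm_apply]⟩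
  have h1 : ∀ f, η'.pullback c (η.pullback (fun x => (c (ψ x))⁻¹) f) = f :=
    Quiv.Hom.pullback_pullback θ.apply_symm_apply ψ.apply_symm_apply fun x => by
      change c x * (c (ψ (ψ.symm x)))⁻¹ = 1
      rw [ψ.apply_symm_apply, mul_inv_cancel₀ (hc x)]
  have h2 : ∀ f, η.pullback (fun x => (c (ψ x))⁻¹) (η'.pullback c f) = f :=
    Quiv.Hom.pullback_pullback θ.symm_apply_apply ψ.symm_apply_apply fun x =>
      inv_mul_cancel₀ (hc _)
  refine ⟨AlgEquiv.ofAlgHom (η'.pullback c) (η.pullback fun x => (c (ψ x))⁻¹)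
    (AlgHom.ext h1) (AlgHom.ext h2), fun v => ?_, ?_⟩
  · ext ⟨u, l, hl⟩
    change (l.map c).prod * _ = _
    obtain _ | ⟨x, l⟩ := l
    · simp only [List.map_nil, List.prod_nil, one_mul, idem, ofWalk]
      congr 1
      simp [Quiv.Hom.walk, Quiv.Walk.nil, η', Quiv.Walk.ext_iff, Equiv.symm_apply_eq]
    · simp [idem, ofWalk, Quiv.Hom.walk, Quiv.Walk.nil, Quiv.Walk.ext_iff]
  -- The rescaled isomorphism sends `S` to `S'` itself, so cyclic equivalence is needed only in its
  -- reflexive form.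
  · have : η'.pullback c S = S' := by
      rw [← h1 S']
      congr 1
      ext p
      rw [Quiv.Hom.pullback_apply, hS, ← mul_assoc, ← List.prod_map_mul, List.prod_eq_one, one_mul]
      intro y hy
      obtain ⟨x, -, rfl⟩ := List.mem_map.1 hy
      exact inv_mul_cancel₀ (hc _)
    change CyclicEquiv (η'.pullback c S) S'
    rw [this]
    exact CyclicEquiv.refl S'

end CPA

namespace Quiv.Involution

variable {k : Type v} [Field k] {Q : Quiv.{u}} {Q' : Quiv.{w}} {σ : Q.Involution}
  (o : σ.OrbitReps)

/-- A quiver which is isomorphic to `Q_G` in a way compatible with the corners is right equivalent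
to it. -/
theorem rightEquiv_skewCornerPotential (hk : (2 : k) ≠ 0) {T T' : Type*} {cor : Q.A → T × Fin 3}
    {cor' : Q'.A → T' × Fin 3} {e : T' → Bool × T} (he : Function.Injective e)
    (θ : Q'.V ≃ (skewQuiver o).V) (ψ : Q'.A ≃ (skewQuiver o).A)
    (hs : ∀ x, (skewQuiver o).s (ψ x) = θ (Q'.s x)) (ht : ∀ x, (skewQuiver o).t (ψ x) = θ (Q'.t x))
    (hcor : ∀ x, skewCorner o cor (ψ x) = (e (cor' x).1, (cor' x).2)) :
    CPA.RightEquiv θ (cornerPotential k cor') (skewCornerPotential k o cor) := by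
  refine CPA.rightEquiv_of_equiv θ ψ hs ht (arrowScale_ne_zero o hk) fun p => ?_
  unfold skewCornerPotential
  simp only [Hom.walk, List.map_map]
  congr 1
  unfold cornerPotential
  congr 1
  refine propext ⟨?_, ?_⟩
  · rintro ⟨t, x, y, z, hx, hy, hz, h, h'⟩
    obtain ⟨v, l, hl⟩ := p
    simp only [List.map_eq_cons_iff, List.map_eq_nil_iff] at h'
    obtain ⟨z, l, rfl, rfl, y, l, rfl, rfl, x, l, rfl, rfl, rfl⟩ := h'
    rw [hcor, Prod.ext_iff] at hx hy hz
    simp only at hx hy hz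
    refine ⟨(cor' x).1, x, y, z, Prod.ext rfl hx.2, Prod.ext (he (hy.1.trans hx.1.symm)) hy.2,
      Prod.ext (he (hz.1.trans hx.1.symm)) hz.2, θ.injective (h.trans ?_), rfl⟩
    exact ht z
  · rintro ⟨t, x, y, z, hx, hy, hz, h, h'⟩
    obtain ⟨v, l, hl⟩ := p
    simp only at h'
    subst h'
    refine ⟨e t, ψ x, ψ y, ψ z, by rw [hcor, hx], by rw [hcor, hy], by rw [hcor, hz], ?_, rfl⟩
    exact (congrArg θ h).trans (ht z).symm

end Quiv.Involution

end

/-! ### The exchange of the loops and the folded sides -/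

section

namespace IdealTriangulation

variable {X : Type u} [TopologicalSpace X] {O : OrientedSurface X} {V : Set X}
  {τ : IdealTriangulation O V}

theorem eq_of_sideSet_eq {p p' : τ.T × Fin 3} (h : τ.sideSet p = τ.sideSet p') :
    p' = p ∨ p' = τ.mate p := τ.isGluing.eq_of_range_eq h

theorem sideSet_mate (p : τ.T × Fin 3) : τ.sideSet (τ.mate p) = τ.sideSet p :=
  τ.isGluing.range_mate p

theorem mate_ne_of_mem_arcs {p : τ.T × Fin 3} (h : τ.sideSet p ∈ τ.arcs) : τ.mate p ≠ p := by
  obtain ⟨p', hp', h⟩ := h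
  rcases eq_of_sideSet_eq h with rfl | rfl
  · exact hp'
  · intro e
    exact hp' (congrArg τ.mate e)

theorem radius_mem_arcs (q : τ.Folded) : τ.radius q ∈ τ.arcs :=
  ⟨_, fun h => fin3_ne12 q.1.2 (congrArg Prod.snd (q.2.symm.trans h)).symm, rfl⟩

theorem radius_eq (q : τ.Folded) : τ.radius q = τ.sideSet (q.1.1, q.1.2 + 2) := by
  rw [← q.2, sideSet_mate]
  rfl

theorem radius_injective {q q' : τ.Folded} (h : τ.radius q = τ.radius q') : q = q' := by
  rcases eq_of_sideSet_eq h with h | h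
  · exact Folded.ext (congrArg Prod.fst h).symm
  · rw [q.2] at h
    exact Folded.ext (congrArg Prod.fst h).symm

theorem sideSet_ne_radius {p : τ.T × Fin 3} (hp : ∀ i, ¬ τ.IsFolded (p.1, i)) (q : τ.Folded) :
    τ.sideSet p ≠ τ.radius q := fun h => by
  rcases eq_of_sideSet_eq h.symm with rfl | h
  · exact hp _ q.2
  · rw [q.2] at h
    rw [h] at hp
    exact hp _ q.2

theorem sideSet_ne_loop {p : τ.T × Fin 3} (hp : ∀ i, ¬ τ.IsFolded (p.1, i)) (hl : ¬ τ.IsLoopSide p)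
    (q : τ.Folded) : τ.sideSet p ≠ τ.loop q := fun h => by
  rcases eq_of_sideSet_eq h.symm with rfl | h
  · exact hp _ q.2
  · exact hl ⟨q, h.symm⟩

theorem over_iff {p : τ.T × Fin 3} (hp : ∀ i, ¬ τ.IsFolded (p.1, i)) (hl : ¬ τ.IsLoopSide p)
    {a : Set X} : τ.Over a p ↔ a = τ.sideSet p :=
  ⟨fun h => h.elim id fun ⟨q, _, h⟩ => (sideSet_ne_loop hp hl q h.symm).elim, .inl⟩

variable {M : Set X} (hτ : τ.IsTame M)

namespace IsTame

include hτ

theorem loop_mem_arcs (q : τ.Folded) : τ.loop q ∈ τ.arcs := ⟨_, hτ.mate_loop_ne q, rfl⟩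

theorem loop_ne_radius (q q' : τ.Folded) : τ.loop q ≠ τ.radius q' := fun h => by
  rcases eq_of_sideSet_eq h with h | h
  · have := q.2
    rw [← h] at this
    exact fin3_ne1 _ (IsFolded.unique q'.2 this)
  · exact hτ.mate_ne q q' (congrArg Prod.fst h).symm

theorem loop_injective {q q' : τ.Folded} (h : τ.loop q = τ.loop q') : q = q' := by
  rcases eq_of_sideSet_eq h with h | h
  · exact Folded.ext (congrArg Prod.fst h).symm
  · exact absurd (congrArg Prod.fst h).symm (hτ.mate_ne q q')

theorem over_mate_iff (q : τ.Folded) {a : Set X} :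
    τ.Over a (τ.mate q.1) ↔ a = τ.loop q ∨ a = τ.radius q := by
  unfold Over
  rw [sideSet_mate]
  refine or_congr_right ⟨?_, fun h => ⟨q, h, rfl⟩⟩
  rintro ⟨q', rfl, h⟩
  rw [hτ.loop_injective h]

omit hτ in
theorem mate_ne_of_over {p : τ.T × Fin 3} {a : τ.arcs} (hp : ∀ i, ¬ τ.IsFolded (p.1, i))
    (h : τ.Over a.1 p) : τ.mate p ≠ p := by
  by_cases hl : τ.IsLoopSide p
  · exact isLoopSide_mate_ne hp hl
  · exact mate_ne_of_mem_arcs ((over_iff hp hl).1 h ▸ a.2)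

/-- Each arc lies over a side of a triangle which is not self-folded. -/
theorem exists_over (a : τ.arcs) : ∃ p : τ.T × Fin 3, (∀ i, ¬ τ.IsFolded (p.1, i)) ∧ τ.Over a.1 p := by
  obtain ⟨_, ⟨t, j⟩, -, rfl⟩ := a
  by_cases h : ∀ i, ¬ τ.IsFolded (t, i)
  · exact ⟨_, h, .inl rfl⟩
  · push Not at h
    obtain ⟨i, hi⟩ := h
    refine ⟨τ.mate (t, i), hτ.loop_mate ⟨_, hi⟩, (hτ.over_mate_iff ⟨_, hi⟩).2 ?_⟩
    rcases fin3_cases i j with rfl | rfl | rfl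
    · exact .inl rfl
    · exact .inr rfl
    · exact .inr (radius_eq ⟨_, hi⟩).symm

open Classical in
/-- The exchange of the loop and the folded side of each self-folded triangle. -/
noncomputable def swap (a : τ.arcs) : τ.arcs :=
  if h : ∃ q, a.1 = τ.radius q then ⟨_, hτ.loop_mem_arcs h.choose⟩
  else if h : ∃ q, a.1 = τ.loop q then ⟨_, radius_mem_arcs h.choose⟩ else a

theorem swap_radius {a : τ.arcs} {q : τ.Folded} (ha : a.1 = τ.radius q) :
    (hτ.swap a).1 = τ.loop q := by
  have h : ∃ q, a.1 = τ.radius q := ⟨q, ha⟩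
  rw [swap, dif_pos h, ← radius_injective (h.choose_spec.symm.trans ha)]

theorem swap_loop {a : τ.arcs} {q : τ.Folded} (ha : a.1 = τ.loop q) :
    (hτ.swap a).1 = τ.radius q := by
  have h : ∃ q, a.1 = τ.loop q := ⟨q, ha⟩
  rw [swap, dif_neg fun ⟨q', h'⟩ => hτ.loop_ne_radius q q' (ha.symm.trans h'), dif_pos h,
    ← hτ.loop_injective (h.choose_spec.symm.trans ha)]

theorem swap_of_ne {a : τ.arcs} (ha : ∀ q : τ.Folded, a.1 ≠ τ.radius q ∧ a.1 ≠ τ.loop q) :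
    hτ.swap a = a := by
  rw [swap, dif_neg fun ⟨q, h⟩ => (ha q).1 h, dif_neg fun ⟨q, h⟩ => (ha q).2 h]

theorem swap_swap (a : τ.arcs) : hτ.swap (hτ.swap a) = a := by
  by_cases h : ∃ q : τ.Folded, a.1 = τ.radius q
  · obtain ⟨q, h⟩ := h
    exact Subtype.ext ((hτ.swap_loop (hτ.swap_radius h)).trans h.symm)
  · by_cases h' : ∃ q : τ.Folded, a.1 = τ.loop q
    · obtain ⟨q, h'⟩ := h'
      exact Subtype.ext ((hτ.swap_radius (hτ.swap_loop h')).trans h'.symm)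
    · push Not at h h'
      rw [hτ.swap_of_ne fun q => ⟨h q, h' q⟩, hτ.swap_of_ne fun q => ⟨h q, h' q⟩]

section

variable {p : τ.T × Fin 3} (hp : ∀ i, ¬ τ.IsFolded (p.1, i))
include hp

theorem swap_of_over {a : τ.arcs} (h : τ.Over a.1 p) (hl : ¬ τ.IsLoopSide p) : hτ.swap a = a := by
  rw [over_iff hp hl] at h
  exact hτ.swap_of_ne fun q => h ▸ ⟨sideSet_ne_radius hp q, sideSet_ne_loop hp hl q⟩

theorem over_swap {a : τ.arcs} (h : τ.Over a.1 p) : τ.Over (hτ.swap a).1 p := by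
  by_cases hl : τ.IsLoopSide p
  · obtain ⟨q, rfl⟩ := hl
    rw [hτ.over_mate_iff] at h ⊢
    exact h.elim (fun h => .inr (hτ.swap_loop h)) fun h => .inl (hτ.swap_radius h)
  · rwa [hτ.swap_of_over hp h hl]

theorem swap_eq_iff {a : τ.arcs} (h : τ.Over a.1 p) : hτ.swap a = a ↔ ¬ τ.IsLoopSide p := by
  refine ⟨?_, hτ.swap_of_over hp h⟩
  rintro e ⟨q, rfl⟩
  have e := congrArg Subtype.val e
  rcases (hτ.over_mate_iff q).1 h with h | h
  · rw [hτ.swap_loop h, h] at e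
    exact hτ.loop_ne_radius q q e.symm
  · rw [hτ.swap_radius h, h] at e
    exact hτ.loop_ne_radius q q e

theorem eq_or_eq_swap {a b : τ.arcs} (ha : τ.Over a.1 p) (hb : τ.Over b.1 p) :
    b = a ∨ b = hτ.swap a := by
  by_cases hl : τ.IsLoopSide p
  · obtain ⟨q, rfl⟩ := hl
    rw [hτ.over_mate_iff] at ha hb
    rcases ha with ha | ha <;> rcases hb with hb | hb
    · exact .inl (Subtype.ext (hb.trans ha.symm))
    · exact .inr (Subtype.ext (hb.trans (hτ.swap_loop ha).symm))
    · exact .inr (Subtype.ext (hb.trans (hτ.swap_radius ha).symm))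
    · exact .inl (Subtype.ext (hb.trans ha.symm))
  · rw [over_iff hp hl] at ha hb
    exact .inl (Subtype.ext (hb.trans ha.symm))

/-- Two sides under the same arc are glued to each other if they are not equal. -/
theorem eq_or_eq_mate {p' : τ.T × Fin 3} (hp' : ∀ i, ¬ τ.IsFolded (p'.1, i)) {a : τ.arcs}
    (ha : τ.Over a.1 p) (ha' : τ.Over a.1 p') : p' = p ∨ ¬ τ.IsLoopSide p ∧ p' = τ.mate p := by
  by_cases hl : τ.IsLoopSide p
  · have hl' : τ.IsLoopSide p' := by
      by_contra h
      exact (hτ.swap_eq_iff hp ha).1 ((hτ.swap_eq_iff hp' ha').2 h) hl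
    obtain ⟨q, rfl⟩ := hl
    obtain ⟨q', rfl⟩ := hl'
    rw [hτ.over_mate_iff] at ha ha'
    left
    rcases ha with ha | ha <;> rcases ha' with hb | hb
    · rw [hτ.loop_injective (hb.symm.trans ha)]
    · exact absurd (ha.symm.trans hb) (hτ.loop_ne_radius q q')
    · exact absurd (hb.symm.trans ha) (hτ.loop_ne_radius q' q)
    · rw [radius_injective (hb.symm.trans ha)]
  · have hl' : ¬ τ.IsLoopSide p' := (hτ.swap_eq_iff hp' ha').1 ((hτ.swap_eq_iff hp ha).2 hl)
    rw [over_iff hp hl] at ha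
    rw [over_iff hp' hl'] at ha'
    exact (eq_of_sideSet_eq (ha.symm.trans ha')).imp id fun h => ⟨hl, h⟩

end

/-- The action on the quiver which exchanges loops and folded sides. -/
noncomputable def involution : τ.quiver.Involution where
  v := hτ.swap
  a := fun x => ⟨(x.1.1, hτ.swap x.1.2.1, hτ.swap x.1.2.2), x.2.1, hτ.over_swap x.2.1 x.2.2.1,
    hτ.over_swap (p := (x.1.1.1, x.1.1.2 + 2)) x.2.1 x.2.2.2⟩
  v_v := hτ.swap_swap
  a_a _ := Subtype.ext (Prod.ext rfl (Prod.ext (hτ.swap_swap _) (hτ.swap_swap _)))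
  s_a _ := rfl
  t_a _ := rfl

theorem isFoldSwap : τ.IsFoldSwap hτ.involution where
  swap _ _ _ ha hb := ⟨Subtype.ext ((hτ.swap_radius ha).trans hb.symm),
    Subtype.ext ((hτ.swap_loop hb).trans ha.symm)⟩
  fix _ ha := hτ.swap_of_ne ha
  arrow _ := rfl

/-- A triangle shares a side with at most one self-folded triangle, so at most one end of an arrow
lies over a loop side. The arcs over a given side form one orbit; hence the arrows with a given
corner form one orbit too. -/
theorem isCornerAction : hτ.involution.IsCornerAction fun x : τ.quiver.A => x.1.1 := by
  have hfix : ∀ x : τ.quiver.A, hτ.swap x.1.2.1 = x.1.2.1 ∨ hτ.swap x.1.2.2 = x.1.2.2 := by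
    intro x
    rw [hτ.swap_eq_iff x.2.1 x.2.2.1, hτ.swap_eq_iff (p := (x.1.1.1, x.1.1.2 + 2)) x.2.1 x.2.2.2,
      ← not_and_or]
    exact fun ⟨h, h'⟩ => fin3_ne2 x.1.1.2 (hτ.isLoopSide_unique h' h)
  refine ⟨hfix, fun _ hs ht => Subtype.ext (Prod.ext rfl (Prod.ext hs ht)), fun x y => ?_,
    fun x y h => ?_⟩
  · refine ⟨fun h => ?_, ?_⟩
    · have h : x.1.1 = y.1.1 := h
      have h1 := hτ.eq_or_eq_swap x.2.1 x.2.2.1 (b := y.1.2.1) (h ▸ y.2.2.1)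
      have h2 := hτ.eq_or_eq_swap (p := (x.1.1.1, x.1.1.2 + 2)) x.2.1 x.2.2.2 (b := y.1.2.2)
        (h ▸ y.2.2.2)
      rcases hfix x with h3 | h3
      · rw [h3, or_self] at h1
        rcases h2 with h2 | h2
        · exact .inl (Subtype.ext (Prod.ext h.symm (Prod.ext h1 h2)))
        · exact .inr (Subtype.ext (Prod.ext h.symm (Prod.ext (h1.trans h3.symm) h2)))
      · rw [h3, or_self] at h2
        rcases h1 with h1 | h1
        · exact .inl (Subtype.ext (Prod.ext h.symm (Prod.ext h1 h2)))
        · exact .inr (Subtype.ext (Prod.ext h.symm (Prod.ext h1 (h2.trans h3.symm))))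
    · rintro (rfl | rfl) <;> rfl
  · have h : y.1.1 = (x.1.1.1, x.1.1.2 + 2) := h
    exact hτ.eq_or_eq_swap (p := (x.1.1.1, x.1.1.2 + 2)) x.2.1 x.2.2.2 (b := y.1.2.1) (h ▸ y.2.2.1)

omit hτ in
theorem finite_arcs : Finite τ.arcs := by
  have := τ.finite
  refine ((finite_range τ.sideSet).subset ?_).to_subtype
  rintro _ ⟨p, -, rfl⟩
  exact ⟨p, rfl⟩

end IsTame

end IdealTriangulation

end

/-! ### The quiver of the double -/

section

namespace IdealTriangulation

open Quiv.Involution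

variable {X : Type u} [TopologicalSpace X] {O : OrientedSurface X} {V : Set X}
  {τ : IdealTriangulation O V} {M : Set X} (hτ : τ.IsTame M)
  (φ : ∀ q : τ.Folded, τ.segment q ≃ₜ unitInterval) {O' : OrientedSurface (τ.Double φ)}
  (hO : O'.atlas = positiveAtlas (hτ.doubleChi φ))

namespace IsTame

include hτ

/-- A loop side is glued to a side of the other copy, and every other side keeps its mate, so a
self-folded triangle of the double would come from one among the triangles that are not self-folded.
-/
theorem not_isFolded_double (p : (Bool × τ.PlainTri) × Fin 3) :
    ¬ (hτ.doubleTriangulation φ hO).IsFolded p := by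
  intro h
  have h : hτ.doubleMate (p.1, p.2 + 1) = (p.1, p.2 + 2) := h
  by_cases hl : τ.IsLoopSide (p.1.2.1, p.2 + 1)
  · rw [hτ.doubleMate_loop hl] at h
    exact Bool.not_ne_self _ (congrArg (fun y => y.1.1) h)
  · have e := hτ.doubleMate_not_snd (p := (p.1, p.2 + 1)) hl
    rw [h] at e
    exact p.1.2.2 p.2 e.symm

omit hτ in
/-- The copy of the side `p` of a triangle which is not self-folded. -/
def copy (ε : Bool) (p : τ.T × Fin 3) (hp : ∀ i, ¬ τ.IsFolded (p.1, i)) :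
    (Bool × τ.PlainTri) × Fin 3 := ((ε, ⟨p.1, hp⟩), p.2)

omit hτ in
theorem copy_eq {ε δ : Bool} {p p' : τ.T × Fin 3} {hp : ∀ i, ¬ τ.IsFolded (p.1, i)}
    {hp' : ∀ i, ¬ τ.IsFolded (p'.1, i)} (h : copy ε p hp = copy δ p' hp') : ε = δ ∧ p = p' := by
  exact ⟨congrArg (fun y : (Bool × τ.PlainTri) × Fin 3 => y.1.1) h,
    Prod.ext (congrArg (fun y : (Bool × τ.PlainTri) × Fin 3 => y.1.2.1) h)
      (congrArg (fun y : (Bool × τ.PlainTri) × Fin 3 => y.2) h)⟩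

theorem sideSet_doubleMate (p : (Bool × τ.PlainTri) × Fin 3) :
    (hτ.doubleTriangulation φ hO).sideSet (hτ.doubleMate p) =
      (hτ.doubleTriangulation φ hO).sideSet p :=
  sideSet_mate (τ := hτ.doubleTriangulation φ hO) p

theorem sideSet_mem_arcs_of_double {p : (Bool × τ.PlainTri) × Fin 3}
    (h : (hτ.doubleTriangulation φ hO).sideSet p ∈ (hτ.doubleTriangulation φ hO).arcs) :
    τ.sideSet (p.1.2.1, p.2) ∈ τ.arcs :=
  ⟨(p.1.2.1, p.2), fun e => mate_ne_of_mem_arcs h (hτ.doubleMate_eq_iff.2 e), rfl⟩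

/-- The arc of the double that corresponds to the arc `a` and the sign `ε`. -/
noncomputable def doubleArcOf (a : τ.arcs) (ε : Bool) : Set (τ.Double φ) :=
  (hτ.doubleTriangulation φ hO).sideSet
    (copy ε (hτ.exists_over a).choose (hτ.exists_over a).choose_spec.1)

/-- Independence of the chosen side: another admissible side under the same arc is its mate, and for
a side that is not a loop side `doubleMate` stays in the same copy. -/
theorem doubleArcOf_eq {a : τ.arcs} {p : τ.T × Fin 3} (hp : ∀ i, ¬ τ.IsFolded (p.1, i))
    (h : τ.Over a.1 p) (ε : Bool) : hτ.doubleArcOf φ hO a ε =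
      (hτ.doubleTriangulation φ hO).sideSet (copy ε p hp) := by
  have h' := (hτ.exists_over a).choose_spec
  unfold doubleArcOf
  generalize_proofs _ hp'
  revert hp'
  obtain ⟨h1, h2⟩ := h'
  generalize (hτ.exists_over a).choose = p' at h1 h2
  intro hp'
  rcases hτ.eq_or_eq_mate hp hp' h h2 with rfl | ⟨hl, rfl⟩
  · rfl
  · have e : hτ.doubleMate (copy ε p hp) = copy ε (τ.mate p) hp' :=
      (hτ.doubleMate_not (p := copy ε p hp) hl).trans
        (Prod.ext (Prod.ext rfl (hτ.baseTri_eq ⟨_, hp'⟩)) rfl)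
    rw [← e]
    exact hτ.sideSet_doubleMate φ hO _

theorem doubleArcOf_swap (a : τ.arcs) (ε : Bool) :
    hτ.doubleArcOf φ hO (hτ.swap a) ε = hτ.doubleArcOf φ hO a ε := by
  obtain ⟨p, hp, h⟩ := hτ.exists_over a
  rw [hτ.doubleArcOf_eq φ hO hp h, hτ.doubleArcOf_eq φ hO hp (hτ.over_swap hp h)]

/-- An arc that is not fixed lies over a loop side, whose copies in `Σ⁺` and `Σ⁻` are glued to each
other. -/
theorem doubleArcOf_of_ne {a : τ.arcs} (ha : hτ.swap a ≠ a) (ε δ : Bool) :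
    hτ.doubleArcOf φ hO a ε = hτ.doubleArcOf φ hO a δ := by
  obtain ⟨p, hp, h⟩ := hτ.exists_over a
  have hl : τ.IsLoopSide p := by
    by_contra hl
    exact ha (hτ.swap_of_over hp h hl)
  have key : hτ.doubleArcOf φ hO a (!ε) = hτ.doubleArcOf φ hO a ε := by
    rw [hτ.doubleArcOf_eq φ hO hp h, hτ.doubleArcOf_eq φ hO hp h]
    exact (congrArg _ (hτ.doubleMate_loop (p := copy ε p hp) hl).symm).trans
      (hτ.sideSet_doubleMate φ hO _)
  rcases Bool.eq_or_eq_not δ ε with rfl | rfl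
  · rfl
  · exact key.symm

theorem doubleArcOf_mem (a : τ.arcs) (ε : Bool) :
    hτ.doubleArcOf φ hO a ε ∈ (hτ.doubleTriangulation φ hO).arcs := by
  obtain ⟨p, hp, h⟩ := hτ.exists_over a
  exact ⟨copy ε p hp, fun e => mate_ne_of_over hp h (hτ.doubleMate_eq_iff.1 e),
    hτ.doubleArcOf_eq φ hO hp h ε⟩

variable (o : hτ.involution.OrbitReps)

/-- The arc of the double that corresponds to a vertex of `Q(τ)_G`. -/
noncomputable def vertexArc (x : (skewQuiver o).V) : (hτ.doubleTriangulation φ hO).arcs :=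
  ⟨_, hτ.doubleArcOf_mem φ hO x.1.1 x.1.2⟩

theorem vertexArc_vertex (a : τ.arcs) (ε : Bool) :
    (hτ.vertexArc φ hO o (o.vertex a ε)).1 = hτ.doubleArcOf φ hO a ε := by
  classical
  have h1 : ∀ ε, hτ.doubleArcOf φ hO (o.rep a) ε = hτ.doubleArcOf φ hO a ε := fun ε => by
    rcases o.rep_cases a with h | h
    · rw [h]
    · rw [h]
      exact hτ.doubleArcOf_swap φ hO a ε
  change hτ.doubleArcOf φ hO (o.rep a) (if _ then _ else _) = _
  split_ifs with h
  · exact h1 ε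
  · rw [hτ.doubleArcOf_of_ne φ hO h true ε, h1]

/-- Equal arcs of the double come from equal or glued sides. For a loop side, gluing changes the
copy, which is harmless since its orbit gives a single vertex of `Q_G`; for the other sides it
preserves both the copy and the arc below. -/
theorem vertexArc_bijective : Function.Bijective (hτ.vertexArc φ hO o) := by
  constructor
  · intro x y h
    obtain ⟨p, hp, hx⟩ := hτ.exists_over x.1.1
    obtain ⟨p', hp', hy⟩ := hτ.exists_over y.1.1
    have h : hτ.doubleArcOf φ hO x.1.1 x.1.2 = hτ.doubleArcOf φ hO y.1.1 y.1.2 :=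
      congrArg Subtype.val h
    rw [hτ.doubleArcOf_eq φ hO hp hx, hτ.doubleArcOf_eq φ hO hp' hy] at h
    have hrep : ∀ {a b : τ.arcs}, a ∈ o.vRep → b ∈ o.vRep → (b = a ∨ b = hτ.swap a) → a = b := by
      rintro a b ha hb (rfl | rfl)
      · rfl
      · exact (o.v_unique a ha hb).symm
    rcases eq_of_sideSet_eq h with e | e
    · obtain ⟨e2, rfl⟩ := copy_eq e
      exact Subtype.ext (Prod.ext (hrep x.2.1 y.2.1 (hτ.eq_or_eq_swap hp hx hy)) e2.symm)
    · have e : copy y.1.2 p' hp' = hτ.doubleMate (copy x.1.2 p hp) := e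
      by_cases hl : τ.IsLoopSide p
      · rw [hτ.doubleMate_loop (p := copy x.1.2 p hp) hl] at e
        obtain ⟨-, rfl⟩ := copy_eq (δ := !x.1.2) (p' := p) (hp' := hp) e
        -- The vertex lies over a loop side, so it is not fixed and carries only the sign `+`.
        have h1 : x.1.2 = true := x.2.2 fun h => (hτ.swap_eq_iff hp hx).1 h hl
        have h2 : y.1.2 = true := y.2.2 fun h => (hτ.swap_eq_iff hp hy).1 h hl
        exact Subtype.ext (Prod.ext (hrep x.2.1 y.2.1 (hτ.eq_or_eq_swap hp hx hy)) (h1.trans h2.symm))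
      · have e1 := hτ.doubleMate_not_snd (p := copy x.1.2 p hp) hl
        rw [← e] at e1
        have e1 : p' = τ.mate p := e1
        subst e1
        rw [hτ.doubleMate_not (p := copy x.1.2 p hp) hl] at e
        rw [over_iff hp' (not_isLoopSide_mate hp), sideSet_mate] at hy
        rw [over_iff hp hl] at hx
        exact Subtype.ext (Prod.ext (Subtype.ext (hx.trans hy.symm))
          (congrArg (fun y : (Bool × τ.PlainTri) × Fin 3 => y.1.1) e).symm)
  · rintro ⟨_, P, hP, rfl⟩
    have hm : τ.mate (P.1.2.1, P.2) ≠ (P.1.2.1, P.2) := fun e => hP (hτ.doubleMate_eq_iff.2 e)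
    let a : τ.arcs := ⟨τ.sideSet (P.1.2.1, P.2), _, hm, rfl⟩
    refine ⟨o.vertex a P.1.1, Subtype.ext ?_⟩
    rw [vertexArc_vertex, hτ.doubleArcOf_eq φ hO (p := (P.1.2.1, P.2)) P.1.2.2 (.inl rfl)]
    rfl

/-- The arrow of the quiver of the double that corresponds to an arrow of `Q(τ)_G`. -/
noncomputable def arrowArc (x : (skewQuiver o).A) : (hτ.doubleTriangulation φ hO).quiver.A :=
  ⟨(copy x.1.2 x.1.1.1.1 x.1.1.2.1, hτ.vertexArc φ hO o ((skewQuiver o).s x),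
    hτ.vertexArc φ hO o ((skewQuiver o).t x)), fun _ => hτ.not_isFolded_double φ hO _,
    .inl ((hτ.vertexArc_vertex φ hO o _ _).trans
      (hτ.doubleArcOf_eq φ hO x.1.1.2.1 x.1.1.2.2.1 _)),
    .inl ((hτ.vertexArc_vertex φ hO o _ _).trans
      (hτ.doubleArcOf_eq φ hO (p := (x.1.1.1.1.1, x.1.1.1.1.2 + 2)) x.1.1.2.1 x.1.1.2.2.2 _))⟩

theorem over_double {p : (Bool × τ.PlainTri) × Fin 3} {A : Set (τ.Double φ)}
    (h : (hτ.doubleTriangulation φ hO).Over A p) : A = (hτ.doubleTriangulation φ hO).sideSet p :=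
  h.elim id fun ⟨q, _⟩ => (hτ.not_isFolded_double φ hO _ q.2).elim

/-- Without self-folded triangles an arrow of the double is determined by its corner, that is, by a
copy and a corner of the original triangulation. On `Q_G`, the same data determine the sign and, by
`isCornerAction`, the orbit of the arrow. -/
theorem arrowArc_bijective : Function.Bijective (hτ.arrowArc φ hO o) := by
  constructor
  · intro x y h
    have h : copy x.1.2 x.1.1.1.1 x.1.1.2.1 = copy y.1.2 y.1.1.1.1 y.1.1.2.1 :=
      congrArg (fun z => z.1.1) h
    obtain ⟨h0, h1⟩ := copy_eq h
    have h2 : x.1.1 = y.1.1 := by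
      rcases (hτ.isCornerAction.cor_eq_iff x.1.1 y.1.1).1 h1 with h2 | h2
      · exact h2.symm
      · rw [h2]
        exact (o.a_unique _ x.2.1 (h2 ▸ y.2.1)).symm
    exact Subtype.ext (Prod.ext h2 h0)
  · rintro ⟨⟨P, A, B⟩, hP, hA, hB⟩
    have hA := hτ.over_double φ hO hA
    have hB := hτ.over_double φ hO hB
    have hA' := hτ.sideSet_mem_arcs_of_double φ hO (p := P) (hA ▸ A.2)
    have hB' := hτ.sideSet_mem_arcs_of_double φ hO (p := (P.1, P.2 + 2)) (hB ▸ B.2)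
    let b : τ.quiver.A := ⟨((P.1.2.1, P.2), ⟨_, hA'⟩, ⟨_, hB'⟩), P.1.2.2, .inl rfl, .inl rfl⟩
    obtain ⟨a, ha, hab⟩ := o.exists_aRep b
    have hc : a.1.1 = (P.1.2.1, P.2) := by
      rcases hab with h | h
      · rw [← h]
      · exact (congrArg (fun y : τ.quiver.A => y.1.1) h).symm
    let x : (skewQuiver o).A := ⟨(a, P.1.1), ha, fun h h' =>
      ((hτ.isCornerAction.fixed a).elim h h').elim⟩
    have hP : copy x.1.2 x.1.1.1.1 x.1.1.2.1 = P :=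
      Prod.ext (Prod.ext rfl (Subtype.ext (Prod.ext_iff.1 hc).1)) (Prod.ext_iff.1 hc).2
    refine ⟨x, Subtype.ext (Prod.ext hP (Prod.ext (Subtype.ext ?_) (Subtype.ext ?_)))⟩
    · refine (hτ.over_double φ hO (hτ.arrowArc φ hO o x).2.2.1).trans (Eq.trans ?_ hA.symm)
      exact congrArg _ hP
    · refine (hτ.over_double φ hO (hτ.arrowArc φ hO o x).2.2.2).trans (Eq.trans ?_ hB.symm)
      exact congrArg (fun P : (Bool × τ.PlainTri) × Fin 3 =>
        (hτ.doubleTriangulation φ hO).sideSet (P.1, P.2 + 2)) hP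

/-- The bijection between the arcs of the double and the vertices of `Q(τ)_G`. -/
noncomputable def vertexEquiv : (hτ.doubleTriangulation φ hO).quiver.V ≃ (skewQuiver o).V :=
  (Equiv.ofBijective _ (hτ.vertexArc_bijective φ hO o)).symm

theorem isNatural_vertexEquiv :
    τ.IsNatural φ (hτ.doubleTriangulation φ hO) o (hτ.vertexEquiv φ hO o) := by
  intro A a ε h
  have hA : A.1 = hτ.doubleArcOf φ hO a ε := by
    have e : hτ.vertexArc φ hO o (hτ.vertexEquiv φ hO o A) = A :=
      (hτ.vertexEquiv φ hO o).symm_apply_apply A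
    rw [← e]
    change hτ.doubleArcOf φ hO (hτ.vertexEquiv φ hO o A).1.1 (hτ.vertexEquiv φ hO o A).1.2 = _
    rw [h]
  rw [hA]
  refine ⟨fun p hp ha => ?_, fun q hq => ?_⟩
  · have hl : ¬ τ.IsLoopSide p := by
      rintro ⟨q, rfl⟩
      exact hp.2.2 q.1.2 (by rw [τ.mate_mate]; exact q.2)
    rw [hτ.doubleArcOf_eq φ hO hp.2.1 (.inl ha)]
    exact hτ.range_doubleChi_side φ (p := copy ε p hp.2.1) hl
  · rw [hτ.doubleArcOf_eq φ hO (hτ.loop_mate q) ((hτ.over_mate_iff q).2 hq.symm)]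
    exact hτ.range_doubleChi_loop φ (p := copy ε (τ.mate q.1) (hτ.loop_mate q)) rfl

/-- The quivers with potential of the double and of the group action are right equivalent. -/
theorem rightEquiv_double {k : Type v} [Field k] (hk : (2 : k) ≠ 0) :
    CPA.RightEquiv (hτ.vertexEquiv φ hO o) ((hτ.doubleTriangulation φ hO).potential k)
      (skewCornerPotential k o fun x : τ.quiver.A => x.1.1) := by
  let ψ := (Equiv.ofBijective _ (hτ.arrowArc_bijective φ hO o)).symm
  have hψ : ∀ x, hτ.arrowArc φ hO o (ψ x) = x := ψ.symm_apply_apply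
  refine rightEquiv_skewCornerPotential o hk (e := fun t : Bool × τ.PlainTri => (t.1, t.2.1))
    (cor' := fun x : (hτ.doubleTriangulation φ hO).quiver.A => x.1.1)
    (fun s t h => Prod.ext (Prod.ext_iff.1 h).1 (Subtype.ext (Prod.ext_iff.1 h).2))
    (hτ.vertexEquiv φ hO o) ψ (fun x => ?_) (fun x => ?_) fun x => ?_
  · refine (hτ.vertexEquiv φ hO o).symm_apply_eq.1 ?_
    exact congrArg (fun y : (hτ.doubleTriangulation φ hO).quiver.A => y.1.2.1) (hψ x)
  · refine (hτ.vertexEquiv φ hO o).symm_apply_eq.1 ?_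
    exact congrArg (fun y : (hτ.doubleTriangulation φ hO).quiver.A => y.1.2.2) (hψ x)
  · have h := congrArg (fun y : (hτ.doubleTriangulation φ hO).quiver.A => y.1.1) (hψ x)
    exact congrArg (fun p : (Bool × τ.PlainTri) × Fin 3 => ((p.1.1, p.1.2.1), p.2)) h

theorem isSkewPotential_double {k : Type v} [Field k] (hk : (2 : k) ≠ 0) :
    IsSkewPotential o (τ.potential k) (skewCornerPotential k o fun x : τ.quiver.A => x.1.1) := by
  have : Finite τ.quiver.V := finite_arcs
  exact isSkewPotential_skewCornerPotential hτ.isCornerAction hk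

end IsTame

end IdealTriangulation

end

/-! ### The main theorem -/

theorem mainTheorem3 {k : Type v} [Field k] (hk : (2 : k) ≠ 0)
    {X : Type u} [TopologicalSpace X] (O : OrientedSurface X) (M P : Set X)
    (hX : O.IsMarkedSurface M P) (hP : P.Nonempty)
    -- the surface is not a once-punctured monogon
    (hmonogon : ¬ (Nonempty (X ≃ₜ Metric.closedBall (0 : ℂ) 1) ∧ M.ncard = 1 ∧ P.ncard = 1))
    (τ : IdealTriangulation O (M ∪ P))
    -- each puncture is enclosed in a self-folded triangle
    (hfold : ∀ x ∈ P, ∃ q : τ.Folded, τ.χ ⟨q.1.1, cornerPt q.1.2⟩ = x)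
    -- no triangle shares a side with two self-folded triangles
    (hshare : ∀ q q' : τ.Folded, (τ.mate q.1).1 = (τ.mate q'.1).1 → q = q')
    (φ : ∀ q : τ.Folded, τ.segment q ≃ₜ unitInterval) :
    ∃ O' : OrientedSurface (τ.Double φ),
      O'.IsMarkedSurface (τ.doubleMarked φ M) ∅ ∧
      τ.IsCompatible φ O' ∧
      ∃ τ' : IdealTriangulation O' (τ.doubleMarked φ M),
        τ'.arcs = τ.doubleArcs φ ∧
        ∃ σ : τ.quiver.Involution, τ.IsFoldSwap σ ∧
          ∀ o : σ.OrbitReps, ∃ S' : CPA k (Quiv.Involution.skewQuiver o),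
            Quiv.Involution.IsSkewPotential o (τ.potential k) S' ∧
            ∃ θ : τ'.quiver.V ≃ (Quiv.Involution.skewQuiver o).V,
              τ.IsNatural φ τ' o θ ∧
              CPA.RightEquiv θ (τ'.potential k) S' := by
  have hτ := τ.isTame hX hP hmonogon hfold hshare
  obtain ⟨O', hO, hM, hcomp⟩ := hτ.exists_double φ
  exact ⟨O', hM, hcomp, hτ.doubleTriangulation φ hO, hτ.arcs_doubleTriangulation φ hO,
    hτ.involution, hτ.isFoldSwap, fun o => ⟨_, hτ.isSkewPotential_double o hk,
      hτ.vertexEquiv φ hO o, hτ.isNatural_vertexEquiv φ hO o, hτ.rightEquiv_double φ hO o hk⟩⟩
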